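/- **Setting.** Let $n=4$, $\langle x\rangle=(1+|x|^2)^{1/2}$, $\gamma(v)=(1-|v|^2)^{-1/2}$, and let $P_v$ be the orthogonal projection of $\mathbb R^4$ to the line of $v$, $P_v^\perp=1-P_v$, $A_v=\gamma(v)P_v+P_v^\perp$. Let $\xi,\ell:\mathbb R\to\mathbb R^4$ be smooth functions of the time $\sigma$, let $R_f\ge1$, $\delta_1>0$, $\gamma=\gamma(\ell(\sigma))$, and put $\tau=\sigma-\gamma R_f$, $\eta=\xi-\gamma R_f\ell$, $\eta'=d\eta/d\tau$. Times are labelled by $\sigma$ or equivalently by $\tau$; $\tau_i=\tau(\sigma_i)$. The hyperboloidal region of Minkowski space $(\mathbb R^{1+4},m)$ is parametrized by $$X^0=\tau+\langle r\rangle,\qquad X'=\eta+r\Theta,\qquad \Theta\in\mathbb S^3,\ \langle r\rangle>\gamma R_f+\delta_1 .$$ Let $Q(s)=\int_1^s(t^6-1)^{-1/2}\,dt$ be the catenoid profile, $Q_\wp=Q(|rA_\ell\Theta-\gamma\langle r\rangle\ell|)$, and, with $Q=Q_\wp$, $W=1+\nabla^\alpha Q\nabla_\alpha Q$, $$\mathcal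 P_{\rm graph}=\Box_m-W^{-1}\nabla^\mu Q\nabla^\nu Q\nabla_\mu\nabla_\nu-2W^{-1}(\nabla^\mu\nabla^\nu Q)\nabla_\mu Q\nabla_\nu+2W^{-2}\nabla^\nu Q\nabla^\mu Q\nabla^\lambda Q(\nabla_\lambda\nabla_\mu Q)\nabla_\nu .$$ **Assumptions on the parameters.** Let $\epsilon>0$, $\sigma_f\in\mathbb R$, and let $C_k,C_\ell>0$, $\delta_\wp\in(0,1]$, $\kappa\in(0,1)$ be constants such that, for $\sigma\in[0,\sigma_f]$ and all $k\ge0$, $|\ell|\le C_\ell\epsilon$, and $|\partial_\sigma^k\dot\ell|$ and $|\partial_\sigma^k(\dot\xi-\ell)|$ are at most $2C_k\delta_\wp\,\epsilon\,\langle\sigma\rangle^{-9/4+\kappa}$. **Notation.** A function $U$ on the profile depends on polar coordinates $(\sigma,\rho,\theta)\in\mathbb R\times\mathbb R\times\mathbb S^3$, where in the hyperboloidal region of the end $\rho>0$ one has $r=\rho$, $\Theta=\theta$. Let $0<c_1<c_2$, and let $\chi=\chi_R$ be a smooth cutoff with $0\le\chi\le1$, $\chi=0$ for $r\le c_1R$,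 $\chi=1$ for $r\ge c_2R$. Put $\tilde U=r^{3/2}U$, $\tilde{\mathcal F}=r^{3/2}(1-\Theta\cdot\eta')\mathcal F$, let $\Sigma_\tau$ be the leaves, $\mathcal D_{\tau_1}^{\tau_2}$ the region between two of them (in the following integrals only the end $\rho>0$, $r=\rho$, is meant), and let $\nabla\!\!\!\!/$ be the gradient on the unit sphere. Set $$\mathcal E^p[\tilde U](\tau)=\int_{\Sigma_\tau}\chi r^p(\partial_r\tilde U)^2\,dr\,d\theta,\qquad \mathcal B^p[\tilde U](\tau_1,\tau_2)=\int_{\mathcal D_{\tau_1}^{\tau_2}}\chi r^{p-1}\Big((\partial_r\tilde U)^2+r^{-2}\big(\tilde U^2+|\nabla\!\!\!\!/\,\tilde U|^2\big)\Big)d\tau\,dr\,d\theta,$$ $$\mathrm{Err}_\chi[\tilde U]=|\chi'|\,r^p\Big((\partial_r\tilde U)^2+r^{-2}\big(\tilde U^2+(\partial_\tau\tilde U)^2+|\nabla\!\!\!\!/\,\tilde U|^2\big)\Big),$$ and, over both ends and the interior of $\Sigma_\tau$, with $r=|\rho|$, $$E[U](\tau)=\int_{\Sigma_\tau}\Big[(1-\chi)\big((\partial_\sigma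 U)^2+(\partial_\rho U)^2+\langle\rho\rangle^{-2}|\nabla\!\!\!\!/\,U|^2+\langle\rho\rangle^{-2}U^2\big)+\chi\big((\partial_\rho U)^2+r^{-2}((\partial_\tau U)^2+U^2+|\nabla\!\!\!\!/\,U|^2)\big)\Big]\langle\rho\rangle^3\,d\rho\,d\theta .$$ **Proposition.** There is $\alpha_0>0$ such that for all $\alpha\in(0,\alpha_0)$ and $0<c_1<c_2$ there are $K>0$ and a function $\delta\mapsto C(\delta)$, both depending only on $\alpha,c_1,c_2$, with the following property. For all $R_f,\delta_1,(C_k),C_\ell,\delta_\wp,\kappa$ as above, for all sufficiently large $\tilde R$, and then all sufficiently small $\tilde\epsilon>0$, there is $\delta>0$ with $\delta\le K(\tilde\epsilon+\tilde R^{-\alpha})$ and $\delta<2\alpha$, such that for all $R>\tilde R$, $0<\epsilon<\tilde\epsilon$, all cutoffs $\chi_R$, and all $\sigma_f,\xi,\ell$ satisfying the assumptions, there is a smooth vector coefficient $b=\mathcal O(r^{-3})$ (that is, on $\{r\ge c_1R\}$, for times in $[0,\sigma_f]$, it is bounded by a multiple of $r^{-3}$, also after time derivatives and, with a gain of $r^{-k}$,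 after $k$ derivatives in $y=r\theta$; the constants of these bounds do not depend on $R,\epsilon,\xi,\ell,\chi$) such that the following holds. For all $0\le\sigma_1<\sigma_2\le\sigma_f$, all $U$ that are $C^2$ at the points of the hyperboloidal region of the end $\rho>0$ with $\sigma\in[\sigma_1,\sigma_2]$ and satisfy $\mathcal P_{\rm graph}U=\mathcal F$ there, and all $p$ with $\delta<p<2-2\alpha$, $$\sup_{\tau_1\le\tau\le\tau_2}\mathcal E^p[\tilde U](\tau)+\mathcal B^p[\tilde U](\tau_1,\tau_2)\le C(\delta)\Big(\mathcal E^p[\tilde U](\tau_1)+\int_{\mathcal D_{\tau_1}^{\tau_2}}\Big(\chi r^p\big|\tilde{\mathcal F}\,(\partial_r\tilde U+b\cdot\nabla\!\!\!\!/\,\tilde U)\big|+\mathrm{Err}_\chi[\tilde U]\Big)d\tau\,dr\,d\theta\Big)$$ $$\qquad+\delta\int_{\mathcal D_{\tau_1}^{\tau_2}}\chi r^{-1-\alpha}|\partial_\tau\tilde U|^2\,d\tau\,dr\,d\theta+\delta\sup_{\tau_1\le\tau\le\tau_2}E[U](\tau).$$ All integrals take values in $[0,\infty]$. -/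

import Mathlib

open scoped ENNReal ContDiff
open MeasureTheory

noncomputable section

namespace CatenoidRp

/-- The Euclidean space `ℝ⁴` (spatial dimension `n = 4`). -/
abbrev E4 : Type := EuclideanSpace ℝ (Fin 4)

/-- The unit sphere `𝕊³ ⊂ ℝ⁴`. -/
abbrev S3 : Type := Metric.sphere (0 : E4) 1

/-- The standard surface measure `dθ` on `𝕊³`. -/
abbrev sphereMeasure : Measure S3 := (volume : Measure E4).toSphere

/-- The bracket `⟨x⟩ = (1 + |x|²)^{1/2}`. -/
def bracket (x : ℝ) : ℝ := √(1 + x ^ 2)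

/-! ### Modulation parameters and foliation

The parameters `ξ, ℓ` are functions of the time `σ`, which labels the leaves. The retarded time is
the function `τ = σ - γ(σ) R_f` of `σ`. -/

/-- The Lorentz factor `γ = (1 - |v|²)^{-1/2}`. -/
def lorentz (v : E4) : ℝ := 1 / √(1 - ‖v‖ ^ 2)

/-- Orthogonal projection `P_v` to the line spanned by `v`. -/
def lineProj (v y : E4) : E4 := (inner ℝ v y / ‖v‖ ^ 2) • v

/-- The spatial part `A_v = γ P_v + P_v^⊥` of the Lorentz boost with velocity `v`. -/
def boostSpatial (v y : E4) : E4 := lorentz v • lineProj v y + (y - lineProj v y)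

/-- Retarded time `τ(σ) = σ - γ(σ) R_f`. -/
def retTime (Rf : ℝ) (l : ℝ → E4) (σ : ℝ) : ℝ := σ - lorentz (l σ) * Rf

/-- Centre of the hyperboloids, `η(σ) = ξ(σ) - γ(σ) R_f ℓ(σ)`. -/
def center (Rf : ℝ) (xi l : ℝ → E4) (σ : ℝ) : E4 := xi σ - (lorentz (l σ) * Rf) • l σ

/-- `η' = dη/dτ`, as a function of `σ`. -/
def centerVel (Rf : ℝ) (xi l : ℝ → E4) (σ : ℝ) : E4 :=
  (deriv (retTime Rf l) σ)⁻¹ • deriv (center Rf xi l) σ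

/-- The parametrization `X⁰ = τ + ⟨r⟩`, `X' = η + y`, `y = r Θ`, of the hyperboloidal region. -/
def chart (Rf : ℝ) (xi l : ℝ → E4) (q : ℝ × E4) : ℝ × E4 :=
  (retTime Rf l q.1 + bracket ‖q.2‖, center Rf xi l q.1 + q.2)

/-- The hyperboloidal part `⟨r⟩ > γ R_f + δ₁` of the leaf with label `σ`. -/
def hypLeaf (Rf δ₁ : ℝ) (l : ℝ → E4) (σ : ℝ) : Set E4 :=
  {y | lorentz (l σ) * Rf + δ₁ < bracket ‖y‖}

/-- The smallness of `ℓ` and the bootstrap assumption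
`|∂_σ^k ℘̇| ≤ 2 C_k δ_℘ ε ⟨σ⟩^{-9/4+κ}` for all `k ≥ 0`, with `℘̇ = (ℓ̇, ξ̇ - ℓ)`,
on the time interval `[0, σ_f]`. -/
structure Bootstrap (Ck : ℕ → ℝ) (Cl δw κ ε σf : ℝ) (xi l : ℝ → E4) : Prop where
  smooth_xi : ContDiff ℝ ∞ xi
  smooth_l : ContDiff ℝ ∞ l
  small_l : ∀ σ ∈ Set.Icc 0 σf, ‖l σ‖ ≤ Cl * ε
  dot_l : ∀ k : ℕ, ∀ σ ∈ Set.Icc 0 σf,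
    ‖iteratedDeriv k (deriv l) σ‖ ≤ 2 * Ck k * δw * ε * bracket σ ^ (-(9 / 4 : ℝ) + κ)
  dot_xi : ∀ k : ℕ, ∀ σ ∈ Set.Icc 0 σf,
    ‖iteratedDeriv k (fun s => deriv xi s - l s) σ‖
      ≤ 2 * Ck k * δw * ε * bracket σ ^ (-(9 / 4 : ℝ) + κ)

/-! ### The operator `P_graph` -/

/-- Height of the upper half of the Riemannian catenoid in `ℝ⁵` over the radius `s ≥ 1`:
`Q(1) = 0`, `Q'(s) = (s⁶ - 1)^{-1/2}`. -/
def catenoidHeight (s : ℝ) : ℝ := ∫ t in (1 : ℝ)..s, 1 / √(t ^ 6 - 1)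

/-- `Q_℘ = Q(|A_ℓ y - γ ⟨r⟩ ℓ|)`, in the chart `(σ, y)`. -/
def profile (l : ℝ → E4) (q : ℝ × E4) : ℝ :=
  catenoidHeight
    ‖boostSpatial (l q.1) q.2 - (lorentz (l q.1) * bracket ‖q.2‖) • l q.1‖

/-- The coordinate directions `∂/∂X^μ`, `μ = 0, …, 4`, of Minkowski space `ℝ^{1+4}`. -/
def coordDir : Fin 5 → ℝ × E4 :=
  Fin.cons ((1 : ℝ), (0 : E4)) (fun j => ((0 : ℝ), EuclideanSpace.single j (1 : ℝ)))

/-- The diagonal `(-1, 1, 1, 1, 1)` of the Minkowski metric and of its inverse. -/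
def mink : Fin 5 → ℝ := Fin.cons (-1 : ℝ) (fun _ => (1 : ℝ))

/-- The derivative `∂f/∂X^μ` of a function `f` that is given in the chart `(σ, y)`. As the
`X^μ` are Cartesian coordinates of the flat metric, `∇_μ ∇_ν = ∂_μ ∂_ν`. -/
def dX (Rf : ℝ) (xi l : ℝ → E4) (μ : Fin 5) (f : ℝ × E4 → ℝ) (q : ℝ × E4) : ℝ :=
  fderiv ℝ f q ((fderiv ℝ (chart Rf xi l) q).inverse (coordDir μ))

/-- The linearized operator
`P_graph = □ - W⁻¹ ∇^μQ ∇^νQ ∇_μ∇_ν - 2 W⁻¹ ∇^μ∇^νQ ∇_μQ ∇_ν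
  + 2 W⁻² ∇^νQ ∇^μQ ∇^λQ (∇_λ∇_μQ) ∇_ν`,
with `Q = Q_℘` and `W = 1 + ∇^αQ ∇_αQ`, in the hyperboloidal region. -/
def pGraph (Rf : ℝ) (xi l : ℝ → E4) (φ : ℝ × E4 → ℝ) (q : ℝ × E4) : ℝ :=
  let d : Fin 5 → (ℝ × E4 → ℝ) → ℝ × E4 → ℝ := dX Rf xi l
  let Q : ℝ × E4 → ℝ := profile l
  let W : ℝ := 1 + ∑ a, mink a * d a Q q ^ 2
  (∑ μ, mink μ * d μ (d μ φ) q)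
    - W⁻¹ * (∑ μ, ∑ ν, (mink μ * d μ Q q) * (mink ν * d ν Q q) * d μ (d ν φ) q)
    - 2 * W⁻¹ * (∑ μ, ∑ ν, (mink μ * mink ν * d μ (d ν Q) q) * d μ Q q * d ν φ q)
    + 2 * (W ^ 2)⁻¹ * (∑ μ, ∑ ν, ∑ lam, (mink ν * d ν Q q) * (mink μ * d μ Q q)
        * (mink lam * d lam Q q) * d lam (d μ Q) q * d ν φ q)

/-! ### Functions on the profile

A function on the profile is a function `U σ ρ θ` of the global polar coordinates
`σ`, `ρ ∈ ℝ`, `θ ∈ 𝕊³`; only the values at unit vectors `θ` matter. In the hyperboloidal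
region of the end `ρ > 0` one has `r = ρ` and `y = r θ`. -/

/-- `U` in the chart `(σ, y)` of the end `ρ > 0`. -/
def farPart (U : ℝ → ℝ → E4 → ℝ) (q : ℝ × E4) : ℝ := U q.1 ‖q.2‖ (‖q.2‖⁻¹ • q.2)

/-- `Ũ = r^{3/2} U`. -/
def conjugated (U : ℝ → ℝ → E4 → ℝ) : ℝ → ℝ → E4 → ℝ :=
  fun σ r θ => r ^ (3 / 2 : ℝ) * U σ r θ

/-- `∂_σ f`. -/
def dSigma (f : ℝ → ℝ → E4 → ℝ) (σ r : ℝ) (θ : E4) : ℝ := deriv (fun s => f s r θ) σ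

/-- `∂_τ f = (dτ/dσ)⁻¹ ∂_σ f`. -/
def dTau (Rf : ℝ) (l : ℝ → E4) (f : ℝ → ℝ → E4 → ℝ) (σ r : ℝ) (θ : E4) : ℝ :=
  (deriv (retTime Rf l) σ)⁻¹ * dSigma f σ r θ

/-- `∂_r f` (or `∂_ρ f`). -/
def dR (f : ℝ → ℝ → E4 → ℝ) (σ r : ℝ) (θ : E4) : ℝ := deriv (fun s => f σ s θ) r

/-- The gradient of `f` on the unit sphere, as a vector of `ℝ⁴` tangent at `θ`. -/
def sphGrad (f : ℝ → ℝ → E4 → ℝ) (σ r : ℝ) (θ : E4) : E4 :=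
  gradient (fun y : E4 => f σ r (‖y‖⁻¹ • y)) θ

/-- A cutoff `χ_R` with `χ_R = 0` for `r ≤ c₁ R` and `χ_R = 1` for `r ≥ c₂ R`. -/
structure IsCutoff (c₁ c₂ R : ℝ) (χ : ℝ → ℝ) : Prop where
  smooth : ContDiff ℝ ∞ χ
  nonneg : ∀ r, 0 ≤ χ r
  le_one : ∀ r, χ r ≤ 1
  eq_zero : ∀ r, r ≤ c₁ * R → χ r = 0
  eq_one : ∀ r, c₂ * R ≤ r → χ r = 1

/-- `∫ g(r, θ) dr dθ` over `r > 0`, `θ ∈ 𝕊³`, for the nonnegative part of `g`. -/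
def leafIntegral (g : ℝ → E4 → ℝ) : ℝ≥0∞ :=
  ∫⁻ r in Set.Ioi (0 : ℝ), ∫⁻ θ : S3, ENNReal.ofReal (g r θ) ∂sphereMeasure

/-- `∫ g dτ dr dθ` over the region between the leaves `σ₁` and `σ₂`, with `dτ = τ'(σ) dσ`. -/
def slabIntegral (Rf : ℝ) (l : ℝ → E4) (σ₁ σ₂ : ℝ) (g : ℝ → ℝ → E4 → ℝ) : ℝ≥0∞ :=
  ∫⁻ σ in Set.Icc σ₁ σ₂, ENNReal.ofReal (deriv (retTime Rf l) σ) * leafIntegral (g σ)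

/-- `𝓔^p[f](σ) = ∫ χ_R r^p (∂_r f)² dr dθ`. -/
def energyP (χ : ℝ → ℝ) (p : ℝ) (f : ℝ → ℝ → E4 → ℝ) (σ : ℝ) : ℝ≥0∞ :=
  leafIntegral (fun r θ => χ r * r ^ p * dR f σ r θ ^ 2)

/-- `𝓑^p[f] = ∫ χ_R r^{p-1} ((∂_r f)² + r⁻² (f² + |∇̸f|²)) dτ dr dθ`. -/
def bulkP (Rf : ℝ) (l : ℝ → E4) (χ : ℝ → ℝ) (p : ℝ) (f : ℝ → ℝ → E4 → ℝ) (σ₁ σ₂ : ℝ) :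
    ℝ≥0∞ :=
  slabIntegral Rf l σ₁ σ₂ (fun σ r θ => χ r * r ^ (p - 1) *
    (dR f σ r θ ^ 2 + (r ^ 2)⁻¹ * (f σ r θ ^ 2 + ‖sphGrad f σ r θ‖ ^ 2)))

/-- The cutoff error `Err_χ[f]`: the squares of `f` and of its first derivatives, multiplied by
`χ'` and by the weights of the corresponding `r^p`-weighted fluxes. -/
def errCutoff (Rf : ℝ) (l : ℝ → E4) (χ : ℝ → ℝ) (p : ℝ) (f : ℝ → ℝ → E4 → ℝ)
    (σ r : ℝ) (θ : E4) : ℝ :=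
  |deriv χ r| * r ^ p * (dR f σ r θ ^ 2
    + (r ^ 2)⁻¹ * (f σ r θ ^ 2 + dTau Rf l f σ r θ ^ 2 + ‖sphGrad f σ r θ‖ ^ 2))

/-- The standard energy `E[U]` of the leaf with label `σ` (both ends and the interior), with
`dV = ⟨ρ⟩³ dρ dθ`, `χ_{≤R} = 1 - χ_R` and `r = |ρ|`. -/
def stdEnergy (Rf : ℝ) (l : ℝ → E4) (χ : ℝ → ℝ) (U : ℝ → ℝ → E4 → ℝ) (σ : ℝ) : ℝ≥0∞ :=
  ∫⁻ ρ : ℝ, ∫⁻ θ : S3, ENNReal.ofReal (bracket ρ ^ 3 *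
    ((1 - χ |ρ|) * (dSigma U σ ρ θ ^ 2 + dR U σ ρ θ ^ 2
        + (bracket ρ ^ 2)⁻¹ * ‖sphGrad U σ ρ θ‖ ^ 2 + (bracket ρ ^ 2)⁻¹ * U σ ρ θ ^ 2)
      + χ |ρ| * (dR U σ ρ θ ^ 2 + (ρ ^ 2)⁻¹ *
          (dTau Rf l U σ ρ θ ^ 2 + U σ ρ θ ^ 2 + ‖sphGrad U σ ρ θ‖ ^ 2)))) ∂sphereMeasure

/-- `F̃ = r^{3/2} (1 - Θ·η') F`. -/
def conjSource (Rf : ℝ) (xi l : ℝ → E4) (F : ℝ × E4 → ℝ) (σ r : ℝ) (θ : E4) : ℝ :=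
  r ^ (3 / 2 : ℝ) * (1 - inner ℝ θ (centerVel Rf xi l σ)) * F (σ, r • θ)

/-- `b = 𝓞(r⁻³)` for `r ≥ r₀` and `σ ∈ [0, σ_f]`: `b` is smooth, and the bound holds, with
constants `M j k`, after any `j` derivatives in time and, with a gain of `r^{-k}`, after
any `k` derivatives in `y = r θ`. -/
structure IsBigOCube (M : ℕ → ℕ → ℝ) (σf r₀ : ℝ) (b : ℝ × E4 → E4) : Prop where
  smooth : ContDiff ℝ ∞ b
  bound : ∀ j k : ℕ, ∀ σ ∈ Set.Icc 0 σf, ∀ y : E4, r₀ ≤ ‖y‖ →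
    ‖iteratedFDeriv ℝ k (fun z : E4 => iteratedDeriv j (fun s => b (s, z)) σ) y‖
      ≤ M j k * ‖y‖ ^ (-3 - (k : ℝ))

/-- `U` is a `C²` solution of `P_graph U = F` in the hyperboloidal region of the end `ρ > 0`
between the leaves `σ₁` and `σ₂`. -/
def IsSolution (Rf δ₁ : ℝ) (xi l : ℝ → E4) (σ₁ σ₂ : ℝ) (U : ℝ → ℝ → E4 → ℝ)
    (F : ℝ × E4 → ℝ) : Prop :=
  ∀ σ ∈ Set.Icc σ₁ σ₂, ∀ y ∈ hypLeaf Rf δ₁ l σ,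
    ContDiffAt ℝ 2 (farPart U) (σ, y) ∧ pGraph Rf xi l (farPart U) (σ, y) = F (σ, y)

end CatenoidRp

end

open CatenoidRp

/-!
The estimate is an energy estimate with a radial multiplier. In the chart `(σ, y)`, `y = r Θ`, put
`φ = r ^ (3 / 2) U`. If the hyperboloids did not move and the catenoid were flat, the equation
would become
`flatTensor^{αβ} ∂_α ∂_β φ - 3 r⁻¹ ∂_r φ - (3/4) r⁻² φ = r ^ (3 / 2) F`.
In general, after multiplication by the Jacobian `Λ = jac` of the chart, the equation differs from
this one by terms of relative size `C (ε + 1 / r)`, where a `σ`-component of a coefficient counts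
as `r⁻¹` and a derivative in `y` gains `r⁻¹`; this is `NearFlatAt`, proved in
`exists_eventually_nearFlatAt`. The reasons are that the velocity of the centres is `O(ε)` with all
its derivatives, and that the gradient of the catenoid is `O(r⁻²)`. The uniformity in the motion is
kept by working with symbols along the filter `smallFar` of small motions and distant points.

The multiplier is `χ r ^ p ∂_r φ` in the density `dr dΘ`, that is, the radial field with coefficient
`multCoeff`. The divergence identity `div_current` has bulk terms which, for the flat operator,
control `χ r ^ (p - 1) ((∂_r φ)² + r⁻² (φ² + |∇̸ φ|²))` with the constant
`coercConst p = (3/4) min (p / 2) (2 - p)`; up to a term with `r ^ (p - 3) (∂_σ φ)²`, half of it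
absorbs the perturbation (`coercive_le_div`). The whole perturbation being absorbed in this way,
the multiplier needs no angular correction, and the estimate holds with the coefficient `b = 0`,
for which the right-hand side has only the radial source term. The flux through a leaf is
`χ r ^ p (∂_r φ)²` up to terms with the weight `r ^ (p - 2)`, which the standard energy bounds
(`flux_bounds`).

Nothing is assumed on the decay of `U`. If the standard energy is infinite, so is the right-hand
side. If it is finite, the identity is applied with the weights `temperedWeight`, which increase to
`r ^ p` but grow only like `r ^ (p / 2)` at infinity: as `p / 2 < 1`, the contribution of a
truncation far out tends to zero, and Fatou's lemma gives `weighted_estimate`. The passage to polar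
coordinates uses only inequalities that hold for functions which need not be measurable, since `U`
is arbitrary outside the region of the equation.

For the constants, let `δ = K R̃ ^ (-α)`. The errors have the weight `r ^ (p - 2 + α)` relative to
the terms on the right with the factor `δ`, and are divided by `coercConst p`. If `p ≥ 1`, this
weight is at most `r ^ (-α)` and `coercConst p ≥ (3/2) α`; if `p < 1`, the constant may be as small
as `(3/8) δ`, but the weight is at most `r ^ (-1 + α)` (`weight_le_mul_coercConst`).
-/

noncomputable section

namespace CatenoidRp

/-! ### Coordinate derivatives and the energy identity -/

/-- The derivative of `f` along the `μ`-th coordinate of the chart `(σ, y) ∈ ℝ × ℝ⁴`. -/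
def pd (μ : Fin 5) (f : ℝ × E4 → ℝ) (q : ℝ × E4) : ℝ := fderiv ℝ f q (coordDir μ)

section pd

variable {f g : ℝ × E4 → ℝ} {q : ℝ × E4} {μ ν : Fin 5}

lemma pd_add (hf : DifferentiableAt ℝ f q) (hg : DifferentiableAt ℝ g q) :
    pd μ (fun x => f x + g x) q = pd μ f q + pd μ g q := by
  simp only [pd]; rw [fderiv_fun_add hf hg]; simp

lemma pd_sub (hf : DifferentiableAt ℝ f q) (hg : DifferentiableAt ℝ g q) :
    pd μ (fun x => f x - g x) q = pd μ f q - pd μ g q := by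
  simp only [pd]; rw [fderiv_fun_sub hf hg]; simp

lemma pd_neg : pd μ (fun x => - f x) q = - pd μ f q := by
  simp only [pd]; rw [fderiv_fun_neg]; simp

lemma pd_mul (hf : DifferentiableAt ℝ f q) (hg : DifferentiableAt ℝ g q) :
    pd μ (fun x => f x * g x) q = pd μ f q * g q + f q * pd μ g q := by
  simp only [pd]; rw [fderiv_fun_mul hf hg]; simp; ring

lemma pd_const (c : ℝ) : pd μ (fun _ => c) q = 0 := by
  simp [pd]

lemma pd_sum {ι : Type*} {s : Finset ι} {F : ι → ℝ × E4 → ℝ}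
    (hF : ∀ i ∈ s, DifferentiableAt ℝ (F i) q) :
    pd μ (fun x => ∑ i ∈ s, F i x) q = ∑ i ∈ s, pd μ (F i) q := by
  simp only [pd]; rw [fderiv_fun_sum hF]; simp

lemma pd_comp {k : ℝ → ℝ} (hk : DifferentiableAt ℝ k (f q)) (hf : DifferentiableAt ℝ f q) :
    pd μ (fun x => k (f x)) q = deriv k (f q) * pd μ f q := by
  have := (hk.hasDerivAt.comp_hasFDerivAt q hf.hasFDerivAt).fderiv
  simp only [pd]
  rw [show (fun x => k (f x)) = k ∘ f from rfl, this]; simp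

lemma pd_congr (h : f =ᶠ[nhds q] g) : pd μ f q = pd μ g q := by
  simp only [pd]; rw [h.fderiv_eq]

lemma contDiffAt_pd {n : ℕ∞} (hf : ContDiffAt ℝ (n + 1 : ℕ∞) f q) : ContDiffAt ℝ n (pd μ f) q := by
  have := hf.fderiv_right (m := n) (by norm_cast)
  exact this.clm_apply contDiffAt_const

lemma pd_comm (hf : ContDiffAt ℝ 2 f q) : pd μ (pd ν f) q = pd ν (pd μ f) q := by
  have h1 : ContDiffAt ℝ 1 (fderiv ℝ f) q := hf.fderiv_right (m := 1) (by norm_num)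
  have key : ∀ a b : Fin 5, pd a (pd b f) q = fderiv ℝ (fderiv ℝ f) q (coordDir a) (coordDir b) := by
    intro a b
    have : pd b f = fun x => fderiv ℝ f x (coordDir b) := rfl
    simp only [this]
    simp only [pd]
    rw [fderiv_clm_apply (h1.differentiableAt (by norm_num)) (differentiableAt_const _)]
    simp
  rw [key, key]
  exact (hf.isSymmSndFDerivAt (by simp)).eq _ _

end pd

/-- The divergence of the energy current of the symmetric tensor `A` and the vector field `Y`. -/
lemma energy_identity {φ : ℝ × E4 → ℝ} {A : Fin 5 → Fin 5 → ℝ × E4 → ℝ}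
    {Y : Fin 5 → ℝ × E4 → ℝ} {q : ℝ × E4} (hφ : ContDiffAt ℝ 2 φ q)
    (hA : ∀ α β, DifferentiableAt ℝ (A α β) q) (hsym : ∀ α β, A α β q = A β α q)
    (hY : ∀ μ, DifferentiableAt ℝ (Y μ) q) :
    ∑ μ, pd μ (fun x => 2 * (∑ ν, A μ ν x * pd ν φ x) * (∑ l, Y l x * pd l φ x)
        - Y μ x * ∑ α, ∑ β, A α β x * (pd α φ x * pd β φ x)) q
      = 2 * (∑ μ, ∑ ν, A μ ν q * pd μ (pd ν φ) q) * (∑ l, Y l q * pd l φ q)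
        + 2 * (∑ μ, ∑ ν, pd μ (A μ ν) q * pd ν φ q) * (∑ l, Y l q * pd l φ q)
        + 2 * (∑ μ, (∑ ν, A μ ν q * pd ν φ q) * (∑ l, pd μ (Y l) q * pd l φ q))
        - (∑ μ, pd μ (Y μ) q) * (∑ α, ∑ β, A α β q * (pd α φ q * pd β φ q))
        - ∑ μ, Y μ q * ∑ α, ∑ β, pd μ (A α β) q * (pd α φ q * pd β φ q) := by
  have hp : ∀ μ, DifferentiableAt ℝ (pd μ φ) q := fun μ =>
    (contDiffAt_pd (n := 1) (by exact_mod_cast hφ)).differentiableAt (by norm_num)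
  have step : ∀ μ, pd μ (fun x => 2 * (∑ ν, A μ ν x * pd ν φ x) * (∑ l, Y l x * pd l φ x)
        - Y μ x * ∑ α, ∑ β, A α β x * (pd α φ x * pd β φ x)) q
      = 2 * ((∑ ν, pd μ (A μ ν) q * pd ν φ q) + ∑ ν, A μ ν q * pd μ (pd ν φ) q)
          * (∑ l, Y l q * pd l φ q)
        + 2 * (∑ ν, A μ ν q * pd ν φ q) * ((∑ l, pd μ (Y l) q * pd l φ q)
          + ∑ l, Y l q * pd l (pd μ φ) q)
        - pd μ (Y μ) q * (∑ α, ∑ β, A α β q * (pd α φ q * pd β φ q))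
        - Y μ q * (∑ α, ∑ β, pd μ (A α β) q * (pd α φ q * pd β φ q))
        - Y μ q * (2 * ∑ α, ∑ β, A α β q * (pd μ (pd α φ) q * pd β φ q)) := by
    intro μ
    have d1 : DifferentiableAt ℝ (fun x => ∑ ν, A μ ν x * pd ν φ x) q :=
      DifferentiableAt.fun_sum fun ν _ => (hA μ ν).fun_mul (hp ν)
    have d2 : DifferentiableAt ℝ (fun x => ∑ l, Y l x * pd l φ x) q :=
      DifferentiableAt.fun_sum fun ν _ => (hY ν).fun_mul (hp ν)
    have d3 : DifferentiableAt ℝ (fun x => ∑ α, ∑ β, A α β x * (pd α φ x * pd β φ x)) q :=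
      DifferentiableAt.fun_sum fun α _ => DifferentiableAt.fun_sum fun β _ =>
        (hA α β).fun_mul ((hp α).fun_mul (hp β))
    rw [pd_sub ((d1.const_mul 2).fun_mul d2) ((hY μ).fun_mul d3), pd_mul (d1.const_mul 2) d2,
      pd_mul (differentiableAt_const _) d1, pd_const, pd_mul (hY μ) d3,
      pd_sum (fun ν _ => (hA μ ν).fun_mul (hp ν)), pd_sum (fun ν _ => (hY ν).fun_mul (hp ν)),
      pd_sum (fun α _ => DifferentiableAt.fun_sum fun β _ => (hA α β).fun_mul ((hp α).fun_mul (hp β)))]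
    have e3 : ∑ i, pd μ (fun x => ∑ β, A i β x * (pd i φ x * pd β φ x)) q
        = (∑ α, ∑ β, pd μ (A α β) q * (pd α φ q * pd β φ q))
          + 2 * ∑ α, ∑ β, A α β q * (pd μ (pd α φ) q * pd β φ q) := by
      have e4 : ∑ α, ∑ β, A α β q * (pd α φ q * pd μ (pd β φ) q)
          = ∑ α, ∑ β, A α β q * (pd μ (pd α φ) q * pd β φ q) := by
        rw [Finset.sum_comm]
        refine Finset.sum_congr rfl fun α _ => Finset.sum_congr rfl fun β _ => ?_
        rw [hsym]; ring
      rw [two_mul]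
      conv_rhs => enter [2, 2]; rw [← e4]
      rw [← Finset.sum_add_distrib, ← Finset.sum_add_distrib]
      refine Finset.sum_congr rfl fun α _ => ?_
      rw [pd_sum (fun β _ => (hA α β).fun_mul ((hp α).fun_mul (hp β))), ← Finset.sum_add_distrib,
        ← Finset.sum_add_distrib]
      refine Finset.sum_congr rfl fun β _ => ?_
      rw [pd_mul (hA α β) ((hp α).fun_mul (hp β)), pd_mul (hp α) (hp β)]
      ring
    have e1 : ∑ i, pd μ (fun x => A μ i x * pd i φ x) q
        = (∑ ν, pd μ (A μ ν) q * pd ν φ q) + ∑ ν, A μ ν q * pd μ (pd ν φ) q := by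
      rw [← Finset.sum_add_distrib]
      exact Finset.sum_congr rfl fun ν _ => pd_mul (hA μ ν) (hp ν)
    have e2 : ∑ i, pd μ (fun x => Y i x * pd i φ x) q
        = (∑ l, pd μ (Y l) q * pd l φ q) + ∑ l, Y l q * pd l (pd μ φ) q := by
      rw [← Finset.sum_add_distrib]
      refine Finset.sum_congr rfl fun ν _ => ?_
      rw [pd_mul (hY ν) (hp ν), pd_comm hφ]
    rw [e1, e2, e3]
    ring
  rw [Finset.sum_congr rfl fun μ _ => step μ]
  simp only [Finset.sum_sub_distrib, Finset.sum_add_distrib, mul_add, add_mul, ← Finset.sum_mul,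
    mul_assoc, ← Finset.mul_sum]
  have e5 : ∑ μ, (∑ ν, A μ ν q * pd ν φ q) * ∑ l, Y l q * pd l (pd μ φ) q
      = ∑ μ, Y μ q * ∑ α, ∑ β, A α β q * (pd μ (pd α φ) q * pd β φ q) := by
    simp only [Finset.sum_mul, Finset.mul_sum]
    rw [Finset.sum_comm]
    refine Finset.sum_congr rfl fun μ _ => Finset.sum_congr rfl fun α _ =>
      Finset.sum_congr rfl fun β _ => by ring
  have e6 : ∑ μ, Y μ q * (2 * ∑ α, ∑ β, A α β q * (pd μ (pd α φ) q * pd β φ q))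
      = 2 * ∑ μ, Y μ q * ∑ α, ∑ β, A α β q * (pd μ (pd α φ) q * pd β φ q) := by
    rw [Finset.mul_sum]; exact Finset.sum_congr rfl fun _ _ => by ring
  rw [e5, e6]
  ring

/-! ### The divergence theorem between two leaves -/

lemma integrableOn_slab {g : ℝ × E4 → ℝ} {s t M : ℝ}
    (hg : ContinuousOn g (Set.Icc s t ×ˢ Set.univ)) (h0 : ∀ σ y, M < ‖y‖ → g (σ, y) = 0) :
    IntegrableOn g (Set.Icc s t ×ˢ Set.univ) := by
  have h1 : IntegrableOn g (Set.Icc s t ×ˢ Metric.closedBall (0 : E4) M) :=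
    (hg.mono (Set.prod_mono_right (Set.subset_univ _))).integrableOn_compact
      (isCompact_Icc.prod (isCompact_closedBall _ _))
  refine h1.of_forall_sdiff_eq_zero (measurableSet_Icc.prod MeasurableSet.univ) ?_
  rintro ⟨σ, y⟩ ⟨⟨h2, -⟩, h3⟩
  apply h0
  simpa [h2] using h3

lemma integrable_leaf {g : E4 → ℝ} {M : ℝ} (hg : Continuous g) (h0 : ∀ y, M < ‖y‖ → g y = 0) :
    Integrable g :=
  hg.integrable_of_hasCompactSupport <|
    HasCompactSupport.of_support_subset_isCompact (isCompact_closedBall (0 : E4) M) <| by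
      intro y hy
      simp only [Metric.mem_closedBall, dist_zero_right]
      by_contra h
      exact hy (h0 y (not_le.1 h))

section

variable {J : ℝ × E4 → ℝ} {s t M : ℝ}

lemma continuousOn_pd (hJ : ∀ σ ∈ Set.Icc s t, ∀ y, ContDiffAt ℝ 1 J (σ, y)) (μ : Fin 5) :
    ContinuousOn (pd μ J) (Set.Icc s t ×ˢ Set.univ) := by
  rintro ⟨σ, y⟩ ⟨h, -⟩
  exact (contDiffAt_pd (n := 0) (by simpa using hJ σ h y)).continuousAt.continuousWithinAt

lemma pd_eq_zero_of_large (h0 : ∀ σ y, M ≤ ‖y‖ → J (σ, y) = 0) (μ : Fin 5) (σ : ℝ) (y : E4)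
    (hy : M < ‖y‖) : pd μ J (σ, y) = 0 := by
  have : J =ᶠ[nhds (σ, y)] fun _ => 0 := by
    have : {q : ℝ × E4 | M < ‖q.2‖} ∈ nhds (σ, y) :=
      (isOpen_lt continuous_const continuous_snd.norm).mem_nhds hy
    filter_upwards [this] with q hq using h0 q.1 q.2 hq.le
  rw [pd_congr this, pd_const]

/-- The integral of the divergence of a current that vanishes for large `‖y‖` is the difference
of its fluxes through the two leaves. -/
lemma integral_divergence {J : Fin 5 → ℝ × E4 → ℝ} (hst : s ≤ t)
    (hJ : ∀ μ, ∀ σ ∈ Set.Icc s t, ∀ y, ContDiffAt ℝ 1 (J μ) (σ, y))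
    (h0 : ∀ μ σ y, M ≤ ‖y‖ → J μ (σ, y) = 0) :
    ∫ q in Set.Icc s t ×ˢ Set.univ, ∑ μ, pd μ (J μ) q
      = (∫ y, J 0 (t, y)) - ∫ y, J 0 (s, y) := by
  have hint : ∀ μ, IntegrableOn (pd μ (J μ)) (Set.Icc s t ×ˢ Set.univ) := fun μ =>
    integrableOn_slab (continuousOn_pd (hJ μ) μ) (pd_eq_zero_of_large (h0 μ) μ)
  have hJs : ∀ μ, ∀ σ ∈ Set.Icc s t, Integrable fun y => J μ (σ, y) := fun μ σ hσ =>
    integrable_leaf (continuous_iff_continuousAt.2 fun y =>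
      ContinuousAt.comp (f := fun y => (σ, y)) (hJ μ σ hσ y).continuousAt (by fun_prop))
      (fun y hy => h0 μ σ y hy.le)
  rw [integral_finsetSum _ fun μ _ => hint μ, Fin.sum_univ_succ]
  have hspace : ∀ j : Fin 4, ∫ q in Set.Icc s t ×ˢ Set.univ, pd j.succ (J j.succ) q = 0 := by
    intro j
    have hi := hint j.succ
    rw [Measure.volume_eq_prod] at hi ⊢
    rw [setIntegral_prod _ hi]
    refine setIntegral_eq_zero_of_forall_eq_zero fun σ hσ => ?_
    rw [Measure.restrict_univ]
    have hd : ∀ y, HasFDerivAt (fun y => J j.succ (σ, y))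
        ((fderiv ℝ (J j.succ) (σ, y)).comp (ContinuousLinearMap.inr ℝ ℝ E4)) y := fun y =>
      ((hJ j.succ σ hσ y).differentiableAt (by norm_num)).hasFDerivAt.comp y
        (hasFDerivAt_prodMk_right σ y)
    have hc : Continuous fun y => pd j.succ (J j.succ) (σ, y) := by
      rw [continuous_iff_continuousAt]
      intro y
      exact ContinuousAt.comp (f := fun y => (σ, y)) (contDiffAt_pd (n := 0)
        (by simpa using hJ j.succ σ hσ y)).continuousAt (by fun_prop)
    have hpi : Integrable fun y => pd j.succ (J j.succ) (σ, y) :=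
      integrable_leaf hc fun y hy => pd_eq_zero_of_large (h0 j.succ) _ σ y hy
    have key := integral_mul_fderiv_eq_neg_fderiv_mul_of_integrable (𝕜 := ℝ) (μ := volume)
      (f := fun _ : E4 => (1 : ℝ)) (g := fun y => J j.succ (σ, y))
      (v := EuclideanSpace.single j (1 : ℝ)) (by simp) ?_ ?_
      (fun _ _ => differentiableAt_const _) (fun y _ => (hd y).differentiableAt)
    · simp only [fderiv_fun_const, one_mul] at key
      have e : ∀ y, fderiv ℝ (fun y => J j.succ (σ, y)) y (EuclideanSpace.single j (1 : ℝ))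
          = pd j.succ (J j.succ) (σ, y) := fun y => by
        rw [(hd y).fderiv]; simp [pd, coordDir]
      simp only [e] at key
      simpa using key
    · have e : ∀ y, fderiv ℝ (fun y => J j.succ (σ, y)) y (EuclideanSpace.single j (1 : ℝ))
          = pd j.succ (J j.succ) (σ, y) := fun y => by
        rw [(hd y).fderiv]; simp [pd, coordDir]
      simpa only [one_mul, e] using hpi
    · simpa only [one_mul] using hJs j.succ σ hσ
  rw [Finset.sum_eq_zero fun j _ => hspace j, add_zero]
  have hi := hint 0
  rw [Measure.volume_eq_prod] at hi ⊢
  rw [← integral_sub (hJs 0 t ⟨hst, le_rfl⟩) (hJs 0 s ⟨le_rfl, hst⟩)]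
  rw [← Measure.prod_restrict, integral_prod_symm _ (by rw [Measure.prod_restrict]; exact hi),
    Measure.restrict_univ]
  refine integral_congr_ae (Filter.Eventually.of_forall fun y => ?_)
  have hd : ∀ σ ∈ Set.uIcc s t, HasDerivAt (fun σ => J 0 (σ, y)) (pd 0 (J 0) (σ, y)) σ := by
    intro σ hσ
    rw [Set.uIcc_of_le hst] at hσ
    have := ((hJ 0 σ hσ y).differentiableAt (by norm_num)).hasFDerivAt.comp_hasDerivAt σ
      ((hasDerivAt_id σ).prodMk (hasDerivAt_const σ y))
    exact this
  simp only
  rw [integral_Icc_eq_integral_Ioc, ← intervalIntegral.integral_of_le hst,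
    intervalIntegral.integral_eq_sub_of_hasDerivAt hd]
  refine ContinuousOn.intervalIntegrable ?_
  rw [Set.uIcc_of_le hst]
  exact (continuousOn_pd (hJ 0) 0).comp (by fun_prop) fun σ hσ => ⟨hσ, trivial⟩

end

/-! ### Derivatives of radial functions -/

section radial

variable {q : ℝ × E4}

lemma pd_zero_snd {f : E4 → ℝ} (hf : DifferentiableAt ℝ f q.2) :
    pd 0 (fun x => f x.2) q = 0 := by
  have : HasFDerivAt (fun x : ℝ × E4 => f x.2) _ q :=
    hf.hasFDerivAt.comp q (hasFDerivAt_snd (p := q))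
  simp [pd, this.fderiv, coordDir]

lemma differentiableAt_coord (j : Fin 4) : DifferentiableAt ℝ (fun x : ℝ × E4 => x.2 j) q :=
  ((EuclideanSpace.proj j : E4 →L[ℝ] ℝ).comp (ContinuousLinearMap.snd ℝ ℝ E4)).differentiableAt

lemma contDiff_coord {n : WithTop ℕ∞} (j : Fin 4) : ContDiff ℝ n (fun x : ℝ × E4 => x.2 j) :=
  ((EuclideanSpace.proj j : E4 →L[ℝ] ℝ).comp (ContinuousLinearMap.snd ℝ ℝ E4)).contDiff

lemma pd_succ_coord (k j : Fin 4) :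
    pd k.succ (fun x : ℝ × E4 => x.2 j) q = if k = j then 1 else 0 := by
  have : HasFDerivAt (fun x : ℝ × E4 => x.2 j)
      ((EuclideanSpace.proj j : E4 →L[ℝ] ℝ).comp (ContinuousLinearMap.snd ℝ ℝ E4)) q :=
    ((EuclideanSpace.proj j : E4 →L[ℝ] ℝ).comp (ContinuousLinearMap.snd ℝ ℝ E4)).hasFDerivAt
  simp [pd, this.fderiv, coordDir, eq_comm]

lemma pd_zero_coord (j : Fin 4) : pd 0 (fun x : ℝ × E4 => x.2 j) q = 0 := by
  have : HasFDerivAt (fun x : ℝ × E4 => x.2 j)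
      ((EuclideanSpace.proj j : E4 →L[ℝ] ℝ).comp (ContinuousLinearMap.snd ℝ ℝ E4)) q :=
    ((EuclideanSpace.proj j : E4 →L[ℝ] ℝ).comp (ContinuousLinearMap.snd ℝ ℝ E4)).hasFDerivAt
  simp [pd, this.fderiv, coordDir]

lemma pd_succ_norm_sq (k : Fin 4) :
    pd k.succ (fun x : ℝ × E4 => ‖x.2‖ ^ 2) q = 2 * q.2 k := by
  have := (hasFDerivAt_snd (𝕜 := ℝ) (p := q)).norm_sq
  simp [pd, this.fderiv, coordDir, EuclideanSpace.inner_single_right]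

lemma contDiffAt_norm_snd {n : WithTop ℕ∞} (h : q.2 ≠ 0) :
    ContDiffAt ℝ n (fun x : ℝ × E4 => ‖x.2‖) q :=
  contDiffAt_snd.norm ℝ h

lemma pd_succ_norm (k : Fin 4) (h : q.2 ≠ 0) :
    pd k.succ (fun x : ℝ × E4 => ‖x.2‖) q = q.2 k / ‖q.2‖ := by
  have hd : DifferentiableAt ℝ (fun x : ℝ × E4 => ‖x.2‖) q :=
    (contDiffAt_norm_snd (n := 1) h).differentiableAt (by norm_num)
  have h1 := pd_succ_norm_sq (q := q) k
  simp only [pow_two] at h1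
  rw [pd_mul hd hd] at h1
  have : ‖q.2‖ ≠ 0 := norm_ne_zero_iff.2 h
  field_simp
  linarith

lemma pd_succ_radial {f : ℝ → ℝ} (k : Fin 4) (h : q.2 ≠ 0) (hf : DifferentiableAt ℝ f ‖q.2‖) :
    pd k.succ (fun x : ℝ × E4 => f ‖x.2‖) q = deriv f ‖q.2‖ * (q.2 k / ‖q.2‖) := by
  rw [pd_comp (f := fun x : ℝ × E4 => ‖x.2‖) hf
    ((contDiffAt_norm_snd (n := 1) h).differentiableAt (by norm_num)), pd_succ_norm k h]

lemma pd_zero_radial {f : ℝ → ℝ} (h : q.2 ≠ 0) (hf : DifferentiableAt ℝ f ‖q.2‖) :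
    pd 0 (fun x : ℝ × E4 => f ‖x.2‖) q = 0 :=
  pd_zero_snd (f := fun y => f ‖y‖) (hf.comp q.2 (differentiableAt_id.norm ℝ h))

lemma bracket_pos (x : ℝ) : 0 < bracket x := by unfold bracket; positivity

lemma bracket_sq (x : ℝ) : bracket x ^ 2 = 1 + x ^ 2 := by
  unfold bracket; exact Real.sq_sqrt (by positivity)

lemma contDiff_bracket {n : WithTop ℕ∞} : ContDiff ℝ n bracket := by
  unfold bracket
  exact (contDiff_const.add (contDiff_id.pow 2)).sqrt fun x => by
    simp only [id]; positivity

lemma hasDerivAt_bracket (x : ℝ) : HasDerivAt bracket (x / bracket x) x := by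
  have h := ((hasDerivAt_pow 2 x).const_add 1).sqrt (by positivity)
  refine h.congr_deriv ?_
  simp [bracket]; ring

end radial

/-! ### The flat operator -/

/-- The second-order coefficients of the Minkowski wave operator in the chart `(σ, y)` of the
hyperboloids `X⁰ = σ + ⟨r⟩`, `X' = y` with a fixed centre. -/
def flatTensor (α β : Fin 5) (q : ℝ × E4) : ℝ :=
  Fin.cases (motive := fun _ => ℝ)
    (Fin.cases (motive := fun _ => ℝ) (-(bracket ‖q.2‖ ^ 2)⁻¹)
      (fun k => -(q.2 k * (bracket ‖q.2‖)⁻¹)) β)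
    (fun j => Fin.cases (motive := fun _ => ℝ) (-(q.2 j * (bracket ‖q.2‖)⁻¹))
      (fun k => if j = k then 1 else 0) β) α

/-- The weights of the components of tensors: a `σ`-component costs a factor `r⁻¹`. -/
def compWeight (r : ℝ) (α : Fin 5) : ℝ := Fin.cases (motive := fun _ => ℝ) r⁻¹ (fun _ => 1) α

section flat

variable {q : ℝ × E4}

@[simp] lemma flatTensor_zero_zero : flatTensor 0 0 q = -(bracket ‖q.2‖ ^ 2)⁻¹ := rfl
@[simp] lemma flatTensor_zero_succ (k : Fin 4) :
    flatTensor 0 k.succ q = -(q.2 k * (bracket ‖q.2‖)⁻¹) := rfl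
@[simp] lemma flatTensor_succ_zero (k : Fin 4) :
    flatTensor k.succ 0 q = -(q.2 k * (bracket ‖q.2‖)⁻¹) := rfl
@[simp] lemma flatTensor_succ_succ (j k : Fin 4) :
    flatTensor j.succ k.succ q = if j = k then 1 else 0 := rfl
@[simp] lemma compWeight_zero (r : ℝ) : compWeight r 0 = r⁻¹ := rfl
@[simp] lemma compWeight_succ (r : ℝ) (j : Fin 4) : compWeight r j.succ = 1 := rfl

lemma compWeight_nonneg {r : ℝ} (hr : 0 ≤ r) (α : Fin 5) : 0 ≤ compWeight r α := by
  refine Fin.cases ?_ (fun j => ?_) α <;> simp [hr]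

lemma flatTensor_symm (α β : Fin 5) : flatTensor α β q = flatTensor β α q := by
  refine Fin.cases (Fin.cases rfl (fun k => rfl) β) (fun j => Fin.cases rfl (fun k => ?_) β) α
  simp [eq_comm]

lemma contDiffAt_bracket_norm {n : WithTop ℕ∞} (h : q.2 ≠ 0) :
    ContDiffAt ℝ n (fun x : ℝ × E4 => bracket ‖x.2‖) q :=
  contDiff_bracket.contDiffAt.comp q (contDiffAt_norm_snd h)

lemma contDiffAt_flatTensor {n : WithTop ℕ∞} (h : q.2 ≠ 0) (α β : Fin 5) :
    ContDiffAt ℝ n (flatTensor α β) q := by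
  have hb : ContDiffAt ℝ n (fun x : ℝ × E4 => bracket ‖x.2‖) q := contDiffAt_bracket_norm h
  have h1 : ContDiffAt ℝ n (fun x : ℝ × E4 => -(bracket ‖x.2‖ ^ 2)⁻¹) q :=
    ((hb.pow 2).inv (pow_pos (bracket_pos _) 2).ne').neg
  have h2 : ∀ k, ContDiffAt ℝ n (fun x : ℝ × E4 => -(x.2 k * (bracket ‖x.2‖)⁻¹)) q := fun k =>
    ((contDiff_coord k).contDiffAt.mul (hb.inv (bracket_pos _).ne')).neg
  refine Fin.cases (Fin.cases h1 (fun k => h2 k) β)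
    (fun j => Fin.cases (h2 j) (fun k => contDiffAt_const) β) α

lemma pd_zero_flatTensor (h : q.2 ≠ 0) (α β : Fin 5) : pd 0 (flatTensor α β) q = 0 := by
  have h1 : ∀ k, DifferentiableAt ℝ (fun y : E4 => -(y k * (bracket ‖y‖)⁻¹)) q.2 := by
    intro k
    have hb : ContDiffAt ℝ 1 (fun y : E4 => bracket ‖y‖) q.2 :=
      contDiff_bracket.contDiffAt.comp q.2 (contDiffAt_id.norm ℝ h)
    exact (((EuclideanSpace.proj k : E4 →L[ℝ] ℝ).contDiff.contDiffAt.mul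
      (hb.inv (bracket_pos _).ne')).neg).differentiableAt (n := 1) (by norm_num)
  have h2 : DifferentiableAt ℝ (fun y : E4 => -(bracket ‖y‖ ^ 2)⁻¹) q.2 := by
    have hb : ContDiffAt ℝ 1 (fun y : E4 => bracket ‖y‖) q.2 :=
      contDiff_bracket.contDiffAt.comp q.2 (contDiffAt_id.norm ℝ h)
    exact (((hb.pow 2).inv (pow_pos (bracket_pos _) 2).ne').neg).differentiableAt (by norm_num)
  refine Fin.cases (Fin.cases (pd_zero_snd h2) (fun k => pd_zero_snd (h1 k)) β)
    (fun j => Fin.cases (pd_zero_snd (h1 j)) (fun k => pd_const _) β) α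

lemma pd_succ_bracket_inv (h : q.2 ≠ 0) (k : Fin 4) :
    pd k.succ (fun x : ℝ × E4 => (bracket ‖x.2‖)⁻¹) q = -(q.2 k / bracket ‖q.2‖ ^ 3) := by
  have hd := (hasDerivAt_bracket ‖q.2‖).inv (bracket_pos _).ne'
  have hd' : HasDerivAt (fun t => (bracket t)⁻¹) _ ‖q.2‖ := hd
  rw [pd_succ_radial (f := fun t => (bracket t)⁻¹) k h hd'.differentiableAt, hd'.deriv]
  have := (bracket_pos ‖q.2‖).ne'
  have : ‖q.2‖ ≠ 0 := norm_ne_zero_iff.2 h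
  field_simp

lemma pd_succ_flatTensor_zero_zero (h : q.2 ≠ 0) (k : Fin 4) :
    pd k.succ (flatTensor 0 0) q = 2 * q.2 k / bracket ‖q.2‖ ^ 4 := by
  have hd : DifferentiableAt ℝ (fun x : ℝ × E4 => (bracket ‖x.2‖)⁻¹) q :=
    ((contDiffAt_bracket_norm (n := 1) h).inv (bracket_pos _).ne').differentiableAt (by norm_num)
  have e : flatTensor 0 0 = fun x : ℝ × E4 => -((bracket ‖x.2‖)⁻¹ * (bracket ‖x.2‖)⁻¹) := by
    funext x; simp [pow_two]
  rw [e, pd_neg, pd_mul hd hd, pd_succ_bracket_inv h]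
  have := (bracket_pos ‖q.2‖).ne'
  field_simp; ring

lemma pd_succ_coord_div_bracket (h : q.2 ≠ 0) (k j : Fin 4) :
    pd k.succ (fun x : ℝ × E4 => x.2 j * (bracket ‖x.2‖)⁻¹) q
      = (if k = j then (bracket ‖q.2‖)⁻¹ else 0) - q.2 k * q.2 j / bracket ‖q.2‖ ^ 3 := by
  have hd : DifferentiableAt ℝ (fun x : ℝ × E4 => (bracket ‖x.2‖)⁻¹) q :=
    ((contDiffAt_bracket_norm (n := 1) h).inv (bracket_pos _).ne').differentiableAt (by norm_num)
  rw [pd_mul (differentiableAt_coord j) hd, pd_succ_coord, pd_succ_bracket_inv h]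
  split_ifs <;> ring

lemma pd_succ_flatTensor_succ_zero (h : q.2 ≠ 0) (k j : Fin 4) :
    pd k.succ (flatTensor j.succ 0) q
      = -((if k = j then (bracket ‖q.2‖)⁻¹ else 0) - q.2 k * q.2 j / bracket ‖q.2‖ ^ 3) := by
  rw [← pd_succ_coord_div_bracket h, ← pd_neg]; rfl

lemma pd_succ_flatTensor_zero_succ (h : q.2 ≠ 0) (k j : Fin 4) :
    pd k.succ (flatTensor 0 j.succ) q
      = -((if k = j then (bracket ‖q.2‖)⁻¹ else 0) - q.2 k * q.2 j / bracket ‖q.2‖ ^ 3) := by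
  rw [← pd_succ_coord_div_bracket h, ← pd_neg]; rfl

lemma pd_succ_flatTensor_succ_succ (i j k : Fin 4) :
    pd i.succ (flatTensor j.succ k.succ) q = 0 := pd_const _

lemma norm_sq_eq_sum (y : E4) : ‖y‖ ^ 2 = ∑ j, y j ^ 2 := by
  rw [EuclideanSpace.norm_sq_eq]; simp

/-- The bulk terms of the energy identity of the flat tensor and the field `F y`: the mixed terms
cancel. Here `n = r F'`. -/
lemma flat_bulk (h : q.2 ≠ 0) {dY : Fin 5 → Fin 5 → ℝ} {Y p : Fin 5 → ℝ} {F n : ℝ}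
    (hY0 : Y 0 = 0) (hY : ∀ j : Fin 4, Y j.succ = F * q.2 j)
    (hdY0 : ∀ μ, dY μ 0 = 0) (hdY0' : ∀ μ, dY 0 μ = 0)
    (hdY : ∀ k j : Fin 4, dY k.succ j.succ
      = (if k = j then F else 0) + n * (q.2 k * q.2 j) / ‖q.2‖ ^ 2) :
    2 * (∑ μ, ∑ ν, pd μ (flatTensor μ ν) q * p ν) * (∑ l, Y l * p l)
        + 2 * (∑ μ, (∑ ν, flatTensor μ ν q * p ν) * (∑ l, dY μ l * p l))
        - (∑ μ, dY μ μ) * (∑ α, ∑ β, flatTensor α β q * (p α * p β))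
        - ∑ μ, Y μ * ∑ α, ∑ β, pd μ (flatTensor α β) q * (p α * p β)
      = -(2 * F + n) * (∑ j : Fin 4, p j.succ ^ 2)
        + 2 * n * ((∑ j : Fin 4, q.2 j * p j.succ) ^ 2 / ‖q.2‖ ^ 2)
        + ((4 * F + n) / bracket ‖q.2‖ ^ 2 - 2 * F * ‖q.2‖ ^ 2 / bracket ‖q.2‖ ^ 4) * p 0 ^ 2 := by
  have hr : ‖q.2‖ ≠ 0 := norm_ne_zero_iff.2 h
  have hb := (bracket_pos ‖q.2‖).ne'
  have hb2 := bracket_sq ‖q.2‖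
  set b := bracket ‖q.2‖ with hbdef
  set r := ‖q.2‖ with hrdef
  have hbq : bracket ‖q.2‖ = b := rfl
  set s := ∑ j : Fin 4, q.2 j * p j.succ with hs
  set G := ∑ j : Fin 4, p j.succ ^ 2 with hG
  have hrs : ∑ j : Fin 4, q.2 j * q.2 j = r ^ 2 := by
    rw [hrdef, norm_sq_eq_sum]; exact Finset.sum_congr rfl fun _ _ => by ring
  have e1 : ∑ l, Y l * p l = F * s := by
    rw [Fin.sum_univ_succ, hY0, hs, Finset.mul_sum]
    simp only [hY]; rw [zero_mul, zero_add]; exact Finset.sum_congr rfl fun _ _ => by ring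
  have e2 : ∑ μ, ∑ ν, pd μ (flatTensor μ ν) q * p ν = -(4 / b - r ^ 2 / b ^ 3) * p 0 := by
    rw [Fin.sum_univ_succ]
    simp only [pd_zero_flatTensor h, zero_mul, Finset.sum_const_zero, zero_add]
    simp only [Fin.sum_univ_succ (n := 4), pd_succ_flatTensor_succ_zero h,
      pd_succ_flatTensor_succ_succ, zero_mul, Finset.sum_const_zero, add_zero, if_true]
    rw [← Finset.sum_mul, Finset.sum_neg_distrib, Finset.sum_sub_distrib, ← Finset.sum_div, hrs, hbq]
    simp only [Finset.sum_const, Finset.card_univ, Fintype.card_fin, nsmul_eq_mul]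
    push_cast; ring
  have e3 : ∑ μ, dY μ μ = 4 * F + n := by
    rw [Fin.sum_univ_succ, hdY0]
    simp only [hdY, if_true, zero_add]
    rw [Finset.sum_add_distrib, ← Finset.sum_div, ← Finset.mul_sum, hrs]
    simp; field_simp
  have e4 : ∑ α, ∑ β, flatTensor α β q * (p α * p β)
      = -(p 0 ^ 2 / b ^ 2) - 2 * p 0 * s / b + G := by
    have hd : ∑ j : Fin 4, ∑ k : Fin 4, flatTensor j.succ k.succ q * (p j.succ * p k.succ) = G := by
      rw [hG]; refine Finset.sum_congr rfl fun j _ => ?_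
      simp; ring
    rw [Fin.sum_univ_succ, Fin.sum_univ_succ]
    simp only [Fin.sum_univ_succ (n := 4)] at hd ⊢
    have h1 : ∑ k : Fin 4, flatTensor 0 k.succ q * (p 0 * p k.succ) = - p 0 * s / b := by
      rw [hs, Finset.mul_sum, Finset.sum_div]; refine Finset.sum_congr rfl fun j _ => ?_
      rw [flatTensor_zero_succ]; ring
    have h2 : ∑ k : Fin 4, flatTensor k.succ 0 q * (p k.succ * p 0) = - p 0 * s / b := by
      rw [hs, Finset.mul_sum, Finset.sum_div]; refine Finset.sum_congr rfl fun j _ => ?_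
      rw [flatTensor_succ_zero]; ring
    rw [Finset.sum_add_distrib, h1, h2, hd, flatTensor_zero_zero, hbq]
    field_simp; ring
  have e5 : ∑ μ, (∑ ν, flatTensor μ ν q * p ν) * (∑ l, dY μ l * p l)
      = -(p 0 / b) * (F * s + n * s) + F * G + n * s ^ 2 / r ^ 2 := by
    have h1 : ∀ k : Fin 4, ∑ l, dY k.succ l * p l = F * p k.succ + n * s / r ^ 2 * q.2 k := by
      intro k
      rw [Fin.sum_univ_succ, hdY0, zero_mul, zero_add]
      simp only [hdY, add_mul, Finset.sum_add_distrib, ite_mul, zero_mul, Finset.sum_ite_eq,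
        Finset.mem_univ, if_true]
      congr 1
      rw [hs, Finset.mul_sum, Finset.sum_div, Finset.sum_mul]
      exact Finset.sum_congr rfl fun _ _ => by ring
    have h2 : ∀ k : Fin 4, ∑ ν, flatTensor k.succ ν q * p ν = p k.succ - p 0 / b * q.2 k := by
      intro k
      rw [Fin.sum_univ_succ]
      simp; ring
    rw [Fin.sum_univ_succ]
    simp only [h1, h2, hdY0', zero_mul, Finset.sum_const_zero, mul_zero, zero_add]
    have h3 : ∀ k : Fin 4, (p k.succ - p 0 / b * q.2 k) * (F * p k.succ + n * s / r ^ 2 * q.2 k)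
        = F * p k.succ ^ 2 + (n * s / r ^ 2 - p 0 / b * F) * (q.2 k * p k.succ)
          - p 0 / b * (n * s / r ^ 2) * (q.2 k * q.2 k) := fun k => by ring
    simp only [h3]
    rw [Finset.sum_sub_distrib, Finset.sum_add_distrib, ← Finset.mul_sum, ← Finset.mul_sum,
      ← Finset.mul_sum, hrs, ← hs, ← hG]
    field_simp; ring
  have e6 : ∑ μ, Y μ * ∑ α, ∑ β, pd μ (flatTensor α β) q * (p α * p β)
      = F * (2 * r ^ 2 / b ^ 4 * p 0 ^ 2 - 2 * p 0 * s / b + 2 * p 0 * s * r ^ 2 / b ^ 3) := by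
    have h1 : ∀ k : Fin 4, ∑ α, ∑ β, pd k.succ (flatTensor α β) q * (p α * p β)
        = 2 * q.2 k / b ^ 4 * p 0 ^ 2 - 2 * p 0 * (p k.succ / b) + 2 * p 0 * s / b ^ 3 * q.2 k := by
      intro k
      have h2 : ∑ j : Fin 4, -((if k = j then b⁻¹ else 0) - q.2 k * q.2 j / b ^ 3)
          * (p 0 * p j.succ) = - p 0 * (p k.succ / b) + p 0 * s / b ^ 3 * q.2 k := by
        simp only [neg_mul, sub_mul, Finset.sum_neg_distrib, Finset.sum_sub_distrib, ite_mul,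
          zero_mul, Finset.sum_ite_eq, Finset.mem_univ, if_true]
        rw [hs, Finset.mul_sum, Finset.sum_div, Finset.sum_mul, neg_sub, sub_eq_neg_add]
        congr 1
        · ring
        · exact Finset.sum_congr rfl fun _ _ => by ring
      rw [Fin.sum_univ_succ, Fin.sum_univ_succ]
      simp only [pd_succ_flatTensor_zero_zero h, pd_succ_flatTensor_zero_succ h]
      have h3 : ∀ j : Fin 4, ∑ β, pd k.succ (flatTensor j.succ β) q * (p j.succ * p β)
          = -((if k = j then b⁻¹ else 0) - q.2 k * q.2 j / b ^ 3) * (p 0 * p j.succ) := by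
        intro j
        rw [Fin.sum_univ_succ]
        simp only [pd_succ_flatTensor_succ_zero h, pd_succ_flatTensor_succ_succ, zero_mul,
          Finset.sum_const_zero, add_zero]
        rw [hbq]; ring
      simp only [h3]
      rw [hbq, h2]
      ring
    rw [Fin.sum_univ_succ, hY0, zero_mul, zero_add]
    simp only [h1, hY]
    have h4 : ∀ k : Fin 4, F * q.2 k * (2 * q.2 k / b ^ 4 * p 0 ^ 2 - 2 * p 0 * (p k.succ / b)
          + 2 * p 0 * s / b ^ 3 * q.2 k)
        = F * (2 / b ^ 4 * p 0 ^ 2 + 2 * p 0 * s / b ^ 3) * (q.2 k * q.2 k)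
          - F * (2 * p 0 / b) * (q.2 k * p k.succ) := fun k => by ring
    simp only [h4]
    rw [Finset.sum_sub_distrib, ← Finset.mul_sum, ← Finset.mul_sum, hrs, ← hs]
    ring
  rw [e1, e2, e3, e4, e5, e6]
  have hr2 : r ^ 2 = b ^ 2 - 1 := by rw [hb2]; ring
  field_simp
  rw [hr2]
  ring

end flat

/-! ### The multiplier identity for perturbations of the flat operator -/

/-- At the point `q`, the function `φ` solves an equation `L φ = H` whose operator `L` differs by
terms of relative size `κ` from the conjugated flat operator
`flatTensor^{αβ} ∂_α ∂_β - 3 r⁻¹ ∂_r - (3/4) r⁻²`. -/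
structure NearFlatAt (κ : ℝ) (φ H : ℝ × E4 → ℝ) (a : Fin 5 → Fin 5 → ℝ × E4 → ℝ)
    (B : Fin 5 → ℝ × E4 → ℝ) (Z : ℝ × E4 → ℝ) (q : ℝ × E4) : Prop where
  smooth : ∀ α β, ContDiffAt ℝ 1 (a α β) q
  symm : ∀ α β, a α β q = a β α q
  bound : ∀ α β, |a α β q| ≤ κ * (compWeight ‖q.2‖ α * compWeight ‖q.2‖ β)
  bound_zero : ∀ α β, |pd 0 (a α β) q| ≤ κ * (compWeight ‖q.2‖ α * compWeight ‖q.2‖ β)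
  bound_succ : ∀ α β, ∀ j : Fin 4,
    |pd j.succ (a α β) q| ≤ κ * (compWeight ‖q.2‖ α * compWeight ‖q.2‖ β) * ‖q.2‖⁻¹
  bound_first : ∀ β, |B β q| ≤ κ * compWeight ‖q.2‖ β * ‖q.2‖⁻¹
  bound_zeroth : |Z q| ≤ κ * ‖q.2‖⁻¹ ^ 2
  eq : (∑ α, ∑ β, (flatTensor α β q + a α β q) * pd α (pd β φ) q)
      - 3 * (∑ j : Fin 4, q.2 j * pd j.succ φ q) / ‖q.2‖ ^ 2 + (∑ β, B β q * pd β φ q)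
      + (-(3 / 4) / ‖q.2‖ ^ 2 + Z q) * φ q = H q

/-- The radial vector field with components `0` and `F(r) y`. -/
def radialField (F : ℝ → ℝ) (μ : Fin 5) (x : ℝ × E4) : ℝ :=
  Fin.cases (motive := fun _ => ℝ) 0 (fun j => F ‖x.2‖ * x.2 j) μ

/-- The energy current of `φ` with the multiplier `radialField F`, including the contribution of
the potential `-(3/4) r⁻²`. -/
def current (a : Fin 5 → Fin 5 → ℝ × E4 → ℝ) (F : ℝ → ℝ) (φ : ℝ × E4 → ℝ) (μ : Fin 5)
    (x : ℝ × E4) : ℝ :=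
  (2 * (∑ ν, (flatTensor μ ν x + a μ ν x) * pd ν φ x) * (∑ l, radialField F l x * pd l φ x)
    - radialField F μ x * ∑ α, ∑ β, (flatTensor α β x + a α β x) * (pd α φ x * pd β φ x))
  - 3 / 4 * (radialField F μ x * ((‖x.2‖ ^ 2)⁻¹ * φ x ^ 2))

/-- The radial derivative of a function of `(σ, y)`. -/
def radDeriv (φ : ℝ × E4 → ℝ) (q : ℝ × E4) : ℝ :=
  (∑ j : Fin 4, q.2 j * pd j.succ φ q) / ‖q.2‖

/-- `|∇_y φ|² + r⁻² φ²`. -/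
def spaceDensity (φ : ℝ × E4 → ℝ) (q : ℝ × E4) : ℝ :=
  (∑ j : Fin 4, pd j.succ φ q ^ 2) + φ q ^ 2 / ‖q.2‖ ^ 2

section identity

variable {κ : ℝ} {φ H : ℝ × E4 → ℝ} {a : Fin 5 → Fin 5 → ℝ × E4 → ℝ}
  {B : Fin 5 → ℝ × E4 → ℝ} {Z : ℝ × E4 → ℝ} {q : ℝ × E4} {F : ℝ → ℝ}

@[simp] lemma radialField_zero (x : ℝ × E4) : radialField F 0 x = 0 := rfl
@[simp] lemma radialField_succ (j : Fin 4) (x : ℝ × E4) :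
    radialField F j.succ x = F ‖x.2‖ * x.2 j := rfl

lemma contDiffAt_radialField (h : q.2 ≠ 0) (hF : ContDiffAt ℝ 1 F ‖q.2‖) (μ : Fin 5) :
    ContDiffAt ℝ 1 (radialField F μ) q := by
  refine Fin.cases contDiffAt_const (fun j => ?_) μ
  exact (hF.comp q (contDiffAt_norm_snd h)).mul (contDiff_coord j).contDiffAt

lemma contDiffAt_current (hφ : ContDiffAt ℝ 2 φ q) (h : q.2 ≠ 0) (hF : ContDiffAt ℝ 1 F ‖q.2‖)
    (ha : ∀ α β, ContDiffAt ℝ 1 (a α β) q) (μ : Fin 5) : ContDiffAt ℝ 1 (current a F φ μ) q := by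
  have hp : ∀ μ, ContDiffAt ℝ 1 (pd μ φ) q := fun μ =>
    contDiffAt_pd (n := 1) (by exact_mod_cast hφ)
  have hφ1 : ContDiffAt ℝ 1 φ q := hφ.of_le (by norm_num)
  have hA : ∀ α β, ContDiffAt ℝ 1 (fun x => flatTensor α β x + a α β x) q := fun α β =>
    (contDiffAt_flatTensor h α β).add (ha α β)
  have hY := contDiffAt_radialField h hF
  have hn : ContDiffAt ℝ 1 (fun x : ℝ × E4 => (‖x.2‖ ^ 2)⁻¹) q :=
    ((contDiffAt_norm_snd h).pow 2).inv (pow_ne_zero 2 (norm_ne_zero_iff.2 h))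
  refine ContDiffAt.sub (ContDiffAt.sub ?_ ?_) ?_
  · exact (contDiffAt_const.mul (ContDiffAt.sum fun ν _ => (hA μ ν).mul (hp ν))).mul
      (ContDiffAt.sum fun l _ => (hY l).mul (hp l))
  · exact (hY μ).mul (ContDiffAt.sum fun α _ => ContDiffAt.sum fun β _ =>
      (hA α β).mul ((hp α).mul (hp β)))
  · exact contDiffAt_const.mul ((hY μ).mul (hn.mul (hφ1.pow 2)))

lemma sum_radialField (p : Fin 5 → ℝ) :
    ∑ l, radialField F l q * p l = F ‖q.2‖ * ∑ j : Fin 4, q.2 j * p j.succ := by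
  rw [Fin.sum_univ_succ, Finset.mul_sum]
  simp only [radialField_zero, radialField_succ, zero_mul, zero_add]
  exact Finset.sum_congr rfl fun _ _ => by ring

lemma pd_zero_radialField (h : q.2 ≠ 0) (hF : ContDiffAt ℝ 1 F ‖q.2‖) (μ : Fin 5) :
    pd 0 (radialField F μ) q = 0 := by
  refine Fin.cases (pd_const _) (fun j => ?_) μ
  exact pd_zero_snd (f := fun y => F ‖y‖ * y j) (DifferentiableAt.fun_mul
    ((hF.differentiableAt (by norm_num)).comp q.2 (differentiableAt_id.norm ℝ h))
    (EuclideanSpace.proj j : E4 →L[ℝ] ℝ).differentiableAt)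

lemma pd_succ_radialField (h : q.2 ≠ 0) (hF : ContDiffAt ℝ 1 F ‖q.2‖) (k j : Fin 4) :
    pd k.succ (radialField F j.succ) q = (if k = j then F ‖q.2‖ else 0)
      + (‖q.2‖ * deriv F ‖q.2‖) * (q.2 k * q.2 j) / ‖q.2‖ ^ 2 := by
  have hr : ‖q.2‖ ≠ 0 := norm_ne_zero_iff.2 h
  have hFd := hF.differentiableAt (n := 1) (by norm_num)
  have hd : DifferentiableAt ℝ (fun x : ℝ × E4 => F ‖x.2‖) q :=
    (hF.comp q (contDiffAt_norm_snd h)).differentiableAt (by norm_num)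
  have : radialField F j.succ = fun x => F ‖x.2‖ * x.2 j := rfl
  rw [this, pd_mul hd (differentiableAt_coord j), pd_succ_radial k h hFd, pd_succ_coord]
  split_ifs <;> field_simp <;> ring

/-- The bulk terms of the energy identity that come from the perturbation `a`. -/
def errBulk (a : Fin 5 → Fin 5 → ℝ × E4 → ℝ) (F : ℝ → ℝ) (φ : ℝ × E4 → ℝ) (q : ℝ × E4) : ℝ :=
  2 * (∑ μ, ∑ ν, pd μ (a μ ν) q * pd ν φ q) * (∑ l, radialField F l q * pd l φ q)
    + 2 * (∑ μ, (∑ ν, a μ ν q * pd ν φ q) * (∑ l, pd μ (radialField F l) q * pd l φ q))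
    - (∑ μ, pd μ (radialField F μ) q) * (∑ α, ∑ β, a α β q * (pd α φ q * pd β φ q))
    - ∑ μ, radialField F μ q * ∑ α, ∑ β, pd μ (a α β) q * (pd α φ q * pd β φ q)

/-- The divergence identity for the multiplier `F(r) y`. The first-order terms `-3 r⁻¹ ∂_r` of the
conjugated operator produce the term with `6 F`. -/
lemma div_current (hφ : ContDiffAt ℝ 2 φ q) (h : q.2 ≠ 0) (hF : ContDiffAt ℝ 1 F ‖q.2‖)
    (hL : NearFlatAt κ φ H a B Z q) :
    ∑ μ, pd μ (current a F φ μ) q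
      = 2 * H q * (F ‖q.2‖ * ∑ j : Fin 4, q.2 j * pd j.succ φ q)
        - (2 * F ‖q.2‖ + ‖q.2‖ * deriv F ‖q.2‖)
          * ((∑ j : Fin 4, pd j.succ φ q ^ 2) + 3 / 4 * φ q ^ 2 / ‖q.2‖ ^ 2)
        + (2 * (‖q.2‖ * deriv F ‖q.2‖) + 6 * F ‖q.2‖)
          * ((∑ j : Fin 4, q.2 j * pd j.succ φ q) ^ 2 / ‖q.2‖ ^ 2)
        + ((4 * F ‖q.2‖ + ‖q.2‖ * deriv F ‖q.2‖) / bracket ‖q.2‖ ^ 2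
          - 2 * F ‖q.2‖ * ‖q.2‖ ^ 2 / bracket ‖q.2‖ ^ 4) * pd 0 φ q ^ 2
        + errBulk a F φ q
        - 2 * (F ‖q.2‖ * ∑ j : Fin 4, q.2 j * pd j.succ φ q)
          * ((∑ β, B β q * pd β φ q) + Z q * φ q) := by
  have hr : ‖q.2‖ ≠ 0 := norm_ne_zero_iff.2 h
  have hp : ∀ μ, DifferentiableAt ℝ (pd μ φ) q := fun μ =>
    (contDiffAt_pd (n := 1) (by exact_mod_cast hφ)).differentiableAt (by norm_num)
  have hφ1 : DifferentiableAt ℝ φ q := hφ.differentiableAt (by norm_num)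
  have hf : ∀ α β, DifferentiableAt ℝ (flatTensor α β) q := fun α β =>
    (contDiffAt_flatTensor (n := 1) h α β).differentiableAt (by norm_num)
  have ha : ∀ α β, DifferentiableAt ℝ (a α β) q := fun α β =>
    (hL.smooth α β).differentiableAt (by norm_num)
  have hA : ∀ α β, DifferentiableAt ℝ (fun x => flatTensor α β x + a α β x) q := fun α β =>
    (hf α β).add (ha α β)
  have hY : ∀ μ, DifferentiableAt ℝ (radialField F μ) q := fun μ =>
    (contDiffAt_radialField h hF μ).differentiableAt (by norm_num)
  have hn : DifferentiableAt ℝ (fun x : ℝ × E4 => (‖x.2‖ ^ 2)⁻¹) q :=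
    (((contDiffAt_norm_snd (n := 1) h).pow 2).inv (pow_ne_zero 2 hr)).differentiableAt (by norm_num)
  have hφ2 : DifferentiableAt ℝ (fun x => φ x ^ 2) q := hφ1.pow 2
  have hw : DifferentiableAt ℝ (fun x : ℝ × E4 => (‖x.2‖ ^ 2)⁻¹ * φ x ^ 2) q := hn.fun_mul hφ2
  -- the contribution of the potential
  have hpot : ∑ μ, pd μ (fun x => 3 / 4 * (radialField F μ x * ((‖x.2‖ ^ 2)⁻¹ * φ x ^ 2))) q
      = 3 / 4 * ((2 * F ‖q.2‖ + ‖q.2‖ * deriv F ‖q.2‖) * φ q ^ 2 / ‖q.2‖ ^ 2)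
        + 3 / 2 * (F ‖q.2‖ * ∑ j : Fin 4, q.2 j * pd j.succ φ q) * φ q / ‖q.2‖ ^ 2 := by
    have hdw : ∀ j : Fin 4, pd j.succ (fun x : ℝ × E4 => (‖x.2‖ ^ 2)⁻¹ * φ x ^ 2) q
        = -2 * φ q ^ 2 / ‖q.2‖ ^ 4 * q.2 j + 2 * φ q / ‖q.2‖ ^ 2 * pd j.succ φ q := by
      intro j
      have hsq : HasDerivAt (fun t : ℝ => (t ^ 2)⁻¹) _ ‖q.2‖ :=
        (hasDerivAt_pow 2 ‖q.2‖).inv (pow_ne_zero 2 hr)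
      rw [pd_mul hn hφ2, pd_succ_radial (f := fun t => (t ^ 2)⁻¹) j h hsq.differentiableAt,
        hsq.deriv]
      simp only [pow_two (φ _)]
      rw [pd_mul hφ1 hφ1]
      field_simp; ring
    have hd2 : ∀ μ, pd μ (fun x => 3 / 4 * (radialField F μ x * ((‖x.2‖ ^ 2)⁻¹ * φ x ^ 2))) q
        = 3 / 4 * (pd μ (radialField F μ) q * ((‖q.2‖ ^ 2)⁻¹ * φ q ^ 2)
          + radialField F μ q * pd μ (fun x : ℝ × E4 => (‖x.2‖ ^ 2)⁻¹ * φ x ^ 2) q) := fun μ => by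
      rw [pd_mul (differentiableAt_const _) ((hY μ).fun_mul hw), pd_const, pd_mul (hY μ) hw]
      ring
    have hrs : ∑ j : Fin 4, q.2 j * q.2 j = ‖q.2‖ ^ 2 := by
      rw [norm_sq_eq_sum]; exact Finset.sum_congr rfl fun _ _ => by ring
    simp only [hd2]
    rw [Fin.sum_univ_succ]
    simp only [pd_zero_radialField h hF, radialField_zero, zero_mul, add_zero, mul_zero, zero_add,
      pd_succ_radialField h hF, radialField_succ, hdw, if_true]
    have e : ∀ j : Fin 4, 3 / 4 * ((F ‖q.2‖ + ‖q.2‖ * deriv F ‖q.2‖ * (q.2 j * q.2 j) / ‖q.2‖ ^ 2)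
          * ((‖q.2‖ ^ 2)⁻¹ * φ q ^ 2) + F ‖q.2‖ * q.2 j
          * (-2 * φ q ^ 2 / ‖q.2‖ ^ 4 * q.2 j + 2 * φ q / ‖q.2‖ ^ 2 * pd j.succ φ q))
        = 3 / 4 * (F ‖q.2‖ * ((‖q.2‖ ^ 2)⁻¹ * φ q ^ 2))
          + 3 / 4 * (‖q.2‖ * deriv F ‖q.2‖ / ‖q.2‖ ^ 2 * ((‖q.2‖ ^ 2)⁻¹ * φ q ^ 2)
            - F ‖q.2‖ * 2 * φ q ^ 2 / ‖q.2‖ ^ 4) * (q.2 j * q.2 j)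
          + 3 / 2 * F ‖q.2‖ * φ q / ‖q.2‖ ^ 2 * (q.2 j * pd j.succ φ q) := fun j => by ring
    simp only [e]
    rw [Finset.sum_add_distrib, Finset.sum_add_distrib, Finset.sum_const, ← Finset.mul_sum,
      ← Finset.mul_sum, hrs]
    simp only [Finset.card_univ, Fintype.card_fin, nsmul_eq_mul]
    push_cast
    field_simp; ring
  have hsplit : ∀ μ, pd μ (current a F φ μ) q
      = pd μ (fun x => 2 * (∑ ν, (flatTensor μ ν x + a μ ν x) * pd ν φ x)
          * (∑ l, radialField F l x * pd l φ x)
          - radialField F μ x * ∑ α, ∑ β, (flatTensor α β x + a α β x) * (pd α φ x * pd β φ x)) q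
        - pd μ (fun x => 3 / 4 * (radialField F μ x * ((‖x.2‖ ^ 2)⁻¹ * φ x ^ 2))) q := by
    intro μ
    refine pd_sub (DifferentiableAt.sub ?_ ?_) (((hY μ).fun_mul hw).const_mul _)
    · exact (((DifferentiableAt.fun_sum fun ν _ => (hA μ ν).fun_mul (hp ν))).const_mul 2).fun_mul
        (DifferentiableAt.fun_sum fun l _ => (hY l).fun_mul (hp l))
    · exact (hY μ).fun_mul (DifferentiableAt.fun_sum fun α _ => DifferentiableAt.fun_sum fun β _ =>
        (hA α β).fun_mul ((hp α).fun_mul (hp β)))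
  simp only [hsplit]
  rw [Finset.sum_sub_distrib, hpot, energy_identity (A := fun α β x => flatTensor α β x + a α β x)
    hφ hA (fun α β => by simp only [flatTensor_symm α β, hL.symm α β]) hY]
  have hflat := flat_bulk h (dY := fun μ l => pd μ (radialField F l) q)
    (Y := fun l => radialField F l q) (p := fun l => pd l φ q) (F := F ‖q.2‖)
    (n := ‖q.2‖ * deriv F ‖q.2‖) rfl (fun j => rfl) (fun μ => pd_const _)
    (pd_zero_radialField h hF) (pd_succ_radialField h hF)
  have hdA : ∀ μ α β, pd μ (fun x => flatTensor α β x + a α β x) q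
      = pd μ (flatTensor α β) q + pd μ (a α β) q := fun μ α β => pd_add (hf α β) (ha α β)
  have heq := hL.eq
  have hS := sum_radialField (q := q) (F := F) (fun l => pd l φ q)
  simp only [hdA, errBulk]
  simp only [add_mul, Finset.sum_add_distrib, mul_add] at hflat heq ⊢
  rw [hS] at hflat ⊢
  generalize (∑ j : Fin 4, q.2 j * pd j.succ φ q) = s at *
  linear_combination hflat + 2 * (F ‖q.2‖ * s) * heq

end identity

/-! ### Pointwise bounds for the bulk terms and the fluxes -/

/-- The weighted size `r⁻¹ |∂_σ φ| + ∑ |∂_j φ|` of the gradient. -/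
def gradSize (φ : ℝ × E4 → ℝ) (q : ℝ × E4) : ℝ := ∑ α, compWeight ‖q.2‖ α * |pd α φ q|

section bounds

variable {κ : ℝ} {φ H : ℝ × E4 → ℝ} {a : Fin 5 → Fin 5 → ℝ × E4 → ℝ}
  {B : Fin 5 → ℝ × E4 → ℝ} {Z : ℝ × E4 → ℝ} {q : ℝ × E4} {F : ℝ → ℝ}

lemma gradSize_nonneg : 0 ≤ gradSize φ q :=
  Finset.sum_nonneg fun α _ => mul_nonneg (compWeight_nonneg (norm_nonneg _) α) (abs_nonneg _)

lemma gradSize_eq : gradSize φ q = ‖q.2‖⁻¹ * |pd 0 φ q| + ∑ j : Fin 4, |pd j.succ φ q| := by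
  rw [gradSize, Fin.sum_univ_succ]; simp

lemma gradSize_sq_le : gradSize φ q ^ 2
    ≤ 5 * ((∑ j : Fin 4, pd j.succ φ q ^ 2) + pd 0 φ q ^ 2 / ‖q.2‖ ^ 2) := by
  have := sq_sum_le_card_mul_sum_sq (s := Finset.univ)
    (f := fun α => compWeight ‖q.2‖ α * |pd α φ q|)
  refine this.trans (le_of_eq ?_)
  rw [Fin.sum_univ_succ]
  simp [mul_pow, div_eq_inv_mul]
  ring

lemma abs_coord_le (y : E4) (j : Fin 4) : |y j| ≤ ‖y‖ := by
  simpa using PiLp.norm_apply_le y j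

lemma abs_sum_coord_mul_le :
    |∑ j : Fin 4, q.2 j * pd j.succ φ q| ≤ ‖q.2‖ * gradSize φ q := by
  rw [gradSize_eq, mul_add, Finset.mul_sum]
  refine (Finset.abs_sum_le_sum_abs _ _).trans ?_
  have : 0 ≤ ‖q.2‖ * (‖q.2‖⁻¹ * |pd 0 φ q|) := by positivity
  refine le_add_of_nonneg_of_le this (Finset.sum_le_sum fun j _ => ?_)
  rw [abs_mul]
  exact mul_le_mul_of_nonneg_right (abs_coord_le _ _) (abs_nonneg _)

lemma abs_sum_mul_le_gradSize {c : Fin 5 → ℝ} {D : ℝ}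
    (hc : ∀ β, |c β| ≤ D * compWeight ‖q.2‖ β) : |∑ β, c β * pd β φ q| ≤ D * gradSize φ q := by
  rw [gradSize, Finset.mul_sum]
  refine (Finset.abs_sum_le_sum_abs _ _).trans (Finset.sum_le_sum fun β _ => ?_)
  rw [abs_mul, ← mul_assoc]
  exact mul_le_mul_of_nonneg_right (hc β) (abs_nonneg _)

lemma abs_quadratic_le {c : Fin 5 → Fin 5 → ℝ} {D : ℝ}
    (hc : ∀ α β, |c α β| ≤ D * (compWeight ‖q.2‖ α * compWeight ‖q.2‖ β)) :
    |∑ α, ∑ β, c α β * (pd α φ q * pd β φ q)| ≤ D * gradSize φ q ^ 2 := by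
  rw [pow_two, gradSize, Finset.sum_mul_sum, Finset.mul_sum]
  refine (Finset.abs_sum_le_sum_abs _ _).trans (Finset.sum_le_sum fun α _ => ?_)
  rw [Finset.mul_sum]
  refine (Finset.abs_sum_le_sum_abs _ _).trans (Finset.sum_le_sum fun β _ => ?_)
  rw [abs_mul, abs_mul]
  calc |c α β| * (|pd α φ q| * |pd β φ q|)
      ≤ D * (compWeight ‖q.2‖ α * compWeight ‖q.2‖ β) * (|pd α φ q| * |pd β φ q|) :=
        mul_le_mul_of_nonneg_right (hc α β) (by positivity)
    _ = _ := by ring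

lemma abs_errBulk_le (hκ : 0 ≤ κ) (h : q.2 ≠ 0) (hF : ContDiffAt ℝ 1 F ‖q.2‖)
    (hL : NearFlatAt κ φ H a B Z q) :
    |errBulk a F φ q| ≤ 26 * κ * (|F ‖q.2‖| + |‖q.2‖ * deriv F ‖q.2‖|) * gradSize φ q ^ 2 := by
  have hr : 0 < ‖q.2‖ := norm_pos_iff.2 h
  set r := ‖q.2‖ with hrdef
  set P := gradSize φ q with hP
  set n := r * deriv F r with hn
  set β := |F r| + |n| with hβ
  have hP0 : 0 ≤ P := gradSize_nonneg
  have hβ0 : 0 ≤ β := by positivity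
  have hFβ : |F r| ≤ β := le_add_of_nonneg_right (abs_nonneg _)
  have hS : |∑ l, radialField F l q * pd l φ q| ≤ |F r| * (r * P) := by
    rw [sum_radialField, abs_mul]
    exact mul_le_mul_of_nonneg_left abs_sum_coord_mul_le (abs_nonneg _)
  have h1 : |∑ μ, ∑ ν, pd μ (a μ ν) q * pd ν φ q| ≤ 5 * (κ * r⁻¹ * P) := by
    refine (Finset.abs_sum_le_sum_abs _ _).trans ?_
    have : ∀ μ ∈ Finset.univ, |∑ ν, pd μ (a μ ν) q * pd ν φ q| ≤ κ * r⁻¹ * P := by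
      intro μ _
      refine abs_sum_mul_le_gradSize fun ν => ?_
      refine Fin.cases ?_ (fun j => ?_) μ
      · refine (hL.bound_zero 0 ν).trans (le_of_eq ?_)
        rw [compWeight_zero]; ring
      · refine (hL.bound_succ j.succ ν j).trans (le_of_eq ?_)
        rw [compWeight_succ]; ring
    refine (Finset.sum_le_sum this).trans (le_of_eq ?_)
    simp
  have h2 : |∑ μ, (∑ ν, a μ ν q * pd ν φ q) * (∑ l, pd μ (radialField F l) q * pd l φ q)|
      ≤ 4 * (κ * P * (β * P)) := by
    rw [Fin.sum_univ_succ]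
    simp only [pd_zero_radialField h hF, zero_mul, Finset.sum_const_zero, mul_zero, zero_add]
    refine (Finset.abs_sum_le_sum_abs _ _).trans ?_
    have : ∀ k ∈ (Finset.univ : Finset (Fin 4)), |(∑ ν, a k.succ ν q * pd ν φ q)
        * (∑ l, pd k.succ (radialField F l) q * pd l φ q)| ≤ κ * P * (β * P) := by
      intro k _
      rw [abs_mul]
      refine mul_le_mul (abs_sum_mul_le_gradSize fun ν => ?_)
        (abs_sum_mul_le_gradSize fun l => ?_) (abs_nonneg _) (by positivity)
      · simpa using hL.bound k.succ ν
      · refine Fin.cases ?_ (fun j => ?_) l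
        · rw [show radialField F 0 = fun _ => (0 : ℝ) from rfl, pd_const, abs_zero]
          exact mul_nonneg hβ0 (compWeight_nonneg hr.le _)
        · rw [pd_succ_radialField h hF, compWeight_succ, mul_one]
          refine (abs_add_le _ _).trans (add_le_add ?_ ?_)
          · split_ifs <;> simp [hrdef]
          · rw [← hrdef, ← hn, abs_div, abs_mul n, abs_of_pos (pow_pos hr 2), abs_mul (q.2 k),
              div_le_iff₀ (pow_pos hr 2)]
            refine mul_le_mul_of_nonneg_left ?_ (abs_nonneg _)
            rw [pow_two]
            exact mul_le_mul (abs_coord_le _ _) (abs_coord_le _ _) (abs_nonneg _) hr.le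
    refine (Finset.sum_le_sum this).trans (le_of_eq ?_)
    simp
  have h3 : |∑ μ, pd μ (radialField F μ) q| ≤ 4 * β := by
    rw [Fin.sum_univ_succ]
    simp only [pd_zero_radialField h hF, zero_add, pd_succ_radialField h hF, if_true]
    rw [Finset.sum_add_distrib, ← Finset.sum_div, ← Finset.mul_sum]
    have hrs : ∑ j : Fin 4, q.2 j * q.2 j = ‖q.2‖ ^ 2 := by
      rw [norm_sq_eq_sum]; exact Finset.sum_congr rfl fun _ _ => by ring
    rw [hrs, ← hrdef, mul_div_cancel_right₀ _ (pow_pos hr 2).ne', ← hn]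
    simp only [Finset.sum_const, Finset.card_univ, Fintype.card_fin, nsmul_eq_mul]
    refine (abs_add_le _ _).trans ?_
    rw [abs_mul]; push_cast
    have := abs_nonneg n
    rw [hβ, Nat.abs_ofNat]; linarith
  have h4 : |∑ α, ∑ β, a α β q * (pd α φ q * pd β φ q)| ≤ κ * P ^ 2 := abs_quadratic_le hL.bound
  have h5 : |∑ μ, radialField F μ q * ∑ α, ∑ β, pd μ (a α β) q * (pd α φ q * pd β φ q)|
      ≤ 4 * (|F r| * r * (κ * r⁻¹ * P ^ 2)) := by
    rw [Fin.sum_univ_succ]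
    simp only [radialField_zero, zero_mul, zero_add]
    refine (Finset.abs_sum_le_sum_abs _ _).trans ?_
    have : ∀ k ∈ (Finset.univ : Finset (Fin 4)), |radialField F k.succ q
        * ∑ α, ∑ β, pd k.succ (a α β) q * (pd α φ q * pd β φ q)|
          ≤ |F r| * r * (κ * r⁻¹ * P ^ 2) := by
      intro k _
      rw [abs_mul]
      refine mul_le_mul ?_ (abs_quadratic_le fun α β => ?_) (abs_nonneg _) (by positivity)
      · rw [radialField_succ, abs_mul]
        exact mul_le_mul_of_nonneg_left (abs_coord_le _ _) (abs_nonneg _)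
      · refine (hL.bound_succ α β k).trans (le_of_eq ?_); ring
    refine (Finset.sum_le_sum this).trans (le_of_eq ?_)
    simp
  have e1 : |F r| * (r * P) * (5 * (κ * r⁻¹ * P)) = 5 * κ * |F r| * P ^ 2 := by
    field_simp
  have e5 : 4 * (|F r| * r * (κ * r⁻¹ * P ^ 2)) = 4 * κ * |F r| * P ^ 2 := by
    field_simp
  have g1 := mul_le_mul h1 hS (abs_nonneg _) (by positivity)
  have g3 := mul_le_mul h3 h4 (abs_nonneg _) (by positivity)
  rw [← abs_mul] at g1 g3
  have hk : κ * |F r| * P ^ 2 ≤ κ * β * P ^ 2 := by gcongr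
  rw [errBulk]
  refine (abs_sub _ _).trans (le_trans (add_le_add ((abs_sub _ _).trans
    (add_le_add (abs_add_le _ _) le_rfl)) le_rfl) ?_)
  rw [mul_assoc 2, abs_mul 2, abs_mul 2, Nat.abs_ofNat]
  nlinarith

end bounds

/-- The radial coefficient `ζ g r⁻⁴` of the multiplier with cutoff `ζ` and weight `g`; the factor
`r⁻⁴` combines the density `r⁻³` of `dr dθ` with the length of `y`. -/
def multCoeff (ζ g : ℝ → ℝ) (r : ℝ) : ℝ := ζ r * g r * (r ^ 4)⁻¹

/-- The constant of the coercive bulk terms of the weight `r ^ p`. -/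
def coercConst (p : ℝ) : ℝ := 3 / 4 * min (p / 2) (2 - p)

/-- The weight `g` grows at least like `r ^ (p / 2)` and at most like `r ^ p`. -/
structure IsGrowthWeight (p : ℝ) (g : ℝ → ℝ) : Prop where
  smooth : ContDiffOn ℝ 1 g (Set.Ioi 0)
  nonneg : ∀ r, 0 < r → 0 ≤ g r
  lower : ∀ r, 0 < r → p / 2 * g r ≤ r * deriv g r
  upper : ∀ r, 0 < r → r * deriv g r ≤ p * g r

section pointwise

variable {κ p : ℝ} {φ H : ℝ × E4 → ℝ} {a : Fin 5 → Fin 5 → ℝ × E4 → ℝ}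
  {B : Fin 5 → ℝ × E4 → ℝ} {Z : ℝ × E4 → ℝ} {q : ℝ × E4} {ζ g : ℝ → ℝ}

lemma IsGrowthWeight.contDiffAt (hg : IsGrowthWeight p g) {r : ℝ} (hr : 0 < r) :
    ContDiffAt ℝ 1 g r := hg.smooth.contDiffAt (isOpen_Ioi.mem_nhds hr)

lemma contDiffAt_multCoeff (hζ : ContDiff ℝ 1 ζ) (hg : IsGrowthWeight p g) {r : ℝ} (hr : 0 < r) :
    ContDiffAt ℝ 1 (multCoeff ζ g) r :=
  (hζ.contDiffAt.mul (hg.contDiffAt hr)).mul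
    ((contDiffAt_id.pow 4).inv (pow_pos hr 4).ne')

lemma mul_deriv_multCoeff (hζ : ContDiff ℝ 1 ζ) (hg : IsGrowthWeight p g) {r : ℝ} (hr : 0 < r) :
    r * deriv (multCoeff ζ g) r = deriv ζ r * g r * (r ^ 3)⁻¹
      + ζ r * (r * deriv g r) * (r ^ 4)⁻¹ - 4 * multCoeff ζ g r := by
  have h1 := (hζ.differentiable (by norm_num) r).hasDerivAt
  have h2 := ((hg.contDiffAt hr).differentiableAt (by norm_num)).hasDerivAt
  have h3 : HasDerivAt (fun r : ℝ => (r ^ 4)⁻¹) _ r :=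
    (hasDerivAt_pow 4 r).inv (pow_pos hr 4).ne'
  have h4 : HasDerivAt (multCoeff ζ g) _ r := (h1.mul h2).mul h3
  rw [h4.deriv, multCoeff]
  simp only [Pi.mul_apply]
  field_simp
  push_cast
  ring

lemma radDeriv_sq_le (h : q.2 ≠ 0) : radDeriv φ q ^ 2 ≤ ∑ j : Fin 4, pd j.succ φ q ^ 2 := by
  have hr : 0 < ‖q.2‖ := norm_pos_iff.2 h
  rw [radDeriv, div_pow, div_le_iff₀ (pow_pos hr 2)]
  have := Finset.sum_mul_sq_le_sq_mul_sq Finset.univ (fun j : Fin 4 => q.2 j)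
    (fun j => pd j.succ φ q)
  rw [norm_sq_eq_sum]
  linarith

/-- Coercivity of the bulk terms of the flat operator at a point: `G` stands for `|∇_y φ|²`, `e₂`
for its radial part, `f` for `r⁻² φ²`, and `w`, `m` and `k` for the weight `ζ g r⁻⁴`, the
part of its radial derivative that contains `r g'`, and the size of the part that contains `r ζ'`. The angular part of `G` has
the factor `2 w - m`, the radial part the factor `m`. -/
lemma coercive_main {c p w m x k e₂ G f : ℝ} (hw : 0 ≤ w) (hm : p / 2 * w ≤ m) (hm2 : m ≤ p * w)
    (hc : 0 ≤ c) (hc1 : c ≤ 3 / 4 * (p / 2)) (hc2 : c ≤ 3 / 4 * (2 - p)) (he : 0 ≤ e₂)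
    (heG : e₂ ≤ G) (hf : 0 ≤ f) (hx : |x| = k) :
    c * (w * (G + f)) - k * (G + f)
      ≤ -((2 * w + (x + m - 4 * w)) * (G + 3 / 4 * f)) + (2 * (x + m - 4 * w) + 6 * w) * e₂ := by
  have i1 : c * w * (G - e₂ + f) ≤ (2 * w - m) * (G - e₂ + 3 / 4 * f) := by
    have h3 : c * w ≤ 3 / 4 * (2 - p) * w := by gcongr
    have h4 : 3 / 4 * (2 - p) * w ≤ 3 / 4 * (2 * w - m) := by linarith
    have h5 : 0 ≤ 2 * w - m := by linarith [mul_nonneg hc hw]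
    have h6 : 0 ≤ G - e₂ := by linarith
    calc c * w * (G - e₂ + f) ≤ 3 / 4 * (2 * w - m) * (G - e₂ + f) := by
          exact mul_le_mul_of_nonneg_right (by linarith) (by linarith)
      _ ≤ _ := by linarith [mul_nonneg h5 h6]
  have i2 : c * w * e₂ ≤ m * e₂ := by
    refine mul_le_mul_of_nonneg_right ?_ he
    have h1 : c * w ≤ 3 / 4 * (p / 2) * w := by gcongr
    have h2 := mul_nonneg hc hw
    linarith
  have i3 : -(k * (G + f)) ≤ x * (e₂ - (G - e₂) - 3 / 4 * f) := by
    have h6 : |e₂ - (G - e₂) - 3 / 4 * f| ≤ G + f := by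
      rw [abs_le]; constructor <;> linarith
    have h7 : |x * (e₂ - (G - e₂) - 3 / 4 * f)| ≤ k * (G + f) := by
      rw [abs_mul, hx]; exact mul_le_mul_of_nonneg_left h6 (hx ▸ abs_nonneg x)
    exact (abs_le.1 h7).1
  linarith

/-- Absorption of the error terms. The terms `E` and `L` come from the second-order and the
lower-order perturbations; with `1450 κ ≤ c`, they cost half of the coercive terms `M`, besides
terms with the time derivative `t` and with the derivative of the cutoff `k`. -/
lemma coercive_absorb {c κ w k G f t D E L T M h : ℝ} (hκ : 0 ≤ κ) (hκc : 1450 * κ ≤ c)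
    (hc34 : c ≤ 3 / 4) (hw : 0 ≤ w) (hk : 0 ≤ k) (hG : 0 ≤ G) (hf : 0 ≤ f) (ht : 0 ≤ t)
    (hE : -(26 * κ * (5 * w + k) * (5 * (G + t))) ≤ E)
    (hLo : L ≤ κ * w * (3 * (5 * (G + t)) + f)) (hT : -((4 * w + k) * t) ≤ T)
    (hh : -h ≤ D) (hM : c * (w * (G + f)) - k * (G + f) ≤ M) :
    c / 2 * (w * (G + f)) ≤ (D + M + T + E - L) + h + 5 * (w * t) + 2 * (k * (G + f + t)) := by
  have b1 : 1450 * κ * (w * (G + f + t)) ≤ c * (w * (G + f + t)) := by gcongr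
  have b2 : 1450 * κ * (k * (G + f + t)) ≤ c * (k * (G + f + t)) := by gcongr
  have b3 : c * (w * t) ≤ 3 / 4 * (w * t) := by gcongr
  have b4 : c * (k * (G + f + t)) ≤ 3 / 4 * (k * (G + f + t)) := by gcongr
  have z1 : 0 ≤ κ * (w * f) := by positivity
  have z2 : 0 ≤ κ * (k * f) := by positivity
  have z3 : 0 ≤ κ * (w * G) := by positivity
  have z4 : 0 ≤ κ * (w * t) := by positivity
  have z5 : 0 ≤ κ * (k * G) := by positivity
  have z6 : 0 ≤ κ * (k * t) := by positivity
  have z7 : 0 ≤ w * t := by positivity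
  have z8 : 0 ≤ k * G := by positivity
  have z9 : 0 ≤ k * f := by positivity
  have z0 : 0 ≤ k * t := by positivity
  linarith

/-- Pointwise coercivity of the multiplier identity. The bulk terms of the flat operator control
`spaceDensity` with the constant `coercConst p`; half of it absorbs the perturbation. -/
lemma coercive_le_div (hζ : ContDiff ℝ 1 ζ) (hζ0 : 0 ≤ ζ ‖q.2‖) (hg : IsGrowthWeight p g)
    (hp0 : 0 < p) (hp : p < 2) (hκ : 0 ≤ κ) (hκc : 1450 * κ ≤ coercConst p)
    (hφ : ContDiffAt ℝ 2 φ q) (h : q.2 ≠ 0) (hL : NearFlatAt κ φ H a B Z q) :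
    coercConst p / 2 * (multCoeff ζ g ‖q.2‖ * spaceDensity φ q)
      ≤ (∑ μ, pd μ (current a (multCoeff ζ g) φ μ) q)
        + 2 * |H q| * (multCoeff ζ g ‖q.2‖ * ‖q.2‖ * |radDeriv φ q|)
        + 5 * (multCoeff ζ g ‖q.2‖ * (pd 0 φ q ^ 2 / ‖q.2‖ ^ 2))
        + 2 * (|deriv ζ ‖q.2‖| * g ‖q.2‖ * (‖q.2‖ ^ 3)⁻¹
          * (spaceDensity φ q + pd 0 φ q ^ 2 / ‖q.2‖ ^ 2)) := by
  have hr : 0 < ‖q.2‖ := norm_pos_iff.2 h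
  have hF := contDiffAt_multCoeff hζ hg hr
  have hdiv := div_current hφ h hF hL
  have herr := abs_errBulk_le hκ h hF hL
  have hn := mul_deriv_multCoeff hζ hg hr
  have her := radDeriv_sq_le (φ := φ) h
  have hP := gradSize_sq_le (φ := φ) (q := q)
  have hP0 := gradSize_nonneg (φ := φ) (q := q)
  have hs := abs_sum_coord_mul_le (φ := φ) (q := q)
  have hB := abs_sum_mul_le_gradSize (φ := φ) (q := q) (c := fun β => B β q) (D := κ * ‖q.2‖⁻¹)
    (fun β => (hL.bound_first β).trans (le_of_eq (by ring)))
  have hZ := hL.bound_zeroth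
  have hg0 := hg.nonneg _ hr
  have hgl := hg.lower _ hr
  have hgu := hg.upper _ hr
  have hb2 := bracket_sq ‖q.2‖
  have hb := bracket_pos ‖q.2‖
  have hw0 : 0 ≤ multCoeff ζ g ‖q.2‖ := by unfold multCoeff; positivity
  have hsr : ∑ j : Fin 4, q.2 j * pd j.succ φ q = ‖q.2‖ * radDeriv φ q := by
    rw [radDeriv]; field_simp
  have hm1 : p / 2 * multCoeff ζ g ‖q.2‖
      ≤ ζ ‖q.2‖ * (‖q.2‖ * deriv g ‖q.2‖) * (‖q.2‖ ^ 4)⁻¹ := by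
    have := mul_le_mul_of_nonneg_left hgl (mul_nonneg hζ0 (inv_pos.2 (pow_pos hr 4)).le)
    rw [multCoeff]; linarith
  have hm2 : ζ ‖q.2‖ * (‖q.2‖ * deriv g ‖q.2‖) * (‖q.2‖ ^ 4)⁻¹ ≤ p * multCoeff ζ g ‖q.2‖ := by
    have := mul_le_mul_of_nonneg_left hgu (mul_nonneg hζ0 (inv_pos.2 (pow_pos hr 4)).le)
    rw [multCoeff]; linarith
  have hx : |deriv ζ ‖q.2‖ * g ‖q.2‖ * (‖q.2‖ ^ 3)⁻¹|
      = |deriv ζ ‖q.2‖| * g ‖q.2‖ * (‖q.2‖ ^ 3)⁻¹ := by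
    rw [abs_mul, abs_mul, abs_of_nonneg hg0, abs_of_nonneg (a := (‖q.2‖ ^ 3)⁻¹) (by positivity)]
  have hm0 : 0 ≤ ζ ‖q.2‖ * (‖q.2‖ * deriv g ‖q.2‖) * (‖q.2‖ ^ 4)⁻¹ :=
    (mul_nonneg (by linarith) hw0).trans hm1
  have hm3 : p * multCoeff ζ g ‖q.2‖ ≤ 2 * multCoeff ζ g ‖q.2‖ := by gcongr
  have hc0 : 0 ≤ coercConst p := by
    have : 0 < min (p / 2) (2 - p) := lt_min (by linarith) (by linarith)
    unfold coercConst; positivity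
  have hc1 : coercConst p ≤ 3 / 4 * (p / 2) := by
    unfold coercConst; gcongr; exact min_le_left _ _
  have hc2 : coercConst p ≤ 3 / 4 * (2 - p) := by
    unfold coercConst; gcongr; exact min_le_right _ _
  rw [hsr] at hdiv hs
  rw [hdiv, spaceDensity]
  set r := ‖q.2‖ with hrdef
  set w := multCoeff ζ g r with hw
  set x := deriv ζ r * g r * (r ^ 3)⁻¹ with hxdef
  set k := |deriv ζ r| * g r * (r ^ 3)⁻¹ with hk
  set m := ζ r * (r * deriv g r) * (r ^ 4)⁻¹ with hm
  set e := radDeriv φ q with he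
  set G := ∑ j : Fin 4, pd j.succ φ q ^ 2 with hG
  set f := φ q ^ 2 / r ^ 2 with hf
  set t := pd 0 φ q ^ 2 / r ^ 2 with ht
  set P := gradSize φ q with hPdef
  set c := coercConst p with hc
  have hk0 : 0 ≤ k := by rw [← hx]; exact abs_nonneg _
  have hf0 : 0 ≤ f := by positivity
  have ht0 : 0 ≤ t := by positivity
  have hG0 : 0 ≤ G := (sq_nonneg e).trans her
  rw [hn] at herr ⊢
  have hβ : |w| + |x + m - 4 * w| ≤ 5 * w + k := by
    rw [abs_of_nonneg hw0]
    have : |x + m - 4 * w| ≤ |x| + |m - 4 * w| := by rw [add_sub_assoc]; exact abs_add_le _ _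
    have h2 : |m - 4 * w| ≤ 4 * w := by
      rw [abs_le]; constructor <;> linarith
    linarith
  -- the error terms
  have herr' : |errBulk a (multCoeff ζ g) φ q| ≤ 26 * κ * (5 * w + k) * (5 * (G + t)) := by
    refine herr.trans ?_
    gcongr
  have hlow : |2 * (w * (r * e)) * ((∑ β, B β q * pd β φ q) + Z q * φ q)|
      ≤ κ * w * (3 * (5 * (G + t)) + f) := by
    have h1 : |(∑ β, B β q * pd β φ q) + Z q * φ q| ≤ κ * r⁻¹ * P + κ * r⁻¹ ^ 2 * |φ q| := by
      refine (abs_add_le _ _).trans (add_le_add hB ?_)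
      rw [abs_mul]; gcongr
    rw [abs_mul, abs_mul, Nat.abs_ofNat, abs_mul, abs_of_nonneg hw0]
    calc 2 * (w * |r * e|) * |(∑ β, B β q * pd β φ q) + Z q * φ q|
        ≤ 2 * (w * (r * P)) * (κ * r⁻¹ * P + κ * r⁻¹ ^ 2 * |φ q|) := by gcongr
      _ = κ * w * (2 * P ^ 2 + 2 * P * (|φ q| / r)) := by field_simp
      _ ≤ κ * w * (3 * P ^ 2 + f) := by
          refine mul_le_mul_of_nonneg_left ?_ (by positivity)
          have : (|φ q| / r) ^ 2 = f := by rw [div_pow, sq_abs]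
          rw [← this]; linarith [two_mul_le_add_sq P (|φ q| / r)]
      _ ≤ _ := by gcongr
  have htime : |((4 * w + (x + m - 4 * w)) / bracket r ^ 2 - 2 * w * r ^ 2 / bracket r ^ 4)
      * pd 0 φ q ^ 2| ≤ (4 * w + k) * t := by
    have h1 : |x + m| ≤ k + 2 * w := by
      refine (abs_add_le _ _).trans (add_le_add hx.le ?_)
      rw [abs_le]; constructor <;> linarith
    have hbr : r ^ 2 ≤ bracket r ^ 2 := by rw [hb2]; linarith
    have h2 : |(x + m) / bracket r ^ 2| ≤ (k + 2 * w) / r ^ 2 := by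
      rw [abs_div, abs_of_pos (pow_pos hb 2)]; gcongr
    have h3 : |2 * w * r ^ 2 / bracket r ^ 4| ≤ 2 * w / r ^ 2 := by
      rw [abs_of_nonneg (by positivity), div_le_div_iff₀ (by positivity) (by positivity)]
      have : r ^ 2 * r ^ 2 ≤ bracket r ^ 2 * bracket r ^ 2 := by gcongr
      calc 2 * w * r ^ 2 * r ^ 2 = 2 * w * (r ^ 2 * r ^ 2) := by ring
        _ ≤ 2 * w * (bracket r ^ 2 * bracket r ^ 2) := by gcongr
        _ = _ := by ring
    rw [abs_mul, abs_of_nonneg (sq_nonneg (pd 0 φ q)), show 4 * w + (x + m - 4 * w) = x + m by ring]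
    calc _ ≤ ((k + 2 * w) / r ^ 2 + 2 * w / r ^ 2) * pd 0 φ q ^ 2 := by
          gcongr; exact (abs_sub _ _).trans (add_le_add h2 h3)
      _ = _ := by rw [ht]; ring
  have hH : |2 * H q * (w * (r * e))| = 2 * |H q| * (w * r * |e|) := by
    rw [abs_mul, abs_mul, abs_mul, abs_mul, Nat.abs_ofNat, abs_of_nonneg hw0, abs_of_pos hr]; ring
  -- the main terms
  have hmain : c * (w * (G + f)) - k * (G + f)
      ≤ -((2 * w + (x + m - 4 * w)) * (G + 3 / 4 * φ q ^ 2 / r ^ 2))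
        + (2 * (x + m - 4 * w) + 6 * w) * ((r * e) ^ 2 / r ^ 2) := by
    have e1 : (r * e) ^ 2 / r ^ 2 = e ^ 2 := by field_simp
    have e2 : 3 / 4 * φ q ^ 2 / r ^ 2 = 3 / 4 * f := by rw [hf]; ring
    rw [e1, e2]
    exact coercive_main hw0 hm1 hm2 hc0 hc1 hc2 (sq_nonneg e) her hf0 hx
  have hfin := coercive_absorb (D := 2 * H q * (w * (r * e))) hκ hκc (by linarith) hw0 hk0 hG0
    hf0 ht0 (abs_le.1 herr').1 (abs_le.1 hlow).2 (abs_le.1 htime).1 (abs_le.1 hH.le).1 hmain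
  refine hfin.trans (le_of_eq ?_)
  ring

/-- Upper and lower bounds for the flux of the energy current through a leaf. -/
lemma flux_bounds (hζ0 : 0 ≤ ζ ‖q.2‖) (hg : IsGrowthWeight p g)
    (hκ : 0 ≤ κ) (hκ1 : 16 * κ ≤ 1) (h : 1 ≤ ‖q.2‖) (hL : NearFlatAt κ φ H a B Z q) :
    |-current a (multCoeff ζ g) φ 0 q
        - 2 * (multCoeff ζ g ‖q.2‖ * ‖q.2‖ * radDeriv φ q ^ 2)|
      ≤ multCoeff ζ g ‖q.2‖ * ‖q.2‖ * (radDeriv φ q ^ 2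
        + (9 * (pd 0 φ q ^ 2 / ‖q.2‖ ^ 4)
          + 5 * κ * ((∑ j : Fin 4, pd j.succ φ q ^ 2) / ‖q.2‖ ^ 2))) := by
  have hr : 0 < ‖q.2‖ := by linarith
  have hP := gradSize_sq_le (φ := φ) (q := q)
  have hP0 := gradSize_nonneg (φ := φ) (q := q)
  have hA := abs_sum_mul_le_gradSize (φ := φ) (q := q) (c := fun ν => a 0 ν q) (D := κ * ‖q.2‖⁻¹)
    (fun ν => (hL.bound 0 ν).trans (le_of_eq (by rw [compWeight_zero]; ring)))
  have hg0 := hg.nonneg _ hr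
  have hw0 : 0 ≤ multCoeff ζ g ‖q.2‖ := by unfold multCoeff; positivity
  have hb2 := bracket_sq ‖q.2‖
  have hb := bracket_pos ‖q.2‖
  have hcur : current a (multCoeff ζ g) φ 0 q
      = 2 * (-(bracket ‖q.2‖ ^ 2)⁻¹ * pd 0 φ q - ‖q.2‖ * radDeriv φ q / bracket ‖q.2‖
          + ∑ ν, a 0 ν q * pd ν φ q)
        * (multCoeff ζ g ‖q.2‖ * (‖q.2‖ * radDeriv φ q)) := by
    have hsr : ∑ j : Fin 4, q.2 j * pd j.succ φ q = ‖q.2‖ * radDeriv φ q := by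
      rw [radDeriv]; field_simp
    rw [current, sum_radialField, hsr]
    simp only [radialField_zero, zero_mul, mul_zero, sub_zero, add_mul, Finset.sum_add_distrib]
    congr 3
    rw [Fin.sum_univ_succ, ← hsr, Finset.sum_div, sub_eq_add_neg, ← Finset.sum_neg_distrib]
    congr 1
    exact Finset.sum_congr rfl fun j _ => by rw [flatTensor_zero_succ]; ring
  rw [hcur]
  set r := ‖q.2‖ with hrdef
  set w := multCoeff ζ g r with hw
  set e := radDeriv φ q with he
  set G := ∑ j : Fin 4, pd j.succ φ q ^ 2 with hG
  set P := gradSize φ q with hPdef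
  set X := ∑ ν, a 0 ν q * pd ν φ q with hX
  set z := pd 0 φ q with hz
  set b := bracket r with hbdef
  have hrb : r ≤ b := le_of_sq_le_sq (by linarith) hb.le
  have hbr : b ≤ 3 / 2 * r := by
    refine le_of_sq_le_sq ?_ (by positivity)
    have : 1 ≤ r ^ 2 := one_le_pow₀ h
    rw [mul_pow, hb2]; linarith
  have hmain : |r * e ^ 2 / b * 2 * r - 2 * (r * e ^ 2)| ≤ 2 / 3 * (r * e ^ 2) := by
    have h1 : r / b ≤ 1 := (div_le_one hb).2 hrb
    have h2 : 2 / 3 ≤ r / b := by rw [le_div_iff₀ hb]; linarith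
    have h3 : r * e ^ 2 / b * 2 * r - 2 * (r * e ^ 2) = -(2 * (1 - r / b)) * (r * e ^ 2) := by
      field_simp; ring
    rw [h3, abs_mul, abs_of_nonneg (a := r * e ^ 2) (by positivity), abs_neg,
      abs_of_nonneg (by linarith)]
    gcongr; linarith
  have htime : |2 * ((b ^ 2)⁻¹ * z) * (r * e)| ≤ r * (e ^ 2 / 8 + 8 * (z ^ 2 / r ^ 4)) := by
    have h1 : (b ^ 2)⁻¹ ≤ (r ^ 2)⁻¹ := by gcongr
    rw [abs_mul, abs_mul, abs_mul, abs_mul, Nat.abs_ofNat, abs_of_pos hr,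
      abs_of_pos (a := (b ^ 2)⁻¹) (by positivity)]
    calc 2 * ((b ^ 2)⁻¹ * |z|) * (r * |e|) ≤ 2 * ((r ^ 2)⁻¹ * |z|) * (r * |e|) := by gcongr
      _ = r * (2 * (|e| * (|z| / r ^ 2))) := by field_simp
      _ ≤ r * (e ^ 2 / 8 + 8 * (|z| / r ^ 2) ^ 2) := by
          refine mul_le_mul_of_nonneg_left ?_ hr.le
          rw [← sq_abs e]
          linarith [sq_nonneg (|e| - 8 * (|z| / r ^ 2))]
      _ = _ := by rw [div_pow, sq_abs]; ring
  have herr : |2 * X * (r * e)| ≤ κ * (r * e ^ 2) + κ * r * (5 * (G / r ^ 2 + z ^ 2 / r ^ 4)) := by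
    rw [abs_mul, abs_mul, abs_mul, Nat.abs_ofNat, abs_of_pos hr]
    calc 2 * |X| * (r * |e|) ≤ 2 * (κ * r⁻¹ * P) * (r * |e|) := by gcongr
      _ = κ * r * (2 * (|e| * (P / r))) := by field_simp
      _ ≤ κ * r * (|e| ^ 2 + (P / r) ^ 2) := by
          gcongr
          linarith [two_mul_le_add_sq |e| (P / r)]
      _ ≤ κ * r * (e ^ 2 + 5 * (G / r ^ 2 + z ^ 2 / r ^ 4)) := by
          refine mul_le_mul_of_nonneg_left (add_le_add (sq_abs e).le ?_) (by positivity)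
          · rw [div_pow, div_le_iff₀ (by positivity)]
            refine hP.trans (le_of_eq ?_)
            field_simp
      _ = _ := by ring
  have hsplit : -(2 * (-(b ^ 2)⁻¹ * z - r * e / b + X) * (w * (r * e))) - 2 * (w * r * e ^ 2)
      = w * ((r * e ^ 2 / b * 2 * r - 2 * (r * e ^ 2)) + 2 * ((b ^ 2)⁻¹ * z) * (r * e)
        - 2 * X * (r * e)) := by
    field_simp; ring
  rw [hsplit, abs_mul, abs_of_nonneg hw0, mul_assoc w r]
  refine mul_le_mul_of_nonneg_left ?_ hw0
  refine (abs_sub _ _).trans (le_trans (add_le_add ((abs_add_le _ _).trans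
    (add_le_add hmain htime)) herr) ?_)
  have z1 : 0 ≤ r * e ^ 2 := by positivity
  have z2 : 0 ≤ r * (z ^ 2 / r ^ 4) := by positivity
  have z3 := mul_le_mul_of_nonneg_right hκ1 z1
  have z4 := mul_le_mul_of_nonneg_right hκ1 z2
  linarith

end pointwise

/-! ### The weighted estimate with a compactly supported cutoff -/

lemma contDiffAt_of_eq_zero {n : WithTop ℕ∞} {f : ℝ × E4 → ℝ} {r₀ : ℝ} {q : ℝ × E4}
    (h0 : ∀ x : ℝ × E4, ‖x.2‖ < r₀ → f x = 0) (hf : r₀ ≤ ‖q.2‖ → ContDiffAt ℝ n f q) :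
    ContDiffAt ℝ n f q := by
  rcases le_or_gt r₀ ‖q.2‖ with h | h
  · exact hf h
  · have : f =ᶠ[nhds q] fun _ => 0 := by
      filter_upwards [(isOpen_lt continuous_snd.norm continuous_const).mem_nhds h] with x hx
      exact h0 x hx
    exact contDiffAt_const.congr_of_eventuallyEq this

lemma ofReal_integral_le_lintegral {X : Type*} [MeasurableSpace X] {m : Measure X} {f g : X → ℝ}
    (hf : Integrable f m) (hfg : f ≤ᵐ[m] g) :
    ENNReal.ofReal (∫ x, f x ∂m) ≤ ∫⁻ x, ENNReal.ofReal (g x) ∂m := by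
  rw [integral_eq_lintegral_pos_part_sub_lintegral_neg_part hf]
  calc ENNReal.ofReal (_ - _) ≤ ENNReal.ofReal (∫⁻ x, ENNReal.ofReal (f x) ∂m).toReal :=
        ENNReal.ofReal_le_ofReal (sub_le_self _ ENNReal.toReal_nonneg)
    _ ≤ ∫⁻ x, ENNReal.ofReal (f x) ∂m := ENNReal.ofReal_toReal_le
    _ ≤ _ := lintegral_mono_ae (hfg.mono fun x hx => ENNReal.ofReal_le_ofReal hx)

/-- The terms of the flux of the energy current that the radial derivative does not control. -/
def fluxErr (κ : ℝ) (φ : ℝ × E4 → ℝ) (q : ℝ × E4) : ℝ :=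
  9 * (pd 0 φ q ^ 2 / ‖q.2‖ ^ 4) + 5 * κ * ((∑ j : Fin 4, pd j.succ φ q ^ 2) / ‖q.2‖ ^ 2)

lemma fluxErr_nonneg {κ : ℝ} (hκ : 0 ≤ κ) (φ : ℝ × E4 → ℝ) (q : ℝ × E4) :
    0 ≤ fluxErr κ φ q := by
  have : 0 ≤ ∑ j : Fin 4, pd j.succ φ q ^ 2 := Finset.sum_nonneg fun _ _ => sq_nonneg _
  unfold fluxErr; positivity

lemma spaceDensity_nonneg (φ : ℝ × E4 → ℝ) (q : ℝ × E4) : 0 ≤ spaceDensity φ q := by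
  have : 0 ≤ ∑ j : Fin 4, pd j.succ φ q ^ 2 := Finset.sum_nonneg fun _ _ => sq_nonneg _
  unfold spaceDensity; positivity

section density

variable {κ : ℝ} {φ : ℝ × E4 → ℝ} {q : ℝ × E4}

lemma contDiffAt_radDeriv (hφ : ContDiffAt ℝ 2 φ q) (h : q.2 ≠ 0) :
    ContDiffAt ℝ 1 (radDeriv φ) q :=
  (ContDiffAt.sum fun j _ => (contDiff_coord j).contDiffAt.mul
    (contDiffAt_pd (n := 1) (by exact_mod_cast hφ))).div (contDiffAt_norm_snd h)
    (norm_ne_zero_iff.2 h)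

lemma contDiffAt_gradSq (hφ : ContDiffAt ℝ 2 φ q) :
    ContDiffAt ℝ 1 (fun x => ∑ j : Fin 4, pd j.succ φ x ^ 2) q :=
  ContDiffAt.sum fun j _ => (contDiffAt_pd (n := 1) (by exact_mod_cast hφ)).pow 2

lemma contDiffAt_spaceDensity (hφ : ContDiffAt ℝ 2 φ q) (h : q.2 ≠ 0) :
    ContDiffAt ℝ 1 (spaceDensity φ) q :=
  (contDiffAt_gradSq hφ).add (((hφ.of_le (by norm_num)).pow 2).div
    ((contDiffAt_norm_snd h).pow 2) (pow_ne_zero 2 (norm_ne_zero_iff.2 h)))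

lemma contDiffAt_timeDensity (hφ : ContDiffAt ℝ 2 φ q) (h : q.2 ≠ 0) (n : ℕ) :
    ContDiffAt ℝ 1 (fun x => pd 0 φ x ^ 2 / ‖x.2‖ ^ n) q :=
  ((contDiffAt_pd (n := 1) (by exact_mod_cast hφ)).pow 2).div
    ((contDiffAt_norm_snd h).pow n) (pow_ne_zero n (norm_ne_zero_iff.2 h))

lemma contDiffAt_fluxErr (hφ : ContDiffAt ℝ 2 φ q) (h : q.2 ≠ 0) :
    ContDiffAt ℝ 1 (fluxErr κ φ) q :=
  (contDiffAt_const.mul (contDiffAt_timeDensity hφ h 4)).add (contDiffAt_const.mul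
    ((contDiffAt_gradSq hφ).div ((contDiffAt_norm_snd h).pow 2)
      (pow_ne_zero 2 (norm_ne_zero_iff.2 h))))

end density

lemma current_eq_zero {a : Fin 5 → Fin 5 → ℝ × E4 → ℝ} {F : ℝ → ℝ} {φ : ℝ × E4 → ℝ} {x : ℝ × E4}
    (h : F ‖x.2‖ = 0) (μ : Fin 5) : current a F φ μ x = 0 := by
  have : ∀ μ, radialField F μ x = 0 := fun μ => by
    refine Fin.cases rfl (fun j => ?_) μ
    rw [radialField_succ, h, zero_mul]
  simp [current, this]

section weighted

variable {w : ℝ → ℝ} {D : ℝ × E4 → ℝ} {r₀ M s t σ : ℝ}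

lemma contDiffAt_weighted {q : ℝ × E4} (hr₀ : 0 < r₀) (hwl : ∀ r, r ≤ r₀ → w r = 0)
    (hw : ∀ r, r₀ ≤ r → ContDiffAt ℝ 1 w r) (hD : r₀ ≤ ‖q.2‖ → ContDiffAt ℝ 1 D q) :
    ContDiffAt ℝ 1 (fun x => w ‖x.2‖ * D x) q :=
  contDiffAt_of_eq_zero (r₀ := r₀) (fun x hx => by rw [hwl ‖x.2‖ hx.le, zero_mul]) fun h =>
    ((hw ‖q.2‖ h).comp q (contDiffAt_norm_snd
      (norm_ne_zero_iff.1 (hr₀.trans_le h).ne'))).mul (hD h)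

lemma integrable_leaf_weighted (hr₀ : 0 < r₀) (hwl : ∀ r, r ≤ r₀ → w r = 0)
    (hwu : ∀ r, M ≤ r → w r = 0) (hw : ∀ r, r₀ ≤ r → ContDiffAt ℝ 1 w r)
    (hD : ∀ y : E4, r₀ ≤ ‖y‖ → ContDiffAt ℝ 1 D (σ, y)) :
    Integrable fun y : E4 => w ‖y‖ * ‖y‖ * D (σ, y) := by
  refine integrable_leaf (M := M) (continuous_iff_continuousAt.2 fun y => ?_) fun y hy => by
    rw [hwu ‖y‖ hy.le]; ring
  have h1 : ContinuousAt (fun x : ℝ × E4 => w ‖x.2‖ * D x) (σ, y) :=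
    (contDiffAt_weighted (q := (σ, y)) hr₀ hwl hw (hD y)).continuousAt
  have h2 : ContinuousAt (fun z : E4 => w ‖z‖ * D (σ, z)) y :=
    ContinuousAt.comp (f := fun z : E4 => (σ, z)) (x := y) h1 (by fun_prop)
  refine (h2.mul continuous_norm.continuousAt).congr (Filter.Eventually.of_forall fun z => ?_)
  simp only [Pi.mul_apply]; ring

lemma integrableOn_slab_weighted (hr₀ : 0 < r₀) (hwl : ∀ r, r ≤ r₀ → w r = 0)
    (hwu : ∀ r, M ≤ r → w r = 0) (hw : ∀ r, r₀ ≤ r → ContDiffAt ℝ 1 w r)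
    (hD : ∀ σ ∈ Set.Icc s t, ∀ y : E4, r₀ ≤ ‖y‖ → ContDiffAt ℝ 1 D (σ, y)) :
    IntegrableOn (fun q : ℝ × E4 => w ‖q.2‖ * D q) (Set.Icc s t ×ˢ Set.univ) := by
  refine integrableOn_slab (M := M) ?_ fun σ y hy => by
    rw [show w ‖((σ, y) : ℝ × E4).2‖ = 0 from hwu ‖y‖ hy.le, zero_mul]
  rintro ⟨σ, y⟩ ⟨hσ, -⟩
  exact (contDiffAt_weighted (q := (σ, y)) hr₀ hwl hw
    (hD σ hσ y)).continuousAt.continuousWithinAt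

end weighted

/-- The region between the leaves with labels `s` and `t`, in the coordinates `(σ, y)`. -/
abbrev slab (s t : ℝ) : Set (ℝ × E4) := Set.Icc s t ×ˢ Set.univ

/-- The weighted estimate on the slab between the leaves `s` and `t` for a compactly supported
cutoff `ζ`, in the coordinates `(σ, y)`. -/
theorem truncated_estimate {κ p r₀ M s t : ℝ} {φ H : ℝ × E4 → ℝ}
    {a : Fin 5 → Fin 5 → ℝ × E4 → ℝ} {B : Fin 5 → ℝ × E4 → ℝ} {Z : ℝ × E4 → ℝ} {ζ g : ℝ → ℝ}
    (hst : s ≤ t) (hr₀ : 1 ≤ r₀) (hζ : ContDiff ℝ 1 ζ) (hζ0 : ∀ r, 0 ≤ ζ r)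
    (hζl : ∀ r, r ≤ r₀ → ζ r = 0) (hζu : ∀ r, M ≤ r → ζ r = 0)
    (hg : IsGrowthWeight p g) (hp0 : 0 < p) (hp : p < 2) (hκ : 0 ≤ κ)
    (hκc : 1450 * κ ≤ coercConst p)
    (hφ : ∀ σ ∈ Set.Icc s t, ∀ y : E4, r₀ ≤ ‖y‖ → ContDiffAt ℝ 2 φ (σ, y))
    (hL : ∀ σ ∈ Set.Icc s t, ∀ y : E4, r₀ ≤ ‖y‖ → NearFlatAt κ φ H a B Z (σ, y)) :
    (∫⁻ y : E4, ENNReal.ofReal (multCoeff ζ g ‖y‖ * ‖y‖ * radDeriv φ (t, y) ^ 2))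
      + ∫⁻ q in slab s t,
        ENNReal.ofReal (coercConst p / 2 * (multCoeff ζ g ‖q.2‖ * spaceDensity φ q))
      ≤ 3 * (∫⁻ y : E4, ENNReal.ofReal (multCoeff ζ g ‖y‖ * ‖y‖ * radDeriv φ (s, y) ^ 2))
        + (∫⁻ y : E4, ENNReal.ofReal (multCoeff ζ g ‖y‖ * ‖y‖ * fluxErr κ φ (s, y)))
        + (∫⁻ y : E4, ENNReal.ofReal (multCoeff ζ g ‖y‖ * ‖y‖ * fluxErr κ φ (t, y)))
        + ∫⁻ q in slab s t,
          ENNReal.ofReal (2 * |H q| * (multCoeff ζ g ‖q.2‖ * ‖q.2‖ * |radDeriv φ q|)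
            + 5 * (multCoeff ζ g ‖q.2‖ * (pd 0 φ q ^ 2 / ‖q.2‖ ^ 2))
            + 2 * (|deriv ζ ‖q.2‖| * g ‖q.2‖ * (‖q.2‖ ^ 3)⁻¹
              * (spaceDensity φ q + pd 0 φ q ^ 2 / ‖q.2‖ ^ 2))) := by
  have hr₀' : 0 < r₀ := by linarith
  have hne : ∀ {y : E4}, r₀ ≤ ‖y‖ → y ≠ 0 := fun {y} h => norm_ne_zero_iff.1 (by linarith)
  have hw0 : ∀ r, 0 ≤ multCoeff ζ g r := fun r => by
    rcases le_or_gt r 0 with h | h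
    · rw [multCoeff, hζl r (by linarith)]; simp
    · have := hg.nonneg r h
      have := hζ0 r
      unfold multCoeff; positivity
  have hwl : ∀ r, r ≤ r₀ → multCoeff ζ g r = 0 := fun r h => by simp [multCoeff, hζl r h]
  have hwu : ∀ r, M ≤ r → multCoeff ζ g r = 0 := fun r h => by simp [multCoeff, hζu r h]
  have hJ : ∀ μ, ∀ σ ∈ Set.Icc s t, ∀ y,
      ContDiffAt ℝ 1 (current a (multCoeff ζ g) φ μ) (σ, y) := by
    intro μ σ hσ y
    refine contDiffAt_of_eq_zero (r₀ := r₀) (fun x hx => ?_) (fun h => ?_)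
    · exact current_eq_zero (x := x) (hwl ‖x.2‖ hx.le) μ
    · have h' : r₀ ≤ ‖y‖ := h
      have hpos : 0 < ‖y‖ := hr₀'.trans_le h'
      exact contDiffAt_current (q := (σ, y)) (hφ σ hσ y h') (hne h')
        (contDiffAt_multCoeff hζ hg hpos) (hL σ hσ y h').smooth μ
  have hJ0 : ∀ μ σ (y : E4), M ≤ ‖y‖ → current a (multCoeff ζ g) φ μ (σ, y) = 0 := fun μ σ y h =>
    current_eq_zero (x := (σ, y)) (hwu ‖y‖ h) μ
  have hdiv := integral_divergence hst hJ hJ0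
  have hdi : IntegrableOn (fun q => ∑ μ, pd μ (current a (multCoeff ζ g) φ μ) q)
      (slab s t) := integrable_finsetSum _ fun μ _ =>
    integrableOn_slab (continuousOn_pd (hJ μ) μ) (pd_eq_zero_of_large (hJ0 μ) μ)
  have hwd : ∀ r, r₀ ≤ r → ContDiffAt ℝ 1 (multCoeff ζ g) r := fun r h =>
    contDiffAt_multCoeff hζ hg (hr₀'.trans_le h)
  have hci : IntegrableOn (fun q : ℝ × E4 =>
      coercConst p / 2 * (multCoeff ζ g ‖q.2‖ * spaceDensity φ q)) (slab s t) :=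
    (integrableOn_slab_weighted hr₀' hwl hwu hwd fun σ hσ y h =>
      contDiffAt_spaceDensity (hφ σ hσ y h) (hne h)).const_mul _
  have hs : s ∈ Set.Icc s t := ⟨le_rfl, hst⟩
  have ht : t ∈ Set.Icc s t := ⟨hst, le_rfl⟩
  have hrad : ∀ σ ∈ Set.Icc s t,
      Integrable fun y : E4 => multCoeff ζ g ‖y‖ * ‖y‖ * radDeriv φ (σ, y) ^ 2 := fun σ hσ =>
    integrable_leaf_weighted (D := fun q => radDeriv φ q ^ 2) hr₀' hwl hwu hwd fun y h =>
      (contDiffAt_radDeriv (hφ σ hσ y h) (hne h)).pow 2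
  have herr : ∀ σ ∈ Set.Icc s t,
      Integrable fun y : E4 => multCoeff ζ g ‖y‖ * ‖y‖ * fluxErr κ φ (σ, y) := fun σ hσ =>
    integrable_leaf_weighted (D := fluxErr κ φ) hr₀' hwl hwu hwd fun y h =>
      contDiffAt_fluxErr (hφ σ hσ y h) (hne h)
  have hcur : ∀ σ ∈ Set.Icc s t, Integrable fun y => current a (multCoeff ζ g) φ 0 (σ, y) :=
    fun σ hσ => integrable_leaf (M := M) (continuous_iff_continuousAt.2 fun y =>
      ContinuousAt.comp (f := fun y => (σ, y)) (hJ 0 σ hσ y).continuousAt (by fun_prop))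
      (fun y hy => hJ0 0 σ y hy.le)
  have hc0 : 0 ≤ coercConst p := by
    have : 0 < min (p / 2) (2 - p) := lt_min (by linarith) (by linarith)
    unfold coercConst; positivity
  have hc1 : coercConst p ≤ 3 / 4 := by
    have h1 : coercConst p ≤ 3 / 4 * (p / 2) := by
      unfold coercConst; gcongr; exact min_le_left _ _
    linarith
  have hflux : ∀ σ ∈ Set.Icc s t, ∀ y : E4, |-current a (multCoeff ζ g) φ 0 (σ, y)
        - 2 * (multCoeff ζ g ‖y‖ * ‖y‖ * radDeriv φ (σ, y) ^ 2)|
      ≤ multCoeff ζ g ‖y‖ * ‖y‖ * (radDeriv φ (σ, y) ^ 2 + fluxErr κ φ (σ, y)) := by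
    intro σ hσ y
    rcases le_or_gt r₀ ‖y‖ with h | h
    · exact flux_bounds (q := (σ, y)) (hζ0 _) hg hκ (by linarith) (hr₀.trans h) (hL σ hσ y h)
    · rw [current_eq_zero (x := (σ, y)) (hwl _ h.le), hwl _ h.le]; simp
  have hlower : ∫ y, multCoeff ζ g ‖y‖ * ‖y‖ * radDeriv φ (t, y) ^ 2
      ≤ (∫ y, multCoeff ζ g ‖y‖ * ‖y‖ * fluxErr κ φ (t, y))
        - ∫ y, current a (multCoeff ζ g) φ 0 (t, y) := by
    rw [← integral_sub (herr t ht) (hcur t ht)]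
    refine integral_mono (hrad t ht) ((herr t ht).sub (hcur t ht)) fun y => ?_
    have := (abs_le.1 (hflux t ht y)).1
    simp only
    linarith
  have hupper : -∫ y, current a (multCoeff ζ g) φ 0 (s, y)
      ≤ 3 * (∫ y, multCoeff ζ g ‖y‖ * ‖y‖ * radDeriv φ (s, y) ^ 2)
        + ∫ y, multCoeff ζ g ‖y‖ * ‖y‖ * fluxErr κ φ (s, y) := by
    rw [← integral_const_mul, ← integral_add ((hrad s hs).const_mul 3) (herr s hs), ← integral_neg]
    refine integral_mono (hcur s hs).neg (((hrad s hs).const_mul 3).add (herr s hs)) fun y => ?_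
    have := (abs_le.1 (hflux s hs y)).2
    simp only
    linarith
  have hbulk : ENNReal.ofReal ((∫ q in slab s t,
        coercConst p / 2 * (multCoeff ζ g ‖q.2‖ * spaceDensity φ q))
        - ∫ q in slab s t, ∑ μ, pd μ (current a (multCoeff ζ g) φ μ) q)
      ≤ ∫⁻ q in slab s t,
          ENNReal.ofReal (2 * |H q| * (multCoeff ζ g ‖q.2‖ * ‖q.2‖ * |radDeriv φ q|)
            + 5 * (multCoeff ζ g ‖q.2‖ * (pd 0 φ q ^ 2 / ‖q.2‖ ^ 2))
            + 2 * (|deriv ζ ‖q.2‖| * g ‖q.2‖ * (‖q.2‖ ^ 3)⁻¹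
              * (spaceDensity φ q + pd 0 φ q ^ 2 / ‖q.2‖ ^ 2))) := by
    rw [← integral_sub hci hdi]
    refine ofReal_integral_le_lintegral (hci.sub hdi) ?_
    rw [Filter.EventuallyLE, ae_restrict_iff' (measurableSet_Icc.prod MeasurableSet.univ)]
    refine Filter.Eventually.of_forall ?_
    rintro ⟨σ, y⟩ ⟨hσ, -⟩
    rcases le_or_gt r₀ ‖y‖ with h | h
    · have := coercive_le_div (q := (σ, y)) hζ (hζ0 _) hg hp0 hp hκ hκc (hφ σ hσ y h) (hne h)
        (hL σ hσ y h)
      simp only at this ⊢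
      linarith
    · have hz : ∀ μ, pd μ (current a (multCoeff ζ g) φ μ) (σ, y) = 0 := fun μ => by
        rw [pd_congr (g := fun _ => 0), pd_const]
        filter_upwards [(isOpen_lt continuous_snd.norm continuous_const).mem_nhds
          (show (σ, y) ∈ {x : ℝ × E4 | ‖x.2‖ < r₀} from h)] with x hx
        exact current_eq_zero (x := x) (hwl ‖x.2‖ (le_of_lt hx)) μ
      have hζd : deriv ζ ‖y‖ = 0 := by
        have : ζ =ᶠ[nhds ‖y‖] fun _ => 0 := by
          filter_upwards [isOpen_Iio.mem_nhds h] with x hx using hζl x (le_of_lt hx)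
        rw [this.deriv_eq]; simp
      simp only [hz, hwl _ h.le, hζd]
      simp
  -- conversion to integrals in `[0, ∞]`
  have hpos : ∀ {D : ℝ × E4 → ℝ}, (∀ q, 0 ≤ D q) → ∀ σ, ∀ y : E4,
      0 ≤ multCoeff ζ g ‖y‖ * ‖y‖ * D (σ, y) := fun {D} hD σ y =>
    mul_nonneg (mul_nonneg (hw0 _) (norm_nonneg _)) (hD _)
  have pr := hpos (D := fun q => radDeriv φ q ^ 2) fun _ => sq_nonneg _
  have pf := hpos (D := fluxErr κ φ) (fluxErr_nonneg hκ φ)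
  have pc : ∀ q : ℝ × E4, 0 ≤ coercConst p / 2 * (multCoeff ζ g ‖q.2‖ * spaceDensity φ q) :=
    fun q => mul_nonneg (by linarith) (mul_nonneg (hw0 _) (spaceDensity_nonneg φ q))
  rw [← ofReal_integral_eq_lintegral_ofReal (hrad t ht) (Filter.Eventually.of_forall (pr t)),
    ← ofReal_integral_eq_lintegral_ofReal (hrad s hs) (Filter.Eventually.of_forall (pr s)),
    ← ofReal_integral_eq_lintegral_ofReal (herr t ht) (Filter.Eventually.of_forall (pf t)),
    ← ofReal_integral_eq_lintegral_ofReal (herr s hs) (Filter.Eventually.of_forall (pf s)),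
    ← ofReal_integral_eq_lintegral_ofReal hci (Filter.Eventually.of_forall pc)]
  refine le_trans ?_ (add_le_add le_rfl hbulk)
  have ir : ∀ σ, 0 ≤ ∫ y : E4, multCoeff ζ g ‖y‖ * ‖y‖ * radDeriv φ (σ, y) ^ 2 := fun σ =>
    integral_nonneg (pr σ)
  have ie : ∀ σ, 0 ≤ ∫ y : E4, multCoeff ζ g ‖y‖ * ‖y‖ * fluxErr κ φ (σ, y) := fun σ =>
    integral_nonneg (pf σ)
  have i1 := ir t
  have i2 := ir s
  have i3 := ie t
  have i4 := ie s
  have i5 : 0 ≤ ∫ q in slab s t,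
    coercConst p / 2 * (multCoeff ζ g ‖q.2‖ * spaceDensity φ q) := integral_nonneg pc
  rw [show (3 : ℝ≥0∞) = ENNReal.ofReal 3 by simp, ← ENNReal.ofReal_mul (by norm_num),
    ← ENNReal.ofReal_add i1 i5, ← ENNReal.ofReal_add (by positivity) i4,
    ← ENNReal.ofReal_add (by positivity) i3]
  refine le_trans (ENNReal.ofReal_le_ofReal ?_) ENNReal.ofReal_add_le
  rw [hdiv]
  linarith

/-! ### Removing the truncation at infinity -/

/-- The integral of a function over a product is at most the iterated integral, also if the
function is not measurable. -/
lemma lintegral_prod_le_lintegral {X Y : Type*} [MeasurableSpace X] [MeasurableSpace Y]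
    (m : Measure X) (n : Measure Y) [SFinite n] (f : X × Y → ℝ≥0∞) :
    ∫⁻ z, f z ∂(m.prod n) ≤ ∫⁻ x, ∫⁻ y, f (x, y) ∂n ∂m := by
  obtain ⟨g, hg, hgf, he⟩ := exists_measurable_le_lintegral_eq (m.prod n) f
  rw [he, lintegral_prod _ hg.aemeasurable]
  exact lintegral_mono fun x => lintegral_mono fun y => hgf (x, y)

lemma setLIntegral_slab_le (s t : ℝ) (f : ℝ × E4 → ℝ≥0∞) :
    ∫⁻ q in slab s t, f q ≤ ∫⁻ σ in Set.Icc s t, ∫⁻ y : E4, f (σ, y) := by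
  rw [slab, Measure.volume_eq_prod, ← Measure.prod_restrict, Measure.restrict_univ]
  exact lintegral_prod_le_lintegral _ _ _

/-- The weight `r ^ p` tempered at the scale `N`, beyond which it grows like `r ^ (p / 2)`.
As `p / 2 < 1`, the error of a truncation at large radii, which has the weight `r ^ (p / 2 - 1)`
relative to the standard energy density, tends to zero. -/
def temperedWeight (p N r : ℝ) : ℝ := r ^ p * (N / (N + r)) ^ (p / 2)

section tempered

variable {p N r : ℝ}

lemma hasDerivAt_temperedWeight (hN : 0 < N) (hr : 0 < r) :
    HasDerivAt (temperedWeight p N)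
      (p * temperedWeight p N r / r - p / 2 * temperedWeight p N r / (N + r)) r := by
  have hNr : 0 < N + r := by linarith
  have h1 : HasDerivAt (fun r : ℝ => r ^ p) (p * r ^ (p - 1)) r :=
    Real.hasDerivAt_rpow_const (Or.inl hr.ne')
  have h2 : HasDerivAt (fun r : ℝ => N / (N + r)) (-N / (N + r) ^ 2) r := by
    have := ((hasDerivAt_id r).const_add N).inv (by simpa using hNr.ne')
    refine (this.const_mul N).congr_deriv ?_ |>.congr_of_eventuallyEq ?_
    · simp; ring
    · exact Filter.Eventually.of_forall fun x => by simp [div_eq_mul_inv]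
  have h3 := h2.rpow_const (p := p / 2) (Or.inl (by positivity))
  have h4 := h1.mul h3
  refine h4.congr_deriv ?_
  rw [Real.rpow_sub_one hr.ne', Real.rpow_sub_one (by positivity), temperedWeight]
  field_simp
  ring

lemma isGrowthWeight_temperedWeight (hp : 0 < p) (hN : 0 < N) :
    IsGrowthWeight p (temperedWeight p N) where
  smooth := by
    have h1 : ContDiffOn ℝ 1 (fun r : ℝ => r ^ p) (Set.Ioi 0) := fun r hr =>
      (Real.contDiffAt_rpow_const_of_ne (ne_of_gt hr)).contDiffWithinAt
    have h2 : ContDiffOn ℝ 1 (fun r : ℝ => (N / (N + r)) ^ (p / 2)) (Set.Ioi 0) := fun r hr => by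
      have hr' : 0 < r := hr
      refine ContDiffAt.contDiffWithinAt ?_
      refine ContDiffAt.rpow_const_of_ne (contDiffAt_const.div
        (contDiffAt_const.add contDiffAt_id) ?_) ?_
      · positivity
      · positivity
    exact h1.mul h2
  nonneg r hr := by unfold temperedWeight; positivity
  lower r hr := by
    have h0 : 0 ≤ temperedWeight p N r := by unfold temperedWeight; positivity
    rw [(hasDerivAt_temperedWeight hN hr).deriv]
    have : r / (N + r) ≤ 1 := (div_le_one (by linarith)).2 (by linarith)
    have h1 : r * (p * temperedWeight p N r / r - p / 2 * temperedWeight p N r / (N + r))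
        = p * temperedWeight p N r - p / 2 * temperedWeight p N r * (r / (N + r)) := by
      field_simp
    rw [h1]
    have h2 : p / 2 * temperedWeight p N r * (r / (N + r)) ≤ p / 2 * temperedWeight p N r * 1 := by
      gcongr
    linarith
  upper r hr := by
    have h0 : 0 ≤ temperedWeight p N r := by unfold temperedWeight; positivity
    rw [(hasDerivAt_temperedWeight hN hr).deriv]
    have h1 : r * (p * temperedWeight p N r / r - p / 2 * temperedWeight p N r / (N + r))
        = p * temperedWeight p N r - p / 2 * temperedWeight p N r * (r / (N + r)) := by
      field_simp
    rw [h1]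
    have : 0 ≤ p / 2 * temperedWeight p N r * (r / (N + r)) := by positivity
    linarith

lemma temperedWeight_le (hp : 0 < p) (hN : 0 < N) (hr : 0 < r) : temperedWeight p N r ≤ r ^ p := by
  unfold temperedWeight
  refine mul_le_of_le_one_right (by positivity) (Real.rpow_le_one (by positivity) ?_ (by positivity))
  exact (div_le_one (by linarith)).2 (by linarith)

lemma temperedWeight_le_half (hp : 0 < p) (hN : 0 < N) (hr : 0 < r) :
    temperedWeight p N r ≤ N ^ (p / 2) * r ^ (p / 2) := by
  unfold temperedWeight
  have h1 : (N / (N + r)) ^ (p / 2) ≤ (N / r) ^ (p / 2) := by gcongr; linarith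
  have h2 : r ^ p = r ^ (p / 2) * r ^ (p / 2) := by rw [← Real.rpow_add hr]; ring_nf
  calc r ^ p * (N / (N + r)) ^ (p / 2) ≤ r ^ p * (N / r) ^ (p / 2) := by gcongr
    _ = _ := by
      rw [Real.div_rpow hN.le hr.le, h2]
      have : 0 < r ^ (p / 2) := by positivity
      field_simp

lemma tendsto_temperedWeight :
    Filter.Tendsto (fun n : ℕ => temperedWeight p (n + 1) r) Filter.atTop (nhds (r ^ p)) := by
  have h1 : Filter.Tendsto (fun n : ℕ => ((n : ℝ) + 1) / ((n : ℝ) + 1 + r)) Filter.atTop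
      (nhds 1) := by
    have h2 : Filter.Tendsto (fun n : ℕ => (n : ℝ) + 1 + r) Filter.atTop Filter.atTop := by
      simp only [add_assoc]
      exact Filter.tendsto_atTop_add_const_right _ _ tendsto_natCast_atTop_atTop
    have h3 : Filter.Tendsto (fun n : ℕ => 1 - r / ((n : ℝ) + 1 + r)) Filter.atTop
        (nhds (1 - 0)) := tendsto_const_nhds.sub (h2.const_div_atTop r)
    rw [sub_zero] at h3
    refine h3.congr' ?_
    filter_upwards [h2.eventually_gt_atTop 0] with n hn
    field_simp; ring
  have h4 := (h1.rpow_const (p := p / 2) (Or.inl one_ne_zero)).const_mul (r ^ p)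
  simpa [temperedWeight] using h4

end tempered

lemma exists_deriv_smoothTransition_le :
    ∃ C : ℝ, 0 < C ∧ ∀ x, |deriv Real.smoothTransition x| ≤ C := by
  have hc : Continuous (deriv Real.smoothTransition) :=
    (Real.smoothTransition.contDiff (n := 1)).continuous_deriv (by norm_num)
  obtain ⟨C, hC⟩ := isCompact_Icc.exists_bound_of_continuousOn (s := Set.Icc (0 : ℝ) 1)
    hc.continuousOn
  refine ⟨max C 1, by positivity, fun x => ?_⟩
  by_cases hx : x ∈ Set.Icc (0 : ℝ) 1
  · exact (hC x hx).trans (le_max_left _ _)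
  · have : deriv Real.smoothTransition x = 0 := by
      rw [Set.mem_Icc, not_and_or, not_le, not_le] at hx
      rcases hx with hx | hx
      · have : Real.smoothTransition =ᶠ[nhds x] fun _ => 0 := by
          filter_upwards [isOpen_Iio.mem_nhds hx] with z hz
          exact Real.smoothTransition.zero_of_nonpos (le_of_lt hz)
        rw [this.deriv_eq]; simp
      · have : Real.smoothTransition =ᶠ[nhds x] fun _ => 1 := by
          filter_upwards [isOpen_Ioi.mem_nhds hx] with z hz
          exact Real.smoothTransition.one_of_one_le (le_of_lt hz)
        rw [this.deriv_eq]; simp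
    rw [this, abs_zero]; positivity

/-- A smooth cutoff that is `1` for `r ≤ M` and `0` for `r ≥ 2 M`. -/
def outerCutoff (M r : ℝ) : ℝ := Real.smoothTransition (2 - r / M)

section outer

variable {M r : ℝ}

lemma contDiff_outerCutoff {n : ℕ∞} : ContDiff ℝ n (outerCutoff M) :=
  Real.smoothTransition.contDiff.comp (contDiff_const.sub (contDiff_id.div_const M))

lemma outerCutoff_nonneg : 0 ≤ outerCutoff M r := Real.smoothTransition.nonneg _
lemma outerCutoff_le_one : outerCutoff M r ≤ 1 := Real.smoothTransition.le_one _

lemma outerCutoff_eq_one (hM : 0 < M) (hr : r ≤ M) : outerCutoff M r = 1 :=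
  Real.smoothTransition.one_of_one_le (by linarith [(div_le_one hM).2 hr])

lemma outerCutoff_eq_zero (hM : 0 < M) (hr : 2 * M ≤ r) : outerCutoff M r = 0 :=
  Real.smoothTransition.zero_of_nonpos (by linarith [(le_div_iff₀ hM).2 hr])

lemma abs_deriv_outerCutoff_le {C : ℝ} (hC : ∀ x, |deriv Real.smoothTransition x| ≤ C)
    (hM : 0 < M) : |deriv (outerCutoff M) r| ≤ C / M := by
  have h1 : HasDerivAt (fun r : ℝ => 2 - r / M) (-(1 / M)) r :=
    ((hasDerivAt_id r).div_const M).const_sub 2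
  have h2 := ((Real.smoothTransition.contDiff (n := 1)).differentiable (by norm_num)
    (2 - r / M)).hasDerivAt.comp r h1
  have h3 : HasDerivAt (outerCutoff M) _ r := h2
  rw [h3.deriv, abs_mul, abs_neg, abs_of_pos (by positivity : 0 < 1 / M), div_eq_mul_one_div C]
  exact mul_le_mul_of_nonneg_right (hC _) (by positivity)

lemma deriv_outerCutoff_eq_zero (hM : 0 < M) (hr : 2 * M < r) : deriv (outerCutoff M) r = 0 := by
  have : outerCutoff M =ᶠ[nhds r] fun _ => 0 := by
    filter_upwards [isOpen_Ioi.mem_nhds hr] with z hz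
    exact outerCutoff_eq_zero hM (le_of_lt hz)
  rw [this.deriv_eq]; simp

end outer

/-- The error of the truncation at radius `M` in the estimate with the weight tempered at `N`
tends to zero for fixed `N`, as `p / 2 < 1`. -/
lemma exists_truncation_radius {p : ℝ} (hp : p < 2) (C : ℝ) {A : ℝ≥0∞} (hA : A ≠ ⊤) (n : ℕ) :
    ∃ M : ℝ, n + 1 ≤ M ∧ ENNReal.ofReal (2 * (C / M) *
      (((n : ℝ) + 1) ^ (p / 2) * (2 * M) ^ (p / 2))) * A ≤ ((n : ℝ≥0∞) + 1)⁻¹ := by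
  have h1 : Filter.Tendsto (fun M : ℝ => 2 * (C / M) *
      (((n : ℝ) + 1) ^ (p / 2) * (2 * M) ^ (p / 2))) Filter.atTop (nhds 0) := by
    have h2 : Filter.Tendsto (fun M : ℝ => 2 * C * ((n : ℝ) + 1) ^ (p / 2) * 2 ^ (p / 2)
        * M ^ (-(1 - p / 2))) Filter.atTop (nhds (2 * C * ((n : ℝ) + 1) ^ (p / 2) * 2 ^ (p / 2) * 0)) :=
      (tendsto_rpow_neg_atTop (by linarith)).const_mul _
    rw [mul_zero] at h2
    refine h2.congr' ?_
    filter_upwards [Filter.eventually_gt_atTop 0] with M hM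
    rw [Real.mul_rpow (by norm_num) hM.le, show -(1 - p / 2) = p / 2 - 1 by ring,
      Real.rpow_sub_one hM.ne']
    field_simp
  have h3 : Filter.Tendsto (fun M : ℝ => ENNReal.ofReal (2 * (C / M) *
      (((n : ℝ) + 1) ^ (p / 2) * (2 * M) ^ (p / 2))) * A) Filter.atTop (nhds 0) := by
    have := ENNReal.Tendsto.mul_const (b := A) (ENNReal.tendsto_ofReal h1) (Or.inr hA)
    simpa using this
  have h4 : (0 : ℝ≥0∞) < ((n : ℝ≥0∞) + 1)⁻¹ := by
    rw [ENNReal.inv_pos]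
    exact ENNReal.add_ne_top.2 ⟨ENNReal.natCast_ne_top n, ENNReal.one_ne_top⟩
  obtain ⟨M, h5, h6⟩ := ((h3.eventually_lt_const h4).and
    (Filter.eventually_ge_atTop ((n : ℝ) + 1))).exists
  exact ⟨M, h6, h5.le⟩

/-- A `C¹` cutoff with values in `[0, 1]` that vanishes for `r ≤ r₀`. -/
structure IsInnerCutoff (r₀ : ℝ) (χ : ℝ → ℝ) : Prop where
  smooth : ContDiff ℝ 1 χ
  nonneg : ∀ r, 0 ≤ χ r
  le_one : ∀ r, χ r ≤ 1
  eq_zero : ∀ r, r ≤ r₀ → χ r = 0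

lemma measurable_leaf_weighted {w : ℝ → ℝ} {D : ℝ × E4 → ℝ} {r₀ σ : ℝ} (hr₀ : 0 < r₀)
    (hwl : ∀ r, r ≤ r₀ → w r = 0) (hw : ∀ r, r₀ ≤ r → ContDiffAt ℝ 1 w r)
    (hD : ∀ y : E4, r₀ ≤ ‖y‖ → ContDiffAt ℝ 1 D (σ, y)) :
    Measurable (fun y : E4 => ENNReal.ofReal (w ‖y‖ * D (σ, y))) := by
  have : Continuous fun y : E4 => w ‖y‖ * D (σ, y) := continuous_iff_continuousAt.2 fun y =>
    ContinuousAt.comp (g := fun x : ℝ × E4 => w ‖x.2‖ * D x) (f := fun z : E4 => (σ, z)) (x := y)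
      (contDiffAt_weighted (q := (σ, y)) hr₀ hwl hw (hD y)).continuousAt (by fun_prop)
  exact this.measurable.ennreal_ofReal

lemma aemeasurable_slab_weighted {w : ℝ → ℝ} {D : ℝ × E4 → ℝ} {r₀ s t : ℝ} (hr₀ : 0 < r₀)
    (hwl : ∀ r, r ≤ r₀ → w r = 0) (hw : ∀ r, r₀ ≤ r → ContDiffAt ℝ 1 w r)
    (hD : ∀ σ ∈ Set.Icc s t, ∀ y : E4, r₀ ≤ ‖y‖ → ContDiffAt ℝ 1 D (σ, y)) :
    AEMeasurable (fun q : ℝ × E4 => ENNReal.ofReal (w ‖q.2‖ * D q))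
      (volume.restrict (slab s t)) := by
  have : ContinuousOn (fun q : ℝ × E4 => w ‖q.2‖ * D q) (slab s t) := by
    rintro ⟨σ, y⟩ ⟨hσ, -⟩
    exact (contDiffAt_weighted (q := (σ, y)) hr₀ hwl hw
      (hD σ hσ y)).continuousAt.continuousWithinAt
  exact (this.aemeasurable (measurableSet_Icc.prod MeasurableSet.univ)).ennreal_ofReal

lemma contDiffAt_multCoeff' {ζ g : ℝ → ℝ} (hζ : ContDiff ℝ 1 ζ) {r : ℝ} (hr : 0 < r)
    (hg : ContDiffAt ℝ 1 g r) : ContDiffAt ℝ 1 (multCoeff ζ g) r :=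
  (hζ.contDiffAt.mul hg).mul ((contDiffAt_id.pow 4).inv (pow_pos hr 4).ne')

/-- The bulk terms on the right-hand side of the estimate, before the term with `∂_σ φ`. -/
def sourceDensity (χ : ℝ → ℝ) (p : ℝ) (φ H : ℝ × E4 → ℝ) (q : ℝ × E4) : ℝ :=
  2 * |H q| * (multCoeff χ (fun r => r ^ p) ‖q.2‖ * ‖q.2‖ * |radDeriv φ q|)
    + 2 * (|deriv χ ‖q.2‖| * ‖q.2‖ ^ p * (‖q.2‖ ^ 3)⁻¹
      * (spaceDensity φ q + pd 0 φ q ^ 2 / ‖q.2‖ ^ 2))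

lemma deriv_inner_eq_zero {r₀ r : ℝ} {χ : ℝ → ℝ} (hχ : IsInnerCutoff r₀ χ) (hr : r < r₀) :
    deriv χ r = 0 := by
  have : χ =ᶠ[nhds r] fun _ => 0 := by
    filter_upwards [isOpen_Iio.mem_nhds hr] with x hx using hχ.eq_zero x (le_of_lt hx)
  rw [this.deriv_eq]; simp

/-- Comparison of the bulk terms for the truncated weight with those for `r ^ p`. -/
lemma truncated_density_le {p r₀ N M C : ℝ} {χ : ℝ → ℝ} {φ H : ℝ × E4 → ℝ} (hr₀ : 0 < r₀)
    (hχ : IsInnerCutoff r₀ χ) (hp : 0 < p) (hN : 0 < N) (hM : 0 < M) (hC0 : 0 ≤ C)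
    (hC : ∀ x, |deriv Real.smoothTransition x| ≤ C) (q : ℝ × E4) :
    2 * |H q| * (multCoeff (fun r => χ r * outerCutoff M r) (temperedWeight p N) ‖q.2‖ * ‖q.2‖
          * |radDeriv φ q|)
        + 5 * (multCoeff (fun r => χ r * outerCutoff M r) (temperedWeight p N) ‖q.2‖
          * (pd 0 φ q ^ 2 / ‖q.2‖ ^ 2))
        + 2 * (|deriv (fun r => χ r * outerCutoff M r) ‖q.2‖| * temperedWeight p N ‖q.2‖
          * (‖q.2‖ ^ 3)⁻¹ * (spaceDensity φ q + pd 0 φ q ^ 2 / ‖q.2‖ ^ 2))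
      ≤ (sourceDensity χ p φ H q
          + multCoeff χ (fun r => r ^ p) ‖q.2‖ * (5 * (pd 0 φ q ^ 2 / ‖q.2‖ ^ 2)))
        + 2 * (C / M) * (N ^ (p / 2) * (2 * M) ^ (p / 2)) *
          (χ ‖q.2‖ * (‖q.2‖ ^ 3)⁻¹ * (spaceDensity φ q + pd 0 φ q ^ 2 / ‖q.2‖ ^ 2)) := by
  have hD : 0 ≤ spaceDensity φ q + pd 0 φ q ^ 2 / ‖q.2‖ ^ 2 :=
    add_nonneg (spaceDensity_nonneg φ q) (by positivity)
  have hχ0 := hχ.nonneg ‖q.2‖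
  rcases lt_or_ge ‖q.2‖ r₀ with h | h
  · have hz := hχ.eq_zero _ h.le
    have hd : deriv (fun r => χ r * outerCutoff M r) ‖q.2‖ = 0 := by
      have : (fun r => χ r * outerCutoff M r) =ᶠ[nhds ‖q.2‖] fun _ => 0 := by
        filter_upwards [isOpen_Iio.mem_nhds h] with x hx
        rw [hχ.eq_zero x (le_of_lt hx), zero_mul]
      rw [this.deriv_eq]; simp
    rw [hd]
    simp only [sourceDensity, multCoeff, hz, deriv_inner_eq_zero hχ h]
    simp
  · have hr : 0 < ‖q.2‖ := hr₀.trans_le h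
    set r := ‖q.2‖
    have hg := temperedWeight_le hp hN hr
    have hg0 := (isGrowthWeight_temperedWeight hp hN).nonneg r hr
    have ho := outerCutoff_nonneg (M := M) (r := r)
    have ho1 := outerCutoff_le_one (M := M) (r := r)
    have hw : multCoeff (fun r => χ r * outerCutoff M r) (temperedWeight p N) r
        ≤ multCoeff χ (fun r => r ^ p) r := by
      unfold multCoeff
      gcongr
      exact mul_le_of_le_one_right hχ0 ho1
    have hder : |deriv (fun r => χ r * outerCutoff M r) r| * temperedWeight p N r
        ≤ |deriv χ r| * r ^ p + C / M * (N ^ (p / 2) * (2 * M) ^ (p / 2)) * χ r := by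
      have h1 := (hχ.smooth.differentiable (by norm_num) r).hasDerivAt
      have h2 := ((contDiff_outerCutoff (M := M) (n := 1)).differentiable
        (by norm_num) r).hasDerivAt
      have h3 : HasDerivAt (fun r => χ r * outerCutoff M r) _ r := h1.mul h2
      have h4 : |deriv (outerCutoff M) r| * temperedWeight p N r
          ≤ C / M * (N ^ (p / 2) * (2 * M) ^ (p / 2)) := by
        rcases le_or_gt r (2 * M) with h5 | h5
        · have h6 := temperedWeight_le_half hp hN hr
          have h7 : N ^ (p / 2) * r ^ (p / 2) ≤ N ^ (p / 2) * (2 * M) ^ (p / 2) := by gcongr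
          exact mul_le_mul (abs_deriv_outerCutoff_le hC hM) (h6.trans h7) hg0 (by positivity)
        · rw [deriv_outerCutoff_eq_zero hM h5, abs_zero, zero_mul]; positivity
      rw [h3.deriv]
      calc |deriv χ r * outerCutoff M r + χ r * deriv (outerCutoff M) r| * temperedWeight p N r
          ≤ (|deriv χ r| * 1 + χ r * |deriv (outerCutoff M) r|) * temperedWeight p N r := by
            refine mul_le_mul_of_nonneg_right ?_ hg0
            refine (abs_add_le _ _).trans (add_le_add ?_ ?_)
            · rw [abs_mul, abs_of_nonneg ho]; gcongr
            · rw [abs_mul, abs_of_nonneg hχ0]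
        _ = |deriv χ r| * temperedWeight p N r
            + χ r * (|deriv (outerCutoff M) r| * temperedWeight p N r) := by ring
        _ ≤ |deriv χ r| * r ^ p + χ r * (C / M * (N ^ (p / 2) * (2 * M) ^ (p / 2))) := by gcongr
        _ = _ := by ring
    have ht : 0 ≤ pd 0 φ q ^ 2 / r ^ 2 := by positivity
    have e1 : 2 * |H q| * (multCoeff (fun r => χ r * outerCutoff M r) (temperedWeight p N) r * r
        * |radDeriv φ q|) ≤ 2 * |H q| * (multCoeff χ (fun r => r ^ p) r * r * |radDeriv φ q|) := by
      gcongr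
    have e2 := mul_le_mul_of_nonneg_right hw ht
    have e3 := mul_le_mul_of_nonneg_right hder (mul_nonneg (inv_nonneg.2 (pow_pos hr 3).le) hD)
    have e4 : sourceDensity χ p φ H q = 2 * |H q| * (multCoeff χ (fun r => r ^ p) r * r
        * |radDeriv φ q|) + 2 * (|deriv χ r| * r ^ p * (r ^ 3)⁻¹
          * (spaceDensity φ q + pd 0 φ q ^ 2 / r ^ 2)) := rfl
    rw [e4]
    linarith

lemma tendsto_multCoeff_truncated {p : ℝ} (χ : ℝ → ℝ) {Mn : ℕ → ℝ} (hM : ∀ n : ℕ, n + 1 ≤ Mn n)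
    (r : ℝ) : Filter.Tendsto (fun n : ℕ => multCoeff (fun r => χ r * outerCutoff (Mn n) r)
      (temperedWeight p (n + 1)) r) Filter.atTop (nhds (multCoeff χ (fun r => r ^ p) r)) := by
  have h1 : Filter.Tendsto (fun n : ℕ => χ r * 1 * temperedWeight p (n + 1) r * (r ^ 4)⁻¹)
      Filter.atTop (nhds (χ r * 1 * r ^ p * (r ^ 4)⁻¹)) :=
    (tendsto_temperedWeight.const_mul _).mul_const _
  rw [multCoeff, ← mul_one (χ r)]
  refine h1.congr' ?_
  filter_upwards [(tendsto_natCast_atTop_atTop (R := ℝ)).eventually_ge_atTop r] with n hn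
  have hn0 : (0 : ℝ) ≤ n := Nat.cast_nonneg n
  have := hM n
  rw [multCoeff, outerCutoff_eq_one (by linarith) (by linarith)]

/-- Fatou's lemma for a family of estimates with an error that tends to zero. -/
lemma lintegral_le_of_tendsto_of_le {X : Type*} [MeasurableSpace X] {μ : Measure X}
    {f : ℕ → X → ℝ} {g : X → ℝ} {A : ℝ≥0∞}
    (hm : ∀ n, AEMeasurable (fun x => ENNReal.ofReal (f n x)) μ)
    (hl : ∀ x, Filter.Tendsto (fun n => f n x) Filter.atTop (nhds (g x)))
    (h : ∀ n : ℕ, ∫⁻ x, ENNReal.ofReal (f n x) ∂μ ≤ A + ((n : ℝ≥0∞) + 1)⁻¹) :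
    ∫⁻ x, ENNReal.ofReal (g x) ∂μ ≤ A := by
  have hinv : Filter.Tendsto (fun n : ℕ => A + ((n : ℝ≥0∞) + 1)⁻¹) Filter.atTop (nhds A) := by
    have h1 : Filter.Tendsto (fun n : ℕ => ((n : ℝ≥0∞) + 1)⁻¹) Filter.atTop (nhds 0) := by
      have := (Filter.tendsto_add_atTop_iff_nat 1).2 ENNReal.tendsto_inv_nat_nhds_zero
      simpa using this
    simpa using h1.const_add A
  calc ∫⁻ x, ENNReal.ofReal (g x) ∂μ
      = ∫⁻ x, Filter.liminf (fun n => ENNReal.ofReal (f n x)) Filter.atTop ∂μ :=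
        lintegral_congr fun x => (ENNReal.tendsto_ofReal (hl x)).liminf_eq.symm
    _ ≤ Filter.liminf (fun n => ∫⁻ x, ENNReal.ofReal (f n x) ∂μ) Filter.atTop :=
        lintegral_liminf_le' hm
    _ ≤ Filter.liminf (fun n : ℕ => A + ((n : ℝ≥0∞) + 1)⁻¹) Filter.atTop :=
        Filter.liminf_le_liminf (Filter.Eventually.of_forall h)
    _ = A := hinv.liminf_eq

lemma measurable_leaf_radDeriv {w : ℝ → ℝ} {φ : ℝ × E4 → ℝ} {r₀ σ : ℝ} (hr₀ : 0 < r₀)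
    (hwl : ∀ r, r ≤ r₀ → w r = 0) (hw : ∀ r, r₀ ≤ r → ContDiffAt ℝ 1 w r)
    (hφ : ∀ y : E4, r₀ ≤ ‖y‖ → ContDiffAt ℝ 2 φ (σ, y)) :
    Measurable (fun y : E4 => ENNReal.ofReal (w ‖y‖ * ‖y‖ * radDeriv φ (σ, y) ^ 2)) := by
  have h := measurable_leaf_weighted (w := fun r => w r * r) (σ := σ)
    (D := fun q => radDeriv φ q ^ 2) hr₀ (fun r h => by rw [hwl r h, zero_mul])
    (fun r h => (hw r h).mul contDiffAt_id) fun y h =>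
      (contDiffAt_radDeriv (q := (σ, y)) (hφ y h) (norm_ne_zero_iff.1 (hr₀.trans_le h).ne')).pow 2
  exact h

lemma aemeasurable_slab_spaceDensity {w : ℝ → ℝ} {φ : ℝ × E4 → ℝ} {r₀ s t c : ℝ} (hr₀ : 0 < r₀)
    (hwl : ∀ r, r ≤ r₀ → w r = 0) (hw : ∀ r, r₀ ≤ r → ContDiffAt ℝ 1 w r)
    (hφ : ∀ σ ∈ Set.Icc s t, ∀ y : E4, r₀ ≤ ‖y‖ → ContDiffAt ℝ 2 φ (σ, y)) :
    AEMeasurable (fun q : ℝ × E4 => ENNReal.ofReal (c * (w ‖q.2‖ * spaceDensity φ q)))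
      (volume.restrict (slab s t)) := by
  have h := aemeasurable_slab_weighted (w := fun r => c * w r) (s := s) (t := t)
    (D := fun q => spaceDensity φ q) hr₀ (fun r h => by rw [hwl r h, mul_zero])
    (fun r h => contDiffAt_const.mul (hw r h)) fun σ hσ y h =>
      contDiffAt_spaceDensity (q := (σ, y)) (hφ σ hσ y h)
        (norm_ne_zero_iff.1 (hr₀.trans_le h).ne')
  simpa only [mul_assoc] using h

section limit

variable {κ p r₀ s t : ℝ} {φ H : ℝ × E4 → ℝ} {a : Fin 5 → Fin 5 → ℝ × E4 → ℝ}
  {B : Fin 5 → ℝ × E4 → ℝ} {Z : ℝ × E4 → ℝ} {χ : ℝ → ℝ}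

/-- The weighted estimate with the weight `r ^ p`, in the coordinates `(σ, y)`, for functions of
finite energy. -/
theorem weighted_estimate (hst : s ≤ t) (hr₀ : 1 ≤ r₀) (hχ : IsInnerCutoff r₀ χ) (hp0 : 0 < p)
    (hp : p < 2) (hκ : 0 ≤ κ) (hκc : 1450 * κ ≤ coercConst p)
    (hφ : ∀ σ ∈ Set.Icc s t, ∀ y : E4, r₀ ≤ ‖y‖ → ContDiffAt ℝ 2 φ (σ, y))
    (hL : ∀ σ ∈ Set.Icc s t, ∀ y : E4, r₀ ≤ ‖y‖ → NearFlatAt κ φ H a B Z (σ, y))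
    {A : ℝ≥0∞} (hA : A ≠ ⊤)
    (hfin : ∀ σ ∈ Set.Icc s t, ∫⁻ y : E4, ENNReal.ofReal (χ ‖y‖ * (‖y‖ ^ 3)⁻¹
      * (spaceDensity φ (σ, y) + pd 0 φ (σ, y) ^ 2 / ‖y‖ ^ 2)) ≤ A) :
    max (∫⁻ y : E4, ENNReal.ofReal (multCoeff χ (fun r => r ^ p) ‖y‖ * ‖y‖
        * radDeriv φ (t, y) ^ 2))
      (∫⁻ q in slab s t, ENNReal.ofReal
        (coercConst p / 2 * (multCoeff χ (fun r => r ^ p) ‖q.2‖ * spaceDensity φ q)))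
      ≤ 3 * (∫⁻ y : E4, ENNReal.ofReal (multCoeff χ (fun r => r ^ p) ‖y‖ * ‖y‖
          * radDeriv φ (s, y) ^ 2))
        + (∫⁻ y : E4, ENNReal.ofReal (multCoeff χ (fun r => r ^ p) ‖y‖ * ‖y‖
          * fluxErr κ φ (s, y)))
        + (∫⁻ y : E4, ENNReal.ofReal (multCoeff χ (fun r => r ^ p) ‖y‖ * ‖y‖
          * fluxErr κ φ (t, y)))
        + ((∫⁻ q in slab s t, ENNReal.ofReal (sourceDensity χ p φ H q))
          + ∫⁻ q in slab s t, ENNReal.ofReal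
            (multCoeff χ (fun r => r ^ p) ‖q.2‖ * (5 * (pd 0 φ q ^ 2 / ‖q.2‖ ^ 2)))) := by
  have hr₀' : 0 < r₀ := by linarith
  have hne : ∀ {y : E4}, r₀ ≤ ‖y‖ → y ≠ 0 := fun {y} h => norm_ne_zero_iff.1 (by linarith)
  obtain ⟨C, hC0, hC⟩ := exists_deriv_smoothTransition_le
  have hA' : ENNReal.ofReal (t - s) * A ≠ ⊤ := ENNReal.mul_ne_top ENNReal.ofReal_ne_top hA
  choose Mn hM1 hM2 using fun n => exists_truncation_radius hp C hA' n
  have hMpos : ∀ n, 0 < Mn n := fun n => by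
    have := hM1 n
    have : (0 : ℝ) ≤ n := Nat.cast_nonneg n
    linarith [hM1 n]
  have hNpos : ∀ n : ℕ, (0 : ℝ) < n + 1 := fun n => by positivity
  set W := multCoeff χ (fun r => r ^ p) with hW
  set w : ℕ → ℝ → ℝ := fun n => multCoeff (fun r => χ r * outerCutoff (Mn n) r)
    (temperedWeight p (n + 1)) with hw
  set RHS := 3 * (∫⁻ y : E4, ENNReal.ofReal (W ‖y‖ * ‖y‖ * radDeriv φ (s, y) ^ 2))
        + (∫⁻ y : E4, ENNReal.ofReal (W ‖y‖ * ‖y‖ * fluxErr κ φ (s, y)))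
        + (∫⁻ y : E4, ENNReal.ofReal (W ‖y‖ * ‖y‖ * fluxErr κ φ (t, y)))
        + ((∫⁻ q in slab s t, ENNReal.ofReal (sourceDensity χ p φ H q))
          + ∫⁻ q in slab s t, ENNReal.ofReal
            (W ‖q.2‖ * (5 * (pd 0 φ q ^ 2 / ‖q.2‖ ^ 2)))) with hRHS
  have hζ : ∀ n, ContDiff ℝ 1 fun r => χ r * outerCutoff (Mn n) r := fun n =>
    hχ.smooth.mul (contDiff_outerCutoff (n := 1))
  have hgw : ∀ n : ℕ, IsGrowthWeight p (temperedWeight p (n + 1)) := fun n =>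
    isGrowthWeight_temperedWeight hp0 (hNpos n)
  have hwl : ∀ n r, r ≤ r₀ → w n r = 0 := fun n r h => by
    simp only [hw, multCoeff, hχ.eq_zero r h, zero_mul]
  have hWl : ∀ r, r ≤ r₀ → W r = 0 := fun r h => by
    simp only [hW, multCoeff, hχ.eq_zero r h, zero_mul]
  have hwd : ∀ n r, r₀ ≤ r → ContDiffAt ℝ 1 (w n) r := fun n r h =>
    contDiffAt_multCoeff (hζ n) (hgw n) (hr₀'.trans_le h)
  have hwW : ∀ n r, 0 ≤ r → w n r ≤ W r := fun n r h => by
    rcases le_or_gt r r₀ with h1 | h1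
    · rw [hwl n r h1, hWl r h1]
    · have hr : 0 < r := hr₀'.trans h1
      have := hχ.nonneg r
      have := outerCutoff_nonneg (M := Mn n) (r := r)
      have := (hgw n).nonneg r hr
      simp only [hw, hW, multCoeff]
      gcongr
      · exact mul_le_of_le_one_right (hχ.nonneg r) outerCutoff_le_one
      · exact temperedWeight_le hp0 (hNpos n) hr
  have key : ∀ n, (∫⁻ y : E4, ENNReal.ofReal (w n ‖y‖ * ‖y‖ * radDeriv φ (t, y) ^ 2))
      + ∫⁻ q in slab s t, ENNReal.ofReal (coercConst p / 2 * (w n ‖q.2‖ * spaceDensity φ q))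
      ≤ RHS + ((n : ℝ≥0∞) + 1)⁻¹ := by
    intro n
    have h := truncated_estimate (M := 2 * Mn n) hst hr₀ (hζ n)
      (fun r => mul_nonneg (hχ.nonneg r) outerCutoff_nonneg)
      (fun r hr => by rw [hχ.eq_zero r hr, zero_mul])
      (fun r hr => by rw [outerCutoff_eq_zero (hMpos n) hr, mul_zero])
      (hgw n) hp0 hp hκ hκc hφ hL
    refine h.trans ?_
    rw [hRHS, add_assoc _ _ ((n : ℝ≥0∞) + 1)⁻¹]
    have hmono : ∀ D : E4 → ℝ, (∀ y, 0 ≤ D y) →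
        ∫⁻ y : E4, ENNReal.ofReal (w n ‖y‖ * ‖y‖ * D y)
          ≤ ∫⁻ y : E4, ENNReal.ofReal (W ‖y‖ * ‖y‖ * D y) := fun D hD =>
      lintegral_mono fun y => ENNReal.ofReal_le_ofReal <|
        mul_le_mul_of_nonneg_right (mul_le_mul_of_nonneg_right
          (hwW n _ (norm_nonneg y)) (norm_nonneg y)) (hD y)
    refine add_le_add (add_le_add (add_le_add ?_ ?_) ?_) ?_
    · gcongr 3 * ?_
      exact hmono (fun y => radDeriv φ (s, y) ^ 2) fun y => sq_nonneg _
    · exact hmono (fun y => fluxErr κ φ (s, y)) fun y => fluxErr_nonneg hκ φ _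
    · exact hmono (fun y => fluxErr κ φ (t, y)) fun y => fluxErr_nonneg hκ φ _
    set c := 2 * (C / Mn n) * (((n : ℝ) + 1) ^ (p / 2) * (2 * Mn n) ^ (p / 2)) with hc
    have hc0 : 0 ≤ c := by have := hMpos n; positivity
    have m1 : AEMeasurable (fun q : ℝ × E4 => ENNReal.ofReal
        (W ‖q.2‖ * (5 * (pd 0 φ q ^ 2 / ‖q.2‖ ^ 2)))) (volume.restrict (slab s t)) :=
      aemeasurable_slab_weighted (D := fun q => 5 * (pd 0 φ q ^ 2 / ‖q.2‖ ^ 2)) hr₀' hWl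
        (fun r h => contDiffAt_multCoeff' hχ.smooth (hr₀'.trans_le h)
          (Real.contDiffAt_rpow_const_of_ne (hr₀'.trans_le h).ne'))
        fun σ hσ y h => contDiffAt_const.mul (contDiffAt_timeDensity (hφ σ hσ y h) (hne h) 2)
    have m2 : AEMeasurable (fun q : ℝ × E4 => ENNReal.ofReal
        (χ ‖q.2‖ * (‖q.2‖ ^ 3)⁻¹ * (spaceDensity φ q + pd 0 φ q ^ 2 / ‖q.2‖ ^ 2)))
        (volume.restrict (slab s t)) :=
      aemeasurable_slab_weighted (w := fun r => χ r * (r ^ 3)⁻¹)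
        (D := fun q => spaceDensity φ q + pd 0 φ q ^ 2 / ‖q.2‖ ^ 2) hr₀'
        (fun r h => by rw [hχ.eq_zero r h, zero_mul])
        (fun r h => hχ.smooth.contDiffAt.mul
          ((contDiffAt_id.pow 3).inv (pow_pos (hr₀'.trans_le h) 3).ne'))
        fun σ hσ y h => (contDiffAt_spaceDensity (hφ σ hσ y h) (hne h)).add
          (contDiffAt_timeDensity (hφ σ hσ y h) (hne h) 2)
    have hX : ∫⁻ q in slab s t, ENNReal.ofReal (χ ‖q.2‖ * (‖q.2‖ ^ 3)⁻¹
        * (spaceDensity φ q + pd 0 φ q ^ 2 / ‖q.2‖ ^ 2)) ≤ ENNReal.ofReal (t - s) * A := by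
      refine (setLIntegral_slab_le s t _).trans ?_
      calc _ ≤ ∫⁻ σ in Set.Icc s t, A := setLIntegral_mono measurable_const hfin
        _ = ENNReal.ofReal (t - s) * A := by
          rw [setLIntegral_const, Real.volume_Icc, mul_comm]
    calc _ ≤ ∫⁻ q in slab s t, ((ENNReal.ofReal (sourceDensity χ p φ H q)
            + ENNReal.ofReal (W ‖q.2‖ * (5 * (pd 0 φ q ^ 2 / ‖q.2‖ ^ 2))))
          + ENNReal.ofReal c * ENNReal.ofReal (χ ‖q.2‖ * (‖q.2‖ ^ 3)⁻¹
            * (spaceDensity φ q + pd 0 φ q ^ 2 / ‖q.2‖ ^ 2))) := by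
          refine lintegral_mono fun q => ?_
          rw [← ENNReal.ofReal_mul hc0]
          refine (ENNReal.ofReal_le_ofReal (truncated_density_le hr₀' hχ hp0 (hNpos n) (hMpos n)
            hC0.le hC q)).trans (ENNReal.ofReal_add_le.trans ?_)
          exact add_le_add ENNReal.ofReal_add_le le_rfl
      _ = ((∫⁻ q in slab s t, ENNReal.ofReal (sourceDensity χ p φ H q))
          + ∫⁻ q in slab s t, ENNReal.ofReal (W ‖q.2‖ * (5 * (pd 0 φ q ^ 2 / ‖q.2‖ ^ 2))))
          + ENNReal.ofReal c * ∫⁻ q in slab s t, ENNReal.ofReal (χ ‖q.2‖ * (‖q.2‖ ^ 3)⁻¹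
            * (spaceDensity φ q + pd 0 φ q ^ 2 / ‖q.2‖ ^ 2)) := by
          rw [lintegral_add_right' _ (m2.const_mul _), lintegral_add_right' _ m1,
            lintegral_const_mul'' _ m2]
      _ ≤ _ := by
          gcongr
          exact (mul_le_mul_right hX _).trans (hM2 n)
  have ht : t ∈ Set.Icc s t := ⟨hst, le_rfl⟩
  have hconv : ∀ r, Filter.Tendsto (fun n => w n r) Filter.atTop (nhds (W r)) :=
    tendsto_multCoeff_truncated χ hM1
  refine max_le ?_ ?_
  · exact lintegral_le_of_tendsto_of_le
      (fun n => (measurable_leaf_radDeriv hr₀' (hwl n) (hwd n) (hφ t ht)).aemeasurable)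
      (fun y => ((hconv ‖y‖).mul_const _).mul_const _) fun n => le_self_add.trans (key n)
  · exact lintegral_le_of_tendsto_of_le
      (fun n => aemeasurable_slab_spaceDensity hr₀' (hwl n) (hwd n) hφ)
      (fun q => ((hconv ‖q.2‖).mul_const _).const_mul _) fun n => le_add_self.trans (key n)

end limit

/-! ### Symbol classes -/

section symbols

open Filter Asymptotics

variable {ι : Type*}

/-- The factor gained by a derivative along the `α`-th coordinate: nothing for `∂_σ`, and `r⁻¹`
for derivatives in `y`. -/
def derWeight (α : Fin 5) (x : ι × (ℝ × E4)) : ℝ :=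
  Fin.cases (motive := fun _ => ℝ) 1 (fun _ => ‖x.2.2‖⁻¹) α

@[simp] lemma derWeight_zero (x : ι × (ℝ × E4)) : derWeight 0 x = 1 := rfl
@[simp] lemma derWeight_succ (j : Fin 4) (x : ι × (ℝ × E4)) : derWeight j.succ x = ‖x.2.2‖⁻¹ := rfl

/-- A family `f` of functions of `(σ, y)`, with parameters in `ι`, is a symbol of size `w` along
the filter `L` of parameters and points: `f = O(w)`, `∂_σ f = O(w)` and `∂_y f = O(w / r)`. The
filter makes the bounds uniform in the parameters. -/
structure IsSymbol (L : Filter (ι × (ℝ × E4))) (w : ι × (ℝ × E4) → ℝ) (f : ι → ℝ × E4 → ℝ) :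
    Prop where
  smooth : ∀ᶠ x in L, ContDiffAt ℝ 1 (f x.1) x.2
  value : (fun x => f x.1 x.2) =O[L] w
  deriv : ∀ α, (fun x => pd α (f x.1) x.2) =O[L] fun x => w x * derWeight α x

variable {L : Filter (ι × (ℝ × E4))} {w w' : ι × (ℝ × E4) → ℝ} {f g : ι → ℝ × E4 → ℝ}

namespace IsSymbol

lemma differentiable (hf : IsSymbol L w f) : ∀ᶠ x in L, DifferentiableAt ℝ (f x.1) x.2 :=
  hf.smooth.mono fun _ h => h.differentiableAt (by norm_num)

lemma mono (hf : IsSymbol L w f) (h : w =O[L] w') : IsSymbol L w' f :=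
  ⟨hf.smooth, hf.value.trans h, fun α => (hf.deriv α).trans (h.mul (isBigO_refl _ _))⟩

lemma congr (hf : IsSymbol L w f) (h : ∀ᶠ x in L, f x.1 =ᶠ[nhds x.2] g x.1) : IsSymbol L w g where
  smooth := by
    filter_upwards [h, hf.smooth] with x h1 h2 using h2.congr_of_eventuallyEq h1.symm
  value := hf.value.congr' (h.mono fun x hx => hx.eq_of_nhds) EventuallyEq.rfl
  deriv α := (hf.deriv α).congr' (h.mono fun x hx => pd_congr hx) EventuallyEq.rfl

lemma add (hf : IsSymbol L w f) (hg : IsSymbol L w g) :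
    IsSymbol L w fun i q => f i q + g i q where
  smooth := by filter_upwards [hf.smooth, hg.smooth] with x h1 h2 using h1.add h2
  value := hf.value.add hg.value
  deriv α := by
    refine ((hf.deriv α).add (hg.deriv α)).congr' ?_ EventuallyEq.rfl
    filter_upwards [hf.differentiable, hg.differentiable] with x h1 h2 using (pd_add h1 h2).symm

lemma neg (hf : IsSymbol L w f) : IsSymbol L w fun i q => - f i q where
  smooth := hf.smooth.mono fun _ h => h.neg
  value := hf.value.neg_left
  deriv α := by simpa only [pd_neg] using (hf.deriv α).neg_left

lemma sub (hf : IsSymbol L w f) (hg : IsSymbol L w g) :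
    IsSymbol L w fun i q => f i q - g i q := by
  simpa only [sub_eq_add_neg] using hf.add hg.neg

lemma mul (hf : IsSymbol L w f) (hg : IsSymbol L w' g) :
    IsSymbol L (fun x => w x * w' x) fun i q => f i q * g i q where
  smooth := by filter_upwards [hf.smooth, hg.smooth] with x h1 h2 using h1.mul h2
  value := hf.value.mul hg.value
  deriv α := by
    have h1 : (fun x => pd α (f x.1) x.2 * g x.1 x.2) =O[L]
        fun x => w x * w' x * derWeight α x :=
      ((hf.deriv α).mul hg.value).congr_right fun x => by ring
    have h2 : (fun x => f x.1 x.2 * pd α (g x.1) x.2) =O[L]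
        fun x => w x * w' x * derWeight α x :=
      (hf.value.mul (hg.deriv α)).congr_right fun x => by ring
    refine (h1.add h2).congr' ?_ EventuallyEq.rfl
    filter_upwards [hf.differentiable, hg.differentiable] with x h1 h2 using (pd_mul h1 h2).symm

lemma const (c : ℝ) : IsSymbol L (fun _ => 1) fun _ _ => c where
  smooth := Eventually.of_forall fun _ => contDiffAt_const
  value := isBigO_const_const c one_ne_zero L
  deriv α := by simpa only [pd_const] using isBigO_zero _ _

lemma zero : IsSymbol L w fun _ _ => 0 where
  smooth := Eventually.of_forall fun _ => contDiffAt_const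
  value := isBigO_zero _ _
  deriv α := by simpa only [pd_const] using isBigO_zero _ _

lemma const_mul (hf : IsSymbol L w f) (c : ℝ) : IsSymbol L w fun i q => c * f i q := by
  simpa only [one_mul] using (const (L := L) c).mul hf

lemma sum {κ : Type*} {s : Finset κ} {F : κ → ι → ℝ × E4 → ℝ}
    (h : ∀ k ∈ s, IsSymbol L w (F k)) : IsSymbol L w fun i q => ∑ k ∈ s, F k i q := by
  classical
  induction s using Finset.induction_on with
  | empty => simpa only [Finset.sum_empty] using zero
  | insert a s ha ih =>
    simp only [Finset.sum_insert ha]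
    exact (h a (Finset.mem_insert_self a s)).add
      (ih fun k hk => h k (Finset.mem_insert_of_mem hk))

lemma mul_one_right (hf : IsSymbol L w f) (hg : IsSymbol L (fun _ => 1) g) :
    IsSymbol L w fun i q => f i q * g i q := by
  simpa only [mul_one] using hf.mul hg

lemma one_mul_left (hf : IsSymbol L (fun _ => 1) f) (hg : IsSymbol L w g) :
    IsSymbol L w fun i q => f i q * g i q := by
  simpa only [one_mul] using hf.mul hg

/-- A smooth function of a bounded symbol that converges is a bounded symbol. -/
lemma comp {ψ : ℝ → ℝ} {c : ℝ} (hψ : ContDiffAt ℝ 1 ψ c) (hf : IsSymbol L (fun _ => 1) f)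
    (hc : Tendsto (fun x : ι × (ℝ × E4) => f x.1 x.2) L (nhds c)) :
    IsSymbol L (fun _ => 1) fun i q => ψ (f i q) where
  smooth := by
    filter_upwards [hf.smooth, hc.eventually (hψ.eventually (by simp))] with x h1 h2
    exact h2.comp x.2 h1
  value := (hψ.continuousAt.tendsto.comp hc).isBigO_one ℝ
  deriv α := by
    have hd : ContinuousAt (_root_.deriv ψ) c := by
      have h0 : ContDiffAt ℝ 0 (fderiv ℝ ψ) c := hψ.fderiv_right (m := 0) (by norm_num)
      have := (h0.clm_apply (contDiffAt_const (c := (1 : ℝ)))).continuousAt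
      simpa only [fderiv_apply_one_eq_deriv] using this
    have h1 : (fun x : ι × (ℝ × E4) => _root_.deriv ψ (f x.1 x.2)) =O[L] fun _ => (1 : ℝ) :=
      (hd.tendsto.comp hc).isBigO_one ℝ
    refine ((h1.mul (hf.deriv α)).congr_right fun x => one_mul _).congr' ?_ EventuallyEq.rfl
    filter_upwards [hf.differentiable, hc.eventually (hψ.eventually (by simp))] with x h2 h3
    exact (pd_comp (h3.differentiableAt (by norm_num)) h2).symm

lemma inv {c : ℝ} (hc : c ≠ 0) (hf : IsSymbol L (fun _ => 1) f)
    (h : Tendsto (fun x : ι × (ℝ × E4) => f x.1 x.2) L (nhds c)) :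
    IsSymbol L (fun _ => 1) fun i q => (f i q)⁻¹ :=
  comp (contDiffAt_id.inv hc) hf h

end IsSymbol

/-- The radius tends to infinity along the filter. -/
def RadiusToInfinity (L : Filter (ι × (ℝ × E4))) : Prop :=
  Tendsto (fun x : ι × (ℝ × E4) => ‖x.2.2‖) L atTop

lemma RadiusToInfinity.eventually_one_le (hL : RadiusToInfinity L) : ∀ᶠ x in L, 1 ≤ ‖x.2.2‖ :=
  hL.eventually_ge_atTop 1

lemma RadiusToInfinity.eventually_ne (hL : RadiusToInfinity L) : ∀ᶠ x in L, x.2.2 ≠ 0 :=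
  hL.eventually_one_le.mono fun x hx => norm_pos_iff.1 (by linarith)

lemma RadiusToInfinity.tendsto_inv (hL : RadiusToInfinity L) :
    Tendsto (fun x : ι × (ℝ × E4) => ‖x.2.2‖⁻¹) L (nhds 0) :=
  tendsto_inv_atTop_zero.comp hL

lemma RadiusToInfinity.inv_isBigO_one (hL : RadiusToInfinity L) :
    (fun x : ι × (ℝ × E4) => ‖x.2.2‖⁻¹) =O[L] fun _ => (1 : ℝ) :=
  hL.tendsto_inv.isBigO_one ℝ

lemma isSymbol_coord (hL : RadiusToInfinity L) (j : Fin 4) :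
    IsSymbol L (fun x => ‖x.2.2‖) fun _ q => q.2 j where
  smooth := Eventually.of_forall fun _ => (contDiff_coord j).contDiffAt
  value := IsBigO.of_bound 1 <| Eventually.of_forall fun x => by
    simpa using abs_coord_le x.2.2 j
  deriv α := by
    refine Fin.cases ?_ (fun k => ?_) α
    · simpa only [pd_zero_coord] using isBigO_zero _ _
    · refine IsBigO.of_bound 1 ?_
      filter_upwards [hL.eventually_one_le] with x hx
      rw [pd_succ_coord, derWeight_succ, mul_inv_cancel₀ (by linarith)]
      split_ifs <;> simp

lemma le_bracket (x : ℝ) : x ≤ bracket x := by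
  refine le_trans (le_abs_self x) (abs_le_of_sq_le_sq' ?_ (bracket_pos x).le).2 |>.trans le_rfl
  rw [bracket_sq, sq_abs]; linarith

lemma bracket_inv_le {r : ℝ} (hr : 0 < r) : (bracket r)⁻¹ ≤ r⁻¹ :=
  inv_anti₀ hr (le_bracket r)

lemma isSymbol_bracket_inv (hL : RadiusToInfinity L) :
    IsSymbol L (fun x => ‖x.2.2‖⁻¹) fun _ q => (bracket ‖q.2‖)⁻¹ where
  smooth := by
    filter_upwards [hL.eventually_ne] with x hx
    exact (contDiffAt_bracket_norm hx).inv (bracket_pos _).ne'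
  value := by
    refine IsBigO.of_bound 1 ?_
    filter_upwards [hL.eventually_one_le] with x hx
    have := bracket_inv_le (r := ‖x.2.2‖) (by linarith)
    rw [Real.norm_of_nonneg (inv_nonneg.2 (bracket_pos _).le),
      Real.norm_of_nonneg (inv_nonneg.2 (norm_nonneg _)), one_mul]
    exact this
  deriv α := by
    refine Fin.cases ?_ (fun k => ?_) α
    · refine (isBigO_zero (fun x : ι × (ℝ × E4) => ‖x.2.2‖⁻¹ * derWeight 0 x) L).congr' ?_
        EventuallyEq.rfl
      filter_upwards [hL.eventually_ne] with x hx
      exact (pd_zero_radial (f := fun r => (bracket r)⁻¹) hx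
        ((hasDerivAt_bracket _).differentiableAt.fun_inv (bracket_pos _).ne')).symm
    · refine IsBigO.of_bound 1 ?_
      filter_upwards [hL.eventually_one_le, hL.eventually_ne] with x hx hx'
      have hr : 0 < ‖x.2.2‖ := by linarith
      have hb := bracket_inv_le hr
      have hb0 : 0 < (bracket ‖x.2.2‖)⁻¹ := inv_pos.2 (bracket_pos _)
      rw [pd_succ_bracket_inv hx' k, derWeight_succ, div_eq_mul_inv, ← inv_pow, norm_neg,
        Real.norm_eq_abs, abs_mul, abs_of_pos (pow_pos hb0 3), one_mul,
        Real.norm_of_nonneg (by positivity)]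
      have h1 : |x.2.2 k| * (bracket ‖x.2.2‖)⁻¹ ≤ 1 := by
        rw [← div_eq_mul_inv, div_le_one (bracket_pos _)]
        exact (abs_coord_le _ _).trans (le_bracket _)
      calc |x.2.2 k| * (bracket ‖x.2.2‖)⁻¹ ^ 3
          = |x.2.2 k| * (bracket ‖x.2.2‖)⁻¹ * ((bracket ‖x.2.2‖)⁻¹ * (bracket ‖x.2.2‖)⁻¹) := by ring
        _ ≤ 1 * (‖x.2.2‖⁻¹ * ‖x.2.2‖⁻¹) := by gcongr
        _ = _ := one_mul _

lemma RadiusToInfinity.mul_inv_isBigO (hL : RadiusToInfinity L) :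
    (fun x : ι × (ℝ × E4) => ‖x.2.2‖ * ‖x.2.2‖⁻¹) =O[L] fun _ => (1 : ℝ) := by
  refine IsBigO.of_bound 1 ?_
  filter_upwards [hL.eventually_one_le] with x hx
  rw [mul_inv_cancel₀ (by linarith)]; simp

/-- The components `y_j / ⟨r⟩` of the gradient of `⟨r⟩`. -/
lemma isSymbol_coord_mul_bracket_inv (hL : RadiusToInfinity L) (j : Fin 4) :
    IsSymbol L (fun _ => 1) fun _ q => q.2 j * (bracket ‖q.2‖)⁻¹ :=
  ((isSymbol_coord hL j).mul (isSymbol_bracket_inv hL)).mono hL.mul_inv_isBigO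

lemma isSymbol_bracket (hL : RadiusToInfinity L) :
    IsSymbol L (fun x => ‖x.2.2‖) fun _ q => bracket ‖q.2‖ := by
  have h1 : IsSymbol L (fun x => ‖x.2.2‖) fun _ q =>
      (∑ j : Fin 4, q.2 j * (q.2 j * (bracket ‖q.2‖)⁻¹)) + (bracket ‖q.2‖)⁻¹ := by
    refine (IsSymbol.sum fun j _ => (isSymbol_coord hL j).mul_one_right
      (isSymbol_coord_mul_bracket_inv hL j)).add ((isSymbol_bracket_inv hL).mono ?_)
    refine IsBigO.of_bound 1 ?_
    filter_upwards [hL.eventually_one_le] with x hx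
    rw [one_mul, norm_inv, norm_norm]
    exact (inv_le_one_of_one_le₀ hx).trans hx
  refine h1.congr (Eventually.of_forall fun x => Eventually.of_forall fun q => ?_)
  have hb := bracket_pos ‖q.2‖
  have h2 := bracket_sq ‖q.2‖
  have h3 := norm_sq_eq_sum q.2
  have h4 : (∑ j : Fin 4, q.2 j * (q.2 j * (bracket ‖q.2‖)⁻¹))
      = (∑ j, q.2 j ^ 2) * (bracket ‖q.2‖)⁻¹ := by
    rw [Finset.sum_mul]; exact Finset.sum_congr rfl fun _ _ => by ring
  beta_reduce
  rw [h4, ← h3]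
  field_simp
  linarith

end symbols

/-! ### The moving frame -/

section frame

open Filter Asymptotics

/-- A motion `(ξ, ℓ)` of the parameters on `[0, σ_f]` for which `ℓ`, `ξ̇ - ℓ` and their relevant
derivatives are at most `A ε`. -/
structure Motion (A : ℝ) where
  ε : ℝ
  σf : ℝ
  xi : ℝ → E4
  l : ℝ → E4
  pos : 0 < ε
  smooth_xi : ContDiff ℝ ∞ xi
  smooth_l : ContDiff ℝ ∞ l
  bound_l : ∀ σ ∈ Set.Icc 0 σf, ‖l σ‖ ≤ A * ε
  bound_dl : ∀ σ ∈ Set.Icc 0 σf, ‖deriv l σ‖ ≤ A * ε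
  bound_ddl : ∀ σ ∈ Set.Icc 0 σf, ‖deriv (deriv l) σ‖ ≤ A * ε
  bound_dxi : ∀ σ ∈ Set.Icc 0 σf, ‖deriv xi σ - l σ‖ ≤ A * ε
  bound_ddxi : ∀ σ ∈ Set.Icc 0 σf, ‖deriv (fun s => deriv xi s - l s) σ‖ ≤ A * ε

variable {A Rf : ℝ}

/-- Small motions, and points far out with time in `[0, σ_f]`. -/
def smallFar (A : ℝ) : Filter (Motion A × (ℝ × E4)) :=
  comap (fun x => x.1.ε) (nhds 0) ⊓ comap (fun x => ‖x.2.2‖) atTop ⊓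
    𝓟 {x | x.2.1 ∈ Set.Icc 0 x.1.σf}

lemma radiusToInfinity_smallFar : RadiusToInfinity (smallFar A) :=
  tendsto_comap.mono_left (inf_le_left.trans inf_le_right)

lemma tendsto_size : Tendsto (fun x : Motion A × (ℝ × E4) => x.1.ε) (smallFar A) (nhds 0) :=
  tendsto_comap.mono_left (inf_le_left.trans inf_le_left)

lemma eventually_time_mem : ∀ᶠ x in smallFar A, x.2.1 ∈ Set.Icc 0 x.1.σf :=
  (inf_le_right : smallFar A ≤ _) (mem_principal_self _)

/-- The size `ε + 1/r` of the perturbation. -/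
def smallness (x : Motion A × (ℝ × E4)) : ℝ := x.1.ε + ‖x.2.2‖⁻¹

lemma size_isBigO_smallness :
    (fun x : Motion A × (ℝ × E4) => x.1.ε) =O[smallFar A] smallness :=
  IsBigO.of_bound 1 <| Eventually.of_forall fun x => by
    have := x.1.pos
    rw [one_mul, Real.norm_of_nonneg this.le, smallness, Real.norm_of_nonneg (by positivity)]
    exact le_add_of_nonneg_right (by positivity)

lemma inv_isBigO_smallness :
    (fun x : Motion A × (ℝ × E4) => ‖x.2.2‖⁻¹) =O[smallFar A] smallness :=
  IsBigO.of_bound 1 <| Eventually.of_forall fun x => by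
    have := x.1.pos
    rw [one_mul, Real.norm_of_nonneg (by positivity), smallness,
      Real.norm_of_nonneg (by positivity)]
    exact le_add_of_nonneg_left this.le

lemma size_isBigO_one : (fun x : Motion A × (ℝ × E4) => x.1.ε) =O[smallFar A] fun _ => (1 : ℝ) :=
  tendsto_size.isBigO_one ℝ

lemma inv_isBigO_one :
    (fun x : Motion A × (ℝ × E4) => ‖x.2.2‖⁻¹) =O[smallFar A] fun _ => (1 : ℝ) :=
  radiusToInfinity_smallFar.inv_isBigO_one

lemma pd_zero_fst {f : ℝ → ℝ} {q : ℝ × E4} (hf : DifferentiableAt ℝ f q.1) :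
    pd 0 (fun x => f x.1) q = deriv f q.1 := by
  have : HasFDerivAt (fun x : ℝ × E4 => f x.1) _ q :=
    hf.hasDerivAt.hasFDerivAt.comp q (hasFDerivAt_fst (p := q))
  simp [pd, this.fderiv, coordDir]

lemma pd_succ_fst {f : ℝ → ℝ} {q : ℝ × E4} (j : Fin 4) : pd j.succ (fun x => f x.1) q = 0 := by
  by_cases h : DifferentiableAt ℝ (fun x : ℝ × E4 => f x.1) q
  · have h1 : HasDerivAt (fun t : ℝ => q + t • (coordDir j.succ : ℝ × E4)) (coordDir j.succ) 0 := by
      simpa using ((hasDerivAt_id (0 : ℝ)).smul_const (coordDir j.succ)).const_add q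
    have h2 := HasFDerivAt.comp_hasDerivAt (0 : ℝ)
      (f := fun t : ℝ => q + t • (coordDir j.succ : ℝ × E4)) (by simpa using h.hasFDerivAt) h1
    have h3 : ((fun x : ℝ × E4 => f x.1) ∘ fun t : ℝ => q + t • (coordDir j.succ : ℝ × E4))
        = fun _ => f q.1 := by funext t; simp [coordDir]
    rw [h3] at h2
    exact h2.unique (hasDerivAt_const _ _)
  · simp [pd, fderiv_zero_of_not_differentiableAt h]

/-- Functions of `σ` that are `O(ε)` in `C¹`. -/
lemma isSymbol_of_time {f : Motion A → ℝ → ℝ} (hf : ∀ d, ContDiff ℝ 1 (f d))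
    (h0 : ∀ d, ∀ σ ∈ Set.Icc 0 d.σf, |f d σ| ≤ A * d.ε)
    (h1 : ∀ d, ∀ σ ∈ Set.Icc 0 d.σf, |deriv (f d) σ| ≤ A * d.ε) :
    IsSymbol (smallFar A) (fun x => x.1.ε) fun d q => f d q.1 where
  smooth := Eventually.of_forall fun x =>
    ((hf x.1).contDiffAt (x := x.2.1)).comp x.2 contDiffAt_fst
  value := by
    refine IsBigO.of_bound A ?_
    filter_upwards [eventually_time_mem] with x hx
    simpa [abs_of_pos x.1.pos] using h0 x.1 x.2.1 hx
  deriv α := by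
    have hd : ∀ d σ, DifferentiableAt ℝ (f d) σ := fun d => (hf d).differentiable (by norm_num)
    refine Fin.cases ?_ (fun j => ?_) α
    · refine IsBigO.of_bound A ?_
      filter_upwards [eventually_time_mem] with x hx
      rw [pd_zero_fst (hd _ _)]
      simpa [abs_of_pos x.1.pos] using h1 x.1 x.2.1 hx
    · simpa only [pd_succ_fst] using isBigO_zero _ _

lemma deriv_apply_coord {f : ℝ → E4} {σ : ℝ} (hf : DifferentiableAt ℝ f σ) (j : Fin 4) :
    deriv (fun s => f s j) σ = deriv f σ j :=
  ((EuclideanSpace.proj j : E4 →L[ℝ] ℝ).hasFDerivAt.comp_hasDerivAt σ hf.hasDerivAt).deriv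

/-- The components of vector-valued functions of `σ` that are `O(ε)` in `C¹`. -/
lemma isSymbol_of_time_coord {f : Motion A → ℝ → E4} (hf : ∀ d, ContDiff ℝ 1 (f d))
    (h0 : ∀ d, ∀ σ ∈ Set.Icc 0 d.σf, ‖f d σ‖ ≤ A * d.ε)
    (h1 : ∀ d, ∀ σ ∈ Set.Icc 0 d.σf, ‖deriv (f d) σ‖ ≤ A * d.ε) (j : Fin 4) :
    IsSymbol (smallFar A) (fun x => x.1.ε) fun d q => f d q.1 j := by
  refine isSymbol_of_time (f := fun d σ => f d σ j)
    (fun d => (EuclideanSpace.proj j : E4 →L[ℝ] ℝ).contDiff.comp (hf d))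
    (fun d σ h => (abs_coord_le _ _).trans (h0 d σ h)) fun d σ h => ?_
  rw [deriv_apply_coord ((hf d).differentiable (by norm_num) σ)]
  exact (abs_coord_le _ _).trans (h1 d σ h)

lemma Motion.contDiff_deriv_l (d : Motion A) {n : ℕ∞} : ContDiff ℝ n (deriv d.l) :=
  ((contDiff_infty_iff_deriv.1 d.smooth_l).2).of_le (by exact_mod_cast le_top)

lemma Motion.contDiff_deriv_xi (d : Motion A) {n : ℕ∞} : ContDiff ℝ n (deriv d.xi) :=
  ((contDiff_infty_iff_deriv.1 d.smooth_xi).2).of_le (by exact_mod_cast le_top)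

lemma Motion.differentiable_l (d : Motion A) : Differentiable ℝ d.l :=
  d.smooth_l.differentiable (by simp)

lemma Motion.differentiable_xi (d : Motion A) : Differentiable ℝ d.xi :=
  d.smooth_xi.differentiable (by simp)

lemma isSymbol_l (j : Fin 4) : IsSymbol (smallFar A) (fun x => x.1.ε) fun d q => d.l q.1 j :=
  isSymbol_of_time_coord (fun d => d.smooth_l.of_le (by exact_mod_cast le_top)) (fun d => d.bound_l)
    (fun d => d.bound_dl) j

lemma isSymbol_deriv_l (j : Fin 4) :
    IsSymbol (smallFar A) (fun x => x.1.ε) fun d q => deriv d.l q.1 j :=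
  isSymbol_of_time_coord (fun d => d.contDiff_deriv_l (n := 1)) (fun d => d.bound_dl)
    (fun d => d.bound_ddl) j

lemma isSymbol_deriv_xi (j : Fin 4) :
    IsSymbol (smallFar A) (fun x => x.1.ε) fun d q => deriv d.xi q.1 j := by
  have h := (isSymbol_of_time_coord (A := A) (f := fun d σ => deriv d.xi σ - d.l σ)
    (fun d => (d.contDiff_deriv_xi (n := 1)).sub (d.smooth_l.of_le (by exact_mod_cast le_top)))
    (fun d => d.bound_dxi) (fun d => d.bound_ddxi) j).add (isSymbol_l j)
  simpa using h

lemma IsSymbol.of_size {f : Motion A → ℝ × E4 → ℝ}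
    (hf : IsSymbol (smallFar A) (fun x => x.1.ε) f) : IsSymbol (smallFar A) (fun _ => 1) f :=
  hf.mono size_isBigO_one

/-- The function `t ↦ (1 - t)^{-1/2}`, so that `γ(v)` is its value at `|v|²`. -/
lemma contDiffAt_invSqrt {n : WithTop ℕ∞} : ContDiffAt ℝ n (fun t : ℝ => 1 / √(1 - t)) 0 := by
  have h : ContDiffAt ℝ n (fun t : ℝ => √(1 - t)) 0 :=
    (contDiffAt_const.sub contDiffAt_id).sqrt (by norm_num)
  exact contDiffAt_const.div h (by norm_num)

lemma isSymbol_norm_sq_l :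
    IsSymbol (smallFar A) (fun x => x.1.ε) fun d q => ‖d.l q.1‖ ^ 2 := by
  simp only [norm_sq_eq_sum]
  simp only [pow_two]
  exact IsSymbol.sum fun j _ => (isSymbol_l j).mul_one_right (isSymbol_l j).of_size

lemma IsSymbol.tendsto_zero_of_size {f : Motion A → ℝ × E4 → ℝ}
    (hf : IsSymbol (smallFar A) (fun x => x.1.ε) f) :
    Tendsto (fun x : Motion A × (ℝ × E4) => f x.1 x.2) (smallFar A) (nhds 0) :=
  hf.value.trans_tendsto tendsto_size

lemma isSymbol_lorentz :
    IsSymbol (smallFar A) (fun _ => 1) fun d q => lorentz (d.l q.1) :=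
  IsSymbol.comp (ψ := fun t => 1 / √(1 - t)) contDiffAt_invSqrt isSymbol_norm_sq_l.of_size
    isSymbol_norm_sq_l.tendsto_zero_of_size

lemma tendsto_lorentz :
    Tendsto (fun x : Motion A × (ℝ × E4) => lorentz (x.1.l x.2.1)) (smallFar A) (nhds 1) := by
  have h := (contDiffAt_invSqrt (n := 1)).continuousAt.tendsto.comp
    (isSymbol_norm_sq_l (A := A)).tendsto_zero_of_size
  simpa [lorentz, Function.comp_def] using h

lemma eventually_norm_l_lt : ∀ᶠ x in smallFar A, ‖x.1.l x.2.1‖ < 1 := by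
  filter_upwards [(isSymbol_norm_sq_l (A := A)).tendsto_zero_of_size.eventually_lt_const
    one_pos] with x hx
  nlinarith [norm_nonneg (x.1.l x.2.1)]

lemma hasDerivAt_lorentz {l : ℝ → E4} {σ : ℝ} (hl : DifferentiableAt ℝ l σ) (h : ‖l σ‖ < 1) :
    HasDerivAt (fun s => lorentz (l s))
      (lorentz (l σ) ^ 3 * ∑ j, l σ j * deriv l σ j) σ := by
  have h0 : 0 < 1 - ‖l σ‖ ^ 2 := by nlinarith [norm_nonneg (l σ)]
  have h1 : HasDerivAt (fun s => 1 - ‖l s‖ ^ 2) _ σ := (hl.hasDerivAt.norm_sq).const_sub 1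
  have h2 : HasDerivAt (fun s => √(1 - ‖l s‖ ^ 2)) _ σ := h1.sqrt h0.ne'
  have h3 := h2.fun_inv (Real.sqrt_pos.2 h0).ne'
  have h4 : (fun s => lorentz (l s)) = fun s => (√(1 - ‖l s‖ ^ 2))⁻¹ := by
    funext s; simp [lorentz]
  rw [h4]
  refine h3.congr_deriv ?_
  have h5 : inner ℝ (l σ) (deriv l σ) = ∑ j, l σ j * deriv l σ j := by
    simp [PiLp.inner_apply, mul_comm]
  rw [h5]
  have := (Real.sqrt_pos.2 h0).ne'
  simp only [lorentz]
  field_simp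

end frame

section frame

open Filter Asymptotics

variable {A Rf : ℝ}

lemma Motion.eventually_norm_l_lt (d : Motion A) {q : ℝ × E4} (h : ‖d.l q.1‖ < 1) :
    ∀ᶠ q' in nhds q, ‖d.l q'.1‖ < 1 := by
  have : ContinuousAt (fun q' : ℝ × E4 => ‖d.l q'.1‖) q :=
    (d.smooth_l.continuous.comp continuous_fst).norm.continuousAt
  exact this.eventually_lt_const h

/-- The derivative of `γ(ℓ(σ))`, as a function of `(σ, y)`. -/
def lorentzRate (d : Motion A) (q : ℝ × E4) : ℝ :=
  lorentz (d.l q.1) ^ 3 * ∑ j, d.l q.1 j * deriv d.l q.1 j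

lemma isSymbol_lorentzRate :
    IsSymbol (smallFar A) (fun x => x.1.ε) lorentzRate := by
  have h3 : IsSymbol (smallFar A) (fun _ => 1) fun d q => lorentz (d.l q.1) ^ 3 := by
    simpa only [pow_succ, pow_zero, one_mul] using
      (isSymbol_lorentz.mul_one_right isSymbol_lorentz).mul_one_right (isSymbol_lorentz (A := A))
  exact h3.one_mul_left
    (IsSymbol.sum fun j _ => (isSymbol_l j).mul_one_right (isSymbol_deriv_l j).of_size)

lemma Motion.hasDerivAt_lorentz (d : Motion A) {q : ℝ × E4} (h : ‖d.l q.1‖ < 1) :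
    HasDerivAt (fun s => lorentz (d.l s)) (lorentzRate d q) q.1 :=
  CatenoidRp.hasDerivAt_lorentz (d.differentiable_l q.1) h

lemma Motion.hasDerivAt_retTime (d : Motion A) {q : ℝ × E4} (h : ‖d.l q.1‖ < 1) :
    HasDerivAt (retTime Rf d.l) (1 - lorentzRate d q * Rf) q.1 :=
  (hasDerivAt_id q.1).sub ((d.hasDerivAt_lorentz h).mul_const Rf)

lemma Motion.hasDerivAt_center (d : Motion A) {q : ℝ × E4} (h : ‖d.l q.1‖ < 1) :
    HasDerivAt (center Rf d.xi d.l) (deriv d.xi q.1 - ((lorentz (d.l q.1) * Rf) • deriv d.l q.1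
      + (lorentzRate d q * Rf) • d.l q.1)) q.1 :=
  (d.differentiable_xi q.1).hasDerivAt.sub
    (((d.hasDerivAt_lorentz h).mul_const Rf).smul (d.differentiable_l q.1).hasDerivAt)

lemma isSymbol_deriv_retTime_sub_one :
    IsSymbol (smallFar A) (fun x => x.1.ε) fun d q => deriv (retTime Rf d.l) q.1 - 1 := by
  refine (isSymbol_lorentzRate.const_mul (-Rf)).congr ?_
  filter_upwards [eventually_norm_l_lt] with x hx
  filter_upwards [x.1.eventually_norm_l_lt hx] with q hq
  rw [(x.1.hasDerivAt_retTime hq).deriv]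
  ring

lemma isSymbol_deriv_center (j : Fin 4) :
    IsSymbol (smallFar A) (fun x => x.1.ε) fun d q => deriv (center Rf d.xi d.l) q.1 j := by
  refine ((isSymbol_deriv_xi j).sub ((isSymbol_lorentz.one_mul_left (isSymbol_deriv_l j)).const_mul
    Rf |>.add ((isSymbol_lorentzRate.mul_one_right (isSymbol_l j).of_size).const_mul Rf))).congr ?_
  filter_upwards [eventually_norm_l_lt] with x hx
  filter_upwards [x.1.eventually_norm_l_lt hx] with q hq
  rw [(x.1.hasDerivAt_center hq).deriv]
  simp only [PiLp.sub_apply, PiLp.add_apply, PiLp.smul_apply, smul_eq_mul]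
  ring

/-- The Jacobian `Λ = τ_σ - (y / ⟨r⟩) · η_σ` of the chart. -/
def jac (Rf : ℝ) (xi l : ℝ → E4) (q : ℝ × E4) : ℝ :=
  deriv (retTime Rf l) q.1
    - ∑ j, q.2 j * (bracket ‖q.2‖)⁻¹ * deriv (center Rf xi l) q.1 j

/-- The components `V_μ^α` of the Cartesian coordinate fields `∂/∂X^μ` in the coordinates
`(σ, y)`: `V_0 = Λ⁻¹ (1, -η_σ)` and `V_j = e_j - (y_j / ⟨r⟩) V_0`. -/
def frame (Rf : ℝ) (xi l : ℝ → E4) (μ α : Fin 5) (q : ℝ × E4) : ℝ :=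
  let v : Fin 5 → ℝ := Fin.cons (jac Rf xi l q)⁻¹
    (fun k => -((jac Rf xi l q)⁻¹ * deriv (center Rf xi l) q.1 k))
  Fin.cases (motive := fun _ => ℝ) (v α)
    (fun j => (if α = j.succ then 1 else 0) - q.2 j * (bracket ‖q.2‖)⁻¹ * v α) μ

@[simp] lemma frame_zero_zero {xi l : ℝ → E4} {q : ℝ × E4} :
    frame Rf xi l 0 0 q = (jac Rf xi l q)⁻¹ := rfl

@[simp] lemma frame_zero_succ {xi l : ℝ → E4} {q : ℝ × E4} (k : Fin 4) :
    frame Rf xi l 0 k.succ q = -((jac Rf xi l q)⁻¹ * deriv (center Rf xi l) q.1 k) := rfl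

lemma frame_succ {xi l : ℝ → E4} {q : ℝ × E4} (j : Fin 4) (α : Fin 5) :
    frame Rf xi l j.succ α q
      = (if α = j.succ then 1 else 0) - q.2 j * (bracket ‖q.2‖)⁻¹ * frame Rf xi l 0 α q := rfl

lemma isSymbol_jac_sub_one :
    IsSymbol (smallFar A) (fun x => x.1.ε) fun d q => jac Rf d.xi d.l q - 1 := by
  refine ((isSymbol_deriv_retTime_sub_one (Rf := Rf)).sub
    (IsSymbol.sum (s := Finset.univ) fun j _ =>
      (isSymbol_coord_mul_bracket_inv radiusToInfinity_smallFar j).one_mul_left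
        (isSymbol_deriv_center (Rf := Rf) j))).congr ?_
  exact Eventually.of_forall fun x => Eventually.of_forall fun q => by simp only [jac]; ring

lemma isSymbol_jac : IsSymbol (smallFar A) (fun _ => 1) fun d q => jac Rf d.xi d.l q := by
  simpa using isSymbol_jac_sub_one.of_size.add (IsSymbol.const (L := smallFar A) 1)

lemma tendsto_jac :
    Tendsto (fun x : Motion A × (ℝ × E4) => jac Rf x.1.xi x.1.l x.2) (smallFar A) (nhds 1) := by
  simpa using (isSymbol_jac_sub_one (A := A) (Rf := Rf)).tendsto_zero_of_size.add_const 1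

lemma isSymbol_jac_inv : IsSymbol (smallFar A) (fun _ => 1) fun d q => (jac Rf d.xi d.l q)⁻¹ :=
  isSymbol_jac.inv one_ne_zero tendsto_jac

lemma isSymbol_frame_zero_succ (k : Fin 4) :
    IsSymbol (smallFar A) (fun x => x.1.ε) fun d q => frame Rf d.xi d.l 0 k.succ q :=
  (isSymbol_jac_inv.one_mul_left (isSymbol_deriv_center k)).neg

lemma isSymbol_frame (μ α : Fin 5) :
    IsSymbol (smallFar A) (fun _ => 1) fun d q => frame Rf d.xi d.l μ α q := by
  have h0 : IsSymbol (smallFar A) (fun _ => 1) fun d q => frame Rf d.xi d.l 0 α q :=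
    Fin.cases isSymbol_jac_inv (fun k => (isSymbol_frame_zero_succ k).of_size) α
  refine Fin.cases h0 (fun j => ?_) μ
  simp only [frame_succ]
  exact (IsSymbol.const _).sub
    ((isSymbol_coord_mul_bracket_inv radiusToInfinity_smallFar j).one_mul_left h0)

/-- The derivative of the chart `(σ, y) ↦ X` sends `∂_σ` to `(τ_σ, η_σ)` and `e_j` to
`(y_j / ⟨r⟩, e_j)`. -/
lemma hasFDerivAt_chart {xi l : ℝ → E4} {q : ℝ × E4} (hτ : DifferentiableAt ℝ (retTime Rf l) q.1)
    (hη : DifferentiableAt ℝ (center Rf xi l) q.1) (hq : q.2 ≠ 0) :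
    ∃ T : ℝ × E4 →L[ℝ] ℝ × E4, HasFDerivAt (chart Rf xi l) T q ∧ ∀ v,
      T v = (deriv (retTime Rf l) q.1 * v.1 + (bracket ‖q.2‖)⁻¹ * inner ℝ q.2 v.2,
        v.1 • deriv (center Rf xi l) q.1 + v.2) := by
  have h1 : HasFDerivAt (fun x : ℝ × E4 => retTime Rf l x.1) _ q :=
    hτ.hasDerivAt.hasFDerivAt.comp q hasFDerivAt_fst
  have h2 : HasFDerivAt (fun x : ℝ × E4 => center Rf xi l x.1) _ q :=
    hη.hasDerivAt.hasFDerivAt.comp q hasFDerivAt_fst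
  have h3 : HasFDerivAt (fun x : ℝ × E4 => bracket ‖x.2‖) _ q :=
    ((contDiffAt_bracket_norm (n := 1) hq).differentiableAt (by norm_num)).hasFDerivAt
  refine ⟨_, (h1.add h3).prodMk (h2.add hasFDerivAt_snd), fun v => ?_⟩
  have h4 : fderiv ℝ (fun x : ℝ × E4 => bracket ‖x.2‖) q v
      = (bracket ‖q.2‖)⁻¹ * inner ℝ q.2 v.2 := by
    have h5 : HasFDerivAt (fun x : ℝ × E4 => 1 + ‖x.2‖ ^ 2) _ q :=
      ((hasFDerivAt_snd (𝕜 := ℝ) (p := q)).norm_sq).const_add 1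
    have h6 : HasFDerivAt (fun x : ℝ × E4 => bracket ‖x.2‖) _ q := h5.sqrt (by positivity)
    rw [h6.fderiv]
    simp [bracket]
    ring
  simp [h4]
  ring

/-- The coordinate vector fields of Minkowski space in the chart `(σ, y)`. -/
lemma dX_eq_sum_frame {xi l : ℝ → E4} {q : ℝ × E4} (hτ : DifferentiableAt ℝ (retTime Rf l) q.1)
    (hη : DifferentiableAt ℝ (center Rf xi l) q.1) (hq : q.2 ≠ 0) (hΛ : jac Rf xi l q ≠ 0)
    (μ : Fin 5) (f : ℝ × E4 → ℝ) :
    dX Rf xi l μ f q = ∑ α, frame Rf xi l μ α q * pd α f q := by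
  obtain ⟨T, hT, hTv⟩ := hasFDerivAt_chart hτ hη hq
  have hjac : ∀ s : ℝ, deriv (retTime Rf l) q.1 * s
      - (bracket ‖q.2‖)⁻¹ * (s * inner ℝ q.2 (deriv (center Rf xi l) q.1))
        = jac Rf xi l q * s := fun s => by
    have : inner ℝ q.2 (deriv (center Rf xi l) q.1)
        = ∑ j, q.2 j * deriv (center Rf xi l) q.1 j := by
      simp [PiLp.inner_apply, mul_comm]
    rw [this, jac, sub_mul, Finset.sum_mul, Finset.mul_sum, Finset.mul_sum]
    exact congrArg₂ _ rfl (Finset.sum_congr rfl fun j _ => by ring)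
  have hinj : Function.Injective (T : ℝ × E4 →ₗ[ℝ] ℝ × E4) := by
    refine (injective_iff_map_eq_zero _).2 fun v hv => ?_
    have hv' : T v = 0 := hv
    rw [hTv, Prod.mk_eq_zero] at hv'
    have h2 : v.2 = -(v.1 • deriv (center Rf xi l) q.1) := (neg_eq_of_add_eq_zero_right hv'.2).symm
    have h1 := hv'.1
    rw [h2, inner_neg_right, real_inner_smul_right, mul_neg, ← sub_eq_add_neg, hjac] at h1
    have h3 : v.1 = 0 := (mul_eq_zero.1 h1).resolve_left hΛ
    rw [h3, zero_smul, neg_zero] at h2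
    exact Prod.ext h3 h2
  set e : (ℝ × E4) ≃L[ℝ] ℝ × E4 :=
    (LinearEquiv.ofInjectiveEndo (T : ℝ × E4 →ₗ[ℝ] ℝ × E4) hinj).toContinuousLinearEquiv with he
  have heT : (e : ℝ × E4 →L[ℝ] ℝ × E4) = T := by ext v <;> rfl
  set V0 : ℝ × E4 := ((jac Rf xi l q)⁻¹, -((jac Rf xi l q)⁻¹ • deriv (center Rf xi l) q.1)) with hV0
  set V : Fin 5 → ℝ × E4 := Fin.cases V0
    (fun j => coordDir j.succ - (q.2 j * (bracket ‖q.2‖)⁻¹) • V0) with hV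
  have hT0 : T V0 = coordDir 0 := by
    rw [hTv, hV0]
    simp only [inner_neg_right, real_inner_smul_right, mul_neg, ← sub_eq_add_neg]
    rw [hjac, mul_inv_cancel₀ hΛ]
    simp [coordDir]
  have hTV : T (V μ) = coordDir μ := by
    refine Fin.cases hT0 (fun j => ?_) μ
    simp only [hV, Fin.cases_succ, map_sub, map_smul, hT0]
    rw [hTv]
    simp [coordDir, EuclideanSpace.inner_single_right, mul_comm]
  have hVf : ∀ μ, V μ = ∑ α, frame Rf xi l μ α q • coordDir α := by
    have h0 : V0 = ∑ α, frame Rf xi l 0 α q • coordDir α := by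
      rw [Fin.sum_univ_succ]
      ext k
      · simp [hV0, coordDir, Prod.fst_sum]
      · fin_cases k <;> simp [hV0, coordDir, Fin.sum_univ_succ]
    refine Fin.cases h0 fun j => ?_
    simp only [hV, Fin.cases_succ, frame_succ, sub_smul, Finset.sum_sub_distrib, ite_smul,
      one_smul, zero_smul, Finset.sum_ite_eq', Finset.mem_univ, if_true]
    rw [h0, Finset.smul_sum]
    simp only [smul_smul]
  have hinv : (fderiv ℝ (chart Rf xi l) q).inverse (coordDir μ) = V μ := by
    rw [hT.fderiv, ← heT, ContinuousLinearMap.inverse_equiv]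
    refine (e.symm_apply_eq).2 ?_
    rw [← hTV, ← heT]; rfl
  rw [dX, hinv, hVf, map_sum]
  simp only [map_smul, smul_eq_mul]
  rfl

end frame

/-! ### The catenoid profile -/

section catenoid

open Filter Asymptotics

variable {A Rf : ℝ}

lemma intervalIntegrable_catenoid {s : ℝ} (hs : 1 ≤ s) :
    IntervalIntegrable (fun t : ℝ => 1 / √(t ^ 6 - 1)) volume 1 s := by
  have h1 : IntervalIntegrable (fun t : ℝ => (t - 1) ^ (-(1 / 2) : ℝ)) volume 1 s := by
    have := (intervalIntegral.intervalIntegrable_rpow' (a := 0) (b := s - 1)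
      (r := (-(1 / 2) : ℝ)) (by norm_num)).comp_sub_right 1
    simpa using this
  refine h1.mono_fun ?_ ?_
  · exact (by fun_prop : Measurable fun t : ℝ => 1 / √(t ^ 6 - 1)).aestronglyMeasurable
  · rw [Set.uIoc_of_le hs]
    refine (ae_restrict_iff' measurableSet_Ioc).2 (Eventually.of_forall fun t ht => ?_)
    have ht1 : 0 < t - 1 := sub_pos.2 ht.1
    have ht6 : t - 1 ≤ t ^ 6 - 1 := by
      have : t ^ 1 ≤ t ^ 6 := pow_le_pow_right₀ ht.1.le (by norm_num)
      linarith
    beta_reduce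
    rw [Real.norm_of_nonneg (by positivity), Real.norm_of_nonneg (by positivity),
      Real.rpow_neg ht1.le, ← Real.sqrt_eq_rpow, one_div]
    exact inv_anti₀ (Real.sqrt_pos.2 ht1) (Real.sqrt_le_sqrt ht6)

lemma hasDerivAt_catenoidHeight {s : ℝ} (hs : 1 < s) :
    HasDerivAt catenoidHeight (1 / √(s ^ 6 - 1)) s := by
  have h6 : 0 < s ^ 6 - 1 := by
    have : (1 : ℝ) < s ^ 6 := one_lt_pow₀ hs (by norm_num)
    linarith
  refine intervalIntegral.integral_hasDerivAt_right (intervalIntegrable_catenoid hs.le) ?_ ?_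
  · exact (by fun_prop : Measurable fun t : ℝ =>
      1 / √(t ^ 6 - 1)).stronglyMeasurable.stronglyMeasurableAtFilter
  · exact continuousAt_const.div (by fun_prop) (Real.sqrt_pos.2 h6).ne'

/-- The length of the spacelike part of the boosted position vector, in terms of its time
component `γ (⟨r⟩ - ℓ · y)`. -/
lemma norm_boost_sq {v y : E4} (hv : ‖v‖ < 1) :
    ‖boostSpatial v y - (lorentz v * bracket ‖y‖) • v‖ ^ 2
      = (lorentz v * (bracket ‖y‖ - inner ℝ v y)) ^ 2 - 1 := by
  have h0 : 0 < 1 - ‖v‖ ^ 2 := by nlinarith [norm_nonneg v]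
  have hg : lorentz v ^ 2 * (1 - ‖v‖ ^ 2) = 1 := by
    rw [lorentz, div_pow, Real.sq_sqrt h0.le]
    field_simp
  have hb := bracket_sq ‖y‖
  rcases eq_or_ne v 0 with rfl | hv0
  · simp [boostSpatial, lineProj, lorentz, hb]
  have hn : ‖v‖ ^ 2 ≠ 0 := pow_ne_zero 2 (norm_ne_zero_iff.2 hv0)
  set g := lorentz v
  set b := bracket ‖y‖
  have e1 : boostSpatial v y - (g * b) • v
      = y + ((g - 1) * (inner ℝ v y / ‖v‖ ^ 2) - g * b) • v := by
    simp only [boostSpatial, lineProj, smul_smul, sub_smul, sub_mul, one_mul]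
    abel
  rw [e1, norm_add_sq_real, norm_smul, mul_pow, Real.norm_eq_abs, sq_abs, real_inner_smul_right,
    real_inner_comm v y]
  have h3 : ‖y‖ ^ 2 = b ^ 2 - 1 := by linarith
  rw [h3]
  generalize inner ℝ v y = i at *
  generalize ‖v‖ ^ 2 = n at *
  set c := (g - 1) * (i / n) - g * b with hc
  have hcn : c * n = (g - 1) * i - g * b * n := by rw [hc]; field_simp
  refine mul_left_cancel₀ hn ?_
  linear_combination (2 * i + c * n + ((g - 1) * i - g * b * n)) * hcn + (i ^ 2 - b ^ 2 * n) * hg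

/-- The derivative of the height of the catenoid as a function of the time component `z` of the
boosted position, divided by `z⁻³`, as a function of `x = 1 / z`. -/
def heightSlope (x : ℝ) : ℝ := (√((1 - x ^ 2) * ((1 - x ^ 2) ^ 3 - x ^ 6)))⁻¹

lemma contDiffAt_heightSlope {n : WithTop ℕ∞} : ContDiffAt ℝ n heightSlope 0 := by
  have h : ContDiffAt ℝ n (fun x : ℝ => (1 - x ^ 2) * ((1 - x ^ 2) ^ 3 - x ^ 6)) 0 := by fun_prop
  exact (h.sqrt (by norm_num)).inv (by norm_num)

lemma hasDerivAt_height {z : ℝ} (hz : 2 ≤ z) :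
    HasDerivAt (fun z => catenoidHeight (√(z ^ 2 - 1))) (z⁻¹ ^ 3 * heightSlope z⁻¹) z := by
  have hs : 1 < √(z ^ 2 - 1) := by
    rw [Real.lt_sqrt (by norm_num)]; nlinarith
  have h1 : HasDerivAt (fun z : ℝ => z ^ 2 - 1) (2 * z) z := by
    simpa using (hasDerivAt_pow 2 z).sub_const 1
  have h2 := (hasDerivAt_catenoidHeight hs).comp z (h1.sqrt (by nlinarith))
  refine h2.congr_deriv ?_
  have hz0 : 0 < z := by linarith
  have hs0 : 0 < z ^ 2 - 1 := by nlinarith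
  have h3 : √(z ^ 2 - 1) ^ 6 = (z ^ 2 - 1) ^ 3 := by
    rw [show (6 : ℕ) = 2 * 3 from rfl, pow_mul, Real.sq_sqrt hs0.le]
  have h4 : (1 - z⁻¹ ^ 2) * ((1 - z⁻¹ ^ 2) ^ 3 - z⁻¹ ^ 6)
      = ((z ^ 2 - 1) * ((z ^ 2 - 1) ^ 3 - 1)) / (z ^ 4) ^ 2 := by
    field_simp
  rw [heightSlope, h4, h3, Real.sqrt_div' _ (by positivity), Real.sqrt_sq (by positivity),
    Real.sqrt_mul hs0.le]
  field_simp

/-- The time component `γ (⟨r⟩ - ℓ · y)` of the boosted position. -/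
def boostTime (l : ℝ → E4) (q : ℝ × E4) : ℝ :=
  lorentz (l q.1) * (bracket ‖q.2‖ - ∑ j, l q.1 j * q.2 j)

lemma profile_eq {l : ℝ → E4} {q : ℝ × E4} (h : ‖l q.1‖ < 1) :
    profile l q = catenoidHeight (√(boostTime l q ^ 2 - 1)) := by
  have h1 : inner ℝ (l q.1) q.2 = ∑ j, l q.1 j * q.2 j := by
    simp [PiLp.inner_apply, mul_comm]
  rw [profile, boostTime, ← h1, ← norm_boost_sq h, Real.sqrt_sq (norm_nonneg _)]

lemma isSymbol_boostTime :
    IsSymbol (smallFar A) (fun x => ‖x.2.2‖) fun d q => boostTime d.l q :=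
  isSymbol_lorentz.one_mul_left ((isSymbol_bracket radiusToInfinity_smallFar).sub
    (IsSymbol.sum fun j _ => (isSymbol_l j).of_size.one_mul_left
      (isSymbol_coord radiusToInfinity_smallFar j)))

/-- `⟨r⟩⁻¹ γ (⟨r⟩ - ℓ · y)`, which tends to `1`. -/
def boostRatio (l : ℝ → E4) (q : ℝ × E4) : ℝ :=
  lorentz (l q.1) * (1 - ∑ j, l q.1 j * (q.2 j * (bracket ‖q.2‖)⁻¹))

lemma boostTime_eq_mul {l : ℝ → E4} {q : ℝ × E4} :
    boostTime l q = boostRatio l q * bracket ‖q.2‖ := by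
  have hb := (bracket_pos ‖q.2‖).ne'
  have h : (∑ j, l q.1 j * (q.2 j * (bracket ‖q.2‖)⁻¹)) * bracket ‖q.2‖
      = ∑ j, l q.1 j * q.2 j := by
    rw [Finset.sum_mul]
    exact Finset.sum_congr rfl fun j _ => by field_simp
  rw [boostTime, boostRatio, mul_assoc, sub_mul, one_mul, h]

lemma isSymbol_sum_l_mul_coord : IsSymbol (smallFar A) (fun x => x.1.ε) fun d q =>
    ∑ j, d.l q.1 j * (q.2 j * (bracket ‖q.2‖)⁻¹) :=
  IsSymbol.sum fun j _ => (isSymbol_l j).mul_one_right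
    (isSymbol_coord_mul_bracket_inv radiusToInfinity_smallFar j)

lemma isSymbol_boostRatio : IsSymbol (smallFar A) (fun _ => 1) fun d q => boostRatio d.l q :=
  isSymbol_lorentz.one_mul_left ((IsSymbol.const 1).sub isSymbol_sum_l_mul_coord.of_size)

lemma tendsto_boostRatio :
    Tendsto (fun x : Motion A × (ℝ × E4) => boostRatio x.1.l x.2) (smallFar A) (nhds 1) := by
  have := (tendsto_lorentz (A := A)).mul
    (isSymbol_sum_l_mul_coord.tendsto_zero_of_size.const_sub 1)
  simpa [boostRatio] using this

lemma isSymbol_boostTime_inv :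
    IsSymbol (smallFar A) (fun x => ‖x.2.2‖⁻¹) fun d q => (boostTime d.l q)⁻¹ := by
  have := (isSymbol_boostRatio (A := A)).inv one_ne_zero tendsto_boostRatio
  simpa only [boostTime_eq_mul, mul_inv] using
    this.one_mul_left (isSymbol_bracket_inv radiusToInfinity_smallFar)

lemma eventually_boostTime : ∀ᶠ x in smallFar A, 2 < boostTime x.1.l x.2 := by
  filter_upwards [(tendsto_boostRatio (A := A)).eventually_const_lt (u := 1 / 2) (by norm_num),
    (radiusToInfinity_smallFar (A := A)).eventually_gt_atTop 4] with x h1 h2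
  rw [boostTime_eq_mul]
  nlinarith [le_bracket ‖x.2.2‖]

/-- The derivative of the profile in the variable `z = boostTime`. -/
def profileSlope (l : ℝ → E4) (q : ℝ × E4) : ℝ :=
  (boostTime l q)⁻¹ ^ 3 * heightSlope (boostTime l q)⁻¹

lemma isSymbol_profileSlope :
    IsSymbol (smallFar A) (fun x => ‖x.2.2‖⁻¹ ^ 3) fun d q => profileSlope d.l q := by
  have h := isSymbol_boostTime_inv (A := A)
  have h3 := (h.mul h).mul h
  have hc : IsSymbol (smallFar A) (fun _ => 1) fun d q => heightSlope (boostTime d.l q)⁻¹ :=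
    IsSymbol.comp contDiffAt_heightSlope (h.mono inv_isBigO_one)
      (h.value.trans_tendsto radiusToInfinity_smallFar.tendsto_inv)
  simpa only [profileSlope, pow_succ, pow_zero, one_mul] using h3.mul_one_right hc

lemma eventually_nhds_differentiable_boostTime : ∀ᶠ x in smallFar A, ∀ᶠ q in nhds x.2,
    DifferentiableAt ℝ (fun q => boostTime x.1.l q) q ∧ ‖x.1.l q.1‖ < 1 ∧ 2 < boostTime x.1.l q
      ∧ q.2 ≠ 0 := by
  filter_upwards [isSymbol_boostTime.smooth, eventually_norm_l_lt, eventually_boostTime,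
    radiusToInfinity_smallFar.eventually_ne] with x h1 h2 h3 h4
  filter_upwards [h1.eventually (by simp), x.1.eventually_norm_l_lt h2,
    h1.continuousAt.eventually_const_lt h3,
    continuous_snd.continuousAt.eventually_ne h4] with q h5 h6 h7 h8
  exact ⟨h5.differentiableAt (by norm_num), h6, h7, h8⟩

lemma pd_profile {l : ℝ → E4} {q : ℝ × E4} (h : DifferentiableAt ℝ (fun q => boostTime l q) q)
    (hl : ∀ᶠ q' in nhds q, ‖l q'.1‖ < 1) (hz : 2 < boostTime l q) (α : Fin 5) :
    pd α (profile l) q = profileSlope l q * pd α (fun q => boostTime l q) q := by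
  have h1 : profile l =ᶠ[nhds q] fun q => catenoidHeight (√(boostTime l q ^ 2 - 1)) :=
    hl.mono fun q' h => profile_eq h
  rw [pd_congr h1]
  have h2 := hasDerivAt_height hz.le
  have h3 := pd_comp (μ := α) (f := fun q => boostTime l q)
    (k := fun z => catenoidHeight (√(z ^ 2 - 1))) h2.differentiableAt h
  rw [h3, h2.deriv]
  rfl

lemma Motion.differentiableAt_lorentz (d : Motion A) {q : ℝ × E4} (h : ‖d.l q.1‖ < 1) :
    DifferentiableAt ℝ (fun q : ℝ × E4 => lorentz (d.l q.1)) q :=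
  DifferentiableAt.comp (g := fun s => lorentz (d.l s)) q
    (d.hasDerivAt_lorentz h).differentiableAt differentiableAt_fst

lemma Motion.differentiableAt_l_coord (d : Motion A) (j : Fin 4) (q : ℝ × E4) :
    DifferentiableAt ℝ (fun q : ℝ × E4 => d.l q.1 j) q :=
  DifferentiableAt.comp (g := fun s => d.l s j) q
    ((EuclideanSpace.proj j : E4 →L[ℝ] ℝ).differentiableAt.comp q.1 (d.differentiable_l q.1))
    differentiableAt_fst

lemma Motion.pd_l_coord_mul (d : Motion A) {q : ℝ × E4} (α : Fin 5) :
    pd α (fun q : ℝ × E4 => ∑ j, d.l q.1 j * q.2 j) q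
      = Fin.cases (motive := fun _ => ℝ) (∑ j, deriv d.l q.1 j * q.2 j) (fun k => d.l q.1 k) α := by
  have hd : ∀ j, DifferentiableAt ℝ (fun s => d.l s j) q.1 := fun j =>
    (EuclideanSpace.proj j : E4 →L[ℝ] ℝ).differentiableAt.comp q.1 (d.differentiable_l q.1)
  rw [pd_sum (s := Finset.univ) (F := fun j (q : ℝ × E4) => d.l q.1 j * q.2 j) fun j _ =>
    (d.differentiableAt_l_coord j q).fun_mul (differentiableAt_coord j)]
  simp only [pd_mul (d.differentiableAt_l_coord _ q) (differentiableAt_coord _)]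
  refine Fin.cases ?_ (fun k => ?_) α
  · rw [Fin.cases_zero]
    refine Finset.sum_congr rfl fun j _ => ?_
    rw [pd_zero_fst (f := fun s => d.l s j) (hd j), pd_zero_coord,
      deriv_apply_coord (d.differentiable_l q.1)]
    simp
  · have h0 : ∀ j, pd k.succ (fun q : ℝ × E4 => d.l q.1 j) q = 0 := fun j =>
      pd_succ_fst (f := fun s => d.l s j) k
    simp [h0, pd_succ_coord]

/-- The first derivatives of `boostTime`. -/
lemma Motion.pd_boostTime (d : Motion A) {q : ℝ × E4} (h : ‖d.l q.1‖ < 1) (hq : q.2 ≠ 0)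
    (α : Fin 5) :
    pd α (fun q => boostTime d.l q) q = Fin.cases (motive := fun _ => ℝ)
      (lorentzRate d q * (bracket ‖q.2‖ - ∑ j, d.l q.1 j * q.2 j)
        - lorentz (d.l q.1) * ∑ j, deriv d.l q.1 j * q.2 j)
      (fun k => lorentz (d.l q.1) * (q.2 k * (bracket ‖q.2‖)⁻¹ - d.l q.1 k)) α := by
  have hb : DifferentiableAt ℝ (fun q : ℝ × E4 => bracket ‖q.2‖) q :=
    (contDiffAt_bracket_norm (n := 1) hq).differentiableAt (by norm_num)
  have hs : DifferentiableAt ℝ (fun q : ℝ × E4 => ∑ j, d.l q.1 j * q.2 j) q :=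
    DifferentiableAt.fun_sum fun j _ =>
      (d.differentiableAt_l_coord j q).fun_mul (differentiableAt_coord j)
  simp only [boostTime]
  rw [pd_mul (d.differentiableAt_lorentz h) (hb.fun_sub hs), pd_sub hb hs, d.pd_l_coord_mul]
  refine Fin.cases ?_ (fun k => ?_) α
  · rw [pd_zero_fst (f := fun s => lorentz (d.l s)) (d.hasDerivAt_lorentz h).differentiableAt,
      (d.hasDerivAt_lorentz h).deriv, pd_zero_radial hq (hasDerivAt_bracket _).differentiableAt]
    simp only [Fin.cases_zero]
    ring
  · rw [pd_succ_fst (f := fun s => lorentz (d.l s)),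
      pd_succ_radial k hq (hasDerivAt_bracket _).differentiableAt, (hasDerivAt_bracket _).deriv]
    simp only [Fin.cases_succ]
    have := norm_ne_zero_iff.2 hq
    field_simp
    ring

lemma isSymbol_pd_boostTime (α : Fin 5) :
    IsSymbol (smallFar A) (fun x => ‖x.2.2‖) fun d q => pd α (fun q => boostTime d.l q) q := by
  have hL := radiusToInfinity_smallFar (A := A)
  have h1 : (fun _ => (1 : ℝ)) =O[smallFar A] fun x => ‖x.2.2‖ := by
    refine IsBigO.of_bound 1 ?_
    filter_upwards [hL.eventually_one_le] with x hx
    simpa using hx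
  have h2 : IsSymbol (smallFar A) (fun x => ‖x.2.2‖) fun d q =>
      Fin.cases (motive := fun _ => ℝ)
      (lorentzRate d q * (bracket ‖q.2‖ - ∑ j, d.l q.1 j * q.2 j)
        - lorentz (d.l q.1) * ∑ j, deriv d.l q.1 j * q.2 j)
      (fun k => lorentz (d.l q.1) * (q.2 k * (bracket ‖q.2‖)⁻¹ - d.l q.1 k)) α := by
    refine Fin.cases ?_ (fun k => ?_) α
    · exact (isSymbol_lorentzRate.of_size.one_mul_left ((isSymbol_bracket hL).sub
        (IsSymbol.sum fun j _ => (isSymbol_l j).of_size.one_mul_left (isSymbol_coord hL j)))).sub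
        (isSymbol_lorentz.one_mul_left (IsSymbol.sum fun j _ =>
          (isSymbol_deriv_l j).of_size.one_mul_left (isSymbol_coord hL j)))
    · exact (isSymbol_lorentz.one_mul_left ((isSymbol_coord_mul_bracket_inv hL k).sub
        (isSymbol_l k).of_size)).mono h1
  refine h2.congr ?_
  filter_upwards [eventually_nhds_differentiable_boostTime] with x hx
  filter_upwards [hx] with q hq
  exact (x.1.pd_boostTime hq.2.1 hq.2.2.2 α).symm

/-- The catenoid is asymptotically flat: its height has derivatives of size `r⁻²`. -/
lemma isSymbol_pd_profile (α : Fin 5) :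
    IsSymbol (smallFar A) (fun x => ‖x.2.2‖⁻¹ ^ 2) fun d q => pd α (profile d.l) q := by
  have h1 := (isSymbol_profileSlope (A := A)).mul (isSymbol_pd_boostTime α)
  refine (h1.mono ?_).congr ?_
  · refine IsBigO.of_bound 1 ?_
    filter_upwards [(radiusToInfinity_smallFar (A := A)).eventually_one_le] with x hx
    have : ‖x.2.2‖ ≠ 0 := by linarith
    rw [one_mul]
    refine le_of_eq (congrArg _ ?_)
    field_simp
  · filter_upwards [eventually_nhds_differentiable_boostTime] with x hx
    filter_upwards [hx] with q hq
    exact (pd_profile hq.1 (x.1.eventually_norm_l_lt hq.2.1) hq.2.2.1 α).symm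

end catenoid

/-! ### The coefficients of the operator -/

section coefficients

open Filter Asymptotics

variable {A Rf : ℝ}

/-- The gradient `y / ⟨r⟩` of `⟨r⟩`. -/
def slope (j : Fin 4) (q : ℝ × E4) : ℝ := q.2 j * (bracket ‖q.2‖)⁻¹

lemma isSymbol_slope (j : Fin 4) : IsSymbol (smallFar A) (fun _ => 1) fun _ q => slope j q :=
  isSymbol_coord_mul_bracket_inv radiusToInfinity_smallFar j

lemma frame_succ_eq {xi l : ℝ → E4} {q : ℝ × E4} (j : Fin 4) (α : Fin 5) :
    frame Rf xi l j.succ α q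
      = (if α = j.succ then 1 else 0) - slope j q * frame Rf xi l 0 α q := rfl

lemma sum_slope_sq (q : ℝ × E4) : ∑ j, slope j q ^ 2 = 1 - (bracket ‖q.2‖)⁻¹ ^ 2 := by
  have hb := bracket_pos ‖q.2‖
  have h1 := bracket_sq ‖q.2‖
  simp only [slope, mul_pow]
  rw [← Finset.sum_mul, ← norm_sq_eq_sum]
  field_simp
  linarith

lemma pd_succ_slope {q : ℝ × E4} (h : q.2 ≠ 0) (k j : Fin 4) :
    pd k.succ (slope j) q
      = (if k = j then (bracket ‖q.2‖)⁻¹ else 0) - q.2 k * q.2 j / bracket ‖q.2‖ ^ 3 :=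
  pd_succ_coord_div_bracket h k j

lemma sum_pd_slope {q : ℝ × E4} (h : q.2 ≠ 0) :
    ∑ j : Fin 4, pd j.succ (slope j) q
      = 3 * (bracket ‖q.2‖)⁻¹ + (bracket ‖q.2‖)⁻¹ ^ 3 := by
  have hb := bracket_pos ‖q.2‖
  have h1 := bracket_sq ‖q.2‖
  have h2 : ∑ j : Fin 4, q.2 j * q.2 j = bracket ‖q.2‖ ^ 2 - 1 := by
    rw [h1, norm_sq_eq_sum]; simp [pow_two]
  simp only [pd_succ_slope h, if_true, Finset.sum_sub_distrib, ← Finset.sum_div, h2]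
  simp only [Finset.sum_const, Finset.card_univ, Fintype.card_fin, nsmul_eq_mul]
  push_cast
  field_simp
  ring

/-- `⟨r⟩` satisfies `∇⟨r⟩ · ∇∇⟨r⟩ = O(r⁻³)`, one order better than the separate factors. -/
lemma sum_slope_mul_pd_slope {q : ℝ × E4} (h : q.2 ≠ 0) (j : Fin 4) :
    ∑ k : Fin 4, slope k q * pd k.succ (slope j) q = q.2 j * (bracket ‖q.2‖)⁻¹ ^ 4 := by
  have hb := bracket_pos ‖q.2‖
  have h1 := bracket_sq ‖q.2‖
  have h2 : ∑ j : Fin 4, q.2 j * q.2 j = bracket ‖q.2‖ ^ 2 - 1 := by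
    rw [h1, norm_sq_eq_sum]; simp [pow_two]
  have h3 : ∑ k : Fin 4, slope k q * (q.2 k * q.2 j / bracket ‖q.2‖ ^ 3)
      = (∑ k : Fin 4, q.2 k * q.2 k) * (q.2 j * (bracket ‖q.2‖)⁻¹ ^ 4) := by
    rw [Finset.sum_mul]
    refine Finset.sum_congr rfl fun k _ => ?_
    simp only [slope]; field_simp
  simp only [pd_succ_slope h, mul_sub, Finset.sum_sub_distrib, h3, h2]
  simp only [mul_ite, mul_zero, Finset.sum_ite_eq', Finset.mem_univ, if_true, slope]
  field_simp
  ring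

/-- The derivative along the frame field `V_μ`. -/
def frameDeriv (Rf : ℝ) (xi l : ℝ → E4) (μ : Fin 5) (f : ℝ × E4 → ℝ) (q : ℝ × E4) : ℝ :=
  ∑ α, frame Rf xi l μ α q * pd α f q

lemma frameDeriv_succ {xi l : ℝ → E4} {q : ℝ × E4} (j : Fin 4) (f : ℝ × E4 → ℝ) :
    frameDeriv Rf xi l j.succ f q = pd j.succ f q - slope j q * frameDeriv Rf xi l 0 f q := by
  simp only [frameDeriv, frame_succ_eq, sub_mul, Finset.sum_sub_distrib, ite_mul, one_mul,
    zero_mul, Finset.sum_ite_eq', Finset.mem_univ, if_true, Finset.mul_sum, mul_assoc]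

lemma IsSymbol.frameDeriv {w : Motion A × (ℝ × E4) → ℝ} {f : Motion A → ℝ × E4 → ℝ}
    (hf : IsSymbol (smallFar A) w f) (μ : Fin 5) :
    (fun x : Motion A × (ℝ × E4) => frameDeriv Rf x.1.xi x.1.l μ (f x.1) x.2)
      =O[smallFar A] w := by
  refine IsBigO.fun_sum fun α _ => ?_
  have hw : (fun x => w x * derWeight α x) =O[smallFar A] w := by
    have : (fun x : Motion A × (ℝ × E4) => derWeight α x) =O[smallFar A] fun _ => (1 : ℝ) :=
      Fin.cases (isBigO_refl _ _) (fun _ => inv_isBigO_one) α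
    simpa using (isBigO_refl w (smallFar A)).mul this
  simpa using (isSymbol_frame (Rf := Rf) μ α).value.mul ((hf.deriv α).trans hw)

/-- The covariant components `∇_μ Q`. -/
def gradQ (Rf : ℝ) (xi l : ℝ → E4) (μ : Fin 5) (q : ℝ × E4) : ℝ :=
  frameDeriv Rf xi l μ (profile l) q

/-- `W = 1 + ∇^α Q ∇_α Q`. -/
def slopeFactor (Rf : ℝ) (xi l : ℝ → E4) (q : ℝ × E4) : ℝ :=
  1 + ∑ a, mink a * gradQ Rf xi l a q ^ 2

/-- `W⁻¹ ∇^μ Q ∇^ν Q`. -/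
def catTensor (Rf : ℝ) (xi l : ℝ → E4) (μ ν : Fin 5) (q : ℝ × E4) : ℝ :=
  (slopeFactor Rf xi l q)⁻¹ * ((mink μ * gradQ Rf xi l μ q) * (mink ν * gradQ Rf xi l ν q))

/-- The coefficients of the first-order terms of `P_graph`. -/
def catVector (Rf : ℝ) (xi l : ℝ → E4) (ν : Fin 5) (q : ℝ × E4) : ℝ :=
  -(2 * (slopeFactor Rf xi l q)⁻¹ * ∑ μ, mink μ * mink ν
      * frameDeriv Rf xi l μ (gradQ Rf xi l ν) q * gradQ Rf xi l μ q)
    + 2 * ((slopeFactor Rf xi l q) ^ 2)⁻¹ * ∑ μ, ∑ lam, (mink ν * gradQ Rf xi l ν q)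
      * (mink μ * gradQ Rf xi l μ q) * (mink lam * gradQ Rf xi l lam q)
      * frameDeriv Rf xi l lam (gradQ Rf xi l μ) q

lemma isSymbol_gradQ (μ : Fin 5) :
    IsSymbol (smallFar A) (fun x => ‖x.2.2‖⁻¹ ^ 2) fun d q => gradQ Rf d.xi d.l μ q := by
  simp only [gradQ, frameDeriv]
  exact IsSymbol.sum fun α _ => (isSymbol_frame μ α).one_mul_left (isSymbol_pd_profile α)

lemma pow_inv_isBigO {m n : ℕ} (h : m ≤ n) :
    (fun x : Motion A × (ℝ × E4) => ‖x.2.2‖⁻¹ ^ n) =O[smallFar A] fun x => ‖x.2.2‖⁻¹ ^ m := by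
  refine IsBigO.of_bound 1 ?_
  filter_upwards [(radiusToInfinity_smallFar (A := A)).eventually_one_le] with x hx
  rw [one_mul, Real.norm_of_nonneg (by positivity), Real.norm_of_nonneg (by positivity)]
  exact pow_le_pow_of_le_one (by positivity) (inv_le_one_of_one_le₀ hx) h

lemma pow_inv_isBigO_one {n : ℕ} :
    (fun x : Motion A × (ℝ × E4) => ‖x.2.2‖⁻¹ ^ n) =O[smallFar A] fun _ => (1 : ℝ) := by
  simpa using pow_inv_isBigO (A := A) (Nat.zero_le n)

lemma isSymbol_sum_gradQ_sq : IsSymbol (smallFar A) (fun x => ‖x.2.2‖⁻¹ ^ 2) fun d q =>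
    ∑ a, mink a * gradQ Rf d.xi d.l a q ^ 2 := by
  simp only [pow_two (gradQ _ _ _ _ _)]
  exact IsSymbol.sum fun a _ => ((isSymbol_gradQ a).mul_one_right
    ((isSymbol_gradQ a).mono pow_inv_isBigO_one)).const_mul _

lemma isSymbol_slopeFactor_inv :
    IsSymbol (smallFar A) (fun _ => 1) fun d q => (slopeFactor Rf d.xi d.l q)⁻¹ := by
  have h := isSymbol_sum_gradQ_sq (A := A) (Rf := Rf)
  have ht : Tendsto (fun x : Motion A × (ℝ × E4) => slopeFactor Rf x.1.xi x.1.l x.2)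
      (smallFar A) (nhds 1) := by
    have h1 : Tendsto (fun x : Motion A × (ℝ × E4) => ‖x.2.2‖⁻¹ ^ 2) (smallFar A) (nhds 0) := by
      simpa using (radiusToInfinity_smallFar (A := A)).tendsto_inv.pow 2
    simpa [slopeFactor] using (h.value.trans_tendsto h1).const_add 1
  exact ((IsSymbol.const 1).add (h.mono pow_inv_isBigO_one)).inv one_ne_zero ht

lemma isSymbol_catTensor (μ ν : Fin 5) :
    IsSymbol (smallFar A) (fun x => ‖x.2.2‖⁻¹ ^ 4) fun d q => catTensor Rf d.xi d.l μ ν q := by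
  have h := (isSymbol_slopeFactor_inv (Rf := Rf)).one_mul_left
    (((isSymbol_gradQ (A := A) (Rf := Rf) μ).const_mul (mink μ)).mul
      ((isSymbol_gradQ (Rf := Rf) ν).const_mul (mink ν)))
  exact h.mono ((isBigO_refl _ _).congr_left fun x => by ring)

lemma catVector_isBigO (ν : Fin 5) :
    (fun x : Motion A × (ℝ × E4) => catVector Rf x.1.xi x.1.l ν x.2)
      =O[smallFar A] fun x => ‖x.2.2‖⁻¹ ^ 4 := by
  have hW := (isSymbol_slopeFactor_inv (A := A) (Rf := Rf)).value
  have hg : ∀ μ, _ := fun μ => (isSymbol_gradQ (A := A) (Rf := Rf) μ).value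
  have hd : ∀ μ ν, _ := fun μ ν => (isSymbol_gradQ (A := A) (Rf := Rf) ν).frameDeriv (Rf := Rf) μ
  have h1 : (fun x : Motion A × (ℝ × E4) => ∑ μ, mink μ * mink ν
      * frameDeriv Rf x.1.xi x.1.l μ (gradQ Rf x.1.xi x.1.l ν) x.2 * gradQ Rf x.1.xi x.1.l μ x.2)
      =O[smallFar A] fun x => ‖x.2.2‖⁻¹ ^ 4 := IsBigO.fun_sum fun μ _ =>
    (((hd μ ν).const_mul_left (mink μ * mink ν)).mul (hg μ)).congr_right fun x => by ring
  have h2 : (fun x : Motion A × (ℝ × E4) => ∑ μ, ∑ lam, (mink ν * gradQ Rf x.1.xi x.1.l ν x.2)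
      * (mink μ * gradQ Rf x.1.xi x.1.l μ x.2) * (mink lam * gradQ Rf x.1.xi x.1.l lam x.2)
      * frameDeriv Rf x.1.xi x.1.l lam (gradQ Rf x.1.xi x.1.l μ) x.2)
      =O[smallFar A] fun x => ‖x.2.2‖⁻¹ ^ 4 := IsBigO.fun_sum fun μ _ => IsBigO.fun_sum fun lam _ =>
    (((((hg ν).const_mul_left (mink ν)).mul ((hg μ).const_mul_left (mink μ))).mul
      ((hg lam).const_mul_left (mink lam))).mul (hd lam μ)).trans
        ((pow_inv_isBigO (show 4 ≤ 8 by norm_num)).congr_left fun x => by ring)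
  have h3 := (hW.const_mul_left 2).mul h1
  have h4 := ((hW.mul hW).const_mul_left 2).mul h2
  simp only [one_mul] at h3 h4
  refine (h3.neg_left.add h4).congr_left fun x => ?_
  simp only [catVector, pow_two (slopeFactor _ _ _ _), mul_inv]

/-- The second-order coefficients of `P_graph` in the coordinates `(σ, y)`. -/
def secondCoeff (Rf : ℝ) (xi l : ℝ → E4) (α β : Fin 5) (q : ℝ × E4) : ℝ :=
  (∑ μ, mink μ * (frame Rf xi l μ α q * frame Rf xi l μ β q))
    - ∑ μ, ∑ ν, catTensor Rf xi l μ ν q * (frame Rf xi l μ α q * frame Rf xi l ν β q)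

/-- The first-order coefficients of `□` in the coordinates `(σ, y)`. -/
def flatFirst (Rf : ℝ) (xi l : ℝ → E4) (β : Fin 5) (q : ℝ × E4) : ℝ :=
  ∑ μ, mink μ * frameDeriv Rf xi l μ (frame Rf xi l μ β) q

/-- The first-order coefficients of `P_graph - □` in the coordinates `(σ, y)`. -/
def catFirst (Rf : ℝ) (xi l : ℝ → E4) (β : Fin 5) (q : ℝ × E4) : ℝ :=
  (∑ ν, catVector Rf xi l ν q * frame Rf xi l ν β q)
    - ∑ μ, ∑ ν, catTensor Rf xi l μ ν q * frameDeriv Rf xi l μ (frame Rf xi l ν β) q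

lemma catFirst_isBigO (β : Fin 5) :
    (fun x : Motion A × (ℝ × E4) => catFirst Rf x.1.xi x.1.l β x.2)
      =O[smallFar A] fun x => ‖x.2.2‖⁻¹ ^ 4 := by
  refine (IsBigO.fun_sum fun ν _ => ?_).sub (IsBigO.fun_sum fun μ _ => IsBigO.fun_sum fun ν _ => ?_)
  · simpa using (catVector_isBigO (Rf := Rf) ν).mul (isSymbol_frame (Rf := Rf) ν β).value
  · simpa using (isSymbol_catTensor (Rf := Rf) μ ν).value.mul
      ((isSymbol_frame (Rf := Rf) ν β).frameDeriv (Rf := Rf) μ)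

lemma mink_zero : mink 0 = -1 := rfl

lemma mink_succ (j : Fin 4) : mink j.succ = 1 := rfl

lemma sum_sub_slope_mul (q : ℝ × E4) (x y : Fin 4 → ℝ) (a b : ℝ) :
    ∑ i, (x i - slope i q * a) * (y i - slope i q * b)
      = (∑ i, x i * y i) - a * (∑ i, slope i q * y i) - b * (∑ i, slope i q * x i)
        + a * b * (1 - (bracket ‖q.2‖)⁻¹ ^ 2) := by
  rw [← sum_slope_sq]
  simp only [Finset.mul_sum, ← Finset.sum_sub_distrib, ← Finset.sum_add_distrib]
  exact Finset.sum_congr rfl fun i _ => by ring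

section flatSecond

variable {xi l : ℝ → E4} {q : ℝ × E4}

lemma sum_mink_frame_zero_zero :
    ∑ μ, mink μ * (frame Rf xi l μ 0 q * frame Rf xi l μ 0 q)
      = -((bracket ‖q.2‖)⁻¹ ^ 2 * frame Rf xi l 0 0 q ^ 2) := by
  rw [Fin.sum_univ_succ]
  simp only [mink_zero, mink_succ, frame_succ_eq, one_mul, sum_sub_slope_mul]
  simp only [(Fin.succ_ne_zero _).symm, if_false]
  simp
  ring

lemma sum_mink_frame_zero_succ (k : Fin 4) :
    ∑ μ, mink μ * (frame Rf xi l μ 0 q * frame Rf xi l μ k.succ q)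
      = -(slope k q * frame Rf xi l 0 0 q)
        - (bracket ‖q.2‖)⁻¹ ^ 2 * (frame Rf xi l 0 0 q * frame Rf xi l 0 k.succ q) := by
  rw [Fin.sum_univ_succ]
  simp only [mink_zero, mink_succ, frame_succ_eq, one_mul, sum_sub_slope_mul]
  simp only [(Fin.succ_ne_zero _).symm, if_false, Fin.succ_inj]
  simp
  ring

lemma sum_mink_frame_succ_succ (j k : Fin 4) :
    ∑ μ, mink μ * (frame Rf xi l μ j.succ q * frame Rf xi l μ k.succ q)
      = (if j = k then 1 else 0) - slope j q * frame Rf xi l 0 k.succ q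
        - slope k q * frame Rf xi l 0 j.succ q
        - (bracket ‖q.2‖)⁻¹ ^ 2 * (frame Rf xi l 0 j.succ q * frame Rf xi l 0 k.succ q) := by
  rw [Fin.sum_univ_succ]
  simp only [mink_zero, mink_succ, frame_succ_eq, one_mul, sum_sub_slope_mul]
  simp only [Fin.succ_inj]
  simp
  ring

end flatSecond

/-- The perturbation `a = Λ A - A₀` of the second-order coefficients. -/
def pertTensor (Rf : ℝ) (xi l : ℝ → E4) (α β : Fin 5) (q : ℝ × E4) : ℝ :=
  jac Rf xi l q * secondCoeff Rf xi l α β q - flatTensor α β q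

lemma secondCoeff_symm {xi l : ℝ → E4} {q : ℝ × E4} (α β : Fin 5) :
    secondCoeff Rf xi l α β q = secondCoeff Rf xi l β α q := by
  simp only [secondCoeff]
  congr 1
  · exact Finset.sum_congr rfl fun μ _ => by ring
  · rw [Finset.sum_comm]
    refine Finset.sum_congr rfl fun μ _ => Finset.sum_congr rfl fun ν _ => ?_
    simp only [catTensor]; ring

lemma pertTensor_symm {xi l : ℝ → E4} {q : ℝ × E4} (α β : Fin 5) :
    pertTensor Rf xi l α β q = pertTensor Rf xi l β α q := by
  simp only [pertTensor]; rw [secondCoeff_symm, flatTensor_symm]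

/-- The part of the perturbation that is due to the motion of the hyperboloids. -/
def motionTensor (Rf : ℝ) (xi l : ℝ → E4) (α β : Fin 5) (q : ℝ × E4) : ℝ :=
  jac Rf xi l q * (∑ μ, mink μ * (frame Rf xi l μ α q * frame Rf xi l μ β q)) - flatTensor α β q

/-- The size of the component `αβ` of a perturbation of relative size `s`. -/
def tensorWeight (α β : Fin 5) (x : Motion A × (ℝ × E4)) : ℝ :=
  smallness x * (compWeight ‖x.2.2‖ α * compWeight ‖x.2.2‖ β)

lemma smallness_nonneg (x : Motion A × (ℝ × E4)) : 0 ≤ smallness x :=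
  add_nonneg x.1.pos.le (by positivity)

lemma inv_le_compWeight {r : ℝ} (hr : 1 ≤ r) (α : Fin 5) : r⁻¹ ≤ compWeight r α :=
  Fin.cases le_rfl (fun _ => by simpa using inv_le_one_of_one_le₀ hr) α

lemma pow_inv_isBigO_tensorWeight (α β : Fin 5) :
    (fun x : Motion A × (ℝ × E4) => ‖x.2.2‖⁻¹ ^ 4) =O[smallFar A] tensorWeight α β := by
  refine (pow_inv_isBigO (show 3 ≤ 4 by norm_num)).trans (IsBigO.of_bound 1 ?_)
  filter_upwards [(radiusToInfinity_smallFar (A := A)).eventually_one_le] with x hx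
  have h0 : 0 ≤ ‖x.2.2‖⁻¹ := by positivity
  have h1 : ‖x.2.2‖⁻¹ ≤ smallness x := le_add_of_nonneg_left x.1.pos.le
  have h2 := inv_le_compWeight hx α
  have h3 := inv_le_compWeight hx β
  have h4 := h0.trans h2
  have h5 := h0.trans h3
  have h6 := smallness_nonneg x
  rw [one_mul, Real.norm_of_nonneg (by positivity), tensorWeight,
    Real.norm_of_nonneg (by positivity), pow_succ, pow_two, mul_assoc]
  gcongr

lemma eventually_nhds_good : ∀ᶠ x in smallFar A, ∀ᶠ q in nhds x.2,
    jac Rf x.1.xi x.1.l q ≠ 0 ∧ ‖x.1.l q.1‖ < 1 ∧ q.2 ≠ 0 := by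
  filter_upwards [isSymbol_jac.smooth, eventually_norm_l_lt,
    (tendsto_jac (A := A) (Rf := Rf)).eventually_ne one_ne_zero,
    radiusToInfinity_smallFar.eventually_ne] with x h1 h2 h3 h4
  filter_upwards [h1.continuousAt.eventually_ne h3, x.1.eventually_norm_l_lt h2,
    continuous_snd.continuousAt.eventually_ne h4] with q h5 h6 h7
  exact ⟨h5, h6, h7⟩

lemma isSymbol_motionTensor (α β : Fin 5) :
    IsSymbol (smallFar A) (tensorWeight α β) fun d q => motionTensor Rf d.xi d.l α β q := by
  have hb := isSymbol_bracket_inv (radiusToInfinity_smallFar (A := A))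
  have hb2 := hb.mul hb
  have hs : (fun x : Motion A × (ℝ × E4) => x.1.ε) =O[smallFar A] smallness :=
    size_isBigO_smallness
  have hz : ∀ k : Fin 4, IsSymbol (smallFar A) (tensorWeight 0 k.succ) fun d q =>
      motionTensor Rf d.xi d.l 0 k.succ q := fun k => by
    have h := (hb2.mono (inv_isBigO_one.mul (isBigO_refl _ _))).mul
      (isSymbol_frame_zero_succ (A := A) (Rf := Rf) k)
    refine (h.neg.mono ?_).congr ?_
    · refine ((isBigO_refl (fun x : Motion A × (ℝ × E4) => ‖x.2.2‖⁻¹) _).mul hs).congr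
        (fun x => by ring) fun x => by simp only [tensorWeight, compWeight_zero, compWeight_succ]; ring
    · filter_upwards [eventually_nhds_good (Rf := Rf)] with x hx
      filter_upwards [hx] with q hq
      have := hq.1
      simp only [motionTensor, sum_mink_frame_zero_succ, flatTensor_zero_succ, frame_zero_zero]
      simp only [slope]
      field_simp
      ring
  refine Fin.cases (Fin.cases ?_ (fun k => ?_) β) (fun j => Fin.cases ?_ (fun k => ?_) β) α
  · refine ((hb2.mul ((isSymbol_jac_sub_one (Rf := Rf)).mul_one_right
      (isSymbol_jac_inv (Rf := Rf)))).mono ?_).congr ?_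
    · refine ((isBigO_refl (fun x : Motion A × (ℝ × E4) => ‖x.2.2‖⁻¹ * ‖x.2.2‖⁻¹) _).mul
        hs).congr_right fun x => by simp only [tensorWeight, compWeight_zero]; ring
    · filter_upwards [eventually_nhds_good (Rf := Rf)] with x hx
      filter_upwards [hx] with q hq
      have := hq.1
      have hb := (bracket_pos ‖q.2‖).ne'
      simp only [motionTensor, sum_mink_frame_zero_zero, flatTensor_zero_zero, frame_zero_zero]
      field_simp
      ring
  · exact hz k
  · refine ((hz j).mono ?_).congr (Eventually.of_forall fun x => Eventually.of_forall fun q => ?_)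
    · exact (isBigO_refl _ _).congr_left fun x => by simp only [tensorWeight]; ring
    · simp only [motionTensor, flatTensor_symm j.succ 0, mul_comm (frame Rf _ _ _ j.succ q)]
  · have hv := fun k => isSymbol_frame_zero_succ (A := A) (Rf := Rf) k
    have h1 := ((isSymbol_slope j).one_mul_left (hv k)).add ((isSymbol_slope k).one_mul_left (hv j))
    have h2 := (hb2.mono (by simpa using inv_isBigO_one.mul inv_isBigO_one)).one_mul_left
      ((hv j).mul_one_right (hv k).of_size)
    have h3 := ((isSymbol_jac_sub_one (A := A) (Rf := Rf)).const_mul (if j = k then 1 else 0)).sub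
      ((isSymbol_jac (Rf := Rf)).one_mul_left (h1.add h2))
    refine (h3.mono ?_).congr (Eventually.of_forall fun x => Eventually.of_forall fun q => ?_)
    · exact hs.congr_right fun x => by simp only [tensorWeight, compWeight_succ]; ring
    · simp only [motionTensor, sum_mink_frame_succ_succ, flatTensor_succ_succ]
      ring

lemma isSymbol_pertTensor (α β : Fin 5) :
    IsSymbol (smallFar A) (tensorWeight α β) fun d q => pertTensor Rf d.xi d.l α β q := by
  have hc : IsSymbol (smallFar A) (tensorWeight α β) fun d q => jac Rf d.xi d.l q *
      ∑ μ, ∑ ν, catTensor Rf d.xi d.l μ ν q * (frame Rf d.xi d.l μ α q * frame Rf d.xi d.l ν β q) :=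
    (isSymbol_jac (Rf := Rf)).one_mul_left <| (IsSymbol.sum fun μ _ => IsSymbol.sum fun ν _ =>
      (isSymbol_catTensor (Rf := Rf) μ ν).mul_one_right
        ((isSymbol_frame (Rf := Rf) μ α).one_mul_left (isSymbol_frame (Rf := Rf) ν β))).mono
        (pow_inv_isBigO_tensorWeight α β)
  refine ((isSymbol_motionTensor (Rf := Rf) α β).sub hc).congr ?_
  exact Eventually.of_forall fun x => Eventually.of_forall fun q => by
    simp only [pertTensor, motionTensor, secondCoeff]; ring

end coefficients

section firstOrder

open Filter Asymptotics

variable {A Rf : ℝ}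

section pointwise

variable {xi l : ℝ → E4} {q : ℝ × E4}

lemma differentiableAt_slope (hq : q.2 ≠ 0) (j : Fin 4) : DifferentiableAt ℝ (slope j) q :=
  ((contDiff_coord (n := 1) j).contDiffAt.mul
    ((contDiffAt_bracket_norm hq).inv (bracket_pos _).ne')).differentiableAt (by norm_num)

lemma pd_zero_slope (hq : q.2 ≠ 0) (j : Fin 4) : pd 0 (slope j) q = 0 := by
  have hb : DifferentiableAt ℝ (fun x : ℝ × E4 => (bracket ‖x.2‖)⁻¹) q :=
    ((contDiffAt_bracket_norm (n := 1) hq).inv (bracket_pos _).ne').differentiableAt (by norm_num)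
  have : slope j = fun x => x.2 j * (bracket ‖x.2‖)⁻¹ := rfl
  rw [this, pd_mul (differentiableAt_coord j) hb, pd_zero_coord,
    pd_zero_radial (f := fun r => (bracket r)⁻¹) hq
      ((hasDerivAt_bracket _).differentiableAt.fun_inv (bracket_pos _).ne')]
  ring

/-- The components of `h · ∇`, applied to `h = y / ⟨r⟩` in the direction of `V_0`. -/
lemma sum_slope_mul_frameDeriv_slope (hq : q.2 ≠ 0) :
    ∑ j, slope j q * frameDeriv Rf xi l 0 (slope j) q
      = (∑ k : Fin 4, frame Rf xi l 0 k.succ q * q.2 k) * (bracket ‖q.2‖)⁻¹ ^ 4 := by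
  have h1 : ∀ j k : Fin 4, pd k.succ (slope j) q = pd j.succ (slope k) q := fun j k => by
    rw [pd_succ_slope hq, pd_succ_slope hq]
    simp [eq_comm, mul_comm]
  have h2 : ∀ j, frameDeriv Rf xi l 0 (slope j) q
      = ∑ k : Fin 4, frame Rf xi l 0 k.succ q * pd j.succ (slope k) q := fun j => by
    rw [frameDeriv, Fin.sum_univ_succ, pd_zero_slope hq, mul_zero, zero_add]
    exact Finset.sum_congr rfl fun k _ => by rw [h1]
  simp only [h2, Finset.mul_sum]
  rw [Finset.sum_comm, Finset.sum_mul]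
  refine Finset.sum_congr rfl fun k _ => ?_
  rw [mul_assoc, ← sum_slope_mul_pd_slope hq, Finset.mul_sum]
  exact Finset.sum_congr rfl fun j _ => by ring

/-- The spatial frame fields `e_j - slope_j V_0` are expressed through `V_0`; the relation
`∑ slope_j² = 1 - ⟨r⟩⁻²` leaves only the factor `⟨r⟩⁻²` in front of the derivative of `V_0`. -/
lemma flatFirst_eq (hq : q.2 ≠ 0) {β : Fin 5} (hv : DifferentiableAt ℝ (frame Rf xi l 0 β) q) :
    flatFirst Rf xi l β q
      = -((∑ j : Fin 4, pd j.succ (slope j) q) * frame Rf xi l 0 β q)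
        - (∑ j : Fin 4, slope j q * pd j.succ (frame Rf xi l 0 β) q)
        + (∑ j : Fin 4, slope j q * frameDeriv Rf xi l 0 (slope j) q) * frame Rf xi l 0 β q
        - (bracket ‖q.2‖)⁻¹ ^ 2 * frameDeriv Rf xi l 0 (frame Rf xi l 0 β) q := by
  have hp : ∀ (j : Fin 4) (α : Fin 5), pd α (frame Rf xi l j.succ β) q
      = -(pd α (slope j) q * frame Rf xi l 0 β q + slope j q * pd α (frame Rf xi l 0 β) q) := by
    intro j α
    have hs := differentiableAt_slope hq j
    have : frame Rf xi l j.succ β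
        = fun q => (if β = j.succ then 1 else 0) - slope j q * frame Rf xi l 0 β q := rfl
    rw [this, pd_sub (differentiableAt_const _) (hs.fun_mul hv), pd_const, pd_mul hs hv, zero_sub]
  have h0 : ∀ j : Fin 4, frameDeriv Rf xi l 0 (frame Rf xi l j.succ β) q
      = -(frameDeriv Rf xi l 0 (slope j) q * frame Rf xi l 0 β q
        + slope j q * frameDeriv Rf xi l 0 (frame Rf xi l 0 β) q) := fun j => by
    simp only [frameDeriv, hp]
    rw [Finset.sum_mul, Finset.mul_sum, ← Finset.sum_add_distrib, ← Finset.sum_neg_distrib]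
    exact Finset.sum_congr rfl fun α _ => by ring
  have hsq := sum_slope_sq q
  have h1 : (bracket ‖q.2‖)⁻¹ ^ 2 = 1 - ∑ j, slope j q ^ 2 := by rw [hsq]; ring
  rw [flatFirst, Fin.sum_univ_succ, mink_zero, h1, sub_mul, one_mul]
  simp only [mink_succ, one_mul, frameDeriv_succ, hp, h0, Finset.sum_mul]
  have h2 : ∀ j : Fin 4, -(pd j.succ (slope j) q * frame Rf xi l 0 β q
        + slope j q * pd j.succ (frame Rf xi l 0 β) q)
      - slope j q * -(frameDeriv Rf xi l 0 (slope j) q * frame Rf xi l 0 β q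
        + slope j q * frameDeriv Rf xi l 0 (frame Rf xi l 0 β) q)
      = -(pd j.succ (slope j) q * frame Rf xi l 0 β q)
        - slope j q * pd j.succ (frame Rf xi l 0 β) q
        + slope j q * frameDeriv Rf xi l 0 (slope j) q * frame Rf xi l 0 β q
        + slope j q ^ 2 * frameDeriv Rf xi l 0 (frame Rf xi l 0 β) q := fun j => by ring
  simp only [h2, Finset.sum_add_distrib, Finset.sum_sub_distrib, Finset.sum_neg_distrib]
  ring

/-- The radial derivative of the Jacobian, `Σ h_j ∂_j Λ = -⟨r⟩⁻⁴ y · η_σ`. -/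
lemma sum_slope_mul_pd_jac (hq : q.2 ≠ 0)
    (hτ : DifferentiableAt ℝ (fun q : ℝ × E4 => deriv (retTime Rf l) q.1) q)
    (hη : ∀ i, DifferentiableAt ℝ (fun q : ℝ × E4 => deriv (center Rf xi l) q.1 i) q) :
    ∑ j : Fin 4, slope j q * pd j.succ (jac Rf xi l) q
      = -((∑ i, q.2 i * deriv (center Rf xi l) q.1 i) * (bracket ‖q.2‖)⁻¹ ^ 4) := by
  have h1 : ∀ j : Fin 4, pd j.succ (jac Rf xi l) q
      = -∑ i, pd j.succ (slope i) q * deriv (center Rf xi l) q.1 i := fun j => by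
    have : jac Rf xi l = fun q => deriv (retTime Rf l) q.1
        - ∑ i, slope i q * deriv (center Rf xi l) q.1 i := rfl
    rw [this, pd_sub hτ (DifferentiableAt.fun_sum fun i _ =>
      (differentiableAt_slope hq i).fun_mul (hη i)), pd_succ_fst, zero_sub,
      pd_sum (s := Finset.univ) (F := fun i (q : ℝ × E4) => slope i q
        * deriv (center Rf xi l) q.1 i) fun i _ => (differentiableAt_slope hq i).fun_mul (hη i)]
    refine congrArg _ (Finset.sum_congr rfl fun i _ => ?_)
    rw [pd_mul (differentiableAt_slope hq i) (hη i),
      pd_succ_fst (f := fun s => deriv (center Rf xi l) s i), mul_zero, add_zero]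
  simp only [h1, mul_neg, Finset.sum_neg_distrib, Finset.mul_sum]
  rw [Finset.sum_comm, Finset.sum_mul]
  refine congrArg _ (Finset.sum_congr rfl fun i _ => ?_)
  have := sum_slope_mul_pd_slope hq i
  rw [mul_right_comm, ← this, Finset.sum_mul]
  exact Finset.sum_congr rfl fun j _ => by ring

/-- The components `y_j / r²` of the logarithmic gradient of `r`. -/
def logGrad (j : Fin 4) (q : ℝ × E4) : ℝ := q.2 j / ‖q.2‖ ^ 2

/-- The first-order coefficients `B` of the conjugated operator, relative to the flat ones. -/
def pertFirst (Rf : ℝ) (xi l : ℝ → E4) (β : Fin 5) (q : ℝ × E4) : ℝ :=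
  jac Rf xi l q * (flatFirst Rf xi l β q + catFirst Rf xi l β q)
    - 3 * (∑ j : Fin 4, jac Rf xi l q * secondCoeff Rf xi l j.succ β q * logGrad j q)
    + 3 * Fin.cases (motive := fun _ => ℝ) 0 (fun k => logGrad k q) β

lemma sum_slope_mul_logGrad (hq : q.2 ≠ 0) :
    ∑ j, slope j q * logGrad j q = (bracket ‖q.2‖)⁻¹ := by
  have hr := norm_ne_zero_iff.2 hq
  have h : ∀ j, slope j q * logGrad j q
      = q.2 j ^ 2 * ((bracket ‖q.2‖)⁻¹ * (‖q.2‖ ^ 2)⁻¹) := fun j => by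
    simp only [slope, logGrad]; ring
  simp only [h, ← Finset.sum_mul, ← norm_sq_eq_sum]
  field_simp

lemma pertFirst_succ (k : Fin 4) :
    pertFirst Rf xi l k.succ q
      = jac Rf xi l q * (flatFirst Rf xi l k.succ q + catFirst Rf xi l k.succ q)
        - 3 * ∑ j : Fin 4, pertTensor Rf xi l j.succ k.succ q * logGrad j q := by
  have h : ∑ j : Fin 4, jac Rf xi l q * secondCoeff Rf xi l j.succ k.succ q * logGrad j q
      = (∑ j : Fin 4, pertTensor Rf xi l j.succ k.succ q * logGrad j q) + logGrad k q := by
    simp only [pertTensor, flatTensor_succ_succ, sub_mul, Finset.sum_sub_distrib, ite_mul, one_mul,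
      zero_mul, Finset.sum_ite_eq', Finset.mem_univ, if_true]
    ring
  rw [pertFirst, h, Fin.cases_succ]
  ring

/-- In the `σ`-component, the terms of size `r⁻¹` of the wave operator cancel against those of the
conjugation with `r ^ (3 / 2)`; what remains is `O((ε + 1 / r) r⁻²)`. -/
lemma pertFirst_zero (hq : q.2 ≠ 0) (hΛ : jac Rf xi l q ≠ 0)
    (hv : DifferentiableAt ℝ (frame Rf xi l 0 0) q) (hj : DifferentiableAt ℝ (jac Rf xi l) q)
    (hτ : DifferentiableAt ℝ (fun q : ℝ × E4 => deriv (retTime Rf l) q.1) q)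
    (hη : ∀ i, DifferentiableAt ℝ (fun q : ℝ × E4 => deriv (center Rf xi l) q.1 i) q) :
    pertFirst Rf xi l 0 q
      = -(bracket ‖q.2‖)⁻¹ ^ 3
        - (jac Rf xi l q)⁻¹ * ((∑ i, q.2 i * deriv (center Rf xi l) q.1 i)
          * (bracket ‖q.2‖)⁻¹ ^ 4)
        + (∑ k : Fin 4, frame Rf xi l 0 k.succ q * q.2 k) * (bracket ‖q.2‖)⁻¹ ^ 4
        - jac Rf xi l q * ((bracket ‖q.2‖)⁻¹ ^ 2 * frameDeriv Rf xi l 0 (frame Rf xi l 0 0) q)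
        + jac Rf xi l q * catFirst Rf xi l 0 q
        - 3 * ∑ j : Fin 4, pertTensor Rf xi l j.succ 0 q * logGrad j q := by
  have h : ∑ j : Fin 4, jac Rf xi l q * secondCoeff Rf xi l j.succ 0 q * logGrad j q
      = (∑ j : Fin 4, pertTensor Rf xi l j.succ 0 q * logGrad j q) - (bracket ‖q.2‖)⁻¹ := by
    have h1 : ∀ j : Fin 4, pertTensor Rf xi l j.succ 0 q * logGrad j q
        = jac Rf xi l q * secondCoeff Rf xi l j.succ 0 q * logGrad j q
          + slope j q * logGrad j q := fun j => by
      rw [pertTensor, flatTensor_succ_zero, slope]; ring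
    simp only [h1, Finset.sum_add_distrib, sum_slope_mul_logGrad hq]
    ring
  have h2 : ∀ j : Fin 4, pd j.succ (frame Rf xi l 0 0) q
      = -((jac Rf xi l q)⁻¹ ^ 2 * pd j.succ (jac Rf xi l) q) := fun j => by
    have : frame Rf xi l 0 0 = fun q => (jac Rf xi l q)⁻¹ := rfl
    rw [this, pd_comp (k := fun t => t⁻¹) (differentiableAt_inv hΛ) hj, deriv_inv]
    field_simp
  have h3 : ∑ j : Fin 4, slope j q * pd j.succ (frame Rf xi l 0 0) q
      = (jac Rf xi l q)⁻¹ ^ 2 * ((∑ i, q.2 i * deriv (center Rf xi l) q.1 i)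
        * (bracket ‖q.2‖)⁻¹ ^ 4) := by
    have h4 : ∀ j : Fin 4, slope j q * pd j.succ (frame Rf xi l 0 0) q
      = -((jac Rf xi l q)⁻¹ ^ 2) * (slope j q * pd j.succ (jac Rf xi l) q) := fun j => by
      rw [h2]; ring
    simp only [h4, ← Finset.mul_sum, sum_slope_mul_pd_jac hq hτ hη]
    ring
  rw [pertFirst, h, Fin.cases_zero, mul_add, flatFirst_eq hq hv, h3,
    sum_slope_mul_frameDeriv_slope hq, sum_pd_slope hq, frame_zero_zero]
  generalize (bracket ‖q.2‖)⁻¹ = b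
  field_simp
  ring

end pointwise

lemma isSymbol_jac_inv_sub_one :
    IsSymbol (smallFar A) (fun x => x.1.ε) fun d q => frame Rf d.xi d.l 0 0 q - 1 := by
  refine ((isSymbol_jac_sub_one (Rf := Rf)).neg.mul_one_right (isSymbol_jac_inv (Rf := Rf))).congr ?_
  filter_upwards [eventually_nhds_good (Rf := Rf)] with x hx
  filter_upwards [hx] with q hq
  have := hq.1
  rw [frame_zero_zero]
  field_simp
  ring

lemma logGrad_isBigO (j : Fin 4) :
    (fun x : Motion A × (ℝ × E4) => logGrad j x.2) =O[smallFar A] fun x => ‖x.2.2‖⁻¹ := by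
  refine IsBigO.of_bound 1 ?_
  filter_upwards [(radiusToInfinity_smallFar (A := A)).eventually_one_le] with x hx
  have hr : 0 < ‖x.2.2‖ := by linarith
  rw [logGrad, norm_div, Real.norm_eq_abs, Real.norm_of_nonneg (by positivity), one_mul,
    Real.norm_of_nonneg (by positivity), div_le_iff₀ (by positivity)]
  refine (abs_coord_le _ j).trans (le_of_eq ?_)
  field_simp

lemma frameDeriv_frame_zero_isBigO (μ β : Fin 5) :
    (fun x : Motion A × (ℝ × E4) => frameDeriv Rf x.1.xi x.1.l μ (frame Rf x.1.xi x.1.l 0 β) x.2)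
      =O[smallFar A] fun x => x.1.ε := by
  refine Fin.cases ?_ (fun k => (isSymbol_frame_zero_succ k).frameDeriv (Rf := Rf) μ) β
  refine ((isSymbol_jac_inv_sub_one (A := A) (Rf := Rf)).frameDeriv (Rf := Rf) μ).congr' ?_
    EventuallyEq.rfl
  filter_upwards [(isSymbol_frame (A := A) (Rf := Rf) 0 0).differentiable] with x hx
  simp only [frameDeriv, pd_sub hx (differentiableAt_const _), pd_const, sub_zero]

/-- The size of the component `β` of the perturbation of the first-order terms. -/
def vectorWeight (β : Fin 5) (x : Motion A × (ℝ × E4)) : ℝ :=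
  smallness x * compWeight ‖x.2.2‖ β * ‖x.2.2‖⁻¹

lemma bracket_inv_pow_isBigO (n : ℕ) :
    (fun x : Motion A × (ℝ × E4) => (bracket ‖x.2.2‖)⁻¹ ^ n) =O[smallFar A]
      fun x => ‖x.2.2‖⁻¹ ^ n :=
  (isSymbol_bracket_inv radiusToInfinity_smallFar).value.pow n

lemma sum_mul_coord_isBigO {f : Fin 4 → Motion A × (ℝ × E4) → ℝ}
    (hf : ∀ k, f k =O[smallFar A] fun x => x.1.ε) :
    (fun x : Motion A × (ℝ × E4) => (∑ k, f k x * x.2.2 k) * (bracket ‖x.2.2‖)⁻¹ ^ 4)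
      =O[smallFar A] fun x => x.1.ε * ‖x.2.2‖⁻¹ ^ 3 := by
  have h : (fun x : Motion A × (ℝ × E4) => ∑ k, f k x * x.2.2 k) =O[smallFar A]
      fun x => x.1.ε * ‖x.2.2‖ := IsBigO.fun_sum fun k _ =>
    (hf k).mul (isSymbol_coord radiusToInfinity_smallFar k).value
  refine (h.mul (bracket_inv_pow_isBigO 4)).trans (IsBigO.of_bound 1 ?_)
  filter_upwards [(radiusToInfinity_smallFar (A := A)).eventually_one_le] with x hx
  have : ‖x.2.2‖ ≠ 0 := by linarith
  rw [one_mul]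
  refine le_of_eq (congrArg _ ?_)
  field_simp

lemma pow_mul_isBigO {m n : ℕ} (h : m ≤ n) :
    (fun x : Motion A × (ℝ × E4) => x.1.ε * ‖x.2.2‖⁻¹ ^ n) =O[smallFar A]
      fun x => smallness x * ‖x.2.2‖⁻¹ ^ m :=
  size_isBigO_smallness.mul (pow_inv_isBigO h)

lemma pow_inv_isBigO_smallness {m n : ℕ} (h : m + 1 ≤ n) :
    (fun x : Motion A × (ℝ × E4) => ‖x.2.2‖⁻¹ ^ n) =O[smallFar A]
      fun x => smallness x * ‖x.2.2‖⁻¹ ^ m :=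
  (pow_inv_isBigO h).trans
    ((inv_isBigO_smallness.mul (isBigO_refl (fun x : Motion A × (ℝ × E4) => ‖x.2.2‖⁻¹ ^ m)
      (smallFar A))).congr_left fun x => by ring)

lemma flatFirst_succ_isBigO (k : Fin 4) :
    (fun x : Motion A × (ℝ × E4) => flatFirst Rf x.1.xi x.1.l k.succ x.2) =O[smallFar A]
      fun x => smallness x * ‖x.2.2‖⁻¹ ^ 1 := by
  have hv := isSymbol_frame_zero_succ (A := A) (Rf := Rf) k
  have hd : ∀ j : Fin 4, (fun x : Motion A × (ℝ × E4) =>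
      pd j.succ (frame Rf x.1.xi x.1.l 0 k.succ) x.2) =O[smallFar A] fun x => x.1.ε * ‖x.2.2‖⁻¹ :=
    fun j => hv.deriv j.succ
  have h0 : (fun x : Motion A × (ℝ × E4) => ∑ j : Fin 4, pd j.succ (slope j) x.2)
      =O[smallFar A] fun x => ‖x.2.2‖⁻¹ := IsBigO.fun_sum fun j _ =>
    ((isSymbol_slope (A := A) j).deriv j.succ).congr_right fun x => by simp
  have h1 : (fun x : Motion A × (ℝ × E4) => (∑ j : Fin 4, pd j.succ (slope j) x.2)
      * frame Rf x.1.xi x.1.l 0 k.succ x.2) =O[smallFar A]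
      fun x => smallness x * ‖x.2.2‖⁻¹ ^ 1 :=
    (h0.mul hv.value).trans
      ((pow_mul_isBigO (show 1 ≤ 1 from le_rfl)).congr_left fun x => by simp; ring)
  have h2 : (fun x : Motion A × (ℝ × E4) => ∑ j : Fin 4, slope j x.2
      * pd j.succ (frame Rf x.1.xi x.1.l 0 k.succ) x.2) =O[smallFar A]
      fun x => smallness x * ‖x.2.2‖⁻¹ ^ 1 :=
    (IsBigO.fun_sum fun j _ => (isSymbol_slope (A := A) j).value.mul (hd j)).trans
      ((pow_mul_isBigO (show 1 ≤ 1 from le_rfl)).congr_left fun x => by simp)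
  have h3 : (fun x : Motion A × (ℝ × E4) => (∑ i : Fin 4, frame Rf x.1.xi x.1.l 0 i.succ x.2
      * x.2.2 i) * (bracket ‖x.2.2‖)⁻¹ ^ 4 * frame Rf x.1.xi x.1.l 0 k.succ x.2) =O[smallFar A]
      fun x => smallness x * ‖x.2.2‖⁻¹ ^ 1 :=
    ((sum_mul_coord_isBigO fun i => (isSymbol_frame_zero_succ i).value).mul
      hv.of_size.value).trans
      ((pow_mul_isBigO (show 1 ≤ 3 by norm_num)).congr_left fun x => by simp)
  have h4 : (fun x : Motion A × (ℝ × E4) => (bracket ‖x.2.2‖)⁻¹ ^ 2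
      * frameDeriv Rf x.1.xi x.1.l 0 (frame Rf x.1.xi x.1.l 0 k.succ) x.2) =O[smallFar A]
      fun x => smallness x * ‖x.2.2‖⁻¹ ^ 1 :=
    ((bracket_inv_pow_isBigO 2).mul (frameDeriv_frame_zero_isBigO 0 k.succ)).trans
      ((pow_mul_isBigO (show 1 ≤ 2 by norm_num)).congr_left fun x => by ring)
  refine (((h1.neg_left.sub h2).add h3).sub h4).congr' ?_ EventuallyEq.rfl
  filter_upwards [hv.differentiable, (radiusToInfinity_smallFar (A := A)).eventually_ne] with x h5 h6
  rw [flatFirst_eq h6 h5, sum_slope_mul_frameDeriv_slope h6]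

lemma sum_pertTensor_mul_logGrad_isBigO (β : Fin 5) :
    (fun x : Motion A × (ℝ × E4) => ∑ j : Fin 4, pertTensor Rf x.1.xi x.1.l j.succ β x.2
      * logGrad j x.2) =O[smallFar A] vectorWeight β :=
  IsBigO.fun_sum fun j _ => ((isSymbol_pertTensor (Rf := Rf) j.succ β).value.mul
    (logGrad_isBigO j)).congr_right fun x => by
      simp only [tensorWeight, vectorWeight, compWeight_succ]; ring

lemma pertFirst_isBigO (β : Fin 5) :
    (fun x : Motion A × (ℝ × E4) => pertFirst Rf x.1.xi x.1.l β x.2) =O[smallFar A]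
      vectorWeight β := by
  have hj := (isSymbol_jac (A := A) (Rf := Rf)).value
  have hs := fun β => sum_pertTensor_mul_logGrad_isBigO (A := A) (Rf := Rf) β
  refine Fin.cases ?_ (fun k => ?_) β
  · have hw : (fun x : Motion A × (ℝ × E4) => smallness x * ‖x.2.2‖⁻¹ ^ 2) =O[smallFar A]
        vectorWeight 0 := (isBigO_refl _ _).congr_right fun x => by
      simp only [vectorWeight, compWeight_zero]; ring
    have h1 := (bracket_inv_pow_isBigO (A := A) 3).trans
      ((pow_inv_isBigO_smallness (show 2 + 1 ≤ 3 from le_rfl)).trans hw)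
    have h2 : (fun x : Motion A × (ℝ × E4) => (jac Rf x.1.xi x.1.l x.2)⁻¹
        * ((∑ i, x.2.2 i * deriv (center Rf x.1.xi x.1.l) x.2.1 i)
          * (bracket ‖x.2.2‖)⁻¹ ^ 4)) =O[smallFar A] vectorWeight 0 := by
      refine ((isSymbol_jac_inv (A := A) (Rf := Rf)).value.mul (sum_mul_coord_isBigO fun i =>
        (isSymbol_deriv_center (A := A) (Rf := Rf) i).value)).congr_left (fun x => ?_) |>.trans
          (((pow_mul_isBigO (show 2 ≤ 3 by norm_num)).trans hw).congr_left fun x => by ring)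
      simp only [mul_comm]
    have h3 : (fun x : Motion A × (ℝ × E4) => (∑ k : Fin 4, frame Rf x.1.xi x.1.l 0 k.succ x.2
        * x.2.2 k) * (bracket ‖x.2.2‖)⁻¹ ^ 4) =O[smallFar A] vectorWeight 0 :=
      (sum_mul_coord_isBigO fun i => (isSymbol_frame_zero_succ i).value).trans
        ((pow_mul_isBigO (show 2 ≤ 3 by norm_num)).trans hw)
    have h4 : (fun x : Motion A × (ℝ × E4) => jac Rf x.1.xi x.1.l x.2 * ((bracket ‖x.2.2‖)⁻¹ ^ 2
        * frameDeriv Rf x.1.xi x.1.l 0 (frame Rf x.1.xi x.1.l 0 0) x.2)) =O[smallFar A]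
        vectorWeight 0 :=
      (hj.mul ((bracket_inv_pow_isBigO 2).mul (frameDeriv_frame_zero_isBigO 0 0))).trans
        (((pow_mul_isBigO (show 2 ≤ 2 from le_rfl)).trans hw).congr_left fun x => by ring)
    have h5 : (fun x : Motion A × (ℝ × E4) => jac Rf x.1.xi x.1.l x.2
        * catFirst Rf x.1.xi x.1.l 0 x.2) =O[smallFar A] vectorWeight 0 :=
      (hj.mul (catFirst_isBigO 0)).trans
        (((pow_inv_isBigO_smallness (show 2 + 1 ≤ 4 by norm_num)).trans hw).congr_left
          fun x => by ring)
    refine (((((h1.neg_left.sub h2).add h3).sub h4).add h5).sub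
      ((hs 0).const_mul_left 3)).congr' ?_ EventuallyEq.rfl
    filter_upwards [(eventually_nhds_good (A := A) (Rf := Rf)).mono fun x hx => hx.self_of_nhds,
      (isSymbol_frame (A := A) (Rf := Rf) 0 0).differentiable,
      (isSymbol_jac (A := A) (Rf := Rf)).differentiable,
      (isSymbol_deriv_retTime_sub_one (A := A) (Rf := Rf)).differentiable,
      eventually_all.2 fun i => (isSymbol_deriv_center (A := A) (Rf := Rf) i).differentiable]
      with x h6 h7 h8 h9 h10
    rw [pertFirst_zero h6.2.2 h6.1 h7 h8 (by simpa using h9.add_const 1) h10]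
  · have hw : (fun x : Motion A × (ℝ × E4) => smallness x * ‖x.2.2‖⁻¹ ^ 1) =O[smallFar A]
        vectorWeight k.succ := (isBigO_refl _ _).congr_right fun x => by
      simp only [vectorWeight, compWeight_succ]; ring
    have h1 := hj.mul ((flatFirst_succ_isBigO (A := A) (Rf := Rf) k).add
      ((catFirst_isBigO (Rf := Rf) k.succ).trans
        (pow_inv_isBigO_smallness (show 1 + 1 ≤ 4 by norm_num))))
    refine ((h1.trans (hw.congr_left fun x => by ring)).sub
      ((hs k.succ).const_mul_left 3)).congr_left fun x => ?_
    rw [pertFirst_succ]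

end firstOrder

/-! ### The conjugated equation -/

section conjugation

open Filter Asymptotics

variable {A Rf : ℝ}

/-- The components `∂_β log r` for all coordinates. -/
def logGradFull (β : Fin 5) (q : ℝ × E4) : ℝ :=
  Fin.cases (motive := fun _ => ℝ) 0 (fun k => logGrad k q) β

/-- The zeroth-order coefficient of the conjugated operator, relative to `-(3/4) r⁻²`. -/
def pertZeroth (Rf : ℝ) (xi l : ℝ → E4) (q : ℝ × E4) : ℝ :=
  (∑ j : Fin 4, ∑ k : Fin 4, pertTensor Rf xi l j.succ k.succ q
      * (9 / 4 * (logGrad j q * logGrad k q) - 3 / 2 * pd j.succ (logGrad k) q))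
    - 3 / 2 * ∑ j : Fin 4, jac Rf xi l q
      * (flatFirst Rf xi l j.succ q + catFirst Rf xi l j.succ q) * logGrad j q

section pointwise

variable {xi l : ℝ → E4} {q : ℝ × E4}

lemma contDiffAt_logGradFull {n : WithTop ℕ∞} (hq : q.2 ≠ 0) (β : Fin 5) :
    ContDiffAt ℝ n (logGradFull β) q :=
  Fin.cases contDiffAt_const (fun k => (contDiff_coord k).contDiffAt.div
    ((contDiffAt_norm_snd hq).pow 2) (pow_ne_zero 2 (norm_ne_zero_iff.2 hq))) β

lemma pd_logGrad (hq : q.2 ≠ 0) (j k : Fin 4) :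
    pd j.succ (logGrad k) q
      = (if j = k then (‖q.2‖ ^ 2)⁻¹ else 0) - 2 * (logGrad j q * logGrad k q) := by
  have hr := norm_ne_zero_iff.2 hq
  have hd : DifferentiableAt ℝ (fun x : ℝ × E4 => (‖x.2‖ ^ 2)⁻¹) q :=
    (((contDiffAt_norm_snd (n := 1) hq).pow 2).inv (pow_ne_zero 2 hr)).differentiableAt
      (by norm_num)
  have : logGrad k = fun x => x.2 k * (‖x.2‖ ^ 2)⁻¹ := by
    funext x; simp [logGrad, div_eq_mul_inv]
  have h1 : pd j.succ (fun x : ℝ × E4 => (‖x.2‖ ^ 2)⁻¹) q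
      = -((‖q.2‖ ^ 2) ^ 2)⁻¹ * (2 * q.2 j) := by
    rw [pd_comp (f := fun x : ℝ × E4 => ‖x.2‖ ^ 2) (k := fun t => t⁻¹)
      (differentiableAt_inv (pow_ne_zero 2 hr)) (((contDiffAt_norm_snd (n := 1) hq).pow
        2).differentiableAt (by norm_num)), deriv_inv, pd_succ_norm_sq]
  rw [this, pd_mul (differentiableAt_coord k) hd, pd_succ_coord, h1]
  simp only [logGrad]
  split_ifs <;> field_simp <;> ring

lemma pd_zero_logGradFull (hq : q.2 ≠ 0) (β : Fin 5) : pd 0 (logGradFull β) q = 0 := by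
  refine Fin.cases (pd_const _) (fun k => ?_) β
  refine pd_zero_snd (f := fun y => y k / ‖y‖ ^ 2) ?_
  have h1 : DifferentiableAt ℝ (fun y : E4 => y k) q.2 :=
    (EuclideanSpace.proj k : E4 →L[ℝ] ℝ).differentiableAt
  have h2 : DifferentiableAt ℝ (fun y : E4 => ‖y‖ ^ 2) q.2 :=
    (differentiableAt_id.norm ℝ hq).fun_pow 2
  simpa only [div_eq_mul_inv] using
    h1.fun_mul (h2.fun_inv (pow_ne_zero 2 (norm_ne_zero_iff.2 hq)))

lemma sum_logGrad_sq (hq : q.2 ≠ 0) : ∑ j, logGrad j q * logGrad j q = (‖q.2‖ ^ 2)⁻¹ := by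
  have hr := norm_ne_zero_iff.2 hq
  have h : ∀ j, logGrad j q * logGrad j q = q.2 j ^ 2 * ((‖q.2‖ ^ 2) ^ 2)⁻¹ := fun j => by
    simp only [logGrad]; ring
  simp only [h, ← Finset.sum_mul, ← norm_sq_eq_sum]
  field_simp

lemma pd_norm_rpow (hq : q.2 ≠ 0) (β : Fin 5) (p : ℝ) :
    pd β (fun x : ℝ × E4 => ‖x.2‖ ^ p) q = ‖q.2‖ ^ p * (p * logGradFull β q) := by
  have hr : 0 < ‖q.2‖ := norm_pos_iff.2 hq
  have hd := (Real.hasDerivAt_rpow_const (x := ‖q.2‖) (p := p) (Or.inl hr.ne'))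
  refine Fin.cases ?_ (fun k => ?_) β
  · rw [pd_zero_radial hq hd.differentiableAt]
    simp [logGradFull]
  · rw [pd_succ_radial k hq hd.differentiableAt, hd.deriv, logGradFull, Fin.cases_succ, logGrad,
      Real.rpow_sub_one hr.ne']
    field_simp

/-- `φ = r^{3/2} u`. -/
def conjugate (u : ℝ × E4 → ℝ) (q : ℝ × E4) : ℝ := ‖q.2‖ ^ (3 / 2 : ℝ) * u q

lemma contDiffAt_norm_rpow {n : WithTop ℕ∞} (hq : q.2 ≠ 0) (p : ℝ) :
    ContDiffAt ℝ n (fun x : ℝ × E4 => ‖x.2‖ ^ p) q :=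
  (contDiffAt_norm_snd hq).rpow_const_of_ne (norm_ne_zero_iff.2 hq)

lemma contDiffAt_conjugate {n : WithTop ℕ∞} {u : ℝ × E4 → ℝ} (hq : q.2 ≠ 0)
    (hu : ContDiffAt ℝ n u q) : ContDiffAt ℝ n (conjugate u) q :=
  (contDiffAt_norm_rpow hq _).mul hu

lemma pd_conjugate {u : ℝ × E4 → ℝ} (hq : q.2 ≠ 0) (hu : DifferentiableAt ℝ u q) (β : Fin 5) :
    pd β (conjugate u) q
      = ‖q.2‖ ^ (3 / 2 : ℝ) * (pd β u q + 3 / 2 * (logGradFull β q * u q)) := by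
  have hd : DifferentiableAt ℝ (fun x : ℝ × E4 => ‖x.2‖ ^ (3 / 2 : ℝ)) q :=
    (contDiffAt_norm_rpow (n := 1) hq _).differentiableAt (by norm_num)
  have : conjugate u = fun x => ‖x.2‖ ^ (3 / 2 : ℝ) * u x := rfl
  rw [this, pd_mul hd hu, pd_norm_rpow hq]
  ring

lemma pd_pd_conjugate {u : ℝ × E4 → ℝ} (hq : q.2 ≠ 0) (hu : ContDiffAt ℝ 2 u q) (α β : Fin 5) :
    ‖q.2‖ ^ (3 / 2 : ℝ) * pd α (pd β u) q = pd α (pd β (conjugate u)) q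
      - 3 / 2 * (logGradFull β q * pd α (conjugate u) q + logGradFull α q * pd β (conjugate u) q)
      + (9 / 4 * (logGradFull α q * logGradFull β q) - 3 / 2 * pd α (logGradFull β) q)
        * conjugate u q := by
  have hu1 : DifferentiableAt ℝ u q := hu.differentiableAt (by norm_num)
  have hp : DifferentiableAt ℝ (pd β u) q :=
    (contDiffAt_pd (n := 1) (by exact_mod_cast hu)).differentiableAt (by norm_num)
  have hT : DifferentiableAt ℝ (logGradFull β) q :=
    (contDiffAt_logGradFull (n := 1) hq β).differentiableAt (by norm_num)
  have hd : DifferentiableAt ℝ (fun x : ℝ × E4 => ‖x.2‖ ^ (3 / 2 : ℝ)) q :=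
    (contDiffAt_norm_rpow (n := 1) hq _).differentiableAt (by norm_num)
  have he : pd β (conjugate u) =ᶠ[nhds q]
      fun x => ‖x.2‖ ^ (3 / 2 : ℝ) * (pd β u x + 3 / 2 * (logGradFull β x * u x)) := by
    filter_upwards [hu.eventually (by simp), continuous_snd.continuousAt.eventually_ne hq]
      with x h1 h2
    exact pd_conjugate h2 (h1.differentiableAt (by norm_num)) β
  rw [pd_congr he, pd_mul hd (hp.fun_add ((hT.fun_mul hu1).const_mul _)),
    pd_add hp ((hT.fun_mul hu1).const_mul _), pd_mul (differentiableAt_const _) (hT.fun_mul hu1),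
    pd_const, pd_mul hT hu1, pd_norm_rpow hq, pd_conjugate hq hu1, pd_conjugate hq hu1, conjugate]
  ring

end pointwise

/-- Conjugation of a second-order operator by a weight with logarithmic gradient `T`. -/
lemma sum_conjugation {A P dT : Fin 5 → Fin 5 → ℝ} {D p T : Fin 5 → ℝ} {φ : ℝ}
    (hA : ∀ α β, A α β = A β α) :
    (∑ α, ∑ β, A α β * (P α β - 3 / 2 * (T β * p α + T α * p β)
        + (9 / 4 * (T α * T β) - 3 / 2 * dT α β) * φ)) + ∑ β, D β * (p β - 3 / 2 * (T β * φ))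
      = (∑ α, ∑ β, A α β * P α β) + (∑ β, (D β - 3 * ∑ α, A α β * T α) * p β)
        + ((∑ α, ∑ β, A α β * (9 / 4 * (T α * T β) - 3 / 2 * dT α β))
          - 3 / 2 * ∑ β, D β * T β) * φ := by
  have h1 : ∑ α, ∑ β, A α β * (T β * p α) = ∑ β, (∑ α, A α β * T α) * p β := by
    refine Finset.sum_congr rfl fun α _ => ?_
    rw [Finset.sum_mul]
    exact Finset.sum_congr rfl fun β _ => by rw [hA α β]; ring
  have h2 : ∑ α, ∑ β, A α β * (T α * p β) = ∑ β, (∑ α, A α β * T α) * p β := by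
    rw [Finset.sum_comm]
    refine Finset.sum_congr rfl fun β _ => ?_
    rw [Finset.sum_mul]
    exact Finset.sum_congr rfl fun α _ => by ring
  have h3 : (∑ α, ∑ β, A α β * (P α β - 3 / 2 * (T β * p α + T α * p β)
        + (9 / 4 * (T α * T β) - 3 / 2 * dT α β) * φ))
      = (∑ α, ∑ β, A α β * P α β) - 3 / 2 * (∑ α, ∑ β, A α β * (T β * p α))
        - 3 / 2 * (∑ α, ∑ β, A α β * (T α * p β))
        + (∑ α, ∑ β, A α β * (9 / 4 * (T α * T β) - 3 / 2 * dT α β)) * φ := by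
    simp only [Finset.mul_sum, Finset.sum_mul, ← Finset.sum_sub_distrib, ← Finset.sum_add_distrib]
    exact Finset.sum_congr rfl fun α _ => Finset.sum_congr rfl fun β _ => by ring
  have h4 : ∑ β, D β * (p β - 3 / 2 * (T β * φ))
      = (∑ β, D β * p β) - 3 / 2 * (∑ β, D β * T β) * φ := by
    simp only [Finset.mul_sum, Finset.sum_mul, ← Finset.sum_sub_distrib]
    exact Finset.sum_congr rfl fun β _ => by ring
  have h5 : ∑ β, (D β - 3 * ∑ α, A α β * T α) * p β
      = (∑ β, D β * p β) - 3 * ∑ β, (∑ α, A α β * T α) * p β := by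
    simp only [sub_mul, Finset.sum_sub_distrib]
    rw [Finset.mul_sum]
    simp only [mul_assoc]
  rw [h3, h4, h5, h1, h2]
  ring

section operator

variable {d : Motion A} {q : ℝ × E4}

lemma Motion.dX_eq (hΛ : jac Rf d.xi d.l q ≠ 0) (hl : ‖d.l q.1‖ < 1) (hq : q.2 ≠ 0) (μ : Fin 5)
    (f : ℝ × E4 → ℝ) : dX Rf d.xi d.l μ f q = frameDeriv Rf d.xi d.l μ f q :=
  dX_eq_sum_frame (d.hasDerivAt_retTime hl).differentiableAt
    (d.hasDerivAt_center hl).differentiableAt hq hΛ μ f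

lemma frameDeriv_congr {xi l : ℝ → E4} {f g : ℝ × E4 → ℝ} (h : f =ᶠ[nhds q] g) (μ : Fin 5) :
    frameDeriv Rf xi l μ f q = frameDeriv Rf xi l μ g q := by
  simp only [frameDeriv, pd_congr h]

lemma frameDeriv_frameDeriv {xi l : ℝ → E4} {u : ℝ × E4 → ℝ} (hu : ContDiffAt ℝ 2 u q)
    (ν μ : Fin 5) (hV : ∀ β, DifferentiableAt ℝ (frame Rf xi l ν β) q) :
    frameDeriv Rf xi l μ (frameDeriv Rf xi l ν u) q
      = (∑ α, ∑ β, frame Rf xi l μ α q * frame Rf xi l ν β q * pd α (pd β u) q)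
        + ∑ β, frameDeriv Rf xi l μ (frame Rf xi l ν β) q * pd β u q := by
  have hp : ∀ β, DifferentiableAt ℝ (pd β u) q := fun β =>
    (contDiffAt_pd (n := 1) (by exact_mod_cast hu)).differentiableAt (by norm_num)
  have h1 : ∀ α, pd α (frameDeriv Rf xi l ν u) q = ∑ β, (pd α (frame Rf xi l ν β) q * pd β u q
      + frame Rf xi l ν β q * pd α (pd β u) q) := fun α => by
    have : frameDeriv Rf xi l ν u = fun x => ∑ β, frame Rf xi l ν β x * pd β u x := rfl
    rw [this, pd_sum fun β _ => (hV β).fun_mul (hp β)]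
    exact Finset.sum_congr rfl fun β _ => pd_mul (hV β) (hp β)
  have h2 : ∑ β, frameDeriv Rf xi l μ (frame Rf xi l ν β) q * pd β u q
      = ∑ α, ∑ β, frame Rf xi l μ α q * (pd α (frame Rf xi l ν β) q * pd β u q) := by
    rw [Finset.sum_comm]
    simp only [frameDeriv, Finset.sum_mul, mul_assoc]
  rw [h2, ← Finset.sum_add_distrib]
  conv_lhs => rw [frameDeriv]
  refine Finset.sum_congr rfl fun α _ => ?_
  rw [h1, Finset.mul_sum, ← Finset.sum_add_distrib]
  exact Finset.sum_congr rfl fun β _ => by ring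

/-- `P_graph` in terms of the moving frame. -/
lemma pGraph_eq_frameDeriv (hg : ∀ᶠ q in nhds q, jac Rf d.xi d.l q ≠ 0 ∧ ‖d.l q.1‖ < 1 ∧ q.2 ≠ 0)
    (u : ℝ × E4 → ℝ) :
    pGraph Rf d.xi d.l u q
      = (∑ μ, mink μ * frameDeriv Rf d.xi d.l μ (frameDeriv Rf d.xi d.l μ u) q)
        - (∑ μ, ∑ ν, catTensor Rf d.xi d.l μ ν q
          * frameDeriv Rf d.xi d.l μ (frameDeriv Rf d.xi d.l ν u) q)
        + ∑ ν, catVector Rf d.xi d.l ν q * frameDeriv Rf d.xi d.l ν u q := by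
  have h1 : ∀ μ f, dX Rf d.xi d.l μ f q = frameDeriv Rf d.xi d.l μ f q := fun μ f =>
    d.dX_eq hg.self_of_nhds.1 hg.self_of_nhds.2.1 hg.self_of_nhds.2.2 μ f
  have h2 : ∀ ν f, dX Rf d.xi d.l ν f =ᶠ[nhds q] frameDeriv Rf d.xi d.l ν f := fun ν f =>
    hg.mono fun x hx => d.dX_eq hx.1 hx.2.1 hx.2.2 ν f
  have h3 : ∀ μ ν f, dX Rf d.xi d.l μ (dX Rf d.xi d.l ν f) q
      = frameDeriv Rf d.xi d.l μ (frameDeriv Rf d.xi d.l ν f) q := fun μ ν f => by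
    rw [h1, frameDeriv_congr (h2 ν f)]
  have h4 : ∀ ν, frameDeriv Rf d.xi d.l ν (profile d.l) = gradQ Rf d.xi d.l ν := fun ν => rfl
  have h5 : 1 + ∑ a, mink a * gradQ Rf d.xi d.l a q ^ 2 = slopeFactor Rf d.xi d.l q := rfl
  simp only [pGraph, h3]
  simp only [h1, h4, h5]
  have e1 : (slopeFactor Rf d.xi d.l q)⁻¹ * (∑ μ, ∑ ν, (mink μ * gradQ Rf d.xi d.l μ q)
      * (mink ν * gradQ Rf d.xi d.l ν q)
      * frameDeriv Rf d.xi d.l μ (frameDeriv Rf d.xi d.l ν u) q)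
      = ∑ μ, ∑ ν, catTensor Rf d.xi d.l μ ν q
          * frameDeriv Rf d.xi d.l μ (frameDeriv Rf d.xi d.l ν u) q := by
    simp only [Finset.mul_sum, catTensor, mul_assoc]
  have e2 : ∑ ν, catVector Rf d.xi d.l ν q * frameDeriv Rf d.xi d.l ν u q
      = -(2 * (slopeFactor Rf d.xi d.l q)⁻¹ * ∑ μ, ∑ ν, mink μ * mink ν
        * frameDeriv Rf d.xi d.l μ (gradQ Rf d.xi d.l ν) q * gradQ Rf d.xi d.l μ q
          * frameDeriv Rf d.xi d.l ν u q)
      + 2 * (slopeFactor Rf d.xi d.l q ^ 2)⁻¹ * ∑ μ, ∑ ν, ∑ lam,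
        (mink ν * gradQ Rf d.xi d.l ν q) * (mink μ * gradQ Rf d.xi d.l μ q)
        * (mink lam * gradQ Rf d.xi d.l lam q)
        * frameDeriv Rf d.xi d.l lam (gradQ Rf d.xi d.l μ) q * frameDeriv Rf d.xi d.l ν u q := by
    rw [Finset.sum_comm (f := fun μ ν => mink μ * mink ν
        * frameDeriv Rf d.xi d.l μ (gradQ Rf d.xi d.l ν) q * gradQ Rf d.xi d.l μ q
          * frameDeriv Rf d.xi d.l ν u q),
      Finset.sum_comm (f := fun μ ν => ∑ lam,
        (mink ν * gradQ Rf d.xi d.l ν q) * (mink μ * gradQ Rf d.xi d.l μ q)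
        * (mink lam * gradQ Rf d.xi d.l lam q)
        * frameDeriv Rf d.xi d.l lam (gradQ Rf d.xi d.l μ) q * frameDeriv Rf d.xi d.l ν u q),
      Finset.mul_sum, Finset.mul_sum, ← Finset.sum_neg_distrib, ← Finset.sum_add_distrib]
    refine Finset.sum_congr rfl fun ν _ => ?_
    simp only [catVector, add_mul, neg_mul, mul_assoc, Finset.sum_mul]
  rw [e1, e2]
  ring

lemma sum_comm_three (f : Fin 5 → Fin 5 → Fin 5 → ℝ) :
    ∑ α, ∑ β, ∑ μ, f α β μ = ∑ μ, ∑ α, ∑ β, f α β μ := by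
  rw [Finset.sum_comm (f := fun μ α => ∑ β, f α β μ)]
  exact Finset.sum_congr rfl fun α _ => Finset.sum_comm

/-- `P_graph` in the coordinates `(σ, y)`. -/
lemma pGraph_eq_coeff (hg : ∀ᶠ q in nhds q, jac Rf d.xi d.l q ≠ 0 ∧ ‖d.l q.1‖ < 1 ∧ q.2 ≠ 0)
    (hV : ∀ ν β, DifferentiableAt ℝ (frame Rf d.xi d.l ν β) q) {u : ℝ × E4 → ℝ}
    (hu : ContDiffAt ℝ 2 u q) :
    pGraph Rf d.xi d.l u q
      = (∑ α, ∑ β, secondCoeff Rf d.xi d.l α β q * pd α (pd β u) q)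
        + ∑ β, (flatFirst Rf d.xi d.l β q + catFirst Rf d.xi d.l β q) * pd β u q := by
  rw [pGraph_eq_frameDeriv hg]
  simp only [frameDeriv_frameDeriv hu _ _ (hV _)]
  generalize hP : (fun α β => pd α (pd β u) q) = P
  generalize hp : (fun β => pd β u q) = p
  have hP' : ∀ α β, pd α (pd β u) q = P α β := fun α β => congrFun (congrFun hP α) β
  have hp' : ∀ β, pd β u q = p β := fun β => congrFun hp β
  have e0 : ∀ ν, frameDeriv Rf d.xi d.l ν u q = ∑ β, frame Rf d.xi d.l ν β q * p β := fun ν => by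
    simp only [frameDeriv, hp']
  simp only [hP', hp', e0]
  have e1 : ∑ α, ∑ β, secondCoeff Rf d.xi d.l α β q * P α β
      = (∑ μ, mink μ * ∑ α, ∑ β, frame Rf d.xi d.l μ α q * frame Rf d.xi d.l μ β q * P α β)
        - ∑ μ, ∑ ν, catTensor Rf d.xi d.l μ ν q
          * ∑ α, ∑ β, frame Rf d.xi d.l μ α q * frame Rf d.xi d.l ν β q * P α β := by
    simp only [secondCoeff, sub_mul, Finset.sum_sub_distrib, Finset.sum_mul, Finset.mul_sum]
    rw [sum_comm_three (fun α β μ =>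
      mink μ * (frame Rf d.xi d.l μ α q * frame Rf d.xi d.l μ β q) * P α β),
      sum_comm_three (fun α β μ => ∑ ν, catTensor Rf d.xi d.l μ ν q
        * (frame Rf d.xi d.l μ α q * frame Rf d.xi d.l ν β q) * P α β)]
    refine congrArg₂ (· - ·) (by simp only [mul_assoc]) (Finset.sum_congr rfl fun μ _ => ?_)
    rw [sum_comm_three (fun α β ν => catTensor Rf d.xi d.l μ ν q
        * (frame Rf d.xi d.l μ α q * frame Rf d.xi d.l ν β q) * P α β)]
    simp only [mul_assoc]
  have e2 : ∑ β, (flatFirst Rf d.xi d.l β q + catFirst Rf d.xi d.l β q) * p β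
      = (∑ μ, mink μ * ∑ β, frameDeriv Rf d.xi d.l μ (frame Rf d.xi d.l μ β) q * p β)
        - (∑ μ, ∑ ν, catTensor Rf d.xi d.l μ ν q
          * ∑ β, frameDeriv Rf d.xi d.l μ (frame Rf d.xi d.l ν β) q * p β)
        + ∑ ν, catVector Rf d.xi d.l ν q * ∑ β, frame Rf d.xi d.l ν β q * p β := by
    simp only [flatFirst, catFirst, add_mul, sub_mul, Finset.sum_add_distrib,
      Finset.sum_sub_distrib, Finset.sum_mul, Finset.mul_sum, mul_assoc]
    rw [Finset.sum_comm, Finset.sum_comm (f := fun β ν => catVector Rf d.xi d.l ν q *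
      (frame Rf d.xi d.l ν β q * p β)), ← sum_comm_three (f := fun μ ν β =>
        catTensor Rf d.xi d.l μ ν q * (frameDeriv Rf d.xi d.l μ (frame Rf d.xi d.l ν β) q * p β))]
    ring
  rw [e1, e2]
  simp only [mul_add, Finset.sum_add_distrib]
  ring

end operator

end conjugation

section conjugation

open Filter Asymptotics

variable {A Rf : ℝ}

lemma pertFirst_eq {xi l : ℝ → E4} {q : ℝ × E4} (β : Fin 5) :
    jac Rf xi l q * (flatFirst Rf xi l β q + catFirst Rf xi l β q)
      - 3 * ∑ α, jac Rf xi l q * secondCoeff Rf xi l α β q * logGradFull α q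
      = pertFirst Rf xi l β q - 3 * logGradFull β q := by
  have h : ∑ α, jac Rf xi l q * secondCoeff Rf xi l α β q * logGradFull α q
      = ∑ j : Fin 4, jac Rf xi l q * secondCoeff Rf xi l j.succ β q * logGrad j q := by
    rw [Fin.sum_univ_succ]
    simp [logGradFull]
  rw [h, pertFirst]
  have : logGradFull β q = Fin.cases (motive := fun _ => ℝ) 0 (fun k => logGrad k q) β := rfl
  rw [this]
  ring

lemma pertZeroth_eq {xi l : ℝ → E4} {q : ℝ × E4} (hq : q.2 ≠ 0) :
    (∑ α, ∑ β, jac Rf xi l q * secondCoeff Rf xi l α β q * (9 / 4 * (logGradFull α q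
        * logGradFull β q) - 3 / 2 * pd α (logGradFull β) q))
      - 3 / 2 * ∑ β, jac Rf xi l q * (flatFirst Rf xi l β q + catFirst Rf xi l β q)
        * logGradFull β q
      = -(3 / 4) / ‖q.2‖ ^ 2 + pertZeroth Rf xi l q := by
  have h0 : logGradFull 0 q = 0 := rfl
  have hc : logGradFull 0 = fun _ => 0 := rfl
  have hs : ∀ k : Fin 4, logGradFull k.succ = logGrad k := fun k => rfl
  have h1 : ∀ f : Fin 5 → ℝ, ∑ β, f β * logGradFull β q = ∑ j : Fin 4, f j.succ * logGrad j q :=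
    fun f => by rw [Fin.sum_univ_succ, h0, mul_zero, zero_add]; rfl
  have h2 : ∀ f : Fin 5 → Fin 5 → ℝ, ∑ α, ∑ β, f α β * (9 / 4 * (logGradFull α q
        * logGradFull β q) - 3 / 2 * pd α (logGradFull β) q)
      = ∑ j : Fin 4, ∑ k : Fin 4, f j.succ k.succ
        * (9 / 4 * (logGrad j q * logGrad k q) - 3 / 2 * pd j.succ (logGrad k) q) := fun f => by
    rw [Fin.sum_univ_succ]
    simp only [h0, pd_zero_logGradFull hq, zero_mul, mul_zero, sub_zero, Finset.sum_const_zero,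
      zero_add]
    refine Finset.sum_congr rfl fun j _ => ?_
    rw [Fin.sum_univ_succ, hc, pd_const]
    simp only [hs]
    ring
  have h3 : ∑ j : Fin 4, (9 / 4 * (logGrad j q * logGrad j q) - 3 / 2 * pd j.succ (logGrad j) q)
      = -(3 / 4) / ‖q.2‖ ^ 2 := by
    have : ∀ j : Fin 4, 9 / 4 * (logGrad j q * logGrad j q) - 3 / 2 * pd j.succ (logGrad j) q
        = 21 / 4 * (logGrad j q * logGrad j q) - 3 / 2 * (‖q.2‖ ^ 2)⁻¹ := fun j => by
      rw [pd_logGrad hq, if_pos rfl]; ring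
    simp only [this, Finset.sum_sub_distrib, ← Finset.mul_sum, sum_logGrad_sq hq]
    simp
    ring
  rw [h1 (fun β => jac Rf xi l q * (flatFirst Rf xi l β q + catFirst Rf xi l β q)),
    h2 (fun α β => jac Rf xi l q * secondCoeff Rf xi l α β q), pertZeroth, ← h3]
  have h4 : ∀ j k : Fin 4, jac Rf xi l q * secondCoeff Rf xi l j.succ k.succ q
      = (if j = k then 1 else 0) + pertTensor Rf xi l j.succ k.succ q := fun j k => by
    rw [pertTensor, flatTensor_succ_succ]; ring
  simp only [h4, add_mul, Finset.sum_add_distrib, ite_mul, one_mul, zero_mul, Finset.sum_ite_eq,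
    Finset.mem_univ, if_true]
  ring

/-- The equation for `φ = r^{3/2} u`, multiplied by the Jacobian of the chart. -/
lemma conjugated_equation {d : Motion A} {q : ℝ × E4}
    (hg : ∀ᶠ q in nhds q, jac Rf d.xi d.l q ≠ 0 ∧ ‖d.l q.1‖ < 1 ∧ q.2 ≠ 0)
    (hV : ∀ ν β, DifferentiableAt ℝ (frame Rf d.xi d.l ν β) q) {u : ℝ × E4 → ℝ}
    (hu : ContDiffAt ℝ 2 u q) :
    (∑ α, ∑ β, (flatTensor α β q + pertTensor Rf d.xi d.l α β q) * pd α (pd β (conjugate u)) q)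
      - 3 * (∑ j : Fin 4, q.2 j * pd j.succ (conjugate u) q) / ‖q.2‖ ^ 2
      + (∑ β, pertFirst Rf d.xi d.l β q * pd β (conjugate u) q)
      + (-(3 / 4) / ‖q.2‖ ^ 2 + pertZeroth Rf d.xi d.l q) * conjugate u q
      = jac Rf d.xi d.l q * (‖q.2‖ ^ (3 / 2 : ℝ) * pGraph Rf d.xi d.l u q) := by
  have hq := hg.self_of_nhds.2.2
  have hu1 : DifferentiableAt ℝ u q := hu.differentiableAt (by norm_num)
  have h1 : ∀ β, ‖q.2‖ ^ (3 / 2 : ℝ) * pd β u q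
      = pd β (conjugate u) q - 3 / 2 * (logGradFull β q * conjugate u q) := fun β => by
    rw [pd_conjugate hq hu1, conjugate]; ring
  have h2 : jac Rf d.xi d.l q * (‖q.2‖ ^ (3 / 2 : ℝ) * pGraph Rf d.xi d.l u q)
      = (∑ α, ∑ β, jac Rf d.xi d.l q * secondCoeff Rf d.xi d.l α β q
          * (‖q.2‖ ^ (3 / 2 : ℝ) * pd α (pd β u) q))
        + ∑ β, jac Rf d.xi d.l q * (flatFirst Rf d.xi d.l β q + catFirst Rf d.xi d.l β q)
          * (‖q.2‖ ^ (3 / 2 : ℝ) * pd β u q) := by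
    rw [pGraph_eq_coeff hg hV hu]
    simp only [mul_add, Finset.mul_sum]
    exact congrArg₂ _ (Finset.sum_congr rfl fun α _ => Finset.sum_congr rfl fun β _ => by ring)
      (Finset.sum_congr rfl fun β _ => by ring)
  have h3 := sum_conjugation (A := fun α β => jac Rf d.xi d.l q * secondCoeff Rf d.xi d.l α β q)
    (P := fun α β => pd α (pd β (conjugate u)) q) (dT := fun α β => pd α (logGradFull β) q)
    (D := fun β => jac Rf d.xi d.l q * (flatFirst Rf d.xi d.l β q + catFirst Rf d.xi d.l β q))
    (p := fun β => pd β (conjugate u) q) (T := fun β => logGradFull β q) (φ := conjugate u q)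
    fun α β => by rw [secondCoeff_symm]
  have h4 : ∑ β, logGradFull β q * pd β (conjugate u) q
      = (∑ j : Fin 4, q.2 j * pd j.succ (conjugate u) q) / ‖q.2‖ ^ 2 := by
    rw [Fin.sum_univ_succ, Finset.sum_div]
    simp only [logGradFull, Fin.cases_zero, Fin.cases_succ, zero_mul, zero_add, logGrad]
    exact Finset.sum_congr rfl fun j _ => by ring
  have h5 : ∑ α, ∑ β, (flatTensor α β q + pertTensor Rf d.xi d.l α β q)
        * pd α (pd β (conjugate u)) q
      = ∑ α, ∑ β, jac Rf d.xi d.l q * secondCoeff Rf d.xi d.l α β q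
        * pd α (pd β (conjugate u)) q := by
    simp only [pertTensor, add_sub_cancel]
  rw [h2]
  simp only [pd_pd_conjugate hq hu, h1]
  have h6 : ∑ β, (pertFirst Rf d.xi d.l β q - 3 * logGradFull β q) * pd β (conjugate u) q
      = (∑ β, pertFirst Rf d.xi d.l β q * pd β (conjugate u) q)
        - 3 * ((∑ j : Fin 4, q.2 j * pd j.succ (conjugate u) q) / ‖q.2‖ ^ 2) := by
    rw [← h4, Finset.mul_sum, ← Finset.sum_sub_distrib]
    exact Finset.sum_congr rfl fun β _ => by ring
  rw [h3, pertZeroth_eq hq, h5]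
  simp only [pertFirst_eq]
  rw [h6]
  ring

lemma pertZeroth_isBigO :
    (fun x : Motion A × (ℝ × E4) => pertZeroth Rf x.1.xi x.1.l x.2) =O[smallFar A]
      fun x => smallness x * ‖x.2.2‖⁻¹ ^ 2 := by
  have hL := radiusToInfinity_smallFar (A := A)
  have hd : ∀ j k : Fin 4, (fun x : Motion A × (ℝ × E4) => 9 / 4 * (logGrad j x.2 * logGrad k x.2)
      - 3 / 2 * pd j.succ (logGrad k) x.2) =O[smallFar A] fun x => ‖x.2.2‖⁻¹ ^ 2 := fun j k => by
    have h1 : (fun x : Motion A × (ℝ × E4) => logGrad j x.2 * logGrad k x.2) =O[smallFar A]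
        fun x => ‖x.2.2‖⁻¹ ^ 2 :=
      ((logGrad_isBigO j).mul (logGrad_isBigO k)).congr_right fun x => by ring
    have h2 : (fun x : Motion A × (ℝ × E4) => if j = k then (‖x.2.2‖ ^ 2)⁻¹ else 0)
        =O[smallFar A] fun x => ‖x.2.2‖⁻¹ ^ 2 := by
      split_ifs
      · exact (isBigO_refl _ _).congr_left fun x => by simp
      · exact isBigO_zero _ _
    refine ((h1.const_mul_left (9 / 4)).sub ((h2.sub (h1.const_mul_left 2)).const_mul_left
      (3 / 2))).congr' ?_ EventuallyEq.rfl
    filter_upwards [hL.eventually_ne] with x hx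
    rw [pd_logGrad hx]
  have h1 : (fun x : Motion A × (ℝ × E4) => ∑ j : Fin 4, ∑ k : Fin 4,
      pertTensor Rf x.1.xi x.1.l j.succ k.succ x.2
      * (9 / 4 * (logGrad j x.2 * logGrad k x.2) - 3 / 2 * pd j.succ (logGrad k) x.2))
      =O[smallFar A] fun x => smallness x * ‖x.2.2‖⁻¹ ^ 2 :=
    IsBigO.fun_sum fun j _ => IsBigO.fun_sum fun k _ =>
      ((isSymbol_pertTensor (Rf := Rf) j.succ k.succ).value.mul (hd j k)).congr_right fun x => by
        simp only [tensorWeight, compWeight_succ]; ring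
  have h2 : (fun x : Motion A × (ℝ × E4) => ∑ j : Fin 4, jac Rf x.1.xi x.1.l x.2
      * (flatFirst Rf x.1.xi x.1.l j.succ x.2 + catFirst Rf x.1.xi x.1.l j.succ x.2)
      * logGrad j x.2) =O[smallFar A] fun x => smallness x * ‖x.2.2‖⁻¹ ^ 2 :=
    IsBigO.fun_sum fun j _ => (((isSymbol_jac (A := A) (Rf := Rf)).value.mul
      ((flatFirst_succ_isBigO (A := A) (Rf := Rf) j).add ((catFirst_isBigO (Rf := Rf) j.succ).trans
        (pow_inv_isBigO_smallness (show 1 + 1 ≤ 4 by norm_num))))).mul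
        (logGrad_isBigO j)).congr_right fun x => by ring
  exact h1.sub (h2.const_mul_left (3 / 2))

/-- Far out and for small motions, the conjugated equation is a small perturbation of the flat
one. -/
theorem exists_eventually_nearFlatAt (A Rf : ℝ) : ∃ C : ℝ, 0 < C ∧ ∀ᶠ x in smallFar A,
    |deriv (retTime Rf x.1.l) x.2.1 - 1| ≤ 1 / 2 ∧
    ∀ κ, C * smallness x ≤ κ → ∀ u F : ℝ × E4 → ℝ, ContDiffAt ℝ 2 u x.2 →
      pGraph Rf x.1.xi x.1.l u x.2 = F x.2 →
      NearFlatAt κ (conjugate u) (fun q => jac Rf x.1.xi x.1.l q * (‖q.2‖ ^ (3 / 2 : ℝ) * F q))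
        (pertTensor Rf x.1.xi x.1.l) (pertFirst Rf x.1.xi x.1.l) (pertZeroth Rf x.1.xi x.1.l)
        x.2 := by
  have ha := fun α β => isSymbol_pertTensor (A := A) (Rf := Rf) α β
  choose c1 hc1 using fun α β => (ha α β).value.bound
  choose c2 hc2 using fun α β γ => ((ha α β).deriv γ).bound
  choose c3 hc3 using fun β => (pertFirst_isBigO (A := A) (Rf := Rf) β).bound
  obtain ⟨c4, hc4⟩ := (pertZeroth_isBigO (A := A) (Rf := Rf)).bound
  obtain ⟨C, hC0, hC1, hC2, hC3, hC4⟩ : ∃ C : ℝ, 0 < C ∧ (∀ α β, c1 α β ≤ C)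
      ∧ (∀ α β γ, c2 α β γ ≤ C) ∧ (∀ β, c3 β ≤ C) ∧ c4 ≤ C := by
    obtain ⟨M1, h1⟩ := Finite.exists_le fun i : Fin 5 × Fin 5 => c1 i.1 i.2
    obtain ⟨M2, h2⟩ := Finite.exists_le fun i : Fin 5 × Fin 5 × Fin 5 => c2 i.1 i.2.1 i.2.2
    obtain ⟨M3, h3⟩ := Finite.exists_le c3
    refine ⟨max 1 (max (max M1 M2) (max M3 c4)), by positivity, fun α β => ?_, fun α β γ => ?_,
      fun β => ?_, by simp⟩
    · exact (h1 (α, β)).trans (by simp)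
    · exact (h2 (α, β, γ)).trans (by simp)
    · exact (h3 β).trans (by simp)
  refine ⟨C, hC0, ?_⟩
  have hτ := (isSymbol_deriv_retTime_sub_one (A := A) (Rf := Rf)).tendsto_zero_of_size
  filter_upwards [eventually_nhds_good (A := A) (Rf := Rf), eventually_all.2 fun ν =>
      eventually_all.2 fun β => (isSymbol_frame (A := A) (Rf := Rf) ν β).differentiable,
    eventually_all.2 fun α => eventually_all.2 fun β => (ha α β).smooth,
    eventually_all.2 fun α => eventually_all.2 fun β => hc1 α β,
    eventually_all.2 fun α => eventually_all.2 fun β => eventually_all.2 fun γ => hc2 α β γ,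
    eventually_all.2 hc3, hc4, (radiusToInfinity_smallFar (A := A)).eventually_one_le,
    hτ.eventually (Metric.closedBall_mem_nhds 0 (show (0 : ℝ) < 1 / 2 by norm_num))]
    with x hg hV hs h1 h2 h3 h4 hr hτ'
  refine ⟨by simpa using hτ', fun κ hκ u F hu hF => ?_⟩
  have hr0 : 0 ≤ ‖x.2.2‖⁻¹ := by positivity
  have hs0 := smallness_nonneg x
  have hw := fun α => compWeight_nonneg (norm_nonneg x.2.2) α
  have key : ∀ {c v w : ℝ}, c ≤ C → 0 ≤ v → |w| ≤ c * ‖smallness x * v‖ → |w| ≤ κ * v := by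
    intro c v w hc hv hwv
    rw [Real.norm_of_nonneg (mul_nonneg hs0 hv)] at hwv
    calc |w| ≤ c * (smallness x * v) := hwv
      _ ≤ C * (smallness x * v) := mul_le_mul_of_nonneg_right hc (mul_nonneg hs0 hv)
      _ = C * smallness x * v := by ring
      _ ≤ κ * v := mul_le_mul_of_nonneg_right hκ hv
  exact {
    smooth := hs
    symm := fun α β => pertTensor_symm α β
    bound := fun α β => key (hC1 α β) (mul_nonneg (hw α) (hw β)) (h1 α β)
    bound_zero := fun α β => key (hC2 α β 0) (mul_nonneg (hw α) (hw β)) (by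
      simpa [tensorWeight] using h2 α β 0)
    bound_succ := fun α β j => by
      rw [mul_assoc]
      refine key (hC2 α β j.succ) (mul_nonneg (mul_nonneg (hw α) (hw β)) hr0) ?_
      have := h2 α β j.succ
      simp only [tensorWeight, derWeight_succ] at this
      rwa [mul_assoc (smallness x)] at this
    bound_first := fun β => by
      rw [mul_assoc]
      refine key (hC3 β) (mul_nonneg (hw β) hr0) ?_
      have := h3 β
      simp only [vectorWeight] at this
      rwa [mul_assoc (smallness x)] at this
    bound_zeroth := key hC4 (by positivity) h4
    eq := by
      beta_reduce
      rw [← hF]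
      exact conjugated_equation hg hV hu }

end conjugation

/-! ### Polar coordinates -/

section polar

lemma lintegral_polar {G : E4 → ℝ≥0∞} (hG : Measurable G) :
    ∫⁻ y, G y = ∫⁻ r in Set.Ioi (0 : ℝ), ∫⁻ θ : S3,
      ENNReal.ofReal (r ^ 3) * G (r • (θ : E4)) ∂sphereMeasure := by
  have hm : Measurable fun z : S3 × Set.Ioi (0 : ℝ) => G ((z.2 : ℝ) • (z.1 : E4)) := by
    fun_prop
  have hm2 : Measurable fun r : Set.Ioi (0 : ℝ) => ∫⁻ θ : S3, G ((r : ℝ) • (θ : E4)) ∂sphereMeasure :=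
    hm.lintegral_prod_left'
  have hdim : Module.finrank ℝ E4 - 1 = 3 := by simp
  have hmp := (volume : Measure E4).measurePreserving_homeomorphUnitSphereProd
  rw [hdim] at hmp
  calc ∫⁻ y, G y = ∫⁻ y in ({0}ᶜ : Set E4), G y := by
        rw [restrict_compl_singleton]
    _ = ∫⁻ x : ({0}ᶜ : Set E4), G x ∂((volume : Measure E4).comap (↑)) :=
        (lintegral_subtype_comap (measurableSet_singleton (0 : E4)).compl G).symm
    _ = ∫⁻ x : ({0}ᶜ : Set E4), (fun z : S3 × Set.Ioi (0 : ℝ) => G ((z.2 : ℝ) • (z.1 : E4)))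
          (homeomorphUnitSphereProd E4 x) ∂((volume : Measure E4).comap (↑)) := by
        refine lintegral_congr fun x => ?_
        have h := congrArg Subtype.val ((homeomorphUnitSphereProd E4).symm_apply_apply x)
        rw [homeomorphUnitSphereProd_symm_apply_coe] at h
        simp only [h]
    _ = ∫⁻ z, G ((z.2 : ℝ) • (z.1 : E4)) ∂(sphereMeasure.prod (Measure.volumeIoiPow 3)) :=
        hmp.lintegral_comp hm
    _ = ∫⁻ r, ∫⁻ θ : S3, G ((r : ℝ) • (θ : E4)) ∂sphereMeasure ∂(Measure.volumeIoiPow 3) :=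
        lintegral_prod_symm _ hm.aemeasurable
    _ = ∫⁻ r : Set.Ioi (0 : ℝ), ENNReal.ofReal ((r : ℝ) ^ 3) * ∫⁻ θ : S3, G ((r : ℝ) • (θ : E4))
          ∂sphereMeasure ∂(Measure.comap Subtype.val volume) := by
        rw [Measure.volumeIoiPow, lintegral_withDensity_eq_lintegral_mul _ (by fun_prop) hm2]
        rfl
    _ = ∫⁻ r in Set.Ioi (0 : ℝ), ENNReal.ofReal (r ^ 3) * ∫⁻ θ : S3, G (r • (θ : E4))
          ∂sphereMeasure :=
        lintegral_subtype_comap measurableSet_Ioi (fun r : ℝ => ENNReal.ofReal (r ^ 3) *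
          ∫⁻ θ : S3, G (r • (θ : E4)) ∂sphereMeasure)
    _ = _ := by
        refine lintegral_congr fun r => ?_
        rw [lintegral_const_mul']
        exact ENNReal.ofReal_ne_top

/-- The integral over `ℝ⁴` of a function that need not be measurable is at most the iterated
integral in polar coordinates. -/
lemma lintegral_le_polar (G : E4 → ℝ≥0∞) :
    ∫⁻ y, G y ≤ ∫⁻ r in Set.Ioi (0 : ℝ), ∫⁻ θ : S3,
      ENNReal.ofReal (r ^ 3) * G (r • (θ : E4)) ∂sphereMeasure := by
  obtain ⟨g, hg, hgG, he⟩ := exists_measurable_le_lintegral_eq volume G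
  rw [he, lintegral_polar hg]
  exact lintegral_mono fun r => lintegral_mono fun θ => mul_le_mul_right (hgG _) _

lemma lintegral_ofReal_le_leafIntegral {G : E4 → ℝ} {g : ℝ → E4 → ℝ}
    (h : ∀ r, 0 < r → ∀ θ : E4, ‖θ‖ = 1 → r ^ 3 * G (r • θ) ≤ g r θ) :
    ∫⁻ y, ENNReal.ofReal (G y) ≤ leafIntegral g := by
  refine (lintegral_le_polar _).trans (setLIntegral_mono' measurableSet_Ioi fun r hr =>
    lintegral_mono fun θ => ?_)
  rw [← ENNReal.ofReal_mul (pow_nonneg (le_of_lt hr) 3)]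
  exact ENNReal.ofReal_le_ofReal (h r hr θ (by simp))

lemma leafIntegral_le_lintegral_ofReal {G : E4 → ℝ} {g : ℝ → E4 → ℝ}
    (hG : Measurable fun y => ENNReal.ofReal (G y))
    (h : ∀ r, 0 < r → ∀ θ : E4, ‖θ‖ = 1 → g r θ ≤ r ^ 3 * G (r • θ)) :
    leafIntegral g ≤ ∫⁻ y, ENNReal.ofReal (G y) := by
  rw [lintegral_polar hG]
  refine setLIntegral_mono' measurableSet_Ioi fun r hr => lintegral_mono fun θ => ?_
  rw [← ENNReal.ofReal_mul (pow_nonneg (le_of_lt hr) 3)]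
  exact ENNReal.ofReal_le_ofReal (h r hr θ (by simp))

lemma norm_smul_unit {r : ℝ} {θ : E4} (hr : 0 < r) (hθ : ‖θ‖ = 1) : ‖r • θ‖ = r := by
  rw [norm_smul, hθ, mul_one, Real.norm_of_nonneg hr.le]

/-- `f`, given in polar coordinates, is the function `u` of `(σ, y)`. -/
def IsPolarForm (f : ℝ → ℝ → E4 → ℝ) (u : ℝ × E4 → ℝ) : Prop :=
  ∀ σ r : ℝ, 0 < r → ∀ θ : E4, ‖θ‖ = 1 → f σ r θ = u (σ, r • θ)

lemma isPolarForm_farPart (U : ℝ → ℝ → E4 → ℝ) : IsPolarForm U (farPart U) := by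
  intro σ r hr θ hθ
  simp only [farPart, norm_smul_unit hr hθ, smul_smul, inv_mul_cancel₀ hr.ne', one_smul]

lemma isPolarForm_conjugated (U : ℝ → ℝ → E4 → ℝ) :
    IsPolarForm (conjugated U) (conjugate (farPart U)) := by
  intro σ r hr θ hθ
  simp only [conjugated, conjugate, norm_smul_unit hr hθ]
  rw [isPolarForm_farPart U σ r hr θ hθ]

section derivatives

variable {f : ℝ → ℝ → E4 → ℝ} {u : ℝ × E4 → ℝ} {σ r : ℝ} {θ : E4}

lemma fderiv_snd_eq_sum (q : ℝ × E4) (z : E4) :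
    fderiv ℝ u q ((0 : ℝ), z) = ∑ j : Fin 4, z j * pd j.succ u q := by
  have h : ((0 : ℝ), z) = ∑ j : Fin 4, z j • (coordDir j.succ : ℝ × E4) := by
    ext k
    · simp [coordDir, Prod.fst_sum]
    · simp [coordDir, Prod.snd_sum, Finset.sum_apply, Pi.single_apply]
  rw [h, map_sum]
  simp only [map_smul, smul_eq_mul]
  rfl

lemma IsPolarForm.dSigma_eq (hf : IsPolarForm f u) (hu : DifferentiableAt ℝ u (σ, r • θ))
    (hr : 0 < r) (hθ : ‖θ‖ = 1) : dSigma f σ r θ = pd 0 u (σ, r • θ) := by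
  have h1 : (fun s => f s r θ) = fun s => u (s, r • θ) := funext fun s => hf s r hr θ hθ
  have h2 : HasDerivAt (fun s : ℝ => (s, r • θ)) ((1 : ℝ), (0 : E4)) σ :=
    (hasDerivAt_id σ).prodMk (hasDerivAt_const σ (r • θ))
  rw [dSigma, h1]
  exact (hu.hasFDerivAt.comp_hasDerivAt σ h2).deriv

lemma IsPolarForm.dR_eq (hf : IsPolarForm f u) (hu : DifferentiableAt ℝ u (σ, r • θ))
    (hr : 0 < r) (hθ : ‖θ‖ = 1) : dR f σ r θ = radDeriv u (σ, r • θ) := by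
  have h1 : (fun s => f σ s θ) =ᶠ[nhds r] fun s => u (σ, s • θ) := by
    filter_upwards [isOpen_Ioi.mem_nhds hr] with s hs using hf σ s hs θ hθ
  have h2 : HasDerivAt (fun s : ℝ => (σ, s • θ)) ((0 : ℝ), θ) r := by
    simpa using (hasDerivAt_const r σ).prodMk ((hasDerivAt_id r).smul_const θ)
  have h3 : HasDerivAt (fun s => u (σ, s • θ)) (fderiv ℝ u (σ, r • θ) (0, θ)) r :=
    hu.hasFDerivAt.comp_hasDerivAt r h2
  rw [dR, h1.deriv_eq, h3.deriv, fderiv_snd_eq_sum, radDeriv, norm_smul_unit hr hθ,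
    eq_div_iff hr.ne', Finset.sum_mul]
  exact Finset.sum_congr rfl fun j _ => by simp; ring

lemma hasFDerivAt_normalize (hθ : ‖θ‖ = 1) :
    HasFDerivAt (fun y : E4 => ‖y‖⁻¹ • y)
      (ContinuousLinearMap.id ℝ E4 - (innerSL ℝ θ).smulRight θ) θ := by
  have hsq : HasFDerivAt (fun y : E4 => ‖y‖ ^ 2) (2 • innerSL ℝ θ) θ :=
    (hasStrictFDerivAt_norm_sq θ).hasFDerivAt
  have hs : HasFDerivAt (fun y : E4 => √(‖y‖ ^ 2))
      ((1 / (2 * √(‖θ‖ ^ 2))) • (2 • innerSL ℝ θ)) θ := hsq.sqrt (by rw [hθ]; norm_num)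
  have hn : HasFDerivAt (fun y : E4 => ‖y‖) (innerSL ℝ θ) θ := by
    refine (hs.congr_of_eventuallyEq (Filter.Eventually.of_forall fun y => ?_)).congr_fderiv ?_
    · exact (Real.sqrt_sq (norm_nonneg y)).symm
    · ext z
      simp [hθ]
  have hi : HasFDerivAt (fun y : E4 => ‖y‖⁻¹) (-(innerSL ℝ θ)) θ := by
    refine ((hasDerivAt_inv (by rw [hθ]; norm_num)).comp_hasFDerivAt θ hn).congr_fderiv ?_
    ext z
    simp [hθ]
  refine (hi.smul (hasFDerivAt_id θ)).congr_fderiv ?_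
  ext z
  simp [hθ, sub_eq_add_neg]

lemma IsPolarForm.norm_sphGrad_sq (hf : IsPolarForm f u) (hu : DifferentiableAt ℝ u (σ, r • θ))
    (hr : 0 < r) (hθ : ‖θ‖ = 1) :
    ‖sphGrad f σ r θ‖ ^ 2 = r ^ 2 * ((∑ j : Fin 4, pd j.succ u (σ, r • θ) ^ 2)
      - radDeriv u (σ, r • θ) ^ 2) := by
  have hθ0 : θ ≠ 0 := by rintro rfl; simp at hθ
  have h1 : (fun y : E4 => f σ r (‖y‖⁻¹ • y)) =ᶠ[nhds θ] fun y => u (σ, r • (‖y‖⁻¹ • y)) := by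
    filter_upwards [isOpen_compl_singleton.mem_nhds hθ0] with y hy
    refine hf σ r hr _ ?_
    rw [norm_smul, norm_inv, norm_norm, inv_mul_cancel₀ (norm_ne_zero_iff.2 hy)]
  set a : E4 := WithLp.toLp 2 fun j => pd j.succ u (σ, r • θ) with ha
  have ha2 : ∀ z : E4, inner ℝ a z = ∑ j : Fin 4, z j * pd j.succ u (σ, r • θ) := fun z => by
    simp [ha, PiLp.inner_apply]
  have hrad : radDeriv u (σ, r • θ) = inner ℝ a θ := by
    rw [ha2, radDeriv, norm_smul_unit hr hθ, div_eq_iff hr.ne', Finset.sum_mul]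
    exact Finset.sum_congr rfl fun j _ => by simp; ring
  have hnorm : (∑ j : Fin 4, pd j.succ u (σ, r • θ) ^ 2) = ‖a‖ ^ 2 := by
    simp [ha, EuclideanSpace.norm_sq_eq]
  have h2 : HasFDerivAt (fun y : E4 => (σ, r • (‖y‖⁻¹ • y)))
      ((0 : E4 →L[ℝ] ℝ).prod
        (r • (ContinuousLinearMap.id ℝ E4 - (innerSL ℝ θ).smulRight θ))) θ :=
    (hasFDerivAt_const σ θ).prodMk ((hasFDerivAt_normalize hθ).const_smul r)
  have hu' : HasFDerivAt u (fderiv ℝ u (σ, r • θ)) (σ, r • (‖θ‖⁻¹ • θ)) := by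
    rw [hθ, inv_one, one_smul]; exact hu.hasFDerivAt
  have h3 : HasGradientAt (fun y : E4 => f σ r (‖y‖⁻¹ • y)) (r • (a - (inner ℝ a θ : ℝ) • θ)) θ := by
    rw [hasGradientAt_iff_hasFDerivAt]
    refine ((hu'.comp θ h2).congr_of_eventuallyEq h1).congr_fderiv ?_
    ext z
    have h4 : ((0 : E4 →L[ℝ] ℝ).prod
        (r • (ContinuousLinearMap.id ℝ E4 - (innerSL ℝ θ).smulRight θ))) z
        = ((0 : ℝ), r • (z - (inner ℝ θ z : ℝ) • θ)) := by simp
    rw [ContinuousLinearMap.comp_apply, h4, fderiv_snd_eq_sum, ← ha2]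
    simp only [InnerProductSpace.toDual_apply_apply, inner_smul_left, inner_smul_right,
      inner_sub_left, inner_sub_right, conj_trivial]
    ring
  rw [sphGrad, h3.gradient, norm_smul, mul_pow, Real.norm_eq_abs, sq_abs, hrad, hnorm,
    norm_sub_sq_real, norm_smul, inner_smul_right, hθ, Real.norm_eq_abs, mul_one, sq_abs]
  ring

end derivatives

end polar

/-! ### Uniform thresholds -/

section thresholds

open Filter

/-- Properties that hold for small motions and far out hold uniformly beyond some radius and below
some size. -/
lemma exists_thresholds {A : ℝ} {P : Motion A → ℝ → E4 → Prop}
    (h : ∀ᶠ x in smallFar A, P x.1 x.2.1 x.2.2) :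
    ∃ ε₀ r₀ : ℝ, 0 < ε₀ ∧ ∀ d : Motion A, d.ε < ε₀ → ∀ σ ∈ Set.Icc 0 d.σf, ∀ y : E4,
      r₀ ≤ ‖y‖ → P d σ y := by
  rw [smallFar, eventually_inf_principal, eventually_inf] at h
  obtain ⟨s, hs, t, ht, h⟩ := h
  obtain ⟨u, hu, hus⟩ := hs
  obtain ⟨v, hv, hvt⟩ := ht
  obtain ⟨ε₀, hε₀, hb⟩ := Metric.mem_nhds_iff.1 hu
  obtain ⟨r₀, hr₀⟩ := mem_atTop_sets.1 hv
  refine ⟨ε₀, r₀, hε₀, fun d hd σ hσ y hy => h (d, σ, y) ⟨hus (hb ?_), hvt (hr₀ _ hy)⟩ hσ⟩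
  simpa [abs_of_pos d.pos] using hd

lemma norm_le_of_coord_le {v : E4} {c : ℝ} (hc : 0 ≤ c) (h : ∀ j, |v j| ≤ c) : ‖v‖ ≤ 2 * c := by
  have h2 : ‖v‖ ^ 2 ≤ (2 * c) ^ 2 := by
    rw [EuclideanSpace.norm_sq_eq]
    calc ∑ j, ‖v j‖ ^ 2 ≤ ∑ _j : Fin 4, c ^ 2 := Finset.sum_le_sum fun j _ =>
          pow_le_pow_left₀ (norm_nonneg _) (h j) 2
      _ = (2 * c) ^ 2 := by simp; ring
  exact le_of_sq_le_sq h2 (by positivity)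

/-- For small motions the chart has bounded Jacobian, the hyperboloids move slowly, and the boosts
are close to the identity. -/
lemma eventually_slow_motion (A Rf : ℝ) : ∀ᶠ x in smallFar A,
    |jac Rf x.1.xi x.1.l x.2| ≤ 2 ∧ ‖centerVel Rf x.1.xi x.1.l x.2.1‖ ≤ 1 / 2
      ∧ lorentz (x.1.l x.2.1) ≤ 2 := by
  have hτ := (isSymbol_deriv_retTime_sub_one (A := A) (Rf := Rf)).tendsto_zero_of_size
  have hη := fun j => (isSymbol_deriv_center (A := A) (Rf := Rf) j).tendsto_zero_of_size
  have hJ := (tendsto_jac (A := A) (Rf := Rf)).abs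
  rw [abs_one] at hJ
  filter_upwards [hτ.eventually (Metric.closedBall_mem_nhds 0 (show (0 : ℝ) < 1 / 2 by norm_num)),
    eventually_all.2 fun j => (hη j).eventually
      (Metric.closedBall_mem_nhds 0 (show (0 : ℝ) < 1 / 8 by norm_num)),
    hJ.eventually_lt_const one_lt_two,
    (tendsto_lorentz (A := A)).eventually_lt_const one_lt_two] with x h1 h2 h3 h4
  have h1' : |deriv (retTime Rf x.1.l) x.2.1 - 1| ≤ 1 / 2 := by simpa using h1
  refine ⟨h3.le, ?_, h4.le⟩
  have h5 : 1 / 2 ≤ deriv (retTime Rf x.1.l) x.2.1 := by linarith [(abs_le.1 h1').1]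
  have h6 : ‖deriv (center Rf x.1.xi x.1.l) x.2.1‖ ≤ 2 * (1 / 8) :=
    norm_le_of_coord_le (by norm_num) fun j => by simpa using h2 j
  rw [centerVel, norm_smul, norm_inv, Real.norm_of_nonneg (by linarith)]
  calc _ ≤ 2 * (2 * (1 / 8) : ℝ) := by
        gcongr
        rw [inv_le_comm₀ (by linarith) two_pos]
        linarith
    _ = 1 / 2 := by norm_num

end thresholds

/-- The motion described by parameters that satisfy the bootstrap assumption. -/
def Bootstrap.motion {Ck : ℕ → ℝ} {Cl δw κ ε σf : ℝ} {xi l : ℝ → E4}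
    (h : Bootstrap Ck Cl δw κ ε σf xi l) (hCk : ∀ k, 0 < Ck k) (hCl : 0 < Cl)
    (hδ1 : δw ≤ 1) (hκ : κ < 1) (hε : 0 < ε) : Motion (Cl + 2 * Ck 0 + 2 * Ck 1) :=
  have hw : ∀ σ : ℝ, bracket σ ^ (-(9 / 4 : ℝ) + κ) ≤ 1 := fun σ =>
    Real.rpow_le_one_of_one_le_of_nonpos (Real.one_le_sqrt.2 (by nlinarith [sq_nonneg σ]))
      (by linarith)
  have hb : ∀ k, ∀ σ : ℝ, 2 * Ck k * δw * ε * bracket σ ^ (-(9 / 4 : ℝ) + κ)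
      ≤ 2 * Ck k * ε := fun k σ => by
    have h0 : 0 ≤ bracket σ ^ (-(9 / 4 : ℝ) + κ) := Real.rpow_nonneg (Real.sqrt_nonneg _) _
    have h1 := (hCk k).le
    calc 2 * Ck k * δw * ε * bracket σ ^ (-(9 / 4 : ℝ) + κ)
        ≤ 2 * Ck k * 1 * ε * 1 := by
          gcongr
          exact hw σ
      _ = _ := by ring
  have c0 := mul_pos (hCk 0) hε
  have c1 := mul_pos (hCk 1) hε
  have cl := mul_pos hCl hε
  { ε := ε
    σf := σf
    xi := xi
    l := l
    pos := hε
    smooth_xi := h.smooth_xi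
    smooth_l := h.smooth_l
    bound_l := fun σ hσ => by linarith [h.small_l σ hσ]
    bound_dl := fun σ hσ => by
      have := h.dot_l 0 σ hσ
      rw [iteratedDeriv_zero] at this
      linarith [hb 0 σ]
    bound_ddl := fun σ hσ => by
      have := h.dot_l 1 σ hσ
      rw [iteratedDeriv_one] at this
      linarith [hb 1 σ]
    bound_dxi := fun σ hσ => by
      have := h.dot_xi 0 σ hσ
      rw [iteratedDeriv_zero] at this
      linarith [hb 0 σ]
    bound_ddxi := fun σ hσ => by
      have := h.dot_xi 1 σ hσ
      rw [iteratedDeriv_one] at this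
      linarith [hb 1 σ] }

/-! ### The weighted quantities in polar coordinates -/

section pointwise

variable {U : ℝ → ℝ → E4 → ℝ} {F : ℝ × E4 → ℝ} {χ : ℝ → ℝ} {Rf p r₀ κ σ r : ℝ} {xi l : ℝ → E4}
  {θ : E4}

lemma multCoeff_rpow_mul (hr : 0 < r) :
    r ^ 3 * (multCoeff χ (fun s => s ^ p) r * r) = χ r * r ^ p := by
  rw [multCoeff]; field_simp

lemma multCoeff_rpow_mul' (hr : 0 < r) :
    r ^ 3 * multCoeff χ (fun s => s ^ p) r = χ r * r ^ (p - 1) := by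
  rw [multCoeff, Real.rpow_sub_one hr.ne']; field_simp

lemma rpow_three_halves_sq (hr : 0 < r) : (r ^ (3 / 2 : ℝ)) ^ 2 = r ^ 3 := by
  rw [← Real.rpow_natCast, ← Real.rpow_mul hr.le, ← Real.rpow_natCast]
  norm_num

lemma smul_unit_ne_zero (hr : 0 < r) (hθ : ‖θ‖ = 1) : r • θ ≠ 0 :=
  norm_ne_zero_iff.1 (by rw [norm_smul_unit hr hθ]; exact hr.ne')

lemma differentiableAt_conjugate_farPart (hr : 0 < r) (hθ : ‖θ‖ = 1)
    (hU : ContDiffAt ℝ 2 (farPart U) (σ, r • θ)) :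
    DifferentiableAt ℝ (conjugate (farPart U)) (σ, r • θ) :=
  (contDiffAt_conjugate (q := (σ, r • θ)) (smul_unit_ne_zero hr hθ) hU).differentiableAt
    (by norm_num)

lemma radDeriv_conjugate (hr : 0 < r) (hθ : ‖θ‖ = 1)
    (hU : ContDiffAt ℝ 2 (farPart U) (σ, r • θ)) :
    radDeriv (conjugate (farPart U)) (σ, r • θ) = dR (conjugated U) σ r θ :=
  ((isPolarForm_conjugated U).dR_eq (differentiableAt_conjugate_farPart hr hθ hU) hr hθ).symm

lemma sum_pd_conjugate_sq (hr : 0 < r) (hθ : ‖θ‖ = 1)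
    (hU : ContDiffAt ℝ 2 (farPart U) (σ, r • θ)) :
    ∑ j : Fin 4, pd j.succ (conjugate (farPart U)) (σ, r • θ) ^ 2
      = dR (conjugated U) σ r θ ^ 2 + (r ^ 2)⁻¹ * ‖sphGrad (conjugated U) σ r θ‖ ^ 2 := by
  rw [(isPolarForm_conjugated U).norm_sphGrad_sq (differentiableAt_conjugate_farPart hr hθ hU)
    hr hθ, ← radDeriv_conjugate hr hθ hU]
  field_simp
  ring

lemma spaceDensity_conjugate (hr : 0 < r) (hθ : ‖θ‖ = 1)
    (hU : ContDiffAt ℝ 2 (farPart U) (σ, r • θ)) :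
    spaceDensity (conjugate (farPart U)) (σ, r • θ) = dR (conjugated U) σ r θ ^ 2
      + (r ^ 2)⁻¹ * (conjugated U σ r θ ^ 2 + ‖sphGrad (conjugated U) σ r θ‖ ^ 2) := by
  rw [spaceDensity, sum_pd_conjugate_sq hr hθ hU, ← isPolarForm_conjugated U σ r hr θ hθ,
    norm_smul_unit hr hθ]
  ring

lemma pd_zero_conjugate_sq_le (hr : 0 < r) (hθ : ‖θ‖ = 1)
    (hU : ContDiffAt ℝ 2 (farPart U) (σ, r • θ)) (hτ : |deriv (retTime Rf l) σ - 1| ≤ 1 / 2) :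
    pd 0 (conjugate (farPart U)) (σ, r • θ) ^ 2 ≤ 9 / 4 * dTau Rf l (conjugated U) σ r θ ^ 2 := by
  obtain ⟨h1, h2⟩ := abs_le.1 hτ
  have h0 : deriv (retTime Rf l) σ ≠ 0 := by linarith
  rw [← (isPolarForm_conjugated U).dSigma_eq (differentiableAt_conjugate_farPart hr hθ hU) hr hθ]
  have h3 : dSigma (conjugated U) σ r θ
      = deriv (retTime Rf l) σ * dTau Rf l (conjugated U) σ r θ := by
    rw [dTau, mul_inv_cancel_left₀ h0]
  rw [h3, mul_pow]
  gcongr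
  nlinarith

lemma dTau_conjugated_sq (hr : 0 < r) :
    dTau Rf l (conjugated U) σ r θ ^ 2 = r ^ 3 * dTau Rf l U σ r θ ^ 2 := by
  have : dSigma (conjugated U) σ r θ = r ^ (3 / 2 : ℝ) * dSigma U σ r θ :=
    deriv_const_mul_field _
  rw [dTau, dTau, this, ← rpow_three_halves_sq hr]
  ring

lemma norm_sphGrad_conjugated_sq (hr : 0 < r) :
    ‖sphGrad (conjugated U) σ r θ‖ ^ 2 = r ^ 3 * ‖sphGrad U σ r θ‖ ^ 2 := by
  have : sphGrad (conjugated U) σ r θ = r ^ (3 / 2 : ℝ) • sphGrad U σ r θ := by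
    rw [sphGrad, sphGrad, gradient, gradient]
    have h : fderiv ℝ (fun y : E4 => conjugated U σ r (‖y‖⁻¹ • y)) θ
        = r ^ (3 / 2 : ℝ) • fderiv ℝ (fun y : E4 => U σ r (‖y‖⁻¹ • y)) θ :=
      congrFun (fderiv_const_smul_field (𝕜 := ℝ) (R := ℝ) (f := fun y : E4 => U σ r (‖y‖⁻¹ • y))
        (r ^ (3 / 2 : ℝ))) θ
    rw [h]
    exact map_smulₛₗ (InnerProductSpace.toDual ℝ E4).symm _ _
  rw [this, norm_smul, mul_pow, Real.norm_eq_abs, sq_abs, rpow_three_halves_sq hr]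

lemma conjugated_sq (hr : 0 < r) : conjugated U σ r θ ^ 2 = r ^ 3 * U σ r θ ^ 2 := by
  rw [conjugated, mul_pow, rpow_three_halves_sq hr]

lemma dR_conjugated_sq_le (hr : 0 < r) (hθ : ‖θ‖ = 1)
    (hU : ContDiffAt ℝ 2 (farPart U) (σ, r • θ)) :
    dR (conjugated U) σ r θ ^ 2
      ≤ 2 * (r ^ 3 * (dR U σ r θ ^ 2 + 9 / 4 * ((r ^ 2)⁻¹ * U σ r θ ^ 2))) := by
  have hd : DifferentiableAt ℝ (fun s => U σ s θ) r := by
    have h1 : (fun s => U σ s θ) =ᶠ[nhds r] fun s => farPart U (σ, s • θ) := by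
      filter_upwards [isOpen_Ioi.mem_nhds hr] with s hs using isPolarForm_farPart U σ s hs θ hθ
    refine DifferentiableAt.congr_of_eventuallyEq ?_ h1
    exact (hU.differentiableAt (by norm_num)).comp r (f := fun s : ℝ => (σ, s • θ)) (by fun_prop)
  have h2 : dR (conjugated U) σ r θ
      = r ^ (3 / 2 : ℝ) * (dR U σ r θ + 3 / 2 * (r⁻¹ * U σ r θ)) := by
    have h3 := (Real.hasDerivAt_rpow_const (p := 3 / 2) (Or.inl hr.ne')).mul hd.hasDerivAt
    have h4 : dR (conjugated U) σ r θ = _ := h3.deriv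
    rw [h4, Real.rpow_sub_one hr.ne', dR]
    ring
  rw [h2, mul_pow, rpow_three_halves_sq hr]
  have h5 : (r ^ 2)⁻¹ * U σ r θ ^ 2 = (r⁻¹ * U σ r θ) ^ 2 := by rw [mul_pow, inv_pow]
  rw [h5]
  have h6 : 0 < r ^ 3 := by positivity
  generalize r⁻¹ * U σ r θ = a at *
  generalize dR U σ r θ = b at *
  nlinarith [mul_nonneg h6.le (sq_nonneg (b - 3 / 2 * a))]

/-- The density of the standard energy in the region where `χ = 1`. -/
def endDensity (Rf : ℝ) (l : ℝ → E4) (U : ℝ → ℝ → E4 → ℝ) (σ r : ℝ) (θ : E4) : ℝ :=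
  r ^ 3 * (dR U σ r θ ^ 2 + (r ^ 2)⁻¹ *
    (dTau Rf l U σ r θ ^ 2 + U σ r θ ^ 2 + ‖sphGrad U σ r θ‖ ^ 2))

/-- The energy density of `r ^ (3 / 2) U` is bounded by that of `U`. -/
lemma conjugate_density_le (hr : 0 < r) (hθ : ‖θ‖ = 1)
    (hU : ContDiffAt ℝ 2 (farPart U) (σ, r • θ)) (hτ : |deriv (retTime Rf l) σ - 1| ≤ 1 / 2) :
    spaceDensity (conjugate (farPart U)) (σ, r • θ)
        + 3 * (pd 0 (conjugate (farPart U)) (σ, r • θ) ^ 2 / r ^ 2)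
      ≤ 7 * endDensity Rf l U σ r θ := by
  have h1 := pd_zero_conjugate_sq_le hr hθ hU hτ
  have h2 := dR_conjugated_sq_le hr hθ hU
  rw [dTau_conjugated_sq hr] at h1
  rw [spaceDensity_conjugate hr hθ hU, conjugated_sq hr, norm_sphGrad_conjugated_sq hr, endDensity,
    div_eq_inv_mul]
  have hi : 0 < (r ^ 2)⁻¹ := by positivity
  have h3 : 0 < r ^ 3 := by positivity
  have h4 := mul_le_mul_of_nonneg_left h1 hi.le
  have n1 : 0 ≤ r ^ 3 * dR U σ r θ ^ 2 := by positivity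
  have n2 : 0 ≤ r ^ 3 * ((r ^ 2)⁻¹ * dTau Rf l U σ r θ ^ 2) := by positivity
  have n3 : 0 ≤ r ^ 3 * ((r ^ 2)⁻¹ * U σ r θ ^ 2) := by positivity
  have n4 : 0 ≤ r ^ 3 * ((r ^ 2)⁻¹ * ‖sphGrad U σ r θ‖ ^ 2) := by positivity
  linarith

lemma fluxErr_conjugate_le (hr : 0 < r) (hθ : ‖θ‖ = 1) (hκ1 : κ ≤ 1)
    (hU : ContDiffAt ℝ 2 (farPart U) (σ, r • θ)) (hτ : |deriv (retTime Rf l) σ - 1| ≤ 1 / 2) :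
    fluxErr κ (conjugate (farPart U)) (σ, r • θ) ≤ 35 * ((r ^ 2)⁻¹ * endDensity Rf l U σ r θ) := by
  have h1 := conjugate_density_le hr hθ hU hτ
  rw [spaceDensity] at h1
  rw [fluxErr]
  simp only [norm_smul_unit hr hθ] at *
  have hi : 0 < (r ^ 2)⁻¹ := by positivity
  have h0 : (0 : ℝ) ≤ ∑ j : Fin 4, pd j.succ (conjugate (farPart U)) (σ, r • θ) ^ 2 :=
    Finset.sum_nonneg fun _ _ => sq_nonneg _
  generalize ∑ j : Fin 4, pd j.succ (conjugate (farPart U)) (σ, r • θ) ^ 2 = N at *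
  generalize pd 0 (conjugate (farPart U)) (σ, r • θ) = e at *
  generalize conjugate (farPart U) (σ, r • θ) = v at *
  generalize endDensity Rf l U σ r θ = D at *
  have h2 : 0 ≤ v ^ 2 / r ^ 2 := by positivity
  have h5 : 0 ≤ e ^ 2 / r ^ 2 := by positivity
  calc 9 * (e ^ 2 / r ^ 4) + 5 * κ * (N / r ^ 2)
      = (r ^ 2)⁻¹ * (9 * (e ^ 2 / r ^ 2) + 5 * κ * N) := by field_simp
    _ ≤ (r ^ 2)⁻¹ * (9 * (e ^ 2 / r ^ 2) + 5 * 1 * N) := by gcongr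
    _ ≤ (r ^ 2)⁻¹ * (35 * D) := mul_le_mul_of_nonneg_left (by linarith) hi.le
    _ = _ := by ring

/-- The source terms of the Cartesian estimate are bounded by those of the polar one. -/
lemma sourceDensity_conjugate_le (hr : 0 < r) (hθ : ‖θ‖ = 1)
    (hχ : 0 ≤ χ r) (hU : ContDiffAt ℝ 2 (farPart U) (σ, r • θ))
    (hτ : |deriv (retTime Rf l) σ - 1| ≤ 1 / 2) (hJ : |jac Rf xi l (σ, r • θ)| ≤ 2)
    (hη : ‖centerVel Rf xi l σ‖ ≤ 1 / 2) :
    r ^ 3 * sourceDensity χ p (conjugate (farPart U))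
        (fun q => jac Rf xi l q * (‖q.2‖ ^ (3 / 2 : ℝ) * F q)) (σ, r • θ)
      ≤ 8 * (χ r * r ^ p * |conjSource Rf xi l F σ r θ * dR (conjugated U) σ r θ|
        + errCutoff Rf l χ p (conjugated U) σ r θ) := by
  have h1 := pd_zero_conjugate_sq_le hr hθ hU hτ
  have hin : 1 / 2 ≤ 1 - inner ℝ θ (centerVel Rf xi l σ) := by
    have := (real_inner_le_norm θ (centerVel Rf xi l σ))
    rw [hθ, one_mul] at this
    linarith
  rw [sourceDensity, spaceDensity_conjugate hr hθ hU, radDeriv_conjugate hr hθ hU, errCutoff,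
    conjSource, mul_add (8 : ℝ), mul_add (r ^ 3)]
  simp only [norm_smul_unit hr hθ]
  have hx : 0 < r ^ (3 / 2 : ℝ) := Real.rpow_pos_of_pos hr _
  have hrp : 0 < r ^ p := Real.rpow_pos_of_pos hr _
  refine add_le_add ?_ ?_
  · have e1 : ∀ h a : ℝ, r ^ 3 * (2 * h * (multCoeff χ (fun s => s ^ p) r * r * a))
        = 2 * (χ r * r ^ p) * (h * a) := fun h a => by
      rw [← multCoeff_rpow_mul hr]; ring
    rw [e1]
    generalize 1 - inner ℝ θ (centerVel Rf xi l σ) = c at *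
    generalize jac Rf xi l (σ, r • θ) = J at *
    rw [abs_mul J, abs_mul _ (F (σ, r • θ)), abs_mul _ (dR (conjugated U) σ r θ),
      abs_mul _ (F (σ, r • θ)), abs_mul _ c, abs_of_pos hx, abs_of_nonneg (a := c) (by linarith)]
    have hY : 0 ≤ χ r * r ^ p * (r ^ (3 / 2 : ℝ) * |F (σ, r • θ)|)
        * |dR (conjugated U) σ r θ| := by positivity
    calc _ = 2 * |J| * (χ r * r ^ p * (r ^ (3 / 2 : ℝ) * |F (σ, r • θ)|)
          * |dR (conjugated U) σ r θ|) := by ring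
      _ ≤ (8 * c) * (χ r * r ^ p * (r ^ (3 / 2 : ℝ) * |F (σ, r • θ)|)
          * |dR (conjugated U) σ r θ|) := mul_le_mul_of_nonneg_right (by linarith) hY
      _ = _ := by ring
  · have hi : 0 < (r ^ 2)⁻¹ := by positivity
    have h4 := mul_le_mul_of_nonneg_left h1 hi.le
    have hX : 0 ≤ |deriv χ r| * r ^ p := by positivity
    calc _ = |deriv χ r| * r ^ p * (2 * (dR (conjugated U) σ r θ ^ 2 + (r ^ 2)⁻¹ *
            (conjugated U σ r θ ^ 2 + ‖sphGrad (conjugated U) σ r θ‖ ^ 2)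
            + (r ^ 2)⁻¹ * pd 0 (conjugate (farPart U)) (σ, r • θ) ^ 2)) := by
          field_simp
      _ ≤ |deriv χ r| * r ^ p * (8 * (dR (conjugated U) σ r θ ^ 2 + (r ^ 2)⁻¹ *
            (conjugated U σ r θ ^ 2 + dTau Rf l (conjugated U) σ r θ ^ 2
              + ‖sphGrad (conjugated U) σ r θ‖ ^ 2))) := by
          refine mul_le_mul_of_nonneg_left ?_ hX
          have n1 : 0 ≤ dR (conjugated U) σ r θ ^ 2 := by positivity
          have n2 : 0 ≤ (r ^ 2)⁻¹ * dTau Rf l (conjugated U) σ r θ ^ 2 := by positivity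
          have n3 : 0 ≤ (r ^ 2)⁻¹ * conjugated U σ r θ ^ 2 := by positivity
          have n4 : 0 ≤ (r ^ 2)⁻¹ * ‖sphGrad (conjugated U) σ r θ‖ ^ 2 := by positivity
          linarith
      _ = _ := by ring

end pointwise

/-! ### The weighted estimate in polar coordinates -/

section integrals

variable {U : ℝ → ℝ → E4 → ℝ} {F : ℝ × E4 → ℝ} {χ : ℝ → ℝ} {Rf p r₀ κ σ s t α : ℝ}
  {xi l : ℝ → E4}

lemma leafIntegral_const_mul {c : ℝ} (hc : 0 ≤ c) (g : ℝ → E4 → ℝ) :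
    leafIntegral (fun r θ => c * g r θ) = ENNReal.ofReal c * leafIntegral g := by
  simp only [leafIntegral, ENNReal.ofReal_mul hc]
  rw [← lintegral_const_mul' _ _ ENNReal.ofReal_ne_top]
  exact lintegral_congr fun r => lintegral_const_mul' _ _ ENNReal.ofReal_ne_top

/-- As `dτ/dσ ≥ 1/2`, integrals in `(σ, y)` are controlled by integrals in `(τ, r, θ)`. -/
lemma lintegral_slab_le_slabIntegral {G : ℝ × E4 → ℝ} {g : ℝ → ℝ → E4 → ℝ} {C : ℝ} (hC : 0 ≤ C)
    (hτ : ∀ σ ∈ Set.Icc s t, |deriv (retTime Rf l) σ - 1| ≤ 1 / 2)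
    (h : ∀ σ ∈ Set.Icc s t, ∀ r, 0 < r → ∀ θ : E4, ‖θ‖ = 1 →
      r ^ 3 * G (σ, r • θ) ≤ C * g σ r θ) :
    ∫⁻ q in slab s t, ENNReal.ofReal (G q)
      ≤ ENNReal.ofReal (2 * C) * slabIntegral Rf l s t g := by
  refine (setLIntegral_slab_le s t _).trans ?_
  rw [slabIntegral, ← lintegral_const_mul' _ _ ENNReal.ofReal_ne_top]
  refine setLIntegral_mono' measurableSet_Icc fun σ hσ => ?_
  have h1 := (lintegral_ofReal_le_leafIntegral (G := fun y => G (σ, y)) (h σ hσ)).trans_eq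
    (leafIntegral_const_mul hC (g σ))
  refine h1.trans ?_
  rw [← mul_assoc, ← ENNReal.ofReal_mul (by positivity)]
  gcongr
  have := (abs_le.1 (hτ σ hσ)).1
  nlinarith

lemma slabIntegral_mono_right {t' : ℝ} (h : t ≤ t') (g : ℝ → ℝ → E4 → ℝ) :
    slabIntegral Rf l s t g ≤ slabIntegral Rf l s t' g :=
  lintegral_mono_set (Set.Icc_subset_Icc_right h)

lemma leafIntegral_endDensity_le (hχ : IsInnerCutoff r₀ χ) :
    leafIntegral (fun r θ => χ r * endDensity Rf l U σ r θ) ≤ stdEnergy Rf l χ U σ := by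
  refine le_trans ?_ (setLIntegral_le_lintegral (Set.Ioi (0 : ℝ)) _)
  refine setLIntegral_mono' measurableSet_Ioi fun r hr => lintegral_mono fun θ => ?_
  refine ENNReal.ofReal_le_ofReal ?_
  have hr : 0 < r := hr
  have hb : r ^ 3 ≤ bracket r ^ 3 := pow_le_pow_left₀ hr.le (le_bracket r) 3
  have h0 := hχ.nonneg r
  have h1 : 0 ≤ 1 - χ r := sub_nonneg.2 (hχ.le_one r)
  simp only [abs_of_pos hr, endDensity]
  calc _ = r ^ 3 * (χ r * (dR U σ r θ ^ 2 + (r ^ 2)⁻¹ *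
          (dTau Rf l U σ r θ ^ 2 + U σ r θ ^ 2 + ‖sphGrad U σ r θ‖ ^ 2))) := by ring
    _ ≤ bracket r ^ 3 * (χ r * (dR U σ r θ ^ 2 + (r ^ 2)⁻¹ *
          (dTau Rf l U σ r θ ^ 2 + U σ r θ ^ 2 + ‖sphGrad U σ r θ‖ ^ 2))) := by gcongr
    _ ≤ _ := by
        have hz : 0 ≤ (1 - χ r) * (dSigma U σ r θ ^ 2 + dR U σ r θ ^ 2
          + (bracket r ^ 2)⁻¹ * ‖sphGrad U σ r θ‖ ^ 2 + (bracket r ^ 2)⁻¹ * U σ r θ ^ 2) := by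
          positivity
        exact mul_le_mul_of_nonneg_left (by linarith) (pow_nonneg (bracket_pos r).le 3)

/-- In the region `r ≥ r₀`, the weight `r ^ (p - 2)` is small. -/
lemma rpow_div_sq_le {r : ℝ} (hr₀ : 1 ≤ r₀) (hr : r₀ ≤ r) (hα : 0 ≤ α) (hpα : p - 2 + α ≤ 0) :
    r ^ p * (r ^ 2)⁻¹ ≤ r₀ ^ (p - 2 + α) := by
  have h1 : 1 ≤ r := hr₀.trans hr
  have h2 : r ^ p * (r ^ 2)⁻¹ = r ^ (p - 2) := by
    rw [Real.rpow_sub (by linarith), Real.rpow_two, div_eq_mul_inv]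
  rw [h2]
  exact (Real.rpow_le_rpow_of_exponent_le h1 (by linarith)).trans
    (Real.rpow_le_rpow_of_nonpos (by linarith) hr hpα)

lemma multCoeff_eq_zero {g : ℝ → ℝ} {r : ℝ} (hχ : IsInnerCutoff r₀ χ) (hr : r ≤ r₀) :
    multCoeff χ g r = 0 := by
  rw [multCoeff, hχ.eq_zero r hr, zero_mul, zero_mul]

section leaf

variable (hχ : IsInnerCutoff r₀ χ)
  (hU : ∀ y : E4, r₀ ≤ ‖y‖ → ContDiffAt ℝ 2 (farPart U) (σ, y))

include hχ hU

lemma energyP_density_eq {r : ℝ} (hr : 0 < r) {θ : E4} (hθ : ‖θ‖ = 1) :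
    r ^ 3 * (multCoeff χ (fun x => x ^ p) ‖r • θ‖ * ‖r • θ‖
        * radDeriv (conjugate (farPart U)) (σ, r • θ) ^ 2)
      = χ r * r ^ p * dR (conjugated U) σ r θ ^ 2 := by
  rw [norm_smul_unit hr hθ]
  rcases le_or_gt r₀ r with h | h
  · rw [radDeriv_conjugate hr hθ (hU _ (by rwa [norm_smul_unit hr hθ])), ← mul_assoc,
      multCoeff_rpow_mul hr]
  · rw [multCoeff_eq_zero hχ h.le, hχ.eq_zero r h.le]
    ring

lemma lintegral_radDeriv_eq_energyP (hr₀ : 1 ≤ r₀) :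
    ∫⁻ y : E4, ENNReal.ofReal (multCoeff χ (fun x => x ^ p) ‖y‖ * ‖y‖
      * radDeriv (conjugate (farPart U)) (σ, y) ^ 2) = energyP χ p (conjugated U) σ := by
  have h0 : 0 < r₀ := by linarith
  refine le_antisymm (lintegral_ofReal_le_leafIntegral fun r hr θ hθ =>
    (energyP_density_eq hχ hU hr hθ).le) ?_
  refine leafIntegral_le_lintegral_ofReal ?_ fun r hr θ hθ =>
    (energyP_density_eq hχ hU hr hθ).ge
  exact measurable_leaf_radDeriv h0 (fun r h => multCoeff_eq_zero hχ h)
    (fun r h => contDiffAt_multCoeff' hχ.smooth (h0.trans_le h)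
      (Real.contDiffAt_rpow_const_of_ne (h0.trans_le h).ne'))
    fun y h => contDiffAt_conjugate (q := (σ, y))
      (norm_ne_zero_iff.1 (h0.trans_le h).ne') (hU y h)

lemma lintegral_fluxErr_le (hr₀ : 1 ≤ r₀) (hκ1 : κ ≤ 1) (hτ : |deriv (retTime Rf l) σ - 1| ≤ 1 / 2) (hα : 0 ≤ α)
    (hpα : p - 2 + α ≤ 0) :
    ∫⁻ y : E4, ENNReal.ofReal (multCoeff χ (fun x => x ^ p) ‖y‖ * ‖y‖
        * fluxErr κ (conjugate (farPart U)) (σ, y))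
      ≤ ENNReal.ofReal (35 * r₀ ^ (p - 2 + α)) * stdEnergy Rf l χ U σ := by
  have h0 : 0 < r₀ := by linarith
  have hm : 0 ≤ 35 * r₀ ^ (p - 2 + α) := by positivity
  refine le_trans ?_ (mul_le_mul_right (leafIntegral_endDensity_le hχ) _)
  rw [← leafIntegral_const_mul hm]
  refine lintegral_ofReal_le_leafIntegral fun r hr θ hθ => ?_
  rw [norm_smul_unit hr hθ]
  rcases le_or_gt r₀ r with h | h
  · have h1 := fluxErr_conjugate_le hr hθ hκ1 (hU _ (by rwa [norm_smul_unit hr hθ])) hτ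
    have hD : 0 ≤ endDensity Rf l U σ r θ := by unfold endDensity; positivity
    have hw : 0 ≤ χ r * r ^ p := mul_nonneg (hχ.nonneg r) (by positivity)
    rw [← mul_assoc, multCoeff_rpow_mul hr]
    calc _ ≤ χ r * r ^ p * (35 * ((r ^ 2)⁻¹ * endDensity Rf l U σ r θ)) :=
          mul_le_mul_of_nonneg_left h1 hw
      _ = 35 * (r ^ p * (r ^ 2)⁻¹) * (χ r * endDensity Rf l U σ r θ) := by ring
      _ ≤ _ := by
          have := hχ.nonneg r
          gcongr
          exact rpow_div_sq_le hr₀ h hα hpα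
  · rw [multCoeff_eq_zero hχ h.le, hχ.eq_zero r h.le]
    simp

lemma lintegral_density_le (hτ : |deriv (retTime Rf l) σ - 1| ≤ 1 / 2) :
    ∫⁻ y : E4, ENNReal.ofReal (χ ‖y‖ * (‖y‖ ^ 3)⁻¹ * (spaceDensity (conjugate (farPart U)) (σ, y)
        + pd 0 (conjugate (farPart U)) (σ, y) ^ 2 / ‖y‖ ^ 2))
      ≤ ENNReal.ofReal 7 * stdEnergy Rf l χ U σ := by
  refine le_trans ?_ (mul_le_mul_right (leafIntegral_endDensity_le hχ) _)
  rw [← leafIntegral_const_mul (by norm_num)]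
  refine lintegral_ofReal_le_leafIntegral fun r hr θ hθ => ?_
  rw [norm_smul_unit hr hθ]
  rcases le_or_gt r₀ r with h | h
  · have h1 := conjugate_density_le hr hθ (hU _ (by rwa [norm_smul_unit hr hθ])) hτ
    have h2 : 0 ≤ pd 0 (conjugate (farPart U)) (σ, r • θ) ^ 2 / r ^ 2 := by positivity
    calc _ = χ r * (spaceDensity (conjugate (farPart U)) (σ, r • θ)
          + pd 0 (conjugate (farPart U)) (σ, r • θ) ^ 2 / r ^ 2) := by field_simp
      _ ≤ χ r * (7 * endDensity Rf l U σ r θ) :=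
          mul_le_mul_of_nonneg_left (by linarith) (hχ.nonneg r)
      _ = _ := by ring
  · rw [hχ.eq_zero r h.le]
    simp

end leaf

section slab

variable (hχ : IsInnerCutoff r₀ χ)
  (hU : ∀ σ ∈ Set.Icc s t, ∀ y : E4, r₀ ≤ ‖y‖ → ContDiffAt ℝ 2 (farPart U) (σ, y))
  (hτ : ∀ σ ∈ Set.Icc s t, |deriv (retTime Rf l) σ - 1| ≤ 1 / 2)

include hχ hU hτ

lemma lintegral_timeDensity_le (hr₀ : 1 ≤ r₀) (hpα : p - 2 + α ≤ 0) :
    ∫⁻ q in slab s t, ENNReal.ofReal (multCoeff χ (fun x => x ^ p) ‖q.2‖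
        * (5 * (pd 0 (conjugate (farPart U)) q ^ 2 / ‖q.2‖ ^ 2)))
      ≤ ENNReal.ofReal (2 * (12 * r₀ ^ (p - 2 + α))) * slabIntegral Rf l s t (fun σ r θ =>
          χ r * r ^ (-1 - α) * dTau Rf l (conjugated U) σ r θ ^ 2) := by
  have h0 : 0 < r₀ := by linarith
  refine lintegral_slab_le_slabIntegral (by positivity) hτ fun σ hσ r hr θ hθ => ?_
  simp only [norm_smul_unit hr hθ]
  rcases le_or_gt r₀ r with h | h
  · have h1 := pd_zero_conjugate_sq_le hr hθ (hU σ hσ _ (by rwa [norm_smul_unit hr hθ])) (hτ σ hσ)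
    have h2 : r ^ (p - 1) * (r ^ 2)⁻¹ = r ^ (p - 2 + α) * r ^ (-1 - α) := by
      rw [← Real.rpow_add hr, ← Real.rpow_two, ← Real.rpow_neg hr.le, ← Real.rpow_add hr]
      ring_nf
    have hw : 0 ≤ χ r * r ^ (p - 1) := mul_nonneg (hχ.nonneg r) (by positivity)
    have h3 : r ^ (p - 2 + α) ≤ r₀ ^ (p - 2 + α) := Real.rpow_le_rpow_of_nonpos h0 h hpα
    have h4 : 0 ≤ dTau Rf l (conjugated U) σ r θ ^ 2 := sq_nonneg _
    have hi : 0 < (r ^ 2)⁻¹ := by positivity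
    rw [← mul_assoc, multCoeff_rpow_mul' hr]
    calc _ ≤ χ r * r ^ (p - 1) * (12 * ((r ^ 2)⁻¹ * dTau Rf l (conjugated U) σ r θ ^ 2)) := by
          refine mul_le_mul_of_nonneg_left ?_ hw
          rw [div_eq_inv_mul]
          have := mul_le_mul_of_nonneg_left h1 hi.le
          have := mul_nonneg hi.le h4
          linarith
      _ = 12 * (r ^ (p - 1) * (r ^ 2)⁻¹) * (χ r * dTau Rf l (conjugated U) σ r θ ^ 2) := by ring
      _ = 12 * (r ^ (p - 2 + α) * r ^ (-1 - α))
          * (χ r * dTau Rf l (conjugated U) σ r θ ^ 2) := by rw [h2]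
      _ ≤ 12 * (r₀ ^ (p - 2 + α) * r ^ (-1 - α))
          * (χ r * dTau Rf l (conjugated U) σ r θ ^ 2) := by
          have := hχ.nonneg r
          gcongr
      _ = _ := by ring
  · rw [multCoeff_eq_zero hχ h.le, hχ.eq_zero r h.le]
    simp

lemma lintegral_sourceDensity_le
    (hJ : ∀ σ ∈ Set.Icc s t, ∀ y : E4, r₀ ≤ ‖y‖ → |jac Rf xi l (σ, y)| ≤ 2)
    (hη : ∀ σ ∈ Set.Icc s t, ‖centerVel Rf xi l σ‖ ≤ 1 / 2) :
    ∫⁻ q in slab s t, ENNReal.ofReal (sourceDensity χ p (conjugate (farPart U))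
        (fun q => jac Rf xi l q * (‖q.2‖ ^ (3 / 2 : ℝ) * F q)) q)
      ≤ ENNReal.ofReal (2 * 8) * slabIntegral Rf l s t (fun σ r θ =>
          χ r * r ^ p * |conjSource Rf xi l F σ r θ * dR (conjugated U) σ r θ|
            + errCutoff Rf l χ p (conjugated U) σ r θ) := by
  refine lintegral_slab_le_slabIntegral (by norm_num) hτ fun σ hσ r hr θ hθ => ?_
  rcases le_or_gt r₀ r with h | h
  · have hy : r₀ ≤ ‖r • θ‖ := by rwa [norm_smul_unit hr hθ]
    exact sourceDensity_conjugate_le hr hθ (hχ.nonneg r) (hU σ hσ _ hy) (hτ σ hσ) (hJ σ hσ _ hy)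
      (hη σ hσ)
  · simp only [sourceDensity, errCutoff, norm_smul_unit hr hθ, multCoeff_eq_zero hχ h.le,
      hχ.eq_zero r h.le, deriv_inner_eq_zero hχ h]
    simp

lemma bulkP_le (hr₀ : 1 ≤ r₀) {c : ℝ} (hc : 0 < c) :
    bulkP Rf l χ p (conjugated U) s t ≤ ENNReal.ofReal (3 / c) * ∫⁻ q in slab s t,
      ENNReal.ofReal (c / 2 * (multCoeff χ (fun x => x ^ p) ‖q.2‖
        * spaceDensity (conjugate (farPart U)) q)) := by
  have h0 : 0 < r₀ := by linarith
  have hw : ∀ r, r₀ ≤ r → ContDiffAt ℝ 1 (multCoeff χ fun x => x ^ p) r := fun r h =>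
    contDiffAt_multCoeff' hχ.smooth (h0.trans_le h)
      (Real.contDiffAt_rpow_const_of_ne (h0.trans_le h).ne')
  have hφ : ∀ σ ∈ Set.Icc s t, ∀ y : E4, r₀ ≤ ‖y‖ →
      ContDiffAt ℝ 2 (conjugate (farPart U)) (σ, y) := fun σ hσ y h =>
    contDiffAt_conjugate (q := (σ, y)) (norm_ne_zero_iff.1 (h0.trans_le h).ne') (hU σ hσ y h)
  have hm := aemeasurable_slab_spaceDensity (c := c / 2) h0
    (fun r h => multCoeff_eq_zero (g := fun x => x ^ p) hχ h) hw hφ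
  rw [slab, Measure.volume_eq_prod, ← Measure.prod_restrict, Measure.restrict_univ] at hm ⊢
  rw [lintegral_prod _ hm, bulkP, slabIntegral, ← lintegral_const_mul' _ _ ENNReal.ofReal_ne_top]
  refine setLIntegral_mono' measurableSet_Icc fun σ hσ => ?_
  have hmσ : Measurable fun y : E4 => ENNReal.ofReal (c / 2 * (multCoeff χ (fun x => x ^ p) ‖y‖
      * spaceDensity (conjugate (farPart U)) (σ, y))) := by
    have := measurable_leaf_weighted (w := fun r => c / 2 * multCoeff χ (fun x => x ^ p) r)
      (D := spaceDensity (conjugate (farPart U))) (σ := σ) h0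
      (fun r h => by rw [multCoeff_eq_zero hχ h, mul_zero])
      (fun r h => contDiffAt_const.mul (hw r h)) fun y h =>
        contDiffAt_spaceDensity (q := (σ, y)) (hφ σ hσ y h)
          (norm_ne_zero_iff.1 (h0.trans_le h).ne')
    simpa only [mul_assoc] using this
  have hle : ENNReal.ofReal (c / 2) * leafIntegral (fun r θ => χ r * r ^ (p - 1) *
      (dR (conjugated U) σ r θ ^ 2 + (r ^ 2)⁻¹ *
        (conjugated U σ r θ ^ 2 + ‖sphGrad (conjugated U) σ r θ‖ ^ 2)))
      ≤ ∫⁻ y : E4, ENNReal.ofReal (c / 2 * (multCoeff χ (fun x => x ^ p) ‖y‖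
        * spaceDensity (conjugate (farPart U)) (σ, y))) := by
    rw [← leafIntegral_const_mul (by positivity)]
    refine leafIntegral_le_lintegral_ofReal hmσ fun r hr θ hθ => ?_
    rw [norm_smul_unit hr hθ]
    rcases le_or_gt r₀ r with h | h
    · rw [spaceDensity_conjugate hr hθ (hU σ hσ _ (by rwa [norm_smul_unit hr hθ])),
        ← multCoeff_rpow_mul' hr]
      exact le_of_eq (by ring)
    · rw [hχ.eq_zero r h.le, multCoeff_eq_zero hχ h.le]
      simp
  refine le_trans ?_ (mul_le_mul_right hle _)
  rw [← mul_assoc, ← ENNReal.ofReal_mul (by positivity)]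
  gcongr
  have := (abs_le.1 (hτ σ hσ)).2
  have h3 : 3 / c * (c / 2) = 3 / 2 := by field_simp
  linarith

end slab

end integrals

section conclusion

variable {U : ℝ → ℝ → E4 → ℝ} {F : ℝ × E4 → ℝ} {χ : ℝ → ℝ} {Rf p r₀ κ s t α : ℝ}
  {xi l : ℝ → E4} {a : Fin 5 → Fin 5 → ℝ × E4 → ℝ} {B : Fin 5 → ℝ × E4 → ℝ} {Z : ℝ × E4 → ℝ}

/-- The `r ^ p` estimate with explicit constants. The weights of the errors are at most
`r₀ ^ (p - 2 + α)`, which is small as `p < 2 - 2 α`. -/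
theorem rp_estimate (hst : s ≤ t) (hr₀ : 1 ≤ r₀) (hχ : IsInnerCutoff r₀ χ) (hp0 : 0 < p)
    (hα : 0 ≤ α) (hp : p < 2) (hpα : p - 2 + α ≤ 0) (hκ : 0 ≤ κ) (hκc : 1450 * κ ≤ coercConst p)
    (hU : ∀ σ ∈ Set.Icc s t, ∀ y : E4, r₀ ≤ ‖y‖ → ContDiffAt ℝ 2 (farPart U) (σ, y))
    (hL : ∀ σ ∈ Set.Icc s t, ∀ y : E4, r₀ ≤ ‖y‖ → NearFlatAt κ (conjugate (farPart U))
      (fun q => jac Rf xi l q * (‖q.2‖ ^ (3 / 2 : ℝ) * F q)) a B Z (σ, y))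
    (hτ : ∀ σ ∈ Set.Icc s t, |deriv (retTime Rf l) σ - 1| ≤ 1 / 2)
    (hJ : ∀ σ ∈ Set.Icc s t, ∀ y : E4, r₀ ≤ ‖y‖ → |jac Rf xi l (σ, y)| ≤ 2)
    (hη : ∀ σ ∈ Set.Icc s t, ‖centerVel Rf xi l σ‖ ≤ 1 / 2)
    {δ C : ℝ} (hδ : 0 < δ) (hC : 64 ≤ C * coercConst p)
    (hδc : 280 * r₀ ^ (p - 2 + α) ≤ δ * coercConst p) :
    (⨆ σ ∈ Set.Icc s t, energyP χ p (conjugated U) σ) + bulkP Rf l χ p (conjugated U) s t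
      ≤ ENNReal.ofReal C * (energyP χ p (conjugated U) s + slabIntegral Rf l s t (fun σ r θ =>
            χ r * r ^ p * |conjSource Rf xi l F σ r θ * dR (conjugated U) σ r θ|
              + errCutoff Rf l χ p (conjugated U) σ r θ))
        + ENNReal.ofReal δ * slabIntegral Rf l s t (fun σ r θ =>
            χ r * r ^ (-1 - α) * dTau Rf l (conjugated U) σ r θ ^ 2)
        + ENNReal.ofReal δ * (⨆ σ ∈ Set.Icc s t, stdEnergy Rf l χ U σ) := by
  set S := ⨆ σ ∈ Set.Icc s t, stdEnergy Rf l χ U σ with hS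
  set N := slabIntegral Rf l s t (fun σ r θ =>
    χ r * r ^ p * |conjSource Rf xi l F σ r θ * dR (conjugated U) σ r θ|
      + errCutoff Rf l χ p (conjugated U) σ r θ) with hN
  set T := slabIntegral Rf l s t (fun σ r θ =>
    χ r * r ^ (-1 - α) * dTau Rf l (conjugated U) σ r θ ^ 2) with hT
  rcases eq_or_ne S ⊤ with hS' | hS'
  · -- without a bound for the standard energy there is nothing to prove
    rw [hS', ENNReal.mul_top (by simpa using hδ), add_top]
    exact le_top
  set c := coercConst p with hc
  have hc0 : 0 < c := by 
    rw [hc, coercConst]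
    exact mul_pos (by norm_num) (lt_min (by linarith) (by linarith))
  have hc1 : c ≤ 1 := by
    rw [hc, coercConst]
    have := min_le_left (p / 2) (2 - p)
    linarith
  have hκ1 : κ ≤ 1 := by linarith
  set m := r₀ ^ (p - 2 + α) with hm
  have hm0 : 0 ≤ m := Real.rpow_nonneg (by linarith) _
  have hSle : ∀ σ ∈ Set.Icc s t, stdEnergy Rf l χ U σ ≤ S := fun σ hσ =>
    le_iSup₂ (f := fun σ _ => stdEnergy Rf l χ U σ) σ hσ
  set X := 3 * energyP χ p (conjugated U) s + ENNReal.ofReal (35 * m) * S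
    + ENNReal.ofReal (35 * m) * S
    + (ENNReal.ofReal (2 * 8) * N + ENNReal.ofReal (2 * (12 * m)) * T) with hX
  have key : ∀ t' ∈ Set.Icc s t, max (energyP χ p (conjugated U) t')
      (∫⁻ q in slab s t', ENNReal.ofReal (c / 2 * (multCoeff χ (fun x => x ^ p) ‖q.2‖
        * spaceDensity (conjugate (farPart U)) q))) ≤ X := by
    intro t' ht'
    have hsub : ∀ σ ∈ Set.Icc s t', σ ∈ Set.Icc s t := fun σ hσ => ⟨hσ.1, hσ.2.trans ht'.2⟩
    have hs : s ∈ Set.Icc s t := ⟨le_rfl, hst⟩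
    have hA : ENNReal.ofReal 7 * S ≠ ⊤ := ENNReal.mul_ne_top ENNReal.ofReal_ne_top hS'
    have h := weighted_estimate ht'.1 hr₀ hχ hp0 hp hκ hκc
      (fun σ hσ y hy => contDiffAt_conjugate (q := (σ, y))
        (norm_ne_zero_iff.1 (by linarith : (0 : ℝ) < ‖y‖).ne') (hU σ (hsub σ hσ) y hy))
      (fun σ hσ => hL σ (hsub σ hσ)) hA fun σ hσ =>
        (lintegral_density_le hχ (hU σ (hsub σ hσ)) (hτ σ (hsub σ hσ))).trans
          (mul_le_mul_right (hSle σ (hsub σ hσ)) _)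
    rw [lintegral_radDeriv_eq_energyP hχ (hU t' ht') hr₀,
      lintegral_radDeriv_eq_energyP hχ (hU s hs) hr₀] at h
    refine h.trans ?_
    refine add_le_add (add_le_add (add_le_add le_rfl ?_) ?_) (add_le_add ?_ ?_)
    · exact (lintegral_fluxErr_le hχ (hU s hs) hr₀ hκ1 (hτ s hs) hα hpα).trans
        (mul_le_mul_right (hSle s hs) _)
    · exact (lintegral_fluxErr_le hχ (hU t' ht') hr₀ hκ1 (hτ t' ht') hα hpα).trans
        (mul_le_mul_right (hSle t' ht') _)
    · exact (lintegral_sourceDensity_le hχ (fun σ hσ => hU σ (hsub σ hσ))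
        (fun σ hσ => hτ σ (hsub σ hσ)) (fun σ hσ => hJ σ (hsub σ hσ))
        (fun σ hσ => hη σ (hsub σ hσ))).trans
        (mul_le_mul_right (slabIntegral_mono_right ht'.2 _) _)
    · exact (lintegral_timeDensity_le hχ (fun σ hσ => hU σ (hsub σ hσ))
        (fun σ hσ => hτ σ (hsub σ hσ)) hr₀ hpα).trans
        (mul_le_mul_right (slabIntegral_mono_right ht'.2 _) _)
  have hk : 1 + 3 / c ≤ 4 / c := by
    rw [← sub_nonneg]
    have : 4 / c - (1 + 3 / c) = (1 - c) / c := by field_simp; ring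
    rw [this]
    exact div_nonneg (by linarith) hc0.le
  have e1 : 4 / c * 16 ≤ C := by
    rw [div_mul_eq_mul_div, div_le_iff₀ hc0]; linarith
  have e2 : 4 / c * (70 * m) ≤ δ := by
    rw [div_mul_eq_mul_div, div_le_iff₀ hc0]; linarith
  have h4c : 0 ≤ 4 / c := by positivity
  have hXle : ENNReal.ofReal (4 / c) * X
      ≤ ENNReal.ofReal C * (energyP χ p (conjugated U) s + N) + ENNReal.ofReal δ * T
        + ENNReal.ofReal δ * S := by
    have hX' : X = 3 * energyP χ p (conjugated U) s + ENNReal.ofReal 16 * N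
        + ENNReal.ofReal (24 * m) * T + ENNReal.ofReal (70 * m) * S := by
      have h1 : ENNReal.ofReal (70 * m) = ENNReal.ofReal (35 * m) + ENNReal.ofReal (35 * m) := by
        rw [← ENNReal.ofReal_add (by positivity) (by positivity)]; ring_nf
      rw [hX, h1, show (2 : ℝ) * 8 = 16 by norm_num, show 2 * (12 * m) = 24 * m by ring]
      ring
    have h3 : (3 : ℝ≥0∞) ≤ ENNReal.ofReal 16 := by
      rw [show (3 : ℝ≥0∞) = ENNReal.ofReal 3 by simp]
      exact ENNReal.ofReal_le_ofReal (by norm_num)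
    calc ENNReal.ofReal (4 / c) * X
        ≤ ENNReal.ofReal (4 / c) * (ENNReal.ofReal 16 * energyP χ p (conjugated U) s
          + ENNReal.ofReal 16 * N + ENNReal.ofReal (70 * m) * T
          + ENNReal.ofReal (70 * m) * S) := by
          rw [hX']
          gcongr
          norm_num
      _ = ENNReal.ofReal (4 / c * 16) * (energyP χ p (conjugated U) s + N)
          + ENNReal.ofReal (4 / c * (70 * m)) * T + ENNReal.ofReal (4 / c * (70 * m)) * S := by
          rw [ENNReal.ofReal_mul h4c, ENNReal.ofReal_mul h4c]
          ring
      _ ≤ _ := by gcongr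
  refine le_trans ?_ hXle
  have hb : bulkP Rf l χ p (conjugated U) s t ≤ ENNReal.ofReal (3 / c) * X :=
    (bulkP_le hχ hU hτ hr₀ hc0).trans
      (mul_le_mul_right ((le_max_right _ _).trans (key t ⟨hst, le_rfl⟩)) _)
  calc _ ≤ X + ENNReal.ofReal (3 / c) * X :=
        add_le_add (iSup₂_le fun σ hσ => (le_max_left _ _).trans (key σ hσ)) hb
    _ = ENNReal.ofReal (1 + 3 / c) * X := by
        rw [ENNReal.ofReal_add zero_le_one (by positivity), ENNReal.ofReal_one, add_mul, one_mul]
    _ ≤ _ := by gcongr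

lemma IsCutoff.isInnerCutoff {c₁ c₂ R : ℝ} (h : IsCutoff c₁ c₂ R χ) : IsInnerCutoff (c₁ * R) χ where
  smooth := h.smooth.of_le (by exact_mod_cast le_top)
  nonneg := h.nonneg
  le_one := h.le_one
  eq_zero := h.eq_zero

lemma isBigOCube_zero (σf r₀ : ℝ) : IsBigOCube (fun _ _ => 0) σf r₀ fun _ => 0 where
  smooth := contDiff_const
  bound j k σ hσ y hy := by
    simp

end conclusion

/-! ### The choice of the constants -/

section constants

open Filter

lemma eventually_mul_rpow_le {a b : ℝ} (hab : a < b) (C : ℝ) {e : ℝ} (he : 0 < e) :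
    ∀ᶠ x : ℝ in atTop, C * x ^ a ≤ e * x ^ b := by
  have h := (tendsto_rpow_neg_atTop (sub_pos.2 hab)).const_mul C
  rw [mul_zero] at h
  filter_upwards [h.eventually_lt_const he, eventually_gt_atTop 0] with x hx hx0
  have h1 : x ^ a = x ^ (-(b - a)) * x ^ b := by
    rw [← Real.rpow_add hx0]; ring_nf
  rw [h1, ← mul_assoc]
  exact mul_le_mul_of_nonneg_right hx.le (Real.rpow_nonneg hx0.le _)

variable {α δ p r₀ : ℝ}

/-- The coercivity constant is at least a multiple of `δ` for all admissible exponents. -/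
lemma le_coercConst (hδ : 0 < δ) (hδα : δ < 2 * α) (hδp : δ < p) (hp : p < 2 - 2 * α) :
    3 / 8 * δ ≤ coercConst p := by
  rw [coercConst]
  have : δ / 2 ≤ min (p / 2) (2 - p) := le_min (by linarith) (by linarith)
  linarith

/-- The errors with the weight `r ^ (p - 2 + α)` are small compared to the coercive terms: for
`p ≥ 1` the coercivity constant is bounded below in terms of `α`; for `p < 1` it may be as small
as `δ`, but then the weight of the errors decays faster. -/
lemma weight_le_mul_coercConst (hα : 0 < α) (hα1 : α < 1 / 10) (hr₀ : 1 ≤ r₀) (hδ : 0 < δ)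
    (hδα : δ < 2 * α) (h1 : 280 * r₀ ^ (-α) ≤ δ * (3 / 2 * α))
    (h2 : 280 * r₀ ^ (-1 + α) ≤ δ * (3 / 8 * δ)) (hδp : δ < p) (hp : p < 2 - 2 * α) :
    280 * r₀ ^ (p - 2 + α) ≤ δ * coercConst p := by
  rcases le_or_gt 1 p with h | h
  · have hm : r₀ ^ (p - 2 + α) ≤ r₀ ^ (-α) :=
      Real.rpow_le_rpow_of_exponent_le hr₀ (by linarith)
    have hc : 3 / 2 * α ≤ coercConst p := by
      rw [coercConst]
      have : 2 * α ≤ min (p / 2) (2 - p) := le_min (by linarith) (by linarith)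
      linarith
    have := mul_le_mul_of_nonneg_left hc hδ.le
    linarith
  · have hm : r₀ ^ (p - 2 + α) ≤ r₀ ^ (-1 + α) :=
      Real.rpow_le_rpow_of_exponent_le hr₀ (by linarith)
    have := mul_le_mul_of_nonneg_left (le_coercConst hδ hδα hδp hp) hδ.le
    linarith

end constants

end CatenoidRp

end

theorem mainTheorem7 :
    ∃ α₀ : ℝ, 0 < α₀ ∧ ∀ α : ℝ, 0 < α → α < α₀ →
    ∀ c₁ c₂ : ℝ, 0 < c₁ → c₁ < c₂ →
    ∃ (K : ℝ) (C : ℝ → ℝ), 0 < K ∧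
    ∀ (Rf δ₁ : ℝ), 1 ≤ Rf → 0 < δ₁ →
    ∀ (Ck : ℕ → ℝ) (Cl δw κ : ℝ), (∀ k, 0 < Ck k) → 0 < Cl → 0 < δw → δw ≤ 1 → 0 < κ → κ < 1 →
    ∃ (M : ℕ → ℕ → ℝ) (Rt₀ : ℝ), 1 ≤ Rt₀ ∧ ∀ Rt : ℝ, Rt₀ ≤ Rt →
    ∃ εt₀ : ℝ, 0 < εt₀ ∧ ∀ εt : ℝ, 0 < εt → εt ≤ εt₀ →
    ∃ δ : ℝ, 0 < δ ∧ δ ≤ K * (εt + Rt ^ (-α)) ∧ δ < 2 * α ∧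
    ∀ (R ε : ℝ), Rt < R → 0 < ε → ε < εt →
    ∀ χ : ℝ → ℝ, IsCutoff c₁ c₂ R χ →
    ∀ (σf : ℝ) (xi l : ℝ → E4), Bootstrap Ck Cl δw κ ε σf xi l →
    ∃ b : ℝ × E4 → E4, IsBigOCube M σf (c₁ * R) b ∧
    ∀ σ₁ σ₂ : ℝ, 0 ≤ σ₁ → σ₁ < σ₂ → σ₂ ≤ σf →
    ∀ (U : ℝ → ℝ → E4 → ℝ) (F : ℝ × E4 → ℝ), IsSolution Rf δ₁ xi l σ₁ σ₂ U F →
    ∀ p : ℝ, δ < p → p < 2 - 2 * α →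
      (⨆ σ ∈ Set.Icc σ₁ σ₂, energyP χ p (conjugated U) σ)
          + bulkP Rf l χ p (conjugated U) σ₁ σ₂
        ≤ ENNReal.ofReal (C δ) *
          (energyP χ p (conjugated U) σ₁
            + slabIntegral Rf l σ₁ σ₂ (fun σ r θ =>
                χ r * r ^ p * |conjSource Rf xi l F σ r θ *
                  (dR (conjugated U) σ r θ
                    + inner ℝ (b (σ, r • θ)) (sphGrad (conjugated U) σ r θ))|
                + errCutoff Rf l χ p (conjugated U) σ r θ))
          + ENNReal.ofReal δ * slabIntegral Rf l σ₁ σ₂ (fun σ r θ =>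
              χ r * r ^ (-1 - α) * dTau Rf l (conjugated U) σ r θ ^ 2)
          + ENNReal.ofReal δ * (⨆ σ ∈ Set.Icc σ₁ σ₂, stdEnergy Rf l χ U σ) := by

  refine ⟨1 / 10, by norm_num, fun α hα hα1 c₁ c₂ hc₁ _ => ?_⟩
  -- The factor `1 / α` makes up for `coercConst p ≥ (3/2) α`, the summand `1` ensures `K > 0`.
  set K : ℝ := 200 * c₁ ^ (-α) / α + 1 with hK
  have hc₁α : 0 < c₁ ^ (-α) := Real.rpow_pos_of_pos hc₁ _
  have hK0 : 0 < K := by positivity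
  -- `C(δ)` is `64 / coercConst p` with the lower bound `(3/8) δ` of `le_coercConst`; in
  -- `512 / (3 δ)`, `512 = 64 * 8`.
  refine ⟨K, fun δ => 512 / (3 * δ), hK0, fun Rf δ₁ hRf hδ₁ Ck Cl δw κ hCk hCl _ hδw1 _ hκ => ?_⟩
  obtain ⟨CA, hCA, hA⟩ := exists_eventually_nearFlatAt (Cl + 2 * Ck 0 + 2 * Ck 1) Rf
  obtain ⟨εA, rA, hεA, hthr⟩ := exists_thresholds
    (P := fun d σ y => (|deriv (retTime Rf d.l) σ - 1| ≤ 1 / 2 ∧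
      ∀ κ, CA * smallness (d, σ, y) ≤ κ → ∀ u F : ℝ × E4 → ℝ, ContDiffAt ℝ 2 u (σ, y) →
        pGraph Rf d.xi d.l u (σ, y) = F (σ, y) →
        NearFlatAt κ (conjugate u) (fun q => jac Rf d.xi d.l q * (‖q.2‖ ^ (3 / 2 : ℝ) * F q))
          (pertTensor Rf d.xi d.l) (pertFirst Rf d.xi d.l) (pertZeroth Rf d.xi d.l) (σ, y))
      ∧ |jac Rf d.xi d.l (σ, y)| ≤ 2 ∧ ‖centerVel Rf d.xi d.l σ‖ ≤ 1 / 2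
      ∧ lorentz (d.l σ) ≤ 2)
    (hA.and (eventually_slow_motion (Cl + 2 * Ck 0 + 2 * Ck 1) Rf))
  -- The largeness of `R̃`: the region `r ≥ c₁ R̃` lies in the hyperboloidal region and in the range
  -- of the asymptotics, and the powers of `R̃` in the errors beat the powers of `δ ∼ R̃ ^ (-α)`.
  have hev : ∀ᶠ x : ℝ in Filter.atTop, (max 1 (max rA (2 * Rf + δ₁)) ≤ c₁ * x ∧ 1 ≤ x) ∧
      K * x ^ (-α) < 2 * α ∧ 280 * (c₁ * x) ^ (-1 + α) ≤ K * x ^ (-α) * (3 / 8 * (K * x ^ (-α)))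
      ∧ 1450 * (CA * (c₁ * x)⁻¹) ≤ 3 / 16 * (K * x ^ (-α)) := by
    have hK2 : 0 < 3 / 8 * K ^ 2 := by positivity
    filter_upwards [(Filter.tendsto_id.const_mul_atTop hc₁).eventually_ge_atTop
        (max 1 (max rA (2 * Rf + δ₁))), Filter.eventually_ge_atTop 1,
      eventually_mul_rpow_le (show -α < 0 by linarith) K hα,
      eventually_mul_rpow_le (show -1 + α < -α + -α by linarith) (280 * c₁ ^ (-1 + α)) hK2,
      eventually_mul_rpow_le (show (-1 : ℝ) < -α by linarith) (1450 * CA * c₁⁻¹)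
        (show 0 < 3 / 16 * K by positivity)] with x h1 h2 h3 h4 h5
    have hx : 0 < x := by linarith
    refine ⟨⟨h1, h2⟩, ?_, ?_, ?_⟩
    · rw [Real.rpow_zero] at h3
      linarith
    · rw [Real.rpow_add hx (-α) (-α)] at h4
      rw [Real.mul_rpow hc₁.le hx.le]
      calc _ = 280 * c₁ ^ (-1 + α) * x ^ (-1 + α) := by ring
        _ ≤ _ := h4
        _ = _ := by ring
    · rw [Real.rpow_neg_one] at h5
      calc _ = 1450 * CA * c₁⁻¹ * x⁻¹ := by rw [mul_inv]; ring
        _ ≤ _ := h5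
        _ = _ := by ring
  obtain ⟨Rt₀, hRt₀⟩ := Filter.eventually_atTop.1 hev
  -- As `b = 0`, its bounds may be taken to be zero.
  refine ⟨fun _ _ => 0, max 1 Rt₀, le_max_left _ _, fun Rt hRt => ?_⟩
  obtain ⟨⟨hx1, hRt1⟩, hx2, hx3, hx4⟩ := hRt₀ Rt ((le_max_right _ _).trans hRt)
  have hRt0 : 0 < Rt := by linarith
  set δ : ℝ := K * Rt ^ (-α) with hδ
  have hδ0 : 0 < δ := mul_pos hK0 (Real.rpow_pos_of_pos hRt0 _)
  -- The second bound on `ε̃` is half of what the absorption `1450 C (ε + 1 / r) ≤ coercConst p`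
  -- allows; the other half is left to `1 / r`.
  refine ⟨min εA (3 / 16 * δ / (1450 * CA)), lt_min hεA (by positivity), fun εt hεt hεt' =>
    ⟨δ, hδ0, ?_, hx2, ?_⟩⟩
  · exact mul_le_mul_of_nonneg_left (by linarith) hK0.le
  intro R ε hR hε hεεt χ hχ σf xi l hB
  refine ⟨fun _ => 0, isBigOCube_zero σf _, fun σ₁ σ₂ hσ₁ hσ hσ₂ U F hU p hδp hp => ?_⟩
  set d := hB.motion hCk hCl hδw1 hκ hε with hd
  have hdε : d.ε < εA := hεεt.trans_le (hεt'.trans (min_le_left _ _))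
  have hcR : c₁ * Rt ≤ c₁ * R := mul_le_mul_of_nonneg_left hR.le hc₁.le
  obtain ⟨hr1, hr2, hr3⟩ : 1 ≤ c₁ * R ∧ rA ≤ c₁ * R ∧ 2 * Rf + δ₁ ≤ c₁ * R := by
    obtain ⟨h1, h2⟩ := max_le_iff.1 hx1
    obtain ⟨h3, h4⟩ := max_le_iff.1 h2
    exact ⟨h1.trans hcR, h3.trans hcR, h4.trans hcR⟩
  have htime : ∀ σ ∈ Set.Icc σ₁ σ₂, σ ∈ Set.Icc 0 d.σf := fun σ h =>
    ⟨hσ₁.trans h.1, h.2.trans hσ₂⟩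
  have hfar := fun σ (hσ : σ ∈ Set.Icc σ₁ σ₂) (y : E4) (hy : c₁ * R ≤ ‖y‖) =>
    hthr d hdε σ (htime σ hσ) y (hr2.trans hy)
  have hhyp : ∀ σ ∈ Set.Icc σ₁ σ₂, ∀ y : E4, c₁ * R ≤ ‖y‖ → y ∈ hypLeaf Rf δ₁ l σ := by
    intro σ hσ y hy
    have h1 : lorentz (l σ) ≤ 2 := (hfar σ hσ y hy).2.2.2
    have h2 : ‖y‖ < bracket ‖y‖ := Real.lt_sqrt_of_sq_lt (by linarith)
    have h3 : lorentz (l σ) * Rf ≤ 2 * Rf := mul_le_mul_of_nonneg_right h1 (by linarith)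
    show lorentz (l σ) * Rf + δ₁ < bracket ‖y‖
    linarith
  obtain ⟨y₀, hy₀⟩ : ∃ y : E4, c₁ * R ≤ ‖y‖ :=
    ⟨(c₁ * R) • EuclideanSpace.single 0 1, by
      rw [norm_smul, PiLp.norm_single, norm_one, mul_one]; exact Real.le_norm_self _⟩
  have hκR : 1450 * (CA * (ε + (c₁ * R)⁻¹)) ≤ 3 / 8 * δ := by
    have h1 : ε ≤ 3 / 16 * δ / (1450 * CA) := hεεt.le.trans (hεt'.trans (min_le_right _ _))
    rw [le_div_iff₀ (by positivity)] at h1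
    have h2 : (c₁ * R)⁻¹ ≤ (c₁ * Rt)⁻¹ := inv_anti₀ (by positivity) hcR
    have h3 := mul_le_mul_of_nonneg_left h2 hCA.le
    linarith
  have hm1 : 280 * (c₁ * R) ^ (-α) ≤ δ * (3 / 2 * α) := by
    have h1 : (c₁ * R) ^ (-α) ≤ (c₁ * Rt) ^ (-α) :=
      Real.rpow_le_rpow_of_nonpos (by positivity) hcR (by linarith)
    have h2 : K * (3 / 2 * α) = 300 * c₁ ^ (-α) + 3 / 2 * α := by
      rw [hK]; field_simp; ring
    rw [Real.mul_rpow hc₁.le hRt0.le] at h1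
    have h3 : 0 < Rt ^ (-α) := Real.rpow_pos_of_pos hRt0 _
    calc _ ≤ 280 * (c₁ ^ (-α) * Rt ^ (-α)) := by linarith
      _ = 280 * c₁ ^ (-α) * Rt ^ (-α) := by ring
      _ ≤ K * (3 / 2 * α) * Rt ^ (-α) := mul_le_mul_of_nonneg_right (by linarith) h3.le
      _ = _ := by rw [hδ]; ring
  have hm2 : 280 * (c₁ * R) ^ (-1 + α) ≤ δ * (3 / 8 * δ) := by
    have h1 : (c₁ * R) ^ (-1 + α) ≤ (c₁ * Rt) ^ (-1 + α) :=
      Real.rpow_le_rpow_of_nonpos (by positivity) hcR (by linarith)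
    linarith
  have hc := le_coercConst hδ0 hx2 hδp hp
  have hεR : 0 ≤ CA * (ε + (c₁ * R)⁻¹) := by positivity
  have main := rp_estimate (Rf := Rf) (xi := xi) (l := l) (U := U) (F := F) hσ.le hr1
    hχ.isInnerCutoff (hδ0.trans hδp) hα.le (by linarith) (by linarith) hεR (hκR.trans hc)
    (fun σ hσ y hy => (hU σ hσ y (hhyp σ hσ y hy)).1)
    (fun σ hσ y hy => (hfar σ hσ y hy).1.2 _ (mul_le_mul_of_nonneg_left
      (add_le_add_right (inv_anti₀ (by linarith) hy) _) hCA.le) _ _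
      (hU σ hσ y (hhyp σ hσ y hy)).1 (hU σ hσ y (hhyp σ hσ y hy)).2)
    (fun σ hσ => (hfar σ hσ y₀ hy₀).1.1)
    (fun σ hσ y hy => (hfar σ hσ y hy).2.1) (fun σ hσ => (hfar σ hσ y₀ hy₀).2.2.1)
    (δ := δ) (C := 512 / (3 * δ)) hδ0 ?_
    (weight_le_mul_coercConst hα hα1 hr1 hδ0 hx2 hm1 hm2 hδp hp)
  · simpa only [inner_zero_left, add_zero] using main
  · rw [div_mul_eq_mul_div, le_div_iff₀ (by positivity)]
    linarith
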